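/- **Weak stability of $\mathsf{TCD}^e_p(K,N)$.** *Setting.* A Lorentzian pre-length space $(X,\mathsf d,\ll,\le,\tau)$ is a proper metric space with a preorder $\le$, a transitive relation $\ll$ contained in $\le$, and a lower semicontinuous $\tau:X^2\to[0,\infty]$ such that $\tau(x,y)+\tau(y,z)\le\tau(x,z)$ for $x\le y\le z$, $\tau(x,y)=0$ if $x\not\le y$, and $\tau(x,y)>0\Leftrightarrow x\ll y$. A causal curve is a non-constant locally Lipschitz curve $\gamma$ on an interval with $\gamma_s\le\gamma_t$ for $s<t$; its $\tau$-length on $[a,b]$ is the infimum of $\sum_i\tau(\gamma_{t_i},\gamma_{t_{i+1}})$ over partitions of $[a,b]$. $X$ is *geodesic* if any $x\le y$ with $x\ne y$ are joined by a causal curve of $\tau$-length $\tau(x,y)$; *locally causally closed* if each point has a neighbourhood $U$ such that $\{x\le y\}\cap(\bar U\times\bar U)$ is closed; *$\mathcal K$-globally hyperbolic* if in every compact set the $\mathsf d$-lengths of causal curves are bounded and $J^+(K_1)\cap J^-(K_2)$ is compact for all compact $K_1,K_2$. A *measured* space carries in addition a Radon measure $\mathfrak m$ with $\operatorname{supp}\mathfrak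 m=X$. For Borel probability measures $\mu,\nu$ let $\Pi_\le(\mu,\nu)$ be the set of couplings concentrated on $\{x\le y\}$, and for $p\in(0,1)$ let $\ell_p(\mu,\nu)=\sup_{\pi\in\Pi_\le(\mu,\nu)}\left(\int\tau^p\,d\pi\right)^{1/p}$ (equal to $-\infty$ if $\Pi_\le(\mu,\nu)=\emptyset$); maximisers are called $\ell_p$-optimal. An $\ell_p$-geodesic is a family $(\mu_t)_{t\in[0,1]}$ with $\ell_p(\mu_s,\mu_t)=(t-s)\,\ell_p(\mu_0,\mu_1)\in(0,\infty)$ for all $0\le s<t\le1$. Put $\ell^p(x,y)=\tau(x,y)^p$ if $x\le y$ and $-\infty$ otherwise. The pair $(\mu,\nu)$ is *timelike $p$-dualisable by $\pi$* if $\ell_p(\mu,\nu)\in(0,\infty)$, $\pi$ is $\ell_p$-optimal with $\pi(\{x\ll y\})=1$, and there are measurable $a,b:X\to\mathbb R$ with $a\oplus b\in L^1(\mu\otimes\nu)$ and $\ell^p\le a\oplus b$ on $\operatorname{supp}\mu\times\operatorname{supp}\nu$. It is *strongly timelike $p$-dualisable by $\pi$* if moreover there is a measurable $\ell^p$-cyclically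 monotone set $\Gamma\subset\{x\ll y\}\cap(\operatorname{supp}\mu\times\operatorname{supp}\nu)$ such that a coupling in $\Pi_\le(\mu,\nu)$ is $\ell_p$-optimal if and only if it is concentrated on $\Gamma$. Let $\mathrm{Ent}(\mu|\mathfrak m)=\int\rho\log\rho\,d\mathfrak m$ if $\mu=\rho\,\mathfrak m$ and $(\rho\log\rho)_+\in L^1(\mathfrak m)$, and $+\infty$ otherwise. For $p\in(0,1)$, $K\in\mathbb R$, $N\in(0,\infty)$, the measured space satisfies $\mathsf{TCD}^e_p(K,N)$ (resp. $\mathsf{wTCD}^e_p(K,N)$) if for every pair $(\mu_0,\mu_1)$ of probability measures of finite (real) entropy that is timelike $p$-dualisable (resp. of compactly supported probability measures of finite entropy that is strongly timelike $p$-dualisable) there are a coupling $\pi$ by which it is timelike (resp. strongly timelike) $p$-dualisable and an $\ell_p$-geodesic $(\mu_t)_{t\in[0,1]}$ from $\mu_0$ to $\mu_1$ such that $e(t)=\mathrm{Ent}(\mu_t|\mathfrak m)$ is real valued and semi-convex on $[0,1]$ and $$e''-\tfrac1N (e')^2\ \ge\ K\int\tau^2\,d\pi\qquad\text{in the sense of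 distributions on }(0,1).$$ *Theorem.* Let $(X_j,\mathsf d_j,\mathfrak m_j,\ll_j,\le_j,\tau_j)$, $j\in\mathbb N\cup\{\infty\}$, be measured Lorentzian geodesic spaces such that: 1. there are a locally causally closed, $\mathcal K$-globally hyperbolic Lorentzian geodesic space $(\bar X,\bar{\mathsf d},\bar\ll,\bar\le,\bar\tau)$ with $\bar\tau$ finite and continuous, and topological embeddings $\iota_j:X_j\to\bar X$, $j\in\mathbb N\cup\{\infty\}$, with $x\le_j y\Leftrightarrow\iota_j(x)\,\bar\le\,\iota_j(y)$ and $\bar\tau(\iota_j(x),\iota_j(y))=\tau_j(x,y)$ for all $x,y\in X_j$; 2. the measures $(\iota_j)_\sharp\mathfrak m_j$, $j\in\mathbb N\cup\{\infty\}$, are Radon on $\bar X$, and $\int\varphi\,d(\iota_j)_\sharp\mathfrak m_j\to\int\varphi\,d(\iota_\infty)_\sharp\mathfrak m_\infty$ for every $\varphi\in C_c(\bar X)$; 3. for some $p\in(0,1)$, $K\in\mathbb R$, $N\in(0,\infty)$, every $X_j$ with $j\in\mathbb N$ satisfies $\mathsf{TCD}^e_p(K,N)$. Then $X_\infty$ satisfies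 $\mathsf{wTCD}^e_p(K,N)$. -/

import Mathlib

open MeasureTheory Set Filter Topology
open scoped ENNReal NNReal ContDiff

universe u v w

/-- A Lorentzian pre-length structure on a proper metric space: a preorder `≤` (`le`), a transitive
relation `≪` (`ll`) contained in it, and a lower semicontinuous time separation function `τ` with
values in `[0,∞]`. -/
structure LorentzianPreLength (X : Type u) [MetricSpace X] [ProperSpace X] where
  le : X → X → Prop
  ll : X → X → Prop
  τ : X → X → ℝ≥0∞
  le_refl : ∀ x, le x x
  le_trans : ∀ x y z, le x y → le y z → le x z
  ll_trans : ∀ x y z, ll x y → ll y z → ll x z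
  le_of_ll : ∀ x y, ll x y → le x y
  lowerSemicontinuous_τ : LowerSemicontinuous fun z : X × X => τ z.1 z.2
  reverse_triangle : ∀ x y z, le x y → le y z → τ x y + τ y z ≤ τ x z
  τ_eq_zero : ∀ x y, ¬ le x y → τ x y = 0
  τ_pos_iff : ∀ x y, 0 < τ x y ↔ ll x y

namespace LorentzianPreLength

section Causality

variable {X : Type u} [MetricSpace X] [ProperSpace X] (L : LorentzianPreLength X)

/-- The causal future `J⁺(A)`. -/
def futureJ (A : Set X) : Set X := {y | ∃ x ∈ A, L.le x y}

/-- The causal past `J⁻(A)`. -/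
def pastJ (A : Set X) : Set X := {x | ∃ y ∈ A, L.le x y}

/-- Every point has a neighbourhood `U` such that `≤` restricted to `closure U` is closed. -/
def LocallyCausallyClosed : Prop :=
  ∀ x : X, ∃ U ∈ 𝓝 x, IsClosed ({z : X × X | L.le z.1 z.2} ∩ closure U ×ˢ closure U)

/-- `γ` is a (future-directed) causal curve on the set `I`, to be used with `I` an interval:
non-constant, locally Lipschitz, and `≤`-monotone. -/
def IsCausalCurve (I : Set ℝ) (γ : ℝ → X) : Prop :=
  (∃ s ∈ I, ∃ t ∈ I, γ s ≠ γ t) ∧ LocallyLipschitzOn I γ ∧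
    ∀ s ∈ I, ∀ t ∈ I, s < t → L.le (γ s) (γ t)

/-- The `τ`-length of a curve on `[a,b]`: the infimum over all partitions
`a = t 0 < t 1 < ⋯ < t n = b` of `∑ τ(γ (t i), γ (t (i+1)))`. -/
noncomputable def length (a b : ℝ) (γ : ℝ → X) : ℝ≥0∞ :=
  sInf {s | ∃ (n : ℕ) (t : ℕ → ℝ), t 0 = a ∧ t n = b ∧ (∀ i < n, t i < t (i + 1)) ∧
    s = ∑ i ∈ Finset.range n, L.τ (γ (t i)) (γ (t (i + 1)))}

/-- Any two distinct causally related points are joined by a maximal causal curve. -/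
def IsGeodesic : Prop :=
  ∀ x y : X, L.le x y → x ≠ y → ∃ (a b : ℝ) (γ : ℝ → X), a < b ∧ γ a = x ∧ γ b = y ∧
    L.IsCausalCurve (Icc a b) γ ∧ L.τ x y = L.length a b γ

/-- In each compact set the `d`-lengths of causal curves are bounded. -/
def NonTotallyImprisoning : Prop :=
  ∀ K : Set X, IsCompact K → ∃ C : ℝ≥0, ∀ (I : Set ℝ) (γ : ℝ → X), I.OrdConnected →
    L.IsCausalCurve I γ → MapsTo γ I K → eVariationOn γ I ≤ C

/-- `𝒦`-global hyperbolicity. -/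
def KGloballyHyperbolic : Prop :=
  L.NonTotallyImprisoning ∧ ∀ K₁ K₂ : Set X, IsCompact K₁ → IsCompact K₂ →
    IsCompact (L.futureJ K₁ ∩ L.pastJ K₂)

end Causality

/-- `ι` is a topological embedding which preserves and reflects `≤` and preserves `τ`. -/
def IsIsomorphicEmbedding {X : Type u} [MetricSpace X] [ProperSpace X] (L : LorentzianPreLength X)
    {Y : Type v} [MetricSpace Y] [ProperSpace Y] (M : LorentzianPreLength Y) (ι : X → Y) : Prop :=
  IsEmbedding ι ∧ (∀ x y, L.le x y ↔ M.le (ι x) (ι y)) ∧ ∀ x y, M.τ (ι x) (ι y) = L.τ x y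

section Transport

variable {X : Type u} [MetricSpace X] [ProperSpace X] [MeasurableSpace X] [BorelSpace X]
  (L : LorentzianPreLength X)

/-- The set `Π_≤(μ,ν)` of causal couplings. -/
def causalCouplings (μ ν : ProbabilityMeasure X) : Set (ProbabilityMeasure (X × X)) :=
  {π | (π : Measure (X × X)).map Prod.fst = μ ∧ (π : Measure (X × X)).map Prod.snd = ν ∧
    ∀ᵐ z ∂(π : Measure (X × X)), L.le z.1 z.2}

/-- The transport functional `(∫ τ^p dπ)^{1/p}`. -/
noncomputable def cost (p : ℝ) (π : ProbabilityMeasure (X × X)) : ℝ≥0∞ :=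
  (∫⁻ z, L.τ z.1 z.2 ^ p ∂(π : Measure (X × X))) ^ (1 / p)

/-- The `p`-Lorentz–Wasserstein distance `ℓ_p(μ,ν)`; it is `⊥ = -∞` if there is no causal
coupling. -/
noncomputable def lorentzWasserstein (p : ℝ) (μ ν : ProbabilityMeasure X) : EReal :=
  ⨆ π ∈ L.causalCouplings μ ν, (L.cost p π : EReal)

/-- `π` is an `ℓ_p`-optimal (causal) coupling of `μ` and `ν`. -/
def IsOptimal (p : ℝ) (μ ν : ProbabilityMeasure X) (π : ProbabilityMeasure (X × X)) : Prop :=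
  π ∈ L.causalCouplings μ ν ∧ (L.cost p π : EReal) = L.lorentzWasserstein p μ ν

open Classical in
/-- The cost `ℓ^p(x,y)`, equal to `τ(x,y)^p` if `x ≤ y` and to `-∞` otherwise. -/
noncomputable def ellPow (p : ℝ) (x y : X) : EReal :=
  if L.le x y then ((L.τ x y ^ p : ℝ≥0∞) : EReal) else ⊥

/-- `(μ,ν)` is timelike `p`-dualisable by `π`. -/
def TimelikeDualisableBy (p : ℝ) (μ ν : ProbabilityMeasure X)
    (π : ProbabilityMeasure (X × X)) : Prop :=
  (0 < L.lorentzWasserstein p μ ν ∧ L.lorentzWasserstein p μ ν < ⊤) ∧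
  (L.IsOptimal p μ ν π ∧ ∀ᵐ z ∂(π : Measure (X × X)), L.ll z.1 z.2) ∧
  ∃ a b : X → ℝ, Measurable a ∧ Measurable b ∧
    Integrable (fun z : X × X => a z.1 + b z.2) ((μ : Measure X).prod (ν : Measure X)) ∧
    ∀ x ∈ (μ : Measure X).support, ∀ y ∈ (ν : Measure X).support,
      L.ellPow p x y ≤ ((a x + b y : ℝ) : EReal)

/-- `ℓ^p`-cyclical monotonicity of `Γ ⊆ X²_≤`; indices in `Fin (n + 1)` are cyclic. -/
def CyclicallyMonotone (p : ℝ) (Γ : Set (X × X)) : Prop :=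
  (∀ z ∈ Γ, L.le z.1 z.2) ∧
  ∀ (n : ℕ) (x y : Fin (n + 1) → X), (∀ i, (x i, y i) ∈ Γ) →
    ∑ i, L.ellPow p (x (i + 1)) (y i) ≤ ∑ i, L.ellPow p (x i) (y i)

/-- The additional requirement in strong timelike `p`-dualisability: optimality of a causal coupling
is characterised by concentration on a single `ℓ^p`-cyclically monotone set of timelike pairs. -/
def HasOptimalitySet (p : ℝ) (μ ν : ProbabilityMeasure X) : Prop :=
  ∃ Γ : Set (X × X), MeasurableSet Γ ∧ L.CyclicallyMonotone p Γ ∧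
    (∀ z ∈ Γ, L.ll z.1 z.2 ∧ z.1 ∈ (μ : Measure X).support ∧ z.2 ∈ (ν : Measure X).support) ∧
    ∀ π ∈ L.causalCouplings μ ν, L.IsOptimal p μ ν π ↔ (π : Measure (X × X)) Γ = 1

/-- `(μ,ν)` is strongly timelike `p`-dualisable by `π`. -/
def StronglyTimelikeDualisableBy (p : ℝ) (μ ν : ProbabilityMeasure X)
    (π : ProbabilityMeasure (X × X)) : Prop :=
  L.TimelikeDualisableBy p μ ν π ∧ L.HasOptimalitySet p μ ν

/-- `(μ_t)`, `t ∈ [0,1]`, is an `ℓ_p`-geodesic (values of `μ` outside `[0,1]` are irrelevant). -/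
def IsEllGeodesic (p : ℝ) (μ : ℝ → ProbabilityMeasure X) : Prop :=
  0 < L.lorentzWasserstein p (μ 0) (μ 1) ∧ L.lorentzWasserstein p (μ 0) (μ 1) < ⊤ ∧
  ∀ s t : ℝ, 0 ≤ s → s < t → t ≤ 1 →
    L.lorentzWasserstein p (μ s) (μ t) =
      ((t - s : ℝ) : EReal) * L.lorentzWasserstein p (μ 0) (μ 1)

end Transport

end LorentzianPreLength

section Entropy

variable {X : Type u} [MeasurableSpace X]

/-- The density of `μ` with respect to `m`. -/
noncomputable def density (μ m : Measure X) (x : X) : ℝ := (μ.rnDeriv m x).toReal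

open Classical in
/-- The relative entropy `Ent(μ|m) = ∫ ρ log ρ dm` if `μ = ρ m` and `(ρ log ρ)₊` is integrable,
`+∞` otherwise; written as the integral of the positive part minus that of the negative part. -/
noncomputable def relEntropy (μ m : Measure X) : EReal :=
  if μ ≪ m ∧ ∫⁻ x, ENNReal.ofReal (density μ m x * Real.log (density μ m x)) ∂m ≠ ⊤ then
    ((∫⁻ x, ENNReal.ofReal (density μ m x * Real.log (density μ m x)) ∂m : ℝ≥0∞) : EReal) -
      ((∫⁻ x, ENNReal.ofReal (-(density μ m x * Real.log (density μ m x))) ∂m : ℝ≥0∞) : EReal)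
  else ⊤

/-- `μ ∈ Dom(Ent(·|m))`: the entropy is a real number. -/
def InEntropyDomain (μ m : Measure X) : Prop := relEntropy μ m ≠ ⊤ ∧ relEntropy μ m ≠ ⊥

end Entropy

/-- `e` is semi-convex on `[0,1]`. -/
def SemiConvex (e : ℝ → ℝ) : Prop := ∃ c : ℝ, ConvexOn ℝ (Icc 0 1) fun t => e t + c * t ^ 2

/-- `e'' - (1/N) (e')² ≥ r` in the sense of distributions on `(0,1)`, for an extended real constant
`r`: tested against nonnegative smooth functions compactly supported in `(0,1)`. An extended
constant is handled by requiring the inequality for all real constants below it (so `r = -∞` is no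
condition, and `r = +∞` cannot be satisfied). -/
def DistribIneq (N : ℝ) (r : EReal) (e : ℝ → ℝ) : Prop :=
  ∀ c : ℝ, (c : EReal) ≤ r → ∀ φ : ℝ → ℝ, ContDiff ℝ ∞ φ → HasCompactSupport φ →
    tsupport φ ⊆ Ioo 0 1 → (∀ t, 0 ≤ φ t) →
    c * ∫ t, φ t ≤ (∫ t, e t * deriv (deriv φ) t) - (1 / N) * ∫ t, (deriv e t) ^ 2 * φ t

namespace LorentzianPreLength

section CurvatureDimension

variable {X : Type u} [MetricSpace X] [ProperSpace X] [MeasurableSpace X] [BorelSpace X]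
  (L : LorentzianPreLength X) (m : Measure X)

/-- `(K,N)`-convexity of the entropy along the curve `(μ_t)` relative to the coupling `π`:
`e(t) = Ent(μ_t|m)` is real valued and semi-convex on `[0,1]`, and
`e'' - (1/N) (e')² ≥ K ∫ τ² dπ` in the sense of distributions. -/
def EntropyConvexAlong (K N : ℝ) (π : ProbabilityMeasure (X × X))
    (μ : ℝ → ProbabilityMeasure X) : Prop :=
  (∀ t ∈ Icc (0 : ℝ) 1, InEntropyDomain (μ t : Measure X) m) ∧
  SemiConvex (fun t => (relEntropy (μ t : Measure X) m).toReal) ∧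
  DistribIneq N
    ((K : EReal) * ((∫⁻ z, L.τ z.1 z.2 ^ 2 ∂(π : Measure (X × X)) : ℝ≥0∞) : EReal))
    (fun t => (relEntropy (μ t : Measure X) m).toReal)

/-- The timelike curvature-dimension condition `TCD^e_p(K,N)`. -/
def TCD (p K N : ℝ) : Prop :=
  ∀ μ₀ μ₁ : ProbabilityMeasure X,
    InEntropyDomain (μ₀ : Measure X) m → InEntropyDomain (μ₁ : Measure X) m →
    (∃ π, L.TimelikeDualisableBy p μ₀ μ₁ π) →
    ∃ π, L.TimelikeDualisableBy p μ₀ μ₁ π ∧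
      ∃ μ : ℝ → ProbabilityMeasure X, μ 0 = μ₀ ∧ μ 1 = μ₁ ∧ L.IsEllGeodesic p μ ∧
        L.EntropyConvexAlong m K N π μ

/-- The weak timelike curvature-dimension condition `wTCD^e_p(K,N)`: the same for strongly timelike
`p`-dualisable pairs of compactly supported measures. -/
def WTCD (p K N : ℝ) : Prop :=
  ∀ μ₀ μ₁ : ProbabilityMeasure X,
    InEntropyDomain (μ₀ : Measure X) m → InEntropyDomain (μ₁ : Measure X) m →
    IsCompact (μ₀ : Measure X).support → IsCompact (μ₁ : Measure X).support →
    (∃ π, L.StronglyTimelikeDualisableBy p μ₀ μ₁ π) →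
    ∃ π, L.StronglyTimelikeDualisableBy p μ₀ μ₁ π ∧
      ∃ μ : ℝ → ProbabilityMeasure X, μ 0 = μ₀ ∧ μ 1 = μ₁ ∧ L.IsEllGeodesic p μ ∧
        L.EntropyConvexAlong m K N π μ

end CurvatureDimension

end LorentzianPreLength

/-- Weak convergence of Radon measures in duality with continuous compactly supported functions. -/
def WeaklyConverges {Y : Type v} [TopologicalSpace Y] [MeasurableSpace Y]
    (ν : ℕ → Measure Y) (ν' : Measure Y) : Prop :=
  (∀ j, IsFiniteMeasureOnCompacts (ν j)) ∧ IsFiniteMeasureOnCompacts ν' ∧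
  ∀ φ : Y → ℝ, Continuous φ → HasCompactSupport φ →
    Tendsto (fun j => ∫ y, φ y ∂(ν j)) atTop (𝓝 (∫ y, φ y ∂ν'))

set_option linter.unusedSectionVars false

/-! The differential inequality does not pass to limits directly, but a midpoint inequality for the
entropy power U = exp(-Ent/N) does. If e'' - (e')²/N ≥ κ, then V = exp(-e/N) satisfies V'' ≤ -(κ/N)
V, and comparison with a Gaussian gives V(1/2) ≥ exp(κ/(8N)) (V(0) + V(1))/2
(`SemiConvex.midpoint_of_distribIneq`). On an interval of half-length h the factor is exp(κh²/(2N)).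
It is weaker than the sharp trigonometric one but agrees with it to second order, so the inequality
at all small scales gives back the distributional one (`DyadicMidpoint.semiConvex_and_distribIneq`).

Everything is transported to the ambient space, where the approximating spaces satisfy
`MidpointCondition`. Given a pair of limit measures all of whose maximal couplings are timelike, one
such coupling is smoothed by a partition of unity into couplings of measures with almost the same
entropy relative to the approximating reference measures. The maximal couplings of these measures
converge to a maximal coupling of the given pair, hence are almost timelike, and restricting them to
the timelike set costs little entropy. Causal diamonds confine all measures to one compact set, so
the curves converge at every time along an ultrafilter. Joint lower semicontinuity of the entropy,
from its Legendre dual formula, then carries the midpoint inequality to the limit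
(`exists_limit_curve`).

This yields the inequality only at the middle of one curve. To have it at every dyadic time t and
every scale h up to the mesh of t, one takes the compact space of curves that move at least as fast
as a geodesic and maximises lexicographically the sums of the entropy power over the dyadic grids of
level 0, 1, 2, and so on. Replacing the curve on (t - h, t + h) by a competitor changes, among the
grid points of the level of t and of coarser levels, only t itself, so the competitor cannot have a
larger entropy power at t (`exists_optimal_curve`). Competitors exist because intermediate pairs
again have only timelike maximal couplings: in the reverse triangle inequality for the transport
cost, strict concavity of x ↦ x^p forces the time separation along intermediate couplings to be a
multiple of that along a maximal coupling of the end points. The same fact compares the curvature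
terms, once the final coupling is chosen to minimise K∫τ² among all maximal ones. Strong
dualisability makes every optimal coupling timelike and admissible. -/

/-! ### Dyadic midpoint inequalities: positivity and semi-convexity. -/

/-- A discrete maximum principle. At a maximal grid point with an end of the interval within δ, the
scale h is chosen to hit the nearer end, where g ≤ 0, and the opposite value is at most S. If both
ends are farther away, the two neighbours are grid points and the maximum spreads to them. -/
theorem nonpos_of_grid_midpoint {g : ℝ → ℝ} {x y S δ : ℝ} (hδ : 0 < δ) (hgx : g x ≤ 0)
    (hgy : g y ≤ 0) (hS : ∀ z ∈ Icc x y, g z ≤ S)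
    (hmid : ∀ (i : ℤ) (h : ℝ), 0 < h → h ≤ δ → x ≤ i * δ - h → i * δ + h ≤ y →
      g (i * δ) ≤ (g (i * δ - h) + g (i * δ + h)) / 2)
    (i : ℤ) (hi : (i * δ : ℝ) ∈ Ioo x y) : g (i * δ) ≤ S / 2 := by
  classical
  set A : Set ℤ := {i : ℤ | (i * δ : ℝ) ∈ Ioo x y} with hA
  have hAfin : A.Finite := by
    refine (Set.finite_Icc ⌊x / δ⌋ ⌈y / δ⌉).subset fun j hj => ?_
    have hj1 : x / δ < j := by rw [div_lt_iff₀ hδ]; exact hj.1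
    have hj2 : (j : ℝ) < y / δ := by rw [lt_div_iff₀ hδ]; exact hj.2
    exact ⟨by exact_mod_cast (Int.floor_le _).trans hj1.le,
      by exact_mod_cast hj2.le.trans (Int.le_ceil _)⟩
  set T := hAfin.toFinset
  have hT : ∀ j, j ∈ T ↔ (j * δ : ℝ) ∈ Ioo x y := fun j => by simp [T, A]
  obtain ⟨k, hkT, hk⟩ := T.exists_max_image (fun j : ℤ => g (j * δ)) ⟨i, (hT i).2 hi⟩
  -- The leftmost maximiser: its left neighbour cannot be maximal as well.
  obtain ⟨l, hlT, hl⟩ := (T.filter fun j : ℤ => g (j * δ) = g (k * δ)).exists_min_image id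
    ⟨k, by simp [hkT]⟩
  rw [Finset.mem_filter] at hlT
  refine (hk i ((hT i).2 hi)).trans ?_
  rw [← hlT.2]
  have hlI := (hT l).1 hlT.1
  by_cases h1 : l * δ - x ≤ δ ∧ l * δ - x ≤ y - l * δ
  · have := hmid l (l * δ - x) (by linarith [hlI.1]) h1.1 (by linarith) (by linarith [h1.2])
    have h2 := hS (l * δ + (l * δ - x)) ⟨by linarith [hlI.1], by linarith [h1.2]⟩
    rw [sub_sub_cancel] at this
    linarith
  by_cases h2 : y - l * δ ≤ δ ∧ y - l * δ ≤ l * δ - x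
  · have := hmid l (y - l * δ) (by linarith [hlI.2]) h2.1 (by linarith [h2.2]) (by linarith)
    have h3 := hS (l * δ - (y - l * δ)) ⟨by linarith [h2.2], by linarith [hlI.2]⟩
    rw [add_sub_cancel] at this
    linarith
  have h3 : δ < l * δ - x ∧ δ < y - l * δ := by grind
  exfalso
  have hm := hmid l δ hδ le_rfl (by linarith) (by linarith)
  have e1 : (l * δ - δ : ℝ) = ((l - 1 : ℤ) : ℝ) * δ := by push_cast; ring
  have e2 : (l * δ + δ : ℝ) = ((l + 1 : ℤ) : ℝ) * δ := by push_cast; ring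
  have m1 : l - 1 ∈ T := by
    rw [hT, ← e1]; exact ⟨by linarith, by linarith⟩
  have m2 : l + 1 ∈ T := by
    rw [hT, ← e2]; exact ⟨by linarith, by linarith⟩
  rw [e1, e2] at hm
  have b1 := hk _ m1
  have b2 := hk _ m2
  rw [← hlT.2] at b1 b2
  have : g ((l - 1 : ℤ) * δ) = g (k * δ) := by rw [← hlT.2]; linarith
  have := hl (l - 1) (Finset.mem_filter.2 ⟨m1, this⟩)
  simp at this

theorem tendsto_dyadic_floor (z : ℝ) :
    Tendsto (fun k : ℕ => (⌊z * 2 ^ k⌋ : ℝ) * (1 / 2) ^ k) atTop (𝓝 z) := by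
  have h0 : Tendsto (fun k : ℕ => (1 / 2 : ℝ) ^ k) atTop (𝓝 0) :=
    tendsto_pow_atTop_nhds_zero_of_lt_one (by norm_num) (by norm_num)
  have hk : ∀ k : ℕ, z * 2 ^ k * (1 / 2) ^ k = z := fun k => by
    rw [mul_assoc, ← mul_pow]; norm_num
  refine tendsto_of_tendsto_of_tendsto_of_le_of_le (g := fun k => z - (1 / 2) ^ k) (h := fun _ => z)
    (by simpa using h0.const_sub z) tendsto_const_nhds (fun k => ?_) (fun k => ?_)
  · have h1 : (z * 2 ^ k - 1) * (1 / 2) ^ k ≤ (⌊z * 2 ^ k⌋ : ℝ) * (1 / 2) ^ k := by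
      gcongr
      exact (Int.sub_one_lt_floor _).le
    rw [sub_mul, hk, one_mul] at h1
    exact h1
  · have h1 : (⌊z * 2 ^ k⌋ : ℝ) * (1 / 2) ^ k ≤ z * 2 ^ k * (1 / 2) ^ k := by
      gcongr
      exact Int.floor_le _
    rw [hk] at h1
    exact h1

/-- A function, bounded above and lower semicontinuous along dyadic approximations from the left,
which satisfies the midpoint inequality around each dyadic point at all scales below the mesh of
that point is convex. -/
theorem convexOn_of_dyadic_midpoint {f : ℝ → ℝ} {a b B : ℝ}
    (hf : ∀ z ∈ Ioo a b, ∀ v < f z, ∃ᶠ k : ℕ in atTop, v < f (⌊z * 2 ^ k⌋ * (1 / 2) ^ k)) (hB : ∀ x ∈ Icc a b, f x ≤ B)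
    (hmid : ∀ (n : ℕ) (i : ℤ) (h : ℝ), 0 < h → h ≤ (1 / 2) ^ n → a ≤ i * (1 / 2) ^ n - h →
      i * (1 / 2) ^ n + h ≤ b →
      f (i * (1 / 2) ^ n) ≤ (f (i * (1 / 2) ^ n - h) + f (i * (1 / 2) ^ n + h)) / 2) :
    ConvexOn ℝ (Icc a b) f := by
  refine LinearOrder.convexOn_of_lt (convex_Icc a b) fun x hx y hy hxy s t hs ht hst => ?_
  have hyx : 0 < y - x := sub_pos.2 hxy
  -- Subtracting the chord reduces convexity to showing that the supremum S of g on [x, y] is at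
  -- most 0.
  set q := (f y - f x) / (y - x) with hq
  set g : ℝ → ℝ := fun z => f z - (f x + q * (z - x)) with hg
  have hgx : g x = 0 := by simp [hg]
  have hgy : g y = 0 := by simp only [hg, hq]; field_simp; ring
  have hsub : Icc x y ⊆ Icc a b := Icc_subset_Icc hx.1 hy.2
  have hbdd : BddAbove (g '' Icc x y) := by
    refine ⟨B + |f x| + |q| * (y - x), ?_⟩
    rintro _ ⟨z, hz, rfl⟩
    have h1 := hB z (hsub hz)
    have h2 : -(q * (z - x)) ≤ |q| * (y - x) := by
      refine (neg_le_abs _).trans ?_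
      rw [abs_mul, abs_of_nonneg (sub_nonneg.2 hz.1)]
      exact mul_le_mul_of_nonneg_left (by linarith [hz.2]) (abs_nonneg _)
    have := neg_le_abs (f x)
    simp only [hg]; linarith
  set S := sSup (g '' Icc x y) with hS
  have hgS : ∀ z ∈ Icc x y, g z ≤ S := fun z hz => le_csSup hbdd ⟨z, hz, rfl⟩
  have hS0 : 0 ≤ S := by rw [← hgx]; exact hgS x (left_mem_Icc.2 hxy.le)
  -- Semicontinuity moves a violation at z to a nearby dyadic point, where the discrete maximum
  -- principle excludes it. Halving S at all interior points forces S ≤ 0.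
  have key : ∀ z ∈ Ioo x y, g z ≤ S / 2 := by
    intro z hz
    by_contra! hlt
    obtain ⟨v, hv1, hv2⟩ := exists_between (lt_sub_iff_add_lt.1 hlt)
    have hz' := tendsto_dyadic_floor z
    have hev : ∀ᶠ k : ℕ in atTop, S / 2 + (f x + q * (⌊z * 2 ^ k⌋ * (1 / 2) ^ k - x)) < v :=
      ((by fun_prop : Continuous fun w : ℝ => S / 2 + (f x + q * (w - x))).continuousAt.tendsto.comp
        hz').eventually (gt_mem_nhds hv1)
    obtain ⟨n, h1, h0, h2⟩ := ((hf z ⟨hx.1.trans_lt hz.1, hz.2.trans_le hy.2⟩ v hv2).and_eventually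
      (hev.and (hz'.eventually (Ioo_mem_nhds hz.1 hz.2)))).exists
    set i : ℤ := ⌊z * 2 ^ n⌋
    replace h1 : S / 2 < g (i * (1 / 2) ^ n) := by simp only [hg]; linarith
    refine absurd (nonpos_of_grid_midpoint (g := g) (x := x) (y := y) (δ := (1 / 2) ^ n)
      (by positivity) hgx.le hgy.le hgS ?_ i h2) (not_le.2 h1)
    intro j h h0 hδ ha hb
    have := hmid n j h h0 hδ (hx.1.trans ha) (hb.trans hy.2)
    simp only [hg]
    linarith
  have hSle : S ≤ S / 2 := by
    refine csSup_le ⟨_, x, left_mem_Icc.2 hxy.le, rfl⟩ ?_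
    rintro _ ⟨z, hz, rfl⟩
    rcases eq_or_lt_of_le hz.1 with h | h
    · rw [← h, hgx]; linarith
    rcases eq_or_lt_of_le hz.2 with h' | h'
    · rw [h', hgy]; linarith
    exact key z ⟨h, h'⟩
  have hmem : s • x + t • y ∈ Icc x y := by
    have hs' : s = 1 - t := by linarith
    subst hs'
    simp only [smul_eq_mul, mem_Icc]
    constructor <;> nlinarith
  have := (hgS _ hmem).trans (by linarith : S ≤ 0)
  simp only [hg, smul_eq_mul] at this ⊢
  have e : q * (s * x + t * y - x) = t * (f y - f x) := by
    have : s * x + t * y - x = t * (y - x) := by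
      rw [show s = 1 - t by linarith]; ring
    rw [this, hq]; field_simp
  rw [e] at this
  have hs' : s = 1 - t := by linarith
  subst hs'
  linarith

/-- The midpoint inequality `U(t) ≥ exp(k h²/2) (U(t-h) + U(t+h))/2` around every dyadic point `t`
of `[0,1]`, at all scales `h` below the mesh of `t` for which both end values are positive. -/
def DyadicMidpoint (k : ℝ) (U : ℝ → ℝ) : Prop :=
  ∀ (n : ℕ) (i : ℤ) (h : ℝ), 0 < h → h ≤ (1 / 2) ^ n → 0 ≤ i * (1 / 2) ^ n - h →
    i * (1 / 2) ^ n + h ≤ 1 → 0 < U (i * (1 / 2) ^ n - h) → 0 < U (i * (1 / 2) ^ n + h) →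
    Real.exp (k * h ^ 2 / 2) * ((U (i * (1 / 2) ^ n - h) + U (i * (1 / 2) ^ n + h)) / 2) ≤
      U (i * (1 / 2) ^ n)

/-- The Gaussian exp(-kt²/2) is a subsolution: inserting it into the right-hand side of the midpoint
inequality reproduces it with the extra factor cosh(kth) ≥ 1. Hence a lower bound by a multiple of
it propagates from t - h and t + h to t. -/
theorem le_mul_exp_of_midpoint {k c t h a b d : ℝ} (hc : 0 ≤ c)
    (ha : c ≤ a * Real.exp (k / 2 * (t - h) ^ 2)) (hb : c ≤ b * Real.exp (k / 2 * (t + h) ^ 2))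
    (hd : Real.exp (k * h ^ 2 / 2) * ((a + b) / 2) ≤ d) : c ≤ d * Real.exp (k / 2 * t ^ 2) := by
  have ha' : c * Real.exp (-(k / 2 * (t - h) ^ 2)) ≤ a := by
    rw [Real.exp_neg, ← div_eq_mul_inv, div_le_iff₀ (Real.exp_pos _)]; exact ha
  have hb' : c * Real.exp (-(k / 2 * (t + h) ^ 2)) ≤ b := by
    rw [Real.exp_neg, ← div_eq_mul_inv, div_le_iff₀ (Real.exp_pos _)]; exact hb
  have h1 : c ≤ c * Real.cosh (k * t * h) := le_mul_of_one_le_right hc (Real.one_le_cosh _)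
  have e1 : Real.exp (k * h ^ 2 / 2) * Real.exp (-(k / 2 * (t - h) ^ 2)) *
      Real.exp (k / 2 * t ^ 2) = Real.exp (k * t * h) := by
    rw [← Real.exp_add, ← Real.exp_add]; congr 1; ring
  have e2 : Real.exp (k * h ^ 2 / 2) * Real.exp (-(k / 2 * (t + h) ^ 2)) *
      Real.exp (k / 2 * t ^ 2) = Real.exp (-(k * t * h)) := by
    rw [← Real.exp_add, ← Real.exp_add]; congr 1; ring
  calc c ≤ c * Real.cosh (k * t * h) := h1
    _ = Real.exp (k * h ^ 2 / 2) * ((c * Real.exp (-(k / 2 * (t - h) ^ 2)) +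
          c * Real.exp (-(k / 2 * (t + h) ^ 2))) / 2) * Real.exp (k / 2 * t ^ 2) := by
        rw [Real.cosh_eq, ← e1, ← e2]; ring
    _ ≤ Real.exp (k * h ^ 2 / 2) * ((a + b) / 2) * Real.exp (k / 2 * t ^ 2) := by gcongr
    _ ≤ d * Real.exp (k / 2 * t ^ 2) := by gcongr

/-- Induction on the level: an odd multiple of the new mesh is the midpoint of two adjacent points
of the old grid. -/
theorem DyadicMidpoint.le_grid {k : ℝ} {U : ℝ → ℝ} (hU : DyadicMidpoint k U) {c : ℝ} (hc : 0 < c)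
    (h0 : c ≤ U 0) (h1 : c ≤ U 1 * Real.exp (k / 2)) (n : ℕ) :
    ∀ i : ℤ, 0 ≤ (i : ℝ) * (1 / 2) ^ n → (i : ℝ) * (1 / 2) ^ n ≤ 1 →
      c ≤ U (i * (1 / 2) ^ n) * Real.exp (k / 2 * (i * (1 / 2) ^ n) ^ 2) := by
  induction n with
  | zero =>
    intro i hi0 hi1
    simp only [pow_zero, mul_one] at *
    have a : 0 ≤ i := by exact_mod_cast hi0
    have b : i ≤ 1 := by exact_mod_cast hi1
    interval_cases i <;> simpa
  | succ n ih =>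
    intro i hi0 hi1
    have hp : (0 : ℝ) < (1 / 2) ^ (n + 1) := by positivity
    have hpn : ((1 : ℝ) / 2) ^ n = 2 * (1 / 2) ^ (n + 1) := by rw [pow_succ]; ring
    rcases Int.even_or_odd' i with ⟨j, rfl | rfl⟩
    · have e : (((2 * j : ℤ) : ℝ)) * (1 / 2) ^ (n + 1) = j * (1 / 2) ^ n := by
        rw [hpn]; push_cast; ring
      rw [e] at hi0 hi1 ⊢
      exact ih j hi0 hi1
    · set t : ℝ := ((2 * j + 1 : ℤ) : ℝ) * (1 / 2) ^ (n + 1) with ht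
      have e1 : t - (1 / 2) ^ (n + 1) = j * (1 / 2) ^ n := by
        rw [hpn, ht]; push_cast; ring
      have e2 : t + (1 / 2) ^ (n + 1) = (j + 1 : ℤ) * (1 / 2) ^ n := by
        rw [hpn, ht]; push_cast; ring
      have i0 : 0 < t := by
        rcases hi0.eq_or_lt with h | h
        · exfalso
          have : ((2 * j + 1 : ℤ) : ℝ) = 0 := by
            rw [ht] at h; rcases mul_eq_zero.1 h.symm with h | h
            · exact h
            · exact absurd h hp.ne'
          have : (2 * j + 1 : ℤ) = 0 := by exact_mod_cast this
          omega
        · exact h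
      have hjr : 0 < (2 * j + 1 : ℤ) := by
        have := pos_of_mul_pos_left i0 hp.le
        exact_mod_cast this
      have hup : (2 * j + 1 : ℤ) ≤ 2 ^ (n + 1) := by
        have : ((2 * j + 1 : ℤ) : ℝ) ≤ 2 ^ (n + 1) := by
          have := mul_le_mul_of_nonneg_right hi1 (by positivity : (0 : ℝ) ≤ 2 ^ (n + 1))
          rw [ht, mul_assoc, ← mul_pow] at this
          simpa using this
        exact_mod_cast this
      have hup' : j + 1 ≤ 2 ^ n := by rw [pow_succ] at hup; omega
      have a0 : 0 ≤ (j : ℝ) * (1 / 2) ^ n :=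
        mul_nonneg (by exact_mod_cast (by omega : 0 ≤ j)) (by positivity)
      have a1 : ((j + 1 : ℤ) : ℝ) * (1 / 2) ^ n ≤ 1 := by
        have : ((j + 1 : ℤ) : ℝ) ≤ 2 ^ n := by exact_mod_cast hup'
        calc ((j + 1 : ℤ) : ℝ) * (1 / 2) ^ n ≤ 2 ^ n * (1 / 2) ^ n := by gcongr
          _ = 1 := by rw [← mul_pow]; norm_num
      have b0 : (j : ℝ) * (1 / 2) ^ n ≤ 1 := by rw [← e1]; linarith
      have b1 : 0 ≤ ((j + 1 : ℤ) : ℝ) * (1 / 2) ^ n := by rw [← e2]; linarith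
      have c1 := ih j a0 b0
      have c2 := ih (j + 1) b1 a1
      rw [← e1] at c1 a0
      rw [← e2] at c2 a1
      exact le_mul_exp_of_midpoint hc.le (h := (1 / 2) ^ (n + 1)) c1 c2
        (hU (n + 1) (2 * j + 1) _ hp le_rfl a0 a1
          (pos_of_mul_pos_left (hc.trans_le c1) (Real.exp_pos _).le)
          (pos_of_mul_pos_left (hc.trans_le c2) (Real.exp_pos _).le))

/-- Positivity at the two ends alone spreads to the whole interval, first over the dyadic points and
then by semicontinuity. This is what later gives finite entropy at all times. -/
theorem DyadicMidpoint.exists_pos_le {k : ℝ} {U : ℝ → ℝ} (hU : DyadicMidpoint k U)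
    (husc : ∀ t ∈ Ioo (0 : ℝ) 1, ∀ v, U t < v →
      ∃ᶠ k : ℕ in atTop, U (⌊t * 2 ^ k⌋ * (1 / 2) ^ k) < v) (h0 : 0 < U 0) (h1 : 0 < U 1) :
    ∃ c > 0, ∀ t ∈ Icc (0 : ℝ) 1, c ≤ U t * Real.exp (k / 2 * t ^ 2) := by
  set c := min (U 0) (U 1 * Real.exp (k / 2)) with hc
  have hcpos : 0 < c := lt_min h0 (by positivity)
  refine ⟨c, hcpos, fun t ht => ?_⟩
  rcases ht.1.eq_or_lt with rfl | ht0
  · simp [hc]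
  rcases ht.2.eq_or_lt with rfl | ht1
  · simp [hc]
  by_contra! hlt
  have hlt' : U t < c * Real.exp (-(k / 2 * t ^ 2)) := by
    rw [Real.exp_neg, ← div_eq_mul_inv, lt_div_iff₀ (Real.exp_pos _)]; exact hlt
  obtain ⟨y, hy1, hy2⟩ := exists_between hlt'
  have e2 : ∀ᶠ s in 𝓝 t, y < c * Real.exp (-(k / 2 * s ^ 2)) :=
    (by fun_prop : Continuous fun s : ℝ => c * Real.exp (-(k / 2 * s ^ 2))).continuousAt.eventually
      (lt_mem_nhds hy2)
  obtain ⟨n, a1, a2, a3⟩ := ((husc t ⟨ht0, ht1⟩ y hy1).and_eventually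
    ((tendsto_dyadic_floor t).eventually (e2.and (Ioo_mem_nhds ht0 ht1)))).exists
  set i : ℤ := ⌊t * 2 ^ n⌋
  have := hU.le_grid hcpos (min_le_left _ _) (min_le_right _ _) n i a3.1.le a3.2.le
  rw [Real.exp_neg, ← div_eq_mul_inv, lt_div_iff₀ (Real.exp_pos _)] at a2
  have h4 : U (i * (1 / 2) ^ n) * Real.exp (k / 2 * (i * (1 / 2) ^ n) ^ 2) <
    y * Real.exp (k / 2 * (i * (1 / 2) ^ n) ^ 2) := mul_lt_mul_of_pos_right a1 (Real.exp_pos _)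
  linarith

theorem add_log_div_two_le_log {a b : ℝ} (ha : 0 < a) (hb : 0 < b) :
    (Real.log a + Real.log b) / 2 ≤ Real.log ((a + b) / 2) := by
  have := strictConcaveOn_log_Ioi.concaveOn.2 (mem_Ioi.2 ha) (mem_Ioi.2 hb)
    (by norm_num : (0 : ℝ) ≤ 1 / 2) (by norm_num : (0 : ℝ) ≤ 1 / 2) (by norm_num)
  simp only [smul_eq_mul] at this
  calc _ = 1 / 2 * Real.log a + 1 / 2 * Real.log b := by ring
    _ ≤ _ := this
    _ = _ := by congr 1; ring

/-- After taking logarithms, the second difference of (k/2)t² cancels the factor exp(kh²/2) exactly,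
and concavity of the logarithm leaves plain midpoint convexity. -/
theorem DyadicMidpoint.convexOn {k : ℝ} {U : ℝ → ℝ} (hU : DyadicMidpoint k U)
    (husc : ∀ t ∈ Ioo (0 : ℝ) 1, ∀ v, U t < v →
      ∃ᶠ k : ℕ in atTop, U (⌊t * 2 ^ k⌋ * (1 / 2) ^ k) < v) (h0 : 0 < U 0) (h1 : 0 < U 1) :
    ConvexOn ℝ (Icc 0 1) fun t => -Real.log (U t) - k / 2 * t ^ 2 := by
  obtain ⟨c, hc, hcU⟩ := hU.exists_pos_le husc h0 h1
  have hpos : ∀ t ∈ Icc (0 : ℝ) 1, 0 < U t := fun t ht =>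
    pos_of_mul_pos_left (hc.trans_le (hcU t ht)) (Real.exp_pos _).le
  refine convexOn_of_dyadic_midpoint (B := -Real.log c) ?_ ?_ ?_
  · intro t ht v hv
    obtain ⟨w, hw1, hw2⟩ := exists_between (lt_sub_iff_add_lt.1 hv)
    have hw : U t < Real.exp (-w) := by
      rw [← Real.log_lt_iff_lt_exp (hpos t (Ioo_subset_Icc_self ht))]; linarith
    have hev := (tendsto_dyadic_floor t).eventually
      (((by fun_prop : Continuous fun s : ℝ => v + k / 2 * s ^ 2).continuousAt.eventually
        (gt_mem_nhds hw1)).and (Ioo_mem_nhds ht.1 ht.2))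
    refine ((husc t ht _ hw).and_eventually hev).mono fun n hn => ?_
    obtain ⟨h1, h2, h3⟩ := hn
    rw [← Real.log_lt_iff_lt_exp (hpos _ (Ioo_subset_Icc_self h3))] at h1
    linarith
  · intro t ht
    have := Real.log_le_log hc (hcU t ht)
    rw [Real.log_mul (hpos t ht).ne' (Real.exp_pos _).ne', Real.log_exp] at this
    linarith
  · intro n i h hh hn ha hb
    set t : ℝ := i * (1 / 2) ^ n
    have p1 := hpos (t - h) ⟨ha, by linarith⟩
    have p2 := hpos (t + h) ⟨by linarith, hb⟩
    have := Real.log_le_log (by positivity) (hU n i h hh hn ha hb p1 p2)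
    rw [Real.log_mul (Real.exp_pos _).ne' (by positivity), Real.log_exp] at this
    have h3 := add_log_div_two_le_log p1 p2
    linarith [show k / 2 * t ^ 2 + k * h ^ 2 / 2 =
      (k / 2 * (t - h) ^ 2 + k / 2 * (t + h) ^ 2) / 2 by ring]

/-! ### From the midpoint inequality to the distributional inequality. -/

/-- Cauchy's mean value theorem against s², followed by the mean value theorem for φ'. -/
theorem exists_secondDiff_eq {φ : ℝ → ℝ} (hφ : ContDiff ℝ ∞ φ) (t : ℝ) {h : ℝ} (hh : 0 < h) :
    ∃ ξ ∈ Ioo (t - h) (t + h), φ (t + h) + φ (t - h) - 2 * φ t = h ^ 2 * deriv (deriv φ) ξ := by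
  have hd : Differentiable ℝ φ := hφ.differentiable (by norm_num)
  have hd2 : Differentiable ℝ (deriv φ) :=
    ((contDiff_infty_iff_deriv.1 hφ).2).differentiable (by norm_num)
  have hψ : ∀ s, HasDerivAt (fun s => φ (t + s) + φ (t - s) - 2 * φ t)
      (deriv φ (t + s) - deriv φ (t - s)) s := by
    intro s
    have a1 : HasDerivAt (fun s => φ (t + s)) (deriv φ (t + s)) s := by
      simpa using (hd (t + s)).hasDerivAt.comp_const_add t s
    have a2 : HasDerivAt (fun s => φ (t - s)) (-deriv φ (t - s)) s := by
      simpa using (hd (t - s)).hasDerivAt.comp_const_sub t s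
    simpa [sub_eq_add_neg] using (a1.add a2).sub_const (2 * φ t)
  have hsq : ∀ s : ℝ, HasDerivAt (fun s : ℝ => s ^ 2) (2 * s) s := fun s => by
    simpa using hasDerivAt_pow 2 s
  obtain ⟨s, hs, hs'⟩ := exists_ratio_hasDerivAt_eq_ratio_slope
    (fun s => φ (t + s) + φ (t - s) - 2 * φ t) _ hh
    (fun s _ => (hψ s).continuousAt.continuousWithinAt) (fun s _ => hψ s)
    (fun s : ℝ => s ^ 2) _ (fun s _ => (hsq s).continuousAt.continuousWithinAt) (fun s _ => hsq s)
  obtain ⟨ξ, hξ, hξ'⟩ := exists_hasDerivAt_eq_slope (deriv φ) (deriv (deriv φ))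
    (by linarith [hs.1] : t - s < t + s) hd2.continuous.continuousOn
    (fun x _ => (hd2 x).hasDerivAt)
  refine ⟨ξ, ⟨by linarith [hξ.1, hs.2], by linarith [hξ.2, hs.2]⟩, ?_⟩
  have hs0 : s ≠ 0 := hs.1.ne'
  have e : deriv φ (t + s) - deriv φ (t - s) = 2 * s * deriv (deriv φ) ξ := by
    rw [hξ', show t + s - (t - s) = 2 * s by ring]; field_simp
  rw [e] at hs'
  simp only [add_zero, sub_zero] at hs'
  have : 2 * s * (φ (t + h) + φ (t - h) - 2 * φ t - h ^ 2 * deriv (deriv φ) ξ) = 0 := by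
    linear_combination -hs'
  have := (mul_eq_zero.1 this).resolve_left (by positivity)
  linarith

/-- The hypothesis only concerns dyadic centres, with scales limited by their level. Near t,
expanding the exponential turns it into dyadic midpoint convexity of -U - (k'/2)s². That function is
then convex on a whole interval, so centre and scale become arbitrary. -/
theorem DyadicMidpoint.secondDiff_le {k : ℝ} {U : ℝ → ℝ} (hU : DyadicMidpoint k U)
    (hc : ContinuousOn U (Ioo 0 1)) (hpos : ∀ t ∈ Icc (0 : ℝ) 1, 0 < U t) {t : ℝ}
    (ht : t ∈ Ioo (0 : ℝ) 1) {k' : ℝ} (hk' : k' < k * U t) :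
    ∀ᶠ h in 𝓝[>] (0 : ℝ), U (t + h) + U (t - h) - 2 * U t ≤ -k' * h ^ 2 := by
  have hct : ContinuousAt U t := hc.continuousAt (Ioo_mem_nhds ht.1 ht.2)
  -- The expression with k - k²h²/2 comes from the bound exp(-x) ≤ 1 - x + x² at x = kh²/2, which is
  -- available for |x| ≤ 1.
  have hev : ∀ᶠ z : ℝ × ℝ in 𝓝 (t, 0), k' < U z.1 * (k - k ^ 2 * z.2 ^ 2 / 2) ∧
      |k * z.2 ^ 2 / 2| < 1 ∧ z.1 ∈ Ioo (0 : ℝ) 1 := by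
    have h1 : ContinuousAt (fun z : ℝ × ℝ => U z.1 * (k - k ^ 2 * z.2 ^ 2 / 2)) (t, 0) := by
      have : ContinuousAt (fun z : ℝ × ℝ => U z.1) (t, 0) :=
        ContinuousAt.comp (f := Prod.fst) (x := ((t, 0) : ℝ × ℝ)) hct continuousAt_fst
      exact this.mul (by fun_prop)
    have h2 : ContinuousAt (fun z : ℝ × ℝ => |k * z.2 ^ 2 / 2|) (t, 0) := by fun_prop
    have h3 : ContinuousAt (fun z : ℝ × ℝ => z.1) (t, 0) := continuousAt_fst
    refine (h1.eventually (lt_mem_nhds ?_)).and ((h2.eventually (gt_mem_nhds ?_)).and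
      (h3.eventually (Ioo_mem_nhds ht.1 ht.2)))
    · simp only; rw [mul_comm] at hk'; simpa using hk'
    · simp
  obtain ⟨r, hr, hball⟩ := Metric.eventually_nhds_iff.1 hev
  have hball' : ∀ s h : ℝ, |s - t| < r → |h| < r → k' < U s * (k - k ^ 2 * h ^ 2 / 2) ∧
      |k * h ^ 2 / 2| < 1 ∧ s ∈ Ioo (0 : ℝ) 1 := fun s h hs hh =>
    hball (y := (s, h)) (by rw [Prod.dist_eq]; simpa [Real.dist_eq] using ⟨hs, hh⟩)
  have hJ : ∀ s ∈ Icc (t - r / 2) (t + r / 2), |s - t| < r := fun s hs => by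
    rw [abs_lt]; constructor <;> linarith [hs.1, hs.2]
  have hconv : ConvexOn ℝ (Icc (t - r / 2) (t + r / 2)) fun s => -U s - k' / 2 * s ^ 2 := by
    refine convexOn_of_dyadic_midpoint (B := |k'| / 2) ?_ ?_ ?_
    · intro s hs v hv
      have hUs := (hc.continuousAt (Ioo_mem_nhds (hball' s 0 (hJ s (Ioo_subset_Icc_self hs))
        (by simpa using hr)).2.2.1 (hball' s 0 (hJ s (Ioo_subset_Icc_self hs))
        (by simpa using hr)).2.2.2)).neg.sub
        (by fun_prop : ContinuousAt (fun s : ℝ => k' / 2 * s ^ 2) s)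
      exact ((tendsto_dyadic_floor s).eventually (hUs.eventually (lt_mem_nhds hv))).frequently
    · intro s hs
      have := (hball' s 0 (hJ s hs) (by simpa using hr)).2.2
      have h1 := (hpos s (Ioo_subset_Icc_self this)).le
      have h2 : -(k' / 2 * s ^ 2) ≤ |k'| / 2 := by
        refine (neg_le_abs _).trans ?_
        rw [abs_mul, abs_div, abs_of_nonneg (sq_nonneg s)]
        norm_num
        refine mul_le_of_le_one_right (by positivity) ?_
        nlinarith [this.1, this.2]
      linarith
    · intro n i h hh hn ha hb
      set s : ℝ := i * (1 / 2) ^ n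
      have b1 := (hball' (s - h) 0 (hJ _ ⟨ha, by linarith⟩) (by simpa using hr)).2.2
      have b2 := (hball' (s + h) 0 (hJ _ ⟨by linarith, hb⟩) (by simpa using hr)).2.2
      have hr2 : |h| < r := by rw [abs_of_pos hh]; linarith
      obtain ⟨c1, c2, c3⟩ := hball' s h (hJ _ ⟨by linarith, by linarith⟩) hr2
      have hm := hU n i h hh hn b1.1.le b2.2.le (hpos _ (Ioo_subset_Icc_self b1))
        (hpos _ (Ioo_subset_Icc_self b2))
      have hm' : U (s - h) + U (s + h) ≤ 2 * U s * Real.exp (-(k * h ^ 2 / 2)) := by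
        rw [Real.exp_neg, ← div_eq_mul_inv, le_div_iff₀ (Real.exp_pos _)]
        linarith
      have hexp := (abs_le.1 (Real.abs_exp_sub_one_sub_id_le
        (x := -(k * h ^ 2 / 2)) (by rw [abs_neg]; exact c2.le))).2
      have hUs := (hpos s (Ioo_subset_Icc_self c3)).le
      have h5 : 2 * U s * Real.exp (-(k * h ^ 2 / 2)) ≤
          2 * U s * (1 - (k * h ^ 2 / 2) + (k * h ^ 2 / 2) ^ 2) := by
        gcongr; linarith
      have h6 : k' * h ^ 2 ≤ U s * (k - k ^ 2 * h ^ 2 / 2) * h ^ 2 := by gcongr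
      have h7 : 2 * U s * (1 - (k * h ^ 2 / 2) + (k * h ^ 2 / 2) ^ 2) =
          2 * U s - U s * (k - k ^ 2 * h ^ 2 / 2) * h ^ 2 := by ring
      linarith [show k' / 2 * (s - h) ^ 2 + k' / 2 * (s + h) ^ 2 =
        2 * (k' / 2 * s ^ 2) + k' * h ^ 2 by ring]
  filter_upwards [Ioo_mem_nhdsGT (by positivity : (0 : ℝ) < r / 2)] with h hh
  have := hconv.2 (x := t - h) ⟨by linarith [hh.2], by linarith [hh.1]⟩ (y := t + h)
    ⟨by linarith [hh.1], by linarith [hh.2]⟩ (by norm_num : (0 : ℝ) ≤ 1 / 2)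
    (by norm_num : (0 : ℝ) ≤ 1 / 2) (by norm_num)
  simp only [smul_eq_mul] at this
  rw [show (1 / 2 * (t - h) + 1 / 2 * (t + h)) = t by ring] at this
  nlinarith

/-- Since uv = (P² - Q²)/4, the inequality log x ≤ x - 1 at uv/a² bounds the second difference of
the logarithm. The term with Q, a squared first difference, is the source of (e')². -/
theorem le_secondDiff_neg_log {N a c P Q h u v k' : ℝ} (hN : 0 < N) (ha : 0 < a) (hu : 0 < u)
    (hv : 0 < v) (hP : P = u + v) (hQ : Q = u - v) (hP' : P - 2 * a ≤ -k' * h ^ 2)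
    (hc : c * h ^ 2 ≤ N * (k' / a * h ^ 2 - k' ^ 2 * h ^ 4 / (4 * a ^ 2) + (Q / (2 * a)) ^ 2)) :
    c * h ^ 2 ≤ -N * Real.log u + -N * Real.log v - 2 * (-N * Real.log a) := by
  have h1 : Real.log (u * v / a ^ 2) ≤ u * v / a ^ 2 - 1 := Real.log_le_sub_one_of_pos (by positivity)
  rw [Real.log_div (by positivity) (by positivity), Real.log_mul hu.ne' hv.ne', Real.log_pow] at h1
  have h2 : u * v = (P ^ 2 - Q ^ 2) / 4 := by rw [hP, hQ]; ring
  have h3 : P ^ 2 ≤ (2 * a - k' * h ^ 2) ^ 2 := by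
    have : 0 < P := by rw [hP]; positivity
    exact pow_le_pow_left₀ this.le (by linarith) 2
  have h4 : u * v / a ^ 2 - 1 ≤
      -(k' / a * h ^ 2 - k' ^ 2 * h ^ 4 / (4 * a ^ 2) + (Q / (2 * a)) ^ 2) := by
    rw [h2]
    have : ((P ^ 2 - Q ^ 2) / 4) / a ^ 2 ≤ (((2 * a - k' * h ^ 2) ^ 2 - Q ^ 2) / 4) / a ^ 2 := by
      gcongr
    refine (sub_le_sub_right this 1).trans (le_of_eq ?_)
    field_simp
    ring
  push_cast at h1
  nlinarith

/-- At a point of differentiability the symmetric difference quotient of U, divided by U(t), tends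
to -e'(t)/N, so the bound of `le_secondDiff_neg_log` tends to N k'/U(t) + (e')²/N. The room between
c and the limit absorbs the errors. -/
theorem DyadicMidpoint.secondDiff_neg_log {k N : ℝ} (hN : 0 < N) {U e : ℝ → ℝ}
    (hU : DyadicMidpoint k U) (hc : ContinuousOn U (Ioo 0 1)) (hpos : ∀ t ∈ Icc (0 : ℝ) 1, 0 < U t)
    (he : ∀ t ∈ Icc (0 : ℝ) 1, e t = -N * Real.log (U t)) {t : ℝ} (ht : t ∈ Ioo (0 : ℝ) 1)
    (hd : DifferentiableAt ℝ e t) {c : ℝ} (hck : c < N * k + (deriv e t) ^ 2 / N) :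
    ∀ᶠ h in 𝓝[>] (0 : ℝ), c * h ^ 2 ≤ e (t + h) + e (t - h) - 2 * e t := by
  have hI : Ioo (0 : ℝ) 1 ∈ 𝓝 t := Ioo_mem_nhds ht.1 ht.2
  have ha := hpos t (Ioo_subset_Icc_self ht)
  have hUe : ∀ s ∈ Ioo (0 : ℝ) 1, U s = Real.exp (-(e s / N)) := fun s hs => by
    rw [he s (Ioo_subset_Icc_self hs), show -(-N * Real.log (U s) / N) = Real.log (U s) by
      field_simp, Real.exp_log (hpos s (Ioo_subset_Icc_self hs))]
  set d := deriv e t with hd'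
  have hUd : HasDerivAt U (-(d / N) * U t) t := by
    have h1 : HasDerivAt (fun s => Real.exp (-(e s / N))) (Real.exp (-(e t / N)) * -(d / N)) t :=
      ((hd.hasDerivAt.div_const N).neg).exp
    rw [← hUe t ht, mul_comm] at h1
    exact h1.congr_of_eventuallyEq (by filter_upwards [hI] with s hs using hUe s hs)
  obtain ⟨k', hk1, hk2⟩ : ∃ k', k' < k * U t ∧ c < N * (k' / U t + (d / N) ^ 2) := by
    have hx : c / N - (d / N) ^ 2 < k := by
      rw [sub_lt_iff_lt_add, div_lt_iff₀ hN]
      calc c < N * k + d ^ 2 / N := hck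
        _ = (k + (d / N) ^ 2) * N := by field_simp
    obtain ⟨y, hy1, hy2⟩ := exists_between hx
    refine ⟨y * U t, by gcongr, ?_⟩
    rw [mul_div_cancel_right₀ _ ha.ne', mul_comm, ← div_lt_iff₀ hN]
    linarith
  have hslope : Tendsto (fun h => (U (t + h) - U (t - h)) / (2 * U t) / h) (𝓝[>] 0) (𝓝 (-(d / N))) := by
    have h1 : HasDerivAt (fun h => U (t + h)) (-(d / N) * U t) 0 := by
      have := hUd; rw [← add_zero t] at this
      simpa using this.comp_const_add t 0
    have h2 : HasDerivAt (fun h => U (t - h)) (-(-(d / N) * U t)) 0 := by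
      have := hUd; rw [← sub_zero t] at this
      simpa using this.comp_const_sub t 0
    have h3 := ((h1.sub h2).div_const (2 * U t)).tendsto_slope_zero_right
    refine (h3.congr fun h => ?_).trans (by
      rw [show (-(d / N) * U t - -(-(d / N) * U t)) / (2 * U t) = -(d / N) by field_simp; ring])
    simp; ring
  have hlim : Tendsto (fun h : ℝ => N * (k' / U t - k' ^ 2 * h ^ 2 / (4 * (U t) ^ 2) +
      ((U (t + h) - U (t - h)) / (2 * U t) / h) ^ 2)) (𝓝[>] 0) (𝓝 (N * (k' / U t + (d / N) ^ 2))) := by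
    have h1 : Tendsto (fun h : ℝ => k' / U t - k' ^ 2 * h ^ 2 / (4 * (U t) ^ 2)) (𝓝[>] 0)
        (𝓝 (k' / U t)) := by
      have : Continuous fun h : ℝ => k' / U t - k' ^ 2 * h ^ 2 / (4 * (U t) ^ 2) := by fun_prop
      simpa using (this.tendsto 0).mono_left nhdsWithin_le_nhds
    have := (h1.add (hslope.pow 2)).const_mul N
    simpa using this
  have hnear : ∀ᶠ h in 𝓝[>] (0 : ℝ), t + h ∈ Ioo (0 : ℝ) 1 ∧ t - h ∈ Ioo (0 : ℝ) 1 := by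
    refine nhdsWithin_le_nhds (Filter.Eventually.and ?_ ?_)
    · exact (by fun_prop : Continuous fun h : ℝ => t + h).continuousAt.eventually
        (by simp only [add_zero]; exact hI)
    · exact (by fun_prop : Continuous fun h : ℝ => t - h).continuousAt.eventually
        (by simp only [sub_zero]; exact hI)
  filter_upwards [hU.secondDiff_le hc hpos ht hk1,
    hlim.eventually (lt_mem_nhds hk2), hnear, self_mem_nhdsWithin] with h h1 h2 h3 hh
  have hh0 : (0 : ℝ) < h := hh
  rw [he _ (Ioo_subset_Icc_self h3.1), he _ (Ioo_subset_Icc_self h3.2),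
    he _ (Ioo_subset_Icc_self ht)]
  refine le_secondDiff_neg_log hN ha (hpos _ (Ioo_subset_Icc_self h3.1))
    (hpos _ (Ioo_subset_Icc_self h3.2)) rfl rfl h1 ?_
  calc c * h ^ 2 ≤ _ := mul_le_mul_of_nonneg_right h2.le (sq_nonneg h)
    _ = _ := by field_simp

theorem ConvexOn.le_secondDiff {κ : ℝ} {e : ℝ → ℝ}
    (hconv : ConvexOn ℝ (Icc 0 1) fun t => e t - κ / 2 * t ^ 2) {t h : ℝ}
    (h1 : t + h ∈ Icc (0 : ℝ) 1) (h2 : t - h ∈ Icc (0 : ℝ) 1) :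
    κ * h ^ 2 ≤ e (t + h) + e (t - h) - 2 * e t := by
  have := hconv.2 h1 h2 (by norm_num : (0 : ℝ) ≤ 1 / 2) (by norm_num : (0 : ℝ) ≤ 1 / 2)
    (by norm_num)
  simp only [smul_eq_mul] at this
  rw [show (1 / 2 * (t + h) + 1 / 2 * (t - h)) = t by ring] at this
  nlinarith

/-- Convex functions are locally Lipschitz in the interior, so Rademacher's theorem applies on
compact subsets. -/
theorem ConvexOn.ae_differentiableAt_of_semiconvex {κ : ℝ} {e : ℝ → ℝ}
    (hconv : ConvexOn ℝ (Icc 0 1) fun t => e t - κ / 2 * t ^ 2) {K : Set ℝ} (hK : IsCompact K)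
    (hK1 : K ⊆ Ioo 0 1) : ∀ᵐ t, t ∈ interior K → DifferentiableAt ℝ e t := by
  have h1 := hconv.locallyLipschitzOn_interior
  rw [interior_Icc] at h1
  obtain ⟨C, hC⟩ := (h1.mono hK1).exists_lipschitzOnWith_of_compact hK
  filter_upwards [hC.ae_differentiableWithinAt_of_mem_real] with t ht htK
  have h2 := (ht (interior_subset htK)).differentiableAt (mem_interior_iff_mem_nhds.1 htK)
  have h3 : DifferentiableAt ℝ (fun t : ℝ => κ / 2 * t ^ 2) t := by fun_prop
  have h4 := h2.add h3
  refine h4.congr_of_eventuallyEq (Eventually.of_forall fun s => ?_)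
  simp

theorem ConvexOn.continuousOn_of_semiconvex {κ : ℝ} {e : ℝ → ℝ}
    (hconv : ConvexOn ℝ (Icc 0 1) fun t => e t - κ / 2 * t ^ 2) : ContinuousOn e (Ioo 0 1) := by
  have h1 := hconv.continuousOn_interior
  rw [interior_Icc] at h1
  have := h1.add (by fun_prop : ContinuousOn (fun t : ℝ => κ / 2 * t ^ 2) (Ioo 0 1))
  exact this.congr fun t _ => by simp

/-- Discrete integration by parts: translation invariance moves the second difference to φ, where it
is a value of φ'' and dominated convergence applies. -/
theorem tendsto_integral_secondDiff {φ e : ℝ → ℝ} (hφ : ContDiff ℝ ∞ φ) (hφc : HasCompactSupport φ)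
    (he : Integrable e) {h : ℕ → ℝ} (hh : ∀ n, 0 < h n) (hlim : Tendsto h atTop (𝓝 0)) :
    (∀ n, Integrable fun t => φ t * ((e (t + h n) + e (t - h n) - 2 * e t) / h n ^ 2)) ∧
    Tendsto (fun n => ∫ t, φ t * ((e (t + h n) + e (t - h n) - 2 * e t) / h n ^ 2)) atTop
      (𝓝 (∫ t, e t * deriv (deriv φ) t)) := by
  have hcont := hφ.continuous
  have hφ2 : ContDiff ℝ ∞ (deriv (deriv φ)) :=
    (contDiff_infty_iff_deriv.1 (contDiff_infty_iff_deriv.1 hφ).2).2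
  obtain ⟨B, hB⟩ := hcont.bounded_above_of_compact_support hφc
  obtain ⟨C, hC⟩ := hφ2.continuous.bounded_above_of_compact_support hφc.deriv.deriv
  have hmul : ∀ {f : ℝ → ℝ}, Integrable f → ∀ s, Integrable fun t => φ (t + s) * f t :=
    fun hf s => hf.bdd_mul (c := B) (by fun_prop) (Eventually.of_forall fun t => hB _)
  have hi1 : ∀ n, Integrable fun t => φ t * e (t + h n) := fun n => by
    simpa using hmul (he.comp_add_right (h n)) 0
  have hi2 : ∀ n, Integrable fun t => φ t * e (t - h n) := fun n => by
    simpa using hmul (he.comp_sub_right (h n)) 0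
  have hi3 : Integrable fun t => φ t * e t := by simpa using hmul he 0
  have hi12 : ∀ n, Integrable fun t => φ t * e (t + h n) + φ t * e (t - h n) :=
    fun n => (hi1 n).add (hi2 n)
  have hm1 : ∀ n, Integrable fun t => φ (t - h n) * e t := fun n => hmul he (-h n)
  have hm12 : ∀ n, Integrable fun t => φ (t - h n) * e t + φ (t + h n) * e t :=
    fun n => (hm1 n).add (hmul he (h n))
  have hexp : ∀ n, (fun t => φ t * ((e (t + h n) + e (t - h n) - 2 * e t) / h n ^ 2)) =
      fun t => (φ t * e (t + h n) + φ t * e (t - h n) - 2 * (φ t * e t)) / h n ^ 2 := fun n => by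
    ext t; ring
  have hint : ∀ n, ∫ t, φ t * ((e (t + h n) + e (t - h n) - 2 * e t) / h n ^ 2) =
      ∫ t, e t * ((φ (t + h n) + φ (t - h n) - 2 * φ t) / h n ^ 2) := by
    intro n
    rw [hexp, integral_div]
    have e1 : ∫ t, φ t * e (t + h n) = ∫ t, φ (t - h n) * e t := by
      rw [← integral_add_right_eq_self (fun t => φ (t - h n) * e t) (h n)]; simp
    have e2 : ∫ t, φ t * e (t - h n) = ∫ t, φ (t + h n) * e t := by
      rw [← integral_sub_right_eq_self (fun t => φ (t + h n) * e t) (h n)]; simp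
    rw [integral_sub (hi12 n) (hi3.const_mul 2),
      integral_add (hi1 n) (hi2 n), integral_const_mul, e1, e2, ← integral_const_mul,
      ← integral_add (hm1 n) (hmul he (h n)),
      ← integral_sub (hm12 n) (hi3.const_mul 2), ← integral_div]
    congr 1; ext t; ring
  refine ⟨fun n => ?_, ?_⟩
  · rw [hexp]
    exact ((hi12 n).sub (hi3.const_mul 2)).div_const _
  simp_rw [hint]
  have hsd : ∀ n t, ∃ ξ ∈ Ioo (t - h n) (t + h n),
      (φ (t + h n) + φ (t - h n) - 2 * φ t) / h n ^ 2 = deriv (deriv φ) ξ := fun n t => by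
    obtain ⟨ξ, h1, h2⟩ := exists_secondDiff_eq hφ t (hh n)
    refine ⟨ξ, h1, ?_⟩
    rw [h2]; have := (hh n).ne'; field_simp
  refine tendsto_integral_of_dominated_convergence (fun t => |e t| * C) (fun n => ?_)
    (he.abs.mul_const C) (fun n => Eventually.of_forall fun t => ?_)
    (Eventually.of_forall fun t => ?_)
  · exact he.aestronglyMeasurable.mul (by fun_prop)
  · obtain ⟨ξ, -, h2⟩ := hsd n t
    rw [h2, norm_mul]
    exact mul_le_mul_of_nonneg_left (hC ξ) (norm_nonneg _)
  · refine Tendsto.const_mul _ ?_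
    choose ξ h1 h2 using fun n => hsd n t
    simp_rw [h2]
    refine (hφ2.continuous.tendsto t).comp ?_
    refine tendsto_of_tendsto_of_tendsto_of_le_of_le (g := fun n => t - h n) (h := fun n => t + h n)
      ?_ ?_ (fun n => (h1 n).1.le) (fun n => (h1 n).2.le)
    · simpa using hlim.const_sub t
    · simpa using hlim.const_add t

/-- Fatou's lemma for the second difference quotients of e tested against φ. Subtracting κφ makes
the integrands nonnegative by semi-convexity, and what remains in the lower limit is (e')²φ/N almost
everywhere. -/
theorem DyadicMidpoint.distribIneq {κ N : ℝ} (hN : 0 < N) {U e : ℝ → ℝ}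
    (hU : DyadicMidpoint (κ / N) U) (hc : ContinuousOn U (Ioo 0 1))
    (hpos : ∀ t ∈ Icc (0 : ℝ) 1, 0 < U t)
    (he : ∀ t ∈ Icc (0 : ℝ) 1, e t = -N * Real.log (U t))
    (hconv : ConvexOn ℝ (Icc 0 1) fun t => e t - κ / 2 * t ^ 2) : DistribIneq N (κ : EReal) e := by
  intro c hcr φ hφ hφc hsupp hφ0
  have hcκ : c ≤ κ := by exact_mod_cast hcr
  refine (mul_le_mul_of_nonneg_right hcκ (integral_nonneg hφ0)).trans ?_
  -- The room δ keeps t ± h inside K, hence inside (0, 1), for t in the support of φ and h ≤ δ.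
  obtain ⟨δ, hδ, hδK⟩ := hφc.isCompact.exists_cthickening_subset_open isOpen_Ioo hsupp
  set K := Metric.cthickening δ (tsupport φ) with hK
  have hKc : IsCompact K := hφc.isCompact.cthickening
  have hsub : tsupport φ ⊆ interior K := by
    refine (Metric.self_subset_thickening hδ _).trans ?_
    exact interior_maximal (Metric.thickening_subset_cthickening _ _) Metric.isOpen_thickening
  have hcont := hconv.continuousOn_of_semiconvex
  -- Nothing is known of e outside [0, 1]; cutting it off makes it integrable without changing the
  -- integrals.
  set e' := K.indicator e with he'
  have he'i : Integrable e' :=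
    ((hcont.mono hδK).integrableOn_compact hKc).integrable_indicator hKc.measurableSet
  set h : ℕ → ℝ := fun n => δ / (n + 1) with hh
  have hh0 : ∀ n, 0 < h n := fun n => by positivity
  have hhδ : ∀ n, h n ≤ δ := fun n => div_le_self hδ.le (by linarith [n.cast_nonneg (α := ℝ)])
  have hhlim : Tendsto h atTop (𝓝 0) := by
    simpa [hh, div_eq_mul_inv] using tendsto_one_div_add_atTop_nhds_zero_nat.const_mul δ
  obtain ⟨hint, hlim⟩ := tendsto_integral_secondDiff hφ hφc he'i hh0 hhlim
  have hφi : Integrable φ := hφ.continuous.integrable_of_hasCompactSupport hφc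
  set F : ℕ → ℝ → ℝ := fun n t =>
    φ t * ((e' (t + h n) + e' (t - h n) - 2 * e' t) / h n ^ 2) - κ * φ t with hF
  have hFi : ∀ n, Integrable (F n) := fun n => (hint n).sub (hφi.const_mul κ)
  have hnear : ∀ n, ∀ t ∈ tsupport φ, t + h n ∈ K ∧ t - h n ∈ K ∧ t ∈ K := fun n t ht => by
    refine ⟨?_, ?_, Metric.self_subset_cthickening _ ht⟩ <;>
    · refine Metric.mem_cthickening_of_dist_le _ t _ _ ht ?_
      simpa [Real.dist_eq, abs_of_pos (hh0 n)] using hhδ n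
  have hFeq : ∀ n, ∀ t ∈ tsupport φ,
      F n t = φ t * ((e (t + h n) + e (t - h n) - 2 * e t) / h n ^ 2 - κ) := fun n t ht => by
    obtain ⟨a, b, d⟩ := hnear n t ht
    simp only [hF, he', indicator_of_mem a, indicator_of_mem b, indicator_of_mem d]; ring
  have hF0 : ∀ n t, 0 ≤ F n t := fun n t => by
    by_cases ht : t ∈ tsupport φ
    · rw [hFeq n t ht]
      obtain ⟨a, b, d⟩ := hnear n t ht
      refine mul_nonneg (hφ0 t) ?_
      rw [sub_nonneg, le_div_iff₀ (by have := hh0 n; positivity)]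
      exact hconv.le_secondDiff (Ioo_subset_Icc_self (hδK a)) (Ioo_subset_Icc_self (hδK b))
    · simp [hF, image_eq_zero_of_notMem_tsupport ht]
  have hliminf : ∀ᵐ t, ENNReal.ofReal ((deriv e t) ^ 2 * φ t / N) ≤
      liminf (fun n => ENNReal.ofReal (F n t)) atTop := by
    filter_upwards [hconv.ae_differentiableAt_of_semiconvex hKc hδK] with t htd
    rcases (hφ0 t).eq_or_lt with h0 | h0
    · simp [← h0]
    have hts : t ∈ tsupport φ := subset_tsupport _ (Function.mem_support.2 h0.ne')
    have hd := htd (hsub hts)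
    refine le_of_forall_lt_imp_le_of_dense fun x hx => ?_
    have hxt : x ≠ ⊤ := hx.ne_top
    have hx' : x.toReal < (deriv e t) ^ 2 * φ t / N := (ENNReal.lt_ofReal_iff_toReal_lt hxt).1 hx
    have hcc : x.toReal / φ t + κ < N * (κ / N) + (deriv e t) ^ 2 / N := by
      have h1 : x.toReal / φ t < (deriv e t) ^ 2 / N := by
        rw [div_lt_iff₀ h0]; calc _ < _ := hx'
          _ = _ := by ring
      have h2 : N * (κ / N) = κ := by field_simp
      linarith
    have hev := hU.secondDiff_neg_log hN hc hpos he (hδK (interior_subset (hsub hts))) hd hcc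
    have hev' := (tendsto_nhdsWithin_iff.2 ⟨hhlim, Eventually.of_forall hh0⟩).eventually hev
    refine le_liminf_of_le (by isBoundedDefault) ?_
    filter_upwards [hev'] with n hn
    rw [← ENNReal.ofReal_toReal hxt]
    refine ENNReal.ofReal_le_ofReal ?_
    rw [hFeq n t hts, mul_comm, ← div_le_iff₀ h0, le_sub_iff_add_le, le_div_iff₀ (by
      have := hh0 n; positivity)]
    exact hn
  have hFint : Tendsto (fun n => ∫ t, F n t) atTop
      (𝓝 ((∫ t, e t * deriv (deriv φ) t) - κ * ∫ t, φ t)) := by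
    have h1 : ∀ n, ∫ t, F n t = (∫ t, φ t * ((e' (t + h n) + e' (t - h n) - 2 * e' t) / h n ^ 2)) -
        κ * ∫ t, φ t := fun n => by
      rw [← integral_const_mul, ← integral_sub (hint n) (hφi.const_mul κ)]
    have h2 : ∫ t, e' t * deriv (deriv φ) t = ∫ t, e t * deriv (deriv φ) t := by
      congr 1; ext t
      by_cases ht : t ∈ tsupport φ
      · rw [he', indicator_of_mem (Metric.self_subset_cthickening _ ht)]
      · have : deriv (deriv φ) t = 0 := by
          by_contra h0
          exact ht (tsupport_deriv_subset (tsupport_deriv_subset (subset_tsupport _ h0)))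
        simp [this]
    simp_rw [h1, ← h2]
    exact hlim.sub_const _
  have hnn : 0 ≤ (∫ t, e t * deriv (deriv φ) t) - κ * ∫ t, φ t :=
    ge_of_tendsto' hFint fun n => integral_nonneg (hF0 n)
  have hkey : ∫⁻ t, ENNReal.ofReal ((deriv e t) ^ 2 * φ t / N) ≤
      ENNReal.ofReal ((∫ t, e t * deriv (deriv φ) t) - κ * ∫ t, φ t) := by
    refine (lintegral_mono_ae hliminf).trans ?_
    refine (lintegral_liminf_le' fun n => (hFi n).aestronglyMeasurable.aemeasurable.ennreal_ofReal).trans ?_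
    have h1 : Tendsto (fun n => ∫⁻ t, ENNReal.ofReal (F n t)) atTop
        (𝓝 (ENNReal.ofReal ((∫ t, e t * deriv (deriv φ) t) - κ * ∫ t, φ t))) := by
      refine ((ENNReal.continuous_ofReal.tendsto _).comp hFint).congr fun n => ?_
      exact ofReal_integral_eq_lintegral_ofReal (hFi n) (Eventually.of_forall (hF0 n))
    exact h1.liminf_eq.le
  have hmeas : AEStronglyMeasurable (fun t => (deriv e t) ^ 2 * φ t / N) volume :=
    (((measurable_deriv e).pow_const 2).mul hφ.continuous.measurable).div_const N |>.aestronglyMeasurable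
  have h3 : ∫ t, (deriv e t) ^ 2 * φ t / N ≤
      (∫ t, e t * deriv (deriv φ) t) - κ * ∫ t, φ t := by
    rw [integral_eq_lintegral_of_nonneg_ae (Eventually.of_forall fun t =>
      div_nonneg (mul_nonneg (sq_nonneg _) (hφ0 t)) hN.le) hmeas]
    exact (ENNReal.toReal_mono ENNReal.ofReal_ne_top hkey).trans (ENNReal.toReal_ofReal hnn).le
  rw [integral_div] at h3
  rw [one_div, ← div_eq_inv_mul]
  linarith

/-- Continuity of U, needed for the second-order argument, comes only after convexity: e is a convex
function plus a quadratic. -/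
theorem DyadicMidpoint.semiConvex_and_distribIneq {κ N : ℝ} (hN : 0 < N) {U e : ℝ → ℝ}
    (hU : DyadicMidpoint (κ / N) U) (husc : ∀ t ∈ Ioo (0 : ℝ) 1, ∀ v, U t < v →
      ∃ᶠ k : ℕ in atTop, U (⌊t * 2 ^ k⌋ * (1 / 2) ^ k) < v) (h0 : 0 < U 0) (h1 : 0 < U 1)
    (he : ∀ t ∈ Icc (0 : ℝ) 1, 0 < U t → e t = -N * Real.log (U t)) :
    (∀ t ∈ Icc (0 : ℝ) 1, 0 < U t) ∧ SemiConvex e ∧ DistribIneq N (κ : EReal) e := by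
  obtain ⟨c, hc, hcU⟩ := hU.exists_pos_le husc h0 h1
  have hpos : ∀ t ∈ Icc (0 : ℝ) 1, 0 < U t := fun t ht =>
    pos_of_mul_pos_left (hc.trans_le (hcU t ht)) (Real.exp_pos _).le
  have he' : ∀ t ∈ Icc (0 : ℝ) 1, e t = -N * Real.log (U t) := fun t ht => he t ht (hpos t ht)
  have hconv : ConvexOn ℝ (Icc 0 1) fun t => e t - κ / 2 * t ^ 2 := by
    refine ((hU.convexOn husc h0 h1).smul hN.le).congr fun t ht => ?_
    simp only [smul_eq_mul, he' t ht]
    field_simp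
  have hUcont : ContinuousOn U (Ioo 0 1) := by
    have h2 : ContinuousOn (fun t => Real.exp (-(e t / N))) (Ioo 0 1) :=
      ((hconv.continuousOn_of_semiconvex.div_const N).neg).rexp
    refine h2.congr fun t ht => ?_
    simp only
    rw [he' t (Ioo_subset_Icc_self ht), show -(-N * Real.log (U t) / N) = Real.log (U t) by
      field_simp, Real.exp_log (hpos t (Ioo_subset_Icc_self ht))]
  refine ⟨hpos, ⟨-(κ / 2), by simpa [sub_eq_add_neg] using hconv⟩, ?_⟩
  exact hU.distribIneq hN hUcont hpos he' hconv

/-! ### From the distributional inequality to the midpoint inequality. -/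

/-- With Z(s) = V(m + s) + V(m - s), the function (Z' + ksZ) exp(-ks²/2) vanishes at 0 and
decreases, because Z'' ≤ -kZ. Hence Z exp(ks²/2) decreases from Z(0) = 2V(m). -/
theorem midpoint_le_of_hasDerivAt {k a b : ℝ} (hab : a ≤ b) {V V' V'' : ℝ → ℝ}
    (hV : ∀ x, HasDerivAt V (V' x) x) (hV' : ∀ x, HasDerivAt V' (V'' x) x)
    (hpos : ∀ x, 0 ≤ V x) (hle : ∀ x ∈ Icc a b, V'' x ≤ -k * V x) :
    Real.exp (k * (b - a) ^ 2 / 8) * ((V a + V b) / 2) ≤ V ((a + b) / 2) := by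
  set m := (a + b) / 2 with hm
  set l := (b - a) / 2 with hl
  have hl0 : 0 ≤ l := by rw [hl]; linarith
  have hd1 : ∀ s, HasDerivAt (fun s => V (m + s) + V (m - s)) (V' (m + s) - V' (m - s)) s := by
    intro s
    exact (((hV (m + s)).comp_const_add m s).add
      ((hV (m - s)).comp_const_sub m s)).congr_deriv (by ring)
  have hd2 : ∀ s, HasDerivAt (fun s => V' (m + s) - V' (m - s)) (V'' (m + s) + V'' (m - s)) s := by
    intro s
    exact (((hV' (m + s)).comp_const_add m s).sub
      ((hV' (m - s)).comp_const_sub m s)).congr_deriv (by ring)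
  have hsq : ∀ s : ℝ, HasDerivAt (fun s : ℝ => k * s ^ 2 / 2) (k * s) s := fun s => by
    exact (((hasDerivAt_pow 2 s).const_mul k).div_const 2).congr_deriv (by norm_num; ring)
  have hY : ∀ s, HasDerivAt (fun s => ((V' (m + s) - V' (m - s)) + k * s * (V (m + s) + V (m - s))) *
      Real.exp (-(k * s ^ 2 / 2)))
      (((V'' (m + s) + V'' (m - s)) + k * (V (m + s) + V (m - s)) -
        (k * s) ^ 2 * (V (m + s) + V (m - s))) * Real.exp (-(k * s ^ 2 / 2))) s := by
    intro s
    have h1 : HasDerivAt (fun s : ℝ => k * s) k s := by simpa using (hasDerivAt_id s).const_mul k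
    exact (((hd2 s).add (h1.mul (hd1 s))).mul (hsq s).neg.exp).congr_deriv (by
      simp only [Pi.add_apply, Pi.mul_apply, Pi.neg_apply]; ring)
  have hYanti : AntitoneOn (fun s => ((V' (m + s) - V' (m - s)) + k * s * (V (m + s) + V (m - s))) *
      Real.exp (-(k * s ^ 2 / 2))) (Icc 0 l) := by
    refine antitoneOn_of_hasDerivWithinAt_nonpos (convex_Icc 0 l)
      (fun s _ => (hY s).continuousAt.continuousWithinAt) (fun s _ => (hY s).hasDerivWithinAt)
      fun s hs => ?_
    have hs' := interior_subset hs
    have h1 := hle (m + s) ⟨by linarith [hs'.1, hs'.2], by linarith [hs'.1, hs'.2]⟩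
    have h2 := hle (m - s) ⟨by linarith [hs'.1, hs'.2], by linarith [hs'.1, hs'.2]⟩
    refine mul_nonpos_of_nonpos_of_nonneg ?_ (Real.exp_pos _).le
    have := mul_nonneg (sq_nonneg (k * s)) (add_nonneg (hpos (m + s)) (hpos (m - s)))
    linarith
  have hZ : ∀ s, HasDerivAt (fun s => (V (m + s) + V (m - s)) * Real.exp (k * s ^ 2 / 2))
      (((V' (m + s) - V' (m - s)) + k * s * (V (m + s) + V (m - s))) *
        Real.exp (k * s ^ 2 / 2)) s := by
    intro s
    exact ((hd1 s).mul (hsq s).exp).congr_deriv (by ring)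
  have hZanti : AntitoneOn (fun s => (V (m + s) + V (m - s)) * Real.exp (k * s ^ 2 / 2))
      (Icc 0 l) := by
    refine antitoneOn_of_hasDerivWithinAt_nonpos (convex_Icc 0 l)
      (fun s _ => (hZ s).continuousAt.continuousWithinAt) (fun s _ => (hZ s).hasDerivWithinAt)
      fun s hs => ?_
    refine mul_nonpos_of_nonpos_of_nonneg ?_ (Real.exp_pos _).le
    have := hYanti (left_mem_Icc.2 hl0) (interior_subset hs) (interior_subset hs).1
    simp only [add_zero, sub_zero, sub_self, mul_zero, zero_mul, add_zero] at this
    exact nonpos_of_mul_nonpos_left this (Real.exp_pos _)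
  have := hZanti (left_mem_Icc.2 hl0) (right_mem_Icc.2 hl0) hl0
  simp only [add_zero, sub_zero] at this
  rw [show m + l = b by rw [hm, hl]; ring, show m - l = a by rw [hm, hl]; ring] at this
  rw [show k * (b - a) ^ 2 / 8 = k * l ^ 2 / 2 by rw [hl]; ring]
  norm_num at this
  linarith

theorem exp_midpoint_of_hasDerivAt {κ N a b : ℝ} (hN : 0 < N) (hab : a ≤ b) {E E' E'' : ℝ → ℝ}
    (hE : ∀ x, HasDerivAt E (E' x) x) (hE' : ∀ x, HasDerivAt E' (E'' x) x)
    (hle : ∀ x ∈ Icc a b, κ + 1 / N * (E' x) ^ 2 ≤ E'' x) :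
    Real.exp (κ / N * (b - a) ^ 2 / 8) * ((Real.exp (-(E a / N)) + Real.exp (-(E b / N))) / 2) ≤
      Real.exp (-(E ((a + b) / 2) / N)) := by
  refine midpoint_le_of_hasDerivAt (V := fun x => Real.exp (-(E x / N)))
    (V' := fun x => Real.exp (-(E x / N)) * -(E' x / N))
    (V'' := fun x => Real.exp (-(E x / N)) * -(E' x / N) * -(E' x / N) +
      Real.exp (-(E x / N)) * -(E'' x / N)) hab (fun x => ((hE x).div_const N).neg.exp)
    (fun x => ?_) (fun x => (Real.exp_pos _).le) (fun x hx => ?_)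
  · exact (((hE x).div_const N).neg.exp).mul ((hE' x).div_const N).neg
  · have h1 : -(E' x / N) * -(E' x / N) - E'' x / N ≤ -(κ / N) := by
      have h2 := div_le_div_of_nonneg_right (hle x hx) hN.le
      have h3 : (κ + 1 / N * (E' x) ^ 2) / N = κ / N + -(E' x / N) * -(E' x / N) := by
        field_simp
      linarith
    have := mul_le_mul_of_nonneg_left h1 (Real.exp_pos (-(E x / N))).le
    linarith

theorem sq_integral_mul_le {η g : ℝ → ℝ} (hη : ∀ t, 0 ≤ η t) (hη1 : ∫ t, η t = 1)
    (hg : Integrable fun t => η t * g t) (hg2 : Integrable fun t => η t * g t ^ 2) :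
    (∫ t, η t * g t) ^ 2 ≤ ∫ t, η t * g t ^ 2 := by
  set a := ∫ t, η t * g t with ha
  have hi : Integrable η := by
    by_contra h
    rw [integral_undef h] at hη1
    exact zero_ne_one hη1
  have h1 : ∫ t, (2 * a * (η t * g t) - a ^ 2 * η t) ≤ ∫ t, η t * g t ^ 2 := by
    refine integral_mono ((hg.const_mul (2 * a)).sub (hi.const_mul (a ^ 2))) hg2 fun t => ?_
    nlinarith [mul_nonneg (hη t) (sq_nonneg (g t - a))]
  rw [integral_sub (hg.const_mul (2 * a)) (hi.const_mul (a ^ 2)), integral_const_mul,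
    integral_const_mul, hη1, ← ha] at h1
  linarith

open scoped Convolution in
-- The translated mollifier is an admissible test function at distance 2δ from the ends. Since e is
-- Lipschitz on compact subintervals, the derivative falls on e almost everywhere, and Jensen's
-- inequality puts the square outside the average.
theorem mollified_distribIneq {κ N c₀ δ : ℝ} {e : ℝ → ℝ}
    (hconv : ConvexOn ℝ (Icc 0 1) fun t => e t - c₀ / 2 * t ^ 2)
    (hd : DistribIneq N (κ : EReal) e) (hN : 0 < N) (hδ : 0 < δ) {φ : ContDiffBump (0 : ℝ)} (hφ : φ.rOut < δ)
    {x : ℝ} (hx : x ∈ Icc (2 * δ) (1 - 2 * δ)) :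
    κ + 1 / N * ((deriv (φ.normed volume) ⋆[ContinuousLinearMap.lsmul ℝ ℝ, volume]
      (Icc δ (1 - δ)).indicator e) x) ^ 2 ≤
    (deriv (deriv (φ.normed volume)) ⋆[ContinuousLinearMap.lsmul ℝ ℝ, volume]
      (Icc δ (1 - δ)).indicator e) x := by
  set η := φ.normed volume with hη
  have hηs : ContDiff ℝ ∞ η := φ.contDiff_normed
  have hηc : HasCompactSupport η := φ.hasCompactSupport_normed
  have hη1 : ∫ t, η t = 1 := φ.integral_normed
  have hη0 : ∀ t, 0 ≤ η t := φ.nonneg_normed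
  have hts : tsupport η = Metric.closedBall 0 φ.rOut := φ.tsupport_normed_eq
  have hts' : ∀ t, δ ≤ |t| → η t = 0 := fun t ht => image_eq_zero_of_notMem_tsupport (by
    rw [hts, Metric.mem_closedBall, dist_zero_right, Real.norm_eq_abs]; linarith)
  set J := Icc δ (1 - δ) with hJ
  have hJ1 : J ⊆ Ioo 0 1 := fun t ht => ⟨hδ.trans_le ht.1, by linarith [ht.2]⟩
  have hcont := hconv.continuousOn_of_semiconvex
  have heint : Integrable (J.indicator e) :=
    ((hcont.mono hJ1).integrableOn_compact isCompact_Icc).integrable_indicator measurableSet_Icc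
  obtain ⟨C, hC⟩ : ∃ C, LipschitzOnWith C e J := by
    have h1 := hconv.locallyLipschitzOn_interior
    rw [interior_Icc] at h1
    obtain ⟨C₁, h1⟩ := (h1.mono hJ1).exists_lipschitzOnWith_of_compact isCompact_Icc
    have h2 : LocallyLipschitzOn J fun t : ℝ => c₀ / 2 * t ^ 2 :=
      (by fun_prop : ContDiff ℝ 1 fun t : ℝ => c₀ / 2 * t ^ 2).locallyLipschitz.locallyLipschitzOn
    obtain ⟨C₂, h2⟩ := h2.exists_lipschitzOnWith_of_compact isCompact_Icc
    refine ⟨C₁ + C₂, fun s hs t ht => ?_⟩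
    have := (h1.add h2) hs ht
    simpa using this
  -- The margin 2δ minus the radius of the mollifier, which is below δ, stays inside J.
  have hin : ∀ t, η t ≠ 0 → x - t ∈ Ioo δ (1 - δ) := fun t ht => by
    have : |t| < δ := by by_contra! h; exact ht (hts' t h)
    rw [abs_lt] at this
    exact ⟨by linarith [hx.1], by linarith [hx.2]⟩
  -- the derivative of the mollification is the mollification of the derivative
  have hder : Integrable (fun t => η t * deriv e (x - t)) ∧
      HasDerivAt (fun y => ∫ t, η t * J.indicator e (y - t)) (∫ t, η t * deriv e (x - t)) x := by
    have hr : 0 < δ - φ.rOut := sub_pos.2 hφ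
    obtain ⟨B, hB⟩ := hηs.continuous.bounded_above_of_compact_support hηc
    refine hasDerivAt_integral_of_dominated_loc_of_lip (s := Metric.ball x (δ - φ.rOut))
      (bound := fun t => η t * C)
      (Metric.ball_mem_nhds x hr) (Eventually.of_forall fun y => ?_) ?_ ?_
      (Eventually.of_forall fun t => ?_) ?_ ?_
    · exact hηs.continuous.aestronglyMeasurable.mul
        (heint.comp_sub_left y).aestronglyMeasurable
    · exact (heint.comp_sub_left x).bdd_mul (c := B) hηs.continuous.aestronglyMeasurable
        (Eventually.of_forall hB)
    · exact (hηs.continuous.measurable.mul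
        ((measurable_deriv e).comp (measurable_const.sub measurable_id))).aestronglyMeasurable
    · refine LipschitzOnWith.of_dist_le_mul fun y hy z hz => ?_
      by_cases ht : t ∈ Metric.closedBall (0 : ℝ) φ.rOut
      · rw [Metric.mem_closedBall, dist_zero_right, Real.norm_eq_abs, abs_le] at ht
        have hyz : ∀ w ∈ Metric.ball x (δ - φ.rOut), w - t ∈ J := fun w hw => by
          rw [Metric.mem_ball, Real.dist_eq, abs_lt] at hw
          exact ⟨by linarith [hx.1], by linarith [hx.2]⟩
        simp only [indicator_of_mem (hyz y hy), indicator_of_mem (hyz z hz)]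
        have := hC.dist_le_mul _ (hyz y hy) _ (hyz z hz)
        rw [Real.dist_eq] at this ⊢
        rw [← mul_sub, abs_mul, abs_of_nonneg (hη0 t), Real.coe_nnabs,
          abs_of_nonneg (mul_nonneg (hη0 t) C.coe_nonneg), mul_assoc]
        refine mul_le_mul_of_nonneg_left (this.trans (le_of_eq ?_)) (hη0 t)
        rw [Real.dist_eq, Real.dist_eq]; simp
      · have : η t = 0 := image_eq_zero_of_notMem_tsupport (by rwa [hts])
        simp [this]
    · exact (hηs.continuous.integrable_of_hasCompactSupport hηc).mul_const _
    · have h1 := hconv.ae_differentiableAt_of_semiconvex isCompact_Icc hJ1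
      rw [interior_Icc] at h1
      have h2 := (Measure.measurePreserving_sub_left volume x).quasiMeasurePreserving.ae h1
      filter_upwards [h2] with t ht
      by_cases h0 : η t = 0
      · simpa [h0] using hasDerivAt_const x (0 : ℝ)
      have h3 := (ht (hin t h0)).hasDerivAt.comp_sub_const x t
      refine (h3.const_mul (η t)).congr_of_eventuallyEq ?_
      have : ∀ᶠ y in 𝓝 x, y - t ∈ Ioo δ (1 - δ) :=
        (by fun_prop : Continuous fun y : ℝ => y - t).continuousAt.eventually
          (Ioo_mem_nhds (hin t h0).1 (hin t h0).2)
      filter_upwards [this] with y hy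
      rw [indicator_of_mem (Ioo_subset_Icc_self hy)]
  have hE' : (deriv η ⋆[ContinuousLinearMap.lsmul ℝ ℝ, volume] J.indicator e) x =
      ∫ t, η t * deriv e (x - t) := by
    refine (HasCompactSupport.hasDerivAt_convolution_left (ContinuousLinearMap.lsmul ℝ ℝ) hηc
      (hηs.of_le (by norm_num)) heint.locallyIntegrable x).unique ?_
    exact hder.2
  have hbound : ∀ t, η t ≠ 0 → |deriv e (x - t)| ≤ C := fun t ht => by
    have := norm_deriv_le_of_lipschitzOn (Icc_mem_nhds (hin t ht).1 (hin t ht).2) hC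
    simpa using this
  have hg2 : Integrable fun t => η t * deriv e (x - t) ^ 2 := by
    refine (hder.1.abs.mul_const (C : ℝ)).mono' ?_ (Eventually.of_forall fun t => ?_)
    · exact (hηs.continuous.measurable.mul
        (((measurable_deriv e).comp (measurable_const.sub measurable_id)).pow_const 2)).aestronglyMeasurable
    · by_cases h0 : η t = 0
      · simp [h0]
      · rw [Real.norm_eq_abs, abs_mul, abs_mul, abs_pow, pow_two, ← mul_assoc]
        exact mul_le_mul_of_nonneg_left (hbound t h0) (by positivity)
  have hsq := sq_integral_mul_le hη0 hη1 hder.1 hg2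
  -- the test function
  have hψs : ContDiff ℝ ∞ fun t => η (x - t) := hηs.comp (by fun_prop)
  have hψt : tsupport (fun t => η (x - t)) ⊆ Icc δ (1 - δ) := by
    refine closure_minimal (fun t ht => ?_) isClosed_Icc
    have := hin (x - t) (Function.mem_support.1 ht)
    rw [sub_sub_cancel] at this
    exact Ioo_subset_Icc_self this
  have hψc : HasCompactSupport fun t => η (x - t) := IsCompact.of_isClosed_subset isCompact_Icc
    (isClosed_tsupport _) hψt
  have hmain := hd κ le_rfl (fun t => η (x - t)) hψs hψc (hψt.trans hJ1) fun t => hη0 _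
  have e1 : ∫ t, η (x - t) = 1 := by rw [integral_sub_left_eq_self η volume x, hη1]
  have hdd : ∀ t, deriv (deriv fun t => η (x - t)) t = deriv (deriv η) (x - t) := fun t => by
    have a1 : (deriv fun t => η (x - t)) = fun t => -deriv η (x - t) := by
      ext s; rw [deriv_comp_const_sub]
    rw [a1, deriv.fun_neg, deriv_comp_const_sub, neg_neg]
  have e2 : ∫ t, e t * deriv (deriv fun t => η (x - t)) t =
      (deriv (deriv η) ⋆[ContinuousLinearMap.lsmul ℝ ℝ, volume] J.indicator e) x := by
    rw [convolution_lsmul_swap]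
    congr 1; ext t
    by_cases ht : t ∈ J
    · simp only [hdd, indicator_of_mem ht, smul_eq_mul]; ring
    · have : deriv (deriv fun t => η (x - t)) t = 0 := by
        by_contra h0
        exact ht (hψt (tsupport_deriv_subset (tsupport_deriv_subset (subset_tsupport _ h0))))
      simp [this, indicator_of_notMem ht]
  have e3 : ∫ t, deriv e t ^ 2 * η (x - t) = ∫ t, η t * deriv e (x - t) ^ 2 := by
    rw [← integral_sub_left_eq_self (fun t => deriv e t ^ 2 * η (x - t)) volume x]
    congr 1; ext t; simp; ring
  rw [e1, e2, e3, mul_one] at hmain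
  rw [hE']
  have := mul_le_mul_of_nonneg_left hsq (by positivity : 0 ≤ 1 / N)
  linarith

open scoped Convolution in
-- The smooth case applies to the mollifications on the fixed interval [2δ, 1 - 2δ]; only the radius
-- of the mollifier tends to 0.
theorem midpoint_of_distribIneq_Icc {κ N c₀ δ : ℝ} {e : ℝ → ℝ}
    (hconv : ConvexOn ℝ (Icc 0 1) fun t => e t - c₀ / 2 * t ^ 2)
    (hd : DistribIneq N (κ : EReal) e) (hN : 0 < N) (hδ : 0 < δ) (hδ4 : δ < 1 / 4) :
    Real.exp (κ / N * (1 - 2 * δ - 2 * δ) ^ 2 / 8) *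
      ((Real.exp (-(e (2 * δ) / N)) + Real.exp (-(e (1 - 2 * δ) / N))) / 2) ≤
      Real.exp (-(e (1 / 2) / N)) := by
  set J := Icc δ (1 - δ) with hJ
  have hJ1 : J ⊆ Ioo 0 1 := fun t ht => ⟨hδ.trans_le ht.1, by linarith [ht.2]⟩
  have hcont := hconv.continuousOn_of_semiconvex
  have heint : Integrable (J.indicator e) :=
    ((hcont.mono hJ1).integrableOn_compact isCompact_Icc).integrable_indicator measurableSet_Icc
  set b : ℕ → ContDiffBump (0 : ℝ) := fun n =>
    { rIn := δ / (n + 1) / 4, rOut := δ / (n + 1) / 2, rIn_pos := by positivity,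
      rIn_lt_rOut := by have : 0 < δ / (n + 1) := by positivity
                        linarith } with hb
  have hb0 : Tendsto (fun n => (b n).rOut) atTop (𝓝 0) := by
    have := (tendsto_one_div_add_atTop_nhds_zero_nat (𝕜 := ℝ)).const_mul (δ / 2)
    simp only [mul_zero] at this
    refine this.congr fun n => ?_
    simp only [hb]; ring
  have hbδ : ∀ n, (b n).rOut < δ := fun n => by
    have : δ / (n + 1) ≤ δ := div_le_self hδ.le (by linarith [n.cast_nonneg (α := ℝ)])
    simp only [hb]; linarith
  have hlim : ∀ x ∈ Ioo δ (1 - δ), Tendsto (fun n =>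
      (((b n).normed volume) ⋆[ContinuousLinearMap.lsmul ℝ ℝ, volume] J.indicator e) x) atTop
      (𝓝 (e x)) := by
    intro x hx
    refine ContDiffBump.convolution_tendsto_right (g := fun _ => J.indicator e) (k := fun _ => x)
      hb0 (Eventually.of_forall fun _ => heint.aestronglyMeasurable) ?_ tendsto_const_nhds
    have h1 : Tendsto (J.indicator e) (𝓝 x) (𝓝 (e x)) := by
      refine Tendsto.congr' ?_ (hcont.continuousAt (isOpen_Ioo.mem_nhds
        (hJ1 (Ioo_subset_Icc_self hx)))).tendsto
      filter_upwards [Ioo_mem_nhds hx.1 hx.2] with y hy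
      rw [indicator_of_mem (Ioo_subset_Icc_self hy)]
    exact h1.comp tendsto_snd
  have hexp : Continuous fun y : ℝ => Real.exp (-(y / N)) := by fun_prop
  have l1 := (hexp.tendsto _).comp (hlim (2 * δ) ⟨by linarith, by linarith⟩)
  have l2 := (hexp.tendsto _).comp (hlim (1 - 2 * δ) ⟨by linarith, by linarith⟩)
  have l3 := (hexp.tendsto _).comp (hlim (1 / 2) ⟨by linarith, by linarith⟩)
  refine le_of_tendsto_of_tendsto' (((l1.add l2).div_const 2).const_mul _) l3 fun n => ?_
  have hηs : ContDiff ℝ ∞ ((b n).normed volume) := (b n).contDiff_normed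
  have hηc : HasCompactSupport ((b n).normed volume) := (b n).hasCompactSupport_normed
  have hη' : ContDiff ℝ ∞ (deriv ((b n).normed volume)) := (contDiff_infty_iff_deriv.1 hηs).2
  have := exp_midpoint_of_hasDerivAt (κ := κ) hN (by linarith : 2 * δ ≤ 1 - 2 * δ)
    (HasCompactSupport.hasDerivAt_convolution_left (ContinuousLinearMap.lsmul ℝ ℝ) hηc
      (hηs.of_le (by norm_num)) heint.locallyIntegrable)
    (HasCompactSupport.hasDerivAt_convolution_left (ContinuousLinearMap.lsmul ℝ ℝ) hηc.deriv
      (hη'.of_le (by norm_num)) heint.locallyIntegrable)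
    (fun x hx => mollified_distribIneq hconv hd hN hδ (hbδ n) hx)
  rw [show (2 * δ + (1 - 2 * δ)) / 2 = (1 / 2 : ℝ) by ring] at this
  exact this

/-- A semi-convex function may be discontinuous at the ends, but it lies below its corrected chord.
This bounds e(2δ) and e(1 - 2δ) from above by quantities tending to e(0) and e(1), the direction
required as δ tends to 0. -/
theorem SemiConvex.midpoint_of_distribIneq {κ N : ℝ} {e : ℝ → ℝ} (he : SemiConvex e)
    (hd : DistribIneq N (κ : EReal) e) (hN : 0 < N) :
    Real.exp (κ / N / 8) * ((Real.exp (-(e 0 / N)) + Real.exp (-(e 1 / N))) / 2) ≤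
      Real.exp (-(e (1 / 2) / N)) := by
  obtain ⟨c, hc⟩ := he
  have hconv : ConvexOn ℝ (Icc 0 1) fun t => e t - (-2 * c) / 2 * t ^ 2 :=
    hc.congr fun t _ => by ring
  have hub : ∀ s ∈ Icc (0 : ℝ) 1, e s ≤ (1 - s) * e 0 + s * (e 1 + c) - c * s ^ 2 := fun s hs => by
    have := hc.2 (left_mem_Icc.2 zero_le_one) (right_mem_Icc.2 zero_le_one)
      (sub_nonneg.2 hs.2) hs.1 (by ring)
    simp only [smul_eq_mul, mul_zero, mul_one, zero_add] at this
    norm_num at this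
    linarith
  have hlim : Tendsto (fun δ : ℝ => Real.exp (κ / N * (1 - 2 * δ - 2 * δ) ^ 2 / 8) *
      ((Real.exp (-(((1 - 2 * δ) * e 0 + 2 * δ * (e 1 + c) - c * (2 * δ) ^ 2) / N)) +
        Real.exp (-(((1 - (1 - 2 * δ)) * e 0 + (1 - 2 * δ) * (e 1 + c) -
          c * (1 - 2 * δ) ^ 2) / N))) / 2)) (𝓝[>] 0)
      (𝓝 (Real.exp (κ / N / 8) * ((Real.exp (-(e 0 / N)) + Real.exp (-(e 1 / N))) / 2))) := by
    refine tendsto_nhdsWithin_of_tendsto_nhds ?_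
    refine Continuous.tendsto' (by fun_prop) _ _ ?_
    norm_num
  refine le_of_tendsto hlim ?_
  filter_upwards [Ioo_mem_nhdsGT (by norm_num : (0 : ℝ) < 1 / 4)] with δ hδ
  refine le_trans ?_ (midpoint_of_distribIneq_Icc hconv hd hN hδ.1 hδ.2)
  have h1 := hub (2 * δ) ⟨by linarith [hδ.1], by linarith [hδ.2]⟩
  have h2 := hub (1 - 2 * δ) ⟨by linarith [hδ.2], by linarith [hδ.1]⟩
  gcongr

/-! ### Relative entropy as an integral, and entropy of restrictions. -/

section EntropyLemmas

variable {X : Type u} [MeasurableSpace X]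

/-- The entropy `∫ ρ log ρ dm` as a Bochner integral. -/
noncomputable def ent (μ m : Measure X) : ℝ :=
  ∫ x, density μ m x * Real.log (density μ m x) ∂m

theorem density_nonneg (μ m : Measure X) (x : X) : 0 ≤ density μ m x := ENNReal.toReal_nonneg

theorem measurable_density (μ m : Measure X) : Measurable (density μ m) :=
  (Measure.measurable_rnDeriv μ m).ennreal_toReal

theorem measurable_density_mul_log (μ m : Measure X) :
    Measurable fun x => density μ m x * Real.log (density μ m x) :=
  (measurable_density μ m).mul (measurable_density μ m).log

theorem integrable_of_lintegral_ofReal_ne_top {m : Measure X} {f : X → ℝ} (hf : AEStronglyMeasurable f m)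
    (h1 : ∫⁻ x, ENNReal.ofReal (f x) ∂m ≠ ⊤) (h2 : ∫⁻ x, ENNReal.ofReal (-f x) ∂m ≠ ⊤) :
    Integrable f m := by
  refine ⟨hf, ?_⟩
  rw [hasFiniteIntegral_iff_norm]
  have : ∀ x, ENNReal.ofReal ‖f x‖ ≤ ENNReal.ofReal (f x) + ENNReal.ofReal (-f x) := fun x => by
    rcases le_total 0 (f x) with h | h
    · rw [Real.norm_of_nonneg h]; exact le_self_add
    · rw [Real.norm_of_nonpos h]; exact le_add_self
  refine (lintegral_mono this).trans_lt ?_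
  rw [lintegral_add_left' hf.aemeasurable.ennreal_ofReal]
  exact ENNReal.add_lt_top.2 ⟨h1.lt_top, h2.lt_top⟩

theorem inEntropyDomain_iff {μ m : Measure X} : InEntropyDomain μ m ↔
    μ ≪ m ∧ Integrable (fun x => density μ m x * Real.log (density μ m x)) m := by
  unfold InEntropyDomain relEntropy
  constructor
  · rintro ⟨h1, h2⟩
    split_ifs at h1 h2 with h
    · refine ⟨h.1, integrable_of_lintegral_ofReal_ne_top
        (measurable_density_mul_log μ m).aestronglyMeasurable h.2 fun h3 => h2 ?_⟩
      rw [h3, EReal.coe_ennreal_top]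
      lift (∫⁻ x, ENNReal.ofReal (density μ m x * Real.log (density μ m x)) ∂m) to ℝ≥0 using h.2
        with a
      rfl
    · exact absurd rfl h1
  · rintro ⟨h1, h2⟩
    have h3 := h2.lintegral_lt_top.ne
    have h4 := h2.neg.lintegral_lt_top.ne
    simp only [Pi.neg_apply] at h4
    rw [if_pos ⟨h1, h3⟩]
    lift (∫⁻ x, ENNReal.ofReal (density μ m x * Real.log (density μ m x)) ∂m) to ℝ≥0 using h3 with a
    lift (∫⁻ x, ENNReal.ofReal (-(density μ m x * Real.log (density μ m x))) ∂m) to ℝ≥0 using h4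
      with b
    rw [EReal.coe_nnreal_eq_coe_real, EReal.coe_nnreal_eq_coe_real, ← EReal.coe_sub]
    exact ⟨EReal.coe_ne_top _, EReal.coe_ne_bot _⟩

theorem InEntropyDomain.toReal_relEntropy {μ m : Measure X} (h : InEntropyDomain μ m) :
    (relEntropy μ m).toReal = ent μ m := by
  obtain ⟨h1, h2⟩ := inEntropyDomain_iff.1 h
  have h3 := h2.lintegral_lt_top.ne
  have h4 := h2.neg.lintegral_lt_top.ne
  simp only [Pi.neg_apply] at h4
  rw [relEntropy, if_pos ⟨h1, h3⟩, ent, integral_eq_lintegral_pos_part_sub_lintegral_neg_part h2]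
  lift (∫⁻ x, ENNReal.ofReal (density μ m x * Real.log (density μ m x)) ∂m) to ℝ≥0 using h3 with a
  lift (∫⁻ x, ENNReal.ofReal (-(density μ m x * Real.log (density μ m x))) ∂m) to ℝ≥0 using h4
    with b
  rfl

theorem relEntropy_map {Y : Type v} [MeasurableSpace Y] {f : X → Y} (hf : MeasurableEmbedding f)
    (μ m : Measure X) [SigmaFinite μ] [SigmaFinite m] :
    relEntropy (μ.map f) (m.map f) = relEntropy μ m := by
  have hac : μ.map f ≪ m.map f ↔ μ ≪ m := by
    refine ⟨fun h => ?_, hf.absolutelyContinuous_map⟩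
    refine Measure.AbsolutelyContinuous.mk fun s hs h0 => ?_
    have := h (s := f '' s) (by rw [hf.map_apply, preimage_image_eq _ hf.injective, h0])
    rwa [hf.map_apply, preimage_image_eq _ hf.injective] at this
  have hd : (fun x => density (μ.map f) (m.map f) (f x)) =ᵐ[m] density μ m := by
    filter_upwards [hf.rnDeriv_map μ m] with x hx
    rw [density, hx, density]
  have e1 : ∀ F : ℝ → ℝ≥0∞, ∫⁻ y, F (density (μ.map f) (m.map f) y) ∂(m.map f) =
      ∫⁻ x, F (density μ m x) ∂m := fun F => by
    rw [hf.lintegral_map]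
    exact lintegral_congr_ae (by filter_upwards [hd] with x hx; rw [hx])
  unfold relEntropy
  rw [hac, e1 fun r => ENNReal.ofReal (r * Real.log r),
    e1 fun r => ENNReal.ofReal (-(r * Real.log r))]

theorem density_withDensity {m : Measure X} [SigmaFinite m] {f : X → ℝ} (hf : Measurable f)
    (hf0 : ∀ x, 0 ≤ f x) : density (m.withDensity fun x => ENNReal.ofReal (f x)) m =ᵐ[m] f := by
  filter_upwards [Measure.rnDeriv_withDensity m hf.ennreal_ofReal] with x hx
  rw [density, hx, ENNReal.toReal_ofReal (hf0 x)]

theorem density_ae_eq_zero {μ m : Measure X} [SigmaFinite μ] [SigmaFinite m] (h : μ ≪ m) {s : Set X}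
    (hs : MeasurableSet s) (h0 : μ s = 0) : ∀ᵐ x ∂m, x ∈ s → density μ m x = 0 := by
  rw [← Measure.setLIntegral_rnDeriv h, setLIntegral_eq_zero_iff hs (Measure.measurable_rnDeriv μ m)] at h0
  filter_upwards [h0] with x hx hxs
  rw [density, hx hxs, ENNReal.toReal_zero]

theorem integrable_density {μ m : Measure X} [IsFiniteMeasure μ] : Integrable (density μ m) m :=
  Measure.integrable_toReal_rnDeriv

theorem integral_density_mul {μ m : Measure X} [SigmaFinite μ] [SigmaFinite m] (h : μ ≪ m)
    (f : X → ℝ) : ∫ x, density μ m x * f x ∂m = ∫ x, f x ∂μ := integral_rnDeriv_smul h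

theorem integrable_density_mul_iff {μ m : Measure X} [SigmaFinite μ] [SigmaFinite m] (h : μ ≪ m)
    (f : X → ℝ) : Integrable (fun x => density μ m x * f x) m ↔ Integrable f μ :=
  integrable_rnDeriv_smul_iff h

theorem integral_density {μ m : Measure X} [IsProbabilityMeasure μ] [SigmaFinite m] (h : μ ≪ m) :
    ∫ x, density μ m x ∂m = 1 := by
  have := integral_density_mul h fun _ => 1
  simpa using this

/-- Young's inequality `r s ≤ r log r + exp (s - 1)`. -/
theorem mul_sub_exp_le_mul_log {r : ℝ} (hr : 0 ≤ r) (s : ℝ) :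
    r * s - Real.exp (s - 1) ≤ r * Real.log r := by
  rcases hr.eq_or_lt with rfl | hr
  · simp [(Real.exp_pos _).le]
  have h1 := Real.add_one_le_exp (s - 1 - Real.log r)
  have h2 : Real.exp (s - 1) = r * Real.exp (s - 1 - Real.log r) := by
    rw [Real.exp_sub (s - 1), Real.exp_log hr]; field_simp
  rw [h2]
  nlinarith

/-- The tangent line of r log r at b; the value r = 0 is allowed. -/
theorem mul_log_add_sub_le {r b : ℝ} (hr : 0 ≤ r) (hb : 0 < b) :
    r * Real.log b + r - b ≤ r * Real.log r := by
  have := mul_sub_exp_le_mul_log hr (1 + Real.log b)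
  rw [add_sub_cancel_left, Real.exp_log hb] at this
  linarith

theorem neg_one_le_mul_log {r : ℝ} (hr : 0 ≤ r) : -1 ≤ r * Real.log r := by
  have := mul_log_add_sub_le hr one_pos
  simp only [Real.log_one] at this
  linarith

theorem mul_log_add_mul_log_le {a b : ℝ} (ha : 0 ≤ a) (hb : 0 ≤ b) :
    a * Real.log a + b * Real.log b ≤ (a + b) * Real.log (a + b) := by
  rcases ha.eq_or_lt with rfl | ha
  · simp
  rcases hb.eq_or_lt with rfl | hb
  · simp
  have h1 := Real.log_le_log ha (by linarith : a ≤ a + b)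
  have h2 := Real.log_le_log hb (by linarith : b ≤ a + b)
  nlinarith

/-- Split r into cs and the rest: x log x is superadditive, and the rest is bounded below by the
tangent line at b. Keeping b free allows the error to be made small later. -/
theorem mul_log_le_of_mul_le {c r s b : ℝ} (hc : 0 < c) (hs : 0 ≤ s) (hb : 0 < b)
    (h : c * s ≤ r) : c * (s * Real.log s) ≤
      r * Real.log r - (r - c * s) * Real.log b + b - c * s * Real.log c := by
  have h1 := mul_log_add_mul_log_le (mul_nonneg hc.le hs) (sub_nonneg.2 h)
  rw [add_sub_cancel] at h1
  have h2 := mul_log_add_sub_le (sub_nonneg.2 h) hb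
  have h3 : c * s * Real.log (c * s) = c * s * Real.log c + c * (s * Real.log s) := by
    rcases hs.eq_or_lt with rfl | hs
    · simp
    rw [Real.log_mul hc.ne' hs.ne']; ring
  linarith

/-- Entropy of a normalised restriction `ν` of a probability measure `μ`. -/
theorem ent_le_of_smul_le {μ ν m : Measure X} [IsProbabilityMeasure μ] [IsProbabilityMeasure ν]
    [SigmaFinite m] {c : ℝ} (hc : 0 < c) (hle : ENNReal.ofReal c • ν ≤ μ)
    {K : Set X} (hK : MeasurableSet K) (hμK : μ Kᶜ = 0) {B : ℝ} (hB : 0 ≤ B)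
    (hmK : m K ≤ ENNReal.ofReal B) (h : InEntropyDomain μ m) :
    InEntropyDomain ν m ∧ ∀ b : ℝ, 0 < b →
      ent ν m ≤ (ent μ m - (1 - c) * Real.log b + b * B) / c - Real.log c := by
  obtain ⟨h1, h2⟩ := inEntropyDomain_iff.1 h
  have hcE : ENNReal.ofReal c ≠ 0 := by simpa using hc
  have hνμ : ν ≪ μ := by
    refine Measure.AbsolutelyContinuous.mk fun s _ h0 => ?_
    have := (hle s).trans_eq h0
    simpa [hcE, hc.not_ge] using this
  have hνm : ν ≪ m := hνμ.trans h1
  set ρ := density μ m with hρ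
  set σ := density ν m with hσ
  have hdens : ∀ᵐ x ∂m, c * σ x ≤ ρ x := by
    have : (fun x => ENNReal.ofReal c * ν.rnDeriv m x) ≤ᵐ[m] μ.rnDeriv m := by
      refine ae_le_of_forall_setLIntegral_le_of_sigmaFinite
        ((Measure.measurable_rnDeriv ν m).const_mul _) fun s hs _ => ?_
      rw [lintegral_const_mul _ (Measure.measurable_rnDeriv ν m), Measure.setLIntegral_rnDeriv hνm,
        Measure.setLIntegral_rnDeriv h1]
      exact hle s
    filter_upwards [this, Measure.rnDeriv_lt_top μ m] with x hx hx'
    have := ENNReal.toReal_mono hx'.ne hx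
    rwa [ENNReal.toReal_mul, ENNReal.toReal_ofReal hc.le] at this
  have hK0 : ∀ᵐ x ∂m, x ∈ Kᶜ → ρ x = 0 := density_ae_eq_zero h1 hK.compl hμK
  have hK1 : ∀ᵐ x ∂m, x ∈ Kᶜ → σ x = 0 := density_ae_eq_zero hνm hK.compl (hνμ hμK)
  have hmK' : m K ≠ ⊤ := (hmK.trans_lt ENNReal.ofReal_lt_top).ne
  have hind : Integrable (K.indicator fun _ => (1 : ℝ)) m :=
    (integrableOn_const hmK').integrable_indicator hK
  have hindB : ∫ x, K.indicator (fun _ => (1 : ℝ)) x ∂m ≤ B := by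
    rw [integral_indicator hK]
    simp only [setIntegral_const, smul_eq_mul, mul_one]
    exact ENNReal.toReal_le_of_le_ofReal hB hmK
  -- An integrable majorant of cσ log σ. The constant b is confined to K, since m itself may be
  -- infinite.
  set G : ℝ → X → ℝ := fun b x => ρ x * Real.log (ρ x) - (ρ x - c * σ x) * Real.log b +
    b * K.indicator (fun _ => (1 : ℝ)) x - c * σ x * Real.log c with hG
  have hGi : ∀ b, Integrable (G b) m := fun b =>
    ((h2.sub ((integrable_density.sub (integrable_density.const_mul c)).mul_const _)).add
      (hind.const_mul b)).sub ((integrable_density.const_mul c).mul_const _)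
  have hup : ∀ b, 0 < b → ∀ᵐ x ∂m, c * (σ x * Real.log (σ x)) ≤ G b x := fun b hb => by
    filter_upwards [hdens, hK0, hK1] with x hx h0 h1
    by_cases hxK : x ∈ K
    · simp only [hG, indicator_of_mem hxK, mul_one]
      exact mul_log_le_of_mul_le hc (density_nonneg _ _ _) hb hx
    · simp [hG, h0 hxK, h1 hxK, indicator_of_notMem hxK]
  have hlow : ∀ᵐ x ∂m, -K.indicator (fun _ => (1 : ℝ)) x ≤ σ x * Real.log (σ x) := by
    filter_upwards [hK1] with x h1
    by_cases hxK : x ∈ K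
    · rw [indicator_of_mem hxK]; exact neg_one_le_mul_log (density_nonneg _ _ _)
    · simp [h1 hxK, indicator_of_notMem hxK]
  have hint : Integrable (fun x => σ x * Real.log (σ x)) m := by
    refine (((hGi 1).abs.div_const c).add hind).mono'
      (measurable_density_mul_log ν m).aestronglyMeasurable ?_
    filter_upwards [hup 1 one_pos, hlow] with x hx hx'
    have h3 : σ x * Real.log (σ x) ≤ |G 1 x| / c := by
      rw [le_div_iff₀ hc, mul_comm]; exact hx.trans (le_abs_self _)
    have h4 : 0 ≤ K.indicator (fun _ => (1 : ℝ)) x := indicator_nonneg (fun _ _ => zero_le_one) x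
    have h5 : 0 ≤ |G 1 x| / c := by positivity
    simp only [Pi.add_apply]
    rw [Real.norm_eq_abs, abs_le]
    constructor <;> linarith
  refine ⟨inEntropyDomain_iff.2 ⟨hνm, hint⟩, fun b hb => ?_⟩
  have hI := integral_mono_ae (hint.const_mul c) (hGi b) (hup b hb)
  rw [integral_const_mul] at hI
  have hGI : ∫ x, G b x ∂m = ent μ m - (1 - c) * Real.log b +
      b * (∫ x, K.indicator (fun _ => (1 : ℝ)) x ∂m) - c * Real.log c := by
    have i1 : Integrable (fun x => c * σ x) m := integrable_density.const_mul c
    have i2 : Integrable (fun x => (ρ x - c * σ x) * Real.log b) m :=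
      (integrable_density.sub i1).mul_const _
    have i3 : Integrable (fun x => ρ x * Real.log (ρ x) - (ρ x - c * σ x) * Real.log b) m :=
      h2.sub i2
    have i4 : Integrable (fun x => ρ x * Real.log (ρ x) - (ρ x - c * σ x) * Real.log b +
      b * K.indicator (fun _ => (1 : ℝ)) x) m := i3.add (hind.const_mul b)
    simp only [hG]
    rw [integral_sub i4 (i1.mul_const _), integral_add i3 (hind.const_mul b), integral_sub h2 i2, integral_mul_const,
      integral_mul_const, integral_sub integrable_density i1, integral_const_mul,
      integral_const_mul, integral_density h1, integral_density hνm, mul_one, ent]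
  rw [hGI] at hI
  have hbB : b * (∫ x, K.indicator (fun _ => (1 : ℝ)) x ∂m) ≤ b * B := by gcongr
  rw [← sub_nonneg]
  have : (ent μ m - (1 - c) * Real.log b + b * B) / c - Real.log c -
      ent ν m = (ent μ m - (1 - c) * Real.log b + b * B - c * Real.log c - c * ent ν m) / c := by
    field_simp
  rw [this]
  change c * ent ν m ≤ _ at hI
  exact div_nonneg (by linarith) hc.le

end EntropyLemmas

/-! ### The dual formula for the entropy and its lower semicontinuity. -/

theorem integrable_and_integral_le_of_tendsto {X : Type u} [MeasurableSpace X] {m : Measure X}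
    {F : ℕ → X → ℝ} {f : X → ℝ} {C : ℝ} (hF : ∀ n, Integrable (F n) m) (h0 : ∀ n, ∀ᵐ x ∂m, 0 ≤ F n x)
    (hlim : ∀ᵐ x ∂m, Tendsto (fun n => F n x) atTop (𝓝 (f x))) (hC : ∀ n, ∫ x, F n x ∂m ≤ C) :
    Integrable f m ∧ ∫ x, f x ∂m ≤ C := by
  have hC0 : 0 ≤ C := (integral_nonneg_of_ae (h0 0)).trans (hC 0)
  have hm : AEStronglyMeasurable f m :=
    aestronglyMeasurable_of_tendsto_ae atTop (fun n => (hF n).aestronglyMeasurable) hlim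
  have hf0 : 0 ≤ᵐ[m] f := by
    filter_upwards [ae_all_iff.2 h0, hlim] with x hx hx'
    exact ge_of_tendsto' hx' hx
  have hle : ∫⁻ x, ENNReal.ofReal (f x) ∂m ≤ ENNReal.ofReal C := by
    calc ∫⁻ x, ENNReal.ofReal (f x) ∂m
        = ∫⁻ x, liminf (fun n => ENNReal.ofReal (F n x)) atTop ∂m := by
          refine lintegral_congr_ae ?_
          filter_upwards [hlim] with x hx
          exact ((ENNReal.continuous_ofReal.tendsto _).comp hx).liminf_eq.symm
      _ ≤ liminf (fun n => ∫⁻ x, ENNReal.ofReal (F n x) ∂m) atTop :=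
          lintegral_liminf_le' fun n => (hF n).aestronglyMeasurable.aemeasurable.ennreal_ofReal
      _ ≤ ENNReal.ofReal C := by
          refine liminf_le_of_le (by isBoundedDefault) fun b hb => ?_
          obtain ⟨n, hn⟩ := hb.exists
          refine hn.trans ?_
          rw [← ofReal_integral_eq_lintegral_ofReal (hF n) (h0 n)]
          exact ENNReal.ofReal_le_ofReal (hC n)
  refine ⟨⟨hm, ?_⟩, ?_⟩
  · rw [hasFiniteIntegral_iff_ofReal hf0]
    exact hle.trans_lt ENNReal.ofReal_lt_top
  · rw [integral_eq_lintegral_of_nonneg_ae hf0 hm]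
    exact (ENNReal.toReal_mono ENNReal.ofReal_ne_top hle).trans (ENNReal.toReal_ofReal hC0).le

theorem abs_exp_sub_exp_le {x y B : ℝ} (hx : x ≤ B) (hy : y ≤ B) :
    |Real.exp (x - 1) - Real.exp (y - 1)| ≤ Real.exp B * |x - y| := by
  have key : ∀ {a b : ℝ}, a ≤ B → b ≤ B → Real.exp (a - 1) - Real.exp (b - 1) ≤ Real.exp B * |a - b| := by
    intro a b ha _
    have h1 := Real.add_one_le_exp (b - a)
    have h2 : Real.exp (b - 1) = Real.exp (a - 1) * Real.exp (b - a) := by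
      rw [← Real.exp_add]; congr 1; ring
    have h3 : Real.exp (a - 1) ≤ Real.exp B := Real.exp_le_exp.2 (by linarith)
    calc Real.exp (a - 1) - Real.exp (b - 1) ≤ Real.exp (a - 1) * (a - b) := by
          rw [h2]; nlinarith [Real.exp_pos (a - 1)]
      _ ≤ Real.exp (a - 1) * |a - b| := by gcongr; exact le_abs_self _
      _ ≤ _ := by gcongr
  rw [abs_le]
  constructor
  · have := key hy hx; rw [abs_sub_comm] at this; linarith
  · exact key hx hy

section Duality

variable {Y : Type w} [MetricSpace Y] [MeasurableSpace Y] [BorelSpace Y]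

/-- Bounded measurable functions are approximated by continuous ones in L¹ of μ + ν, hence for both
integrals at once. Truncation to the same bound B keeps the exponential Lipschitz with constant exp
B. -/
theorem dual_le_of_measurable {μ ν : Measure Y} [IsFiniteMeasure μ] [IsFiniteMeasure ν] {c : ℝ}
    (h : ∀ φ : Y → ℝ, Continuous φ → (∃ B, ∀ y, |φ y| ≤ B) →
      ∫ y, φ y ∂μ - ∫ y, Real.exp (φ y - 1) ∂ν ≤ c)
    {φ : Y → ℝ} (hφ : Measurable φ) {B : ℝ} (hB : ∀ y, |φ y| ≤ B) :
    ∫ y, φ y ∂μ - ∫ y, Real.exp (φ y - 1) ∂ν ≤ c := by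
  have bint : ∀ {lam : Measure Y} [IsFiniteMeasure lam] {f : Y → ℝ}, Measurable f → ∀ {C : ℝ},
      (∀ y, |f y| ≤ C) → Integrable f lam := fun hf C hC =>
    Integrable.of_bound hf.aestronglyMeasurable C (Eventually.of_forall hC)
  have bexp : ∀ {f : Y → ℝ}, (∀ y, |f y| ≤ B) → ∀ y, |Real.exp (f y - 1)| ≤ Real.exp B :=
    fun hf y => by
      rw [abs_of_pos (Real.exp_pos _)]
      exact Real.exp_le_exp.2 (by linarith [(abs_le.1 (hf y)).2])
  refine le_of_forall_pos_le_add fun ε hε => ?_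
  have hε' : 0 < ε / (1 + Real.exp B) := by positivity
  obtain ⟨g, hg, -⟩ := (bint hφ hB (lam := μ + ν)).exists_boundedContinuous_integral_sub_le hε'
  set g' : Y → ℝ := fun y => max (-B) (min B (g y)) with hg'
  have hg'c : Continuous g' := continuous_const.max (continuous_const.min g.continuous)
  have hB0 : ∀ y : Y, 0 ≤ B := fun y => (abs_nonneg _).trans (hB y)
  have hg'B : ∀ y, |g' y| ≤ B := fun y => by
    have := hB0 y
    rw [abs_le]
    exact ⟨le_max_left _ _, max_le (by linarith) (min_le_left _ _)⟩
  have hclose : ∀ y, |φ y - g' y| ≤ ‖φ y - g y‖ := fun y => by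
    have h1 := abs_le.1 (hB y)
    have h2 : φ y = max (-B) (min B (φ y)) := by
      rw [min_eq_right h1.2, max_eq_right h1.1]
    rw [Real.norm_eq_abs]
    conv_lhs => rw [h2]
    simp only [hg']
    exact (abs_max_sub_max_le_max _ _ _ _).trans (by
      simp only [sub_self, abs_zero]
      refine max_le (abs_nonneg _) ((abs_min_sub_min_le_max _ _ _ _).trans ?_)
      simp)
  have hsum : ∫ y, |φ y - g' y| ∂μ + ∫ y, |φ y - g' y| ∂ν ≤ ε / (1 + Real.exp B) := by
    have hd : ∀ {lam : Measure Y} [IsFiniteMeasure lam], Integrable (fun y => |φ y - g' y|) lam :=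
      fun {lam} _ => ((bint hφ hB).sub (bint hg'c.measurable hg'B)).abs
    rw [← integral_add_measure hd hd]
    exact (integral_mono hd ((bint hφ hB).sub (g.integrable _)).norm hclose).trans hg
  have h1 := h g' hg'c ⟨B, hg'B⟩
  have h2 : ∫ y, φ y ∂μ - ∫ y, g' y ∂μ ≤ ∫ y, |φ y - g' y| ∂μ := by
    rw [← integral_sub (bint hφ hB) (bint hg'c.measurable hg'B)]
    exact integral_mono ((bint hφ hB).sub (bint hg'c.measurable hg'B))
      ((bint hφ hB).sub (bint hg'c.measurable hg'B)).abs fun y => le_abs_self _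
  have i1 : Integrable (fun y => Real.exp (φ y - 1)) ν :=
    bint (hφ.sub_const 1).exp (bexp hB)
  have i2 : Integrable (fun y => Real.exp (g' y - 1)) ν :=
    bint (hg'c.measurable.sub_const 1).exp (bexp hg'B)
  have h3 : ∫ y, Real.exp (g' y - 1) ∂ν - ∫ y, Real.exp (φ y - 1) ∂ν ≤
      Real.exp B * ∫ y, |φ y - g' y| ∂ν := by
    rw [← integral_sub i2 i1, ← integral_const_mul]
    refine integral_mono (i2.sub i1)
      (((bint hφ hB).sub (bint hg'c.measurable hg'B)).abs.const_mul _) fun y => ?_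
    have := abs_exp_sub_exp_le (abs_le.1 (hg'B y)).2 (abs_le.1 (hB y)).2
    rw [abs_sub_comm (g' y)] at this
    exact (le_abs_self _).trans this
  have e1 : 0 ≤ ∫ y, |φ y - g' y| ∂μ := integral_nonneg fun _ => abs_nonneg _
  have e2 : 0 ≤ ∫ y, |φ y - g' y| ∂ν := integral_nonneg fun _ => abs_nonneg _
  have h4 : ∫ y, |φ y - g' y| ∂μ + Real.exp B * ∫ y, |φ y - g' y| ∂ν ≤ ε := by
    have := mul_le_mul_of_nonneg_left hsum (by positivity : 0 ≤ 1 + Real.exp B)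
    rw [mul_div_cancel₀ _ (by positivity : (1 + Real.exp B) ≠ 0)] at this
    nlinarith [Real.exp_pos B]
  linarith

/-- The optimal test function in the dual problem is 1 + log ρ. It is approached through truncated
densities and Fatou's lemma, after large multiples of indicators of null sets have shown that a
density exists. The cut-off ψ replaces n by a finite measure without affecting D. -/
theorem inEntropyDomain_of_dual {μ n : Measure Y} [IsProbabilityMeasure μ] [SigmaFinite n] {D : Set Y}
    (hD : MeasurableSet D) (hμD : μ Dᶜ = 0) {ψ : Y → ℝ} (hψ : Continuous ψ) (hψ0 : ∀ y, 0 ≤ ψ y)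
    (hψi : Integrable ψ n) (hψD : ∀ y ∈ D, ψ y = 1) {c : ℝ}
    (h : ∀ φ : Y → ℝ, Continuous φ → (∃ B, ∀ y, |φ y| ≤ B) →
      ∫ y, φ y ∂μ - ∫ y, Real.exp (φ y - 1) * ψ y ∂n ≤ c) :
    InEntropyDomain μ n ∧ ent μ n ≤ c := by
  set ν : Measure Y := n.withDensity fun y => ENNReal.ofReal (ψ y) with hν
  have hνfin : IsFiniteMeasure ν := isFiniteMeasure_withDensity_ofReal hψi.2
  have hνint : ∀ f : Y → ℝ, ∫ y, f y ∂ν = ∫ y, f y * ψ y ∂n := fun f => by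
    rw [hν, integral_withDensity_eq_integral_toReal_smul hψ.measurable.ennreal_ofReal
      (Eventually.of_forall fun _ => ENNReal.ofReal_lt_top)]
    congr 1; ext y
    rw [ENNReal.toReal_ofReal (hψ0 y), smul_eq_mul, mul_comm]
  have key : ∀ {φ : Y → ℝ}, Measurable φ → ∀ {B : ℝ}, (∀ y, |φ y| ≤ B) →
      ∫ y, φ y ∂μ - ∫ y, Real.exp (φ y - 1) * ψ y ∂n ≤ c := by
    intro φ hφ B hB
    rw [← hνint]
    refine dual_le_of_measurable (fun φ h1 h2 => ?_) hφ hB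
    rw [hνint]; exact h φ h1 h2
  have hac : μ ≪ n := by
    refine Measure.AbsolutelyContinuous.mk fun s hs h0 => ?_
    -- On an n-null set the exponential term does not see the test function, so k μ(s) stays bounded
    -- in k.
    have h1 : ∀ k : ℕ, (k : ℝ) * μ.real s ≤ c + ∫ y, Real.exp (-1) * ψ y ∂n := fun k => by
      have := key (φ := s.indicator fun _ => (k : ℝ)) (measurable_const.indicator hs) (B := k)
        fun y => by
          by_cases hy : y ∈ s <;> simp [hy]
      rw [integral_indicator hs] at this
      simp only [setIntegral_const, smul_eq_mul] at this
      have e : ∫ y, Real.exp (s.indicator (fun _ => (k : ℝ)) y - 1) * ψ y ∂n =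
          ∫ y, Real.exp (-1) * ψ y ∂n := by
        refine integral_congr_ae ?_
        have : ∀ᵐ y ∂n, y ∉ s := measure_eq_zero_iff_ae_notMem.1 h0
        filter_upwards [this] with y hy
        rw [indicator_of_notMem hy, zero_sub]
      rw [e] at this
      linarith
    have h2 : μ.real s ≤ 0 := by
      by_contra! hlt
      obtain ⟨k, hk⟩ := exists_nat_gt ((c + ∫ y, Real.exp (-1) * ψ y ∂n) / μ.real s)
      rw [div_lt_iff₀ hlt] at hk
      linarith [h1 k]
    exact (measureReal_eq_zero_iff (measure_ne_top _ _)).1 (le_antisymm h2 measureReal_nonneg)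
  set ρ := density μ n with hρ
  have hρm : Measurable ρ := measurable_density μ n
  have hρ0 : ∀ y, 0 ≤ ρ y := density_nonneg μ n
  -- Truncation of the density to [exp(-k), exp k], which bounds its logarithm by k.
  set C : ℕ → Y → ℝ := fun k y => max (Real.exp (-k)) (min (ρ y) (Real.exp k)) with hC
  have hCm : ∀ k : ℕ, Measurable (C k) := fun k => measurable_const.max (hρm.min measurable_const)
  have hC1 : ∀ (k : ℕ) y, Real.exp (-k) ≤ C k y := fun k y => le_max_left _ _
  have hC2 : ∀ (k : ℕ) y, C k y ≤ Real.exp k := fun k y =>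
    max_le (Real.exp_le_exp.2 (by linarith [k.cast_nonneg (α := ℝ)])) (min_le_right _ _)
  have hCpos : ∀ (k : ℕ) y, 0 < C k y := fun k y => (Real.exp_pos _).trans_le (hC1 k y)
  have hlog : ∀ (k : ℕ) y, |Real.log (C k y)| ≤ k := fun k y => by
    rw [abs_le]
    constructor
    · rw [Real.le_log_iff_exp_le (hCpos k y)]; exact hC1 k y
    · rw [Real.log_le_iff_le_exp (hCpos k y)]; exact hC2 k y
  have hφm : ∀ k : ℕ, Measurable fun y => 1 + Real.log (C k y) := fun k => (hCm k).log.const_add 1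
  have hφB : ∀ (k : ℕ) y, |1 + Real.log (C k y)| ≤ 1 + k := fun k y =>
    (abs_add_le _ _).trans (by rw [abs_one]; linarith [hlog k y])
  have hi1 : ∀ k : ℕ, Integrable (fun y => ρ y * (1 + Real.log (C k y))) n := fun k => by
    rw [hρ, integrable_density_mul_iff hac]
    exact Integrable.of_bound (hφm k).aestronglyMeasurable (1 + k) (Eventually.of_forall (hφB k))
  have hi2 : ∀ k : ℕ, Integrable (fun y => C k y * ψ y) n := fun k =>
    hψi.bdd_mul (c := Real.exp k) (hCm k).aestronglyMeasurable (Eventually.of_forall fun y => by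
      rw [Real.norm_of_nonneg (hCpos k y).le]; exact hC2 k y)
  have hint : ∀ k : ℕ, ∫ y, (ρ y * (1 + Real.log (C k y)) - C k y * ψ y + ψ y) ∂n ≤
      c + ∫ y, ψ y ∂n := fun k => by
    have i3 : Integrable (fun y => ρ y * (1 + Real.log (C k y)) - C k y * ψ y) n :=
      (hi1 k).sub (hi2 k)
    rw [integral_add i3 hψi, integral_sub (hi1 k) (hi2 k), hρ, integral_density_mul hac]
    have := key (hφm k) (hφB k)
    have e : ∀ y, Real.exp (1 + Real.log (C k y) - 1) = C k y := fun y => by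
      rw [add_sub_cancel_left, Real.exp_log (hCpos k y)]
    simp only [e] at this
    linarith
  have hDn : ∀ᵐ y ∂n, y ∈ Dᶜ → ρ y = 0 := density_ae_eq_zero hac hD.compl hμD
  -- Adding ψ makes the integrands nonnegative for Fatou. Where ρ is below the truncation this rests
  -- on (k + 1) exp(-k) ≤ 1.
  have hnonneg : ∀ k : ℕ, ∀ᵐ y ∂n, 0 ≤ ρ y * (1 + Real.log (C k y)) - C k y * ψ y + ψ y := fun k => by
    filter_upwards [hDn] with y hy
    have hek : Real.exp (-k) ≤ 1 := Real.exp_le_one_iff.2 (by linarith [k.cast_nonneg (α := ℝ)])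
    by_cases hyD : y ∈ D
    · rw [hψD y hyD]
      rcases le_total (ρ y) (Real.exp (-k)) with h1 | h1
      · have hCk : C k y = Real.exp (-k) := by
          simp only [hC]; rw [max_eq_left ((min_le_left _ _).trans h1)]
        rw [hCk, Real.log_exp]
        have h2 : (k + 1 : ℝ) * Real.exp (-k) ≤ 1 := by
          rw [Real.exp_neg, ← div_eq_mul_inv, div_le_one (Real.exp_pos _)]
          exact Real.add_one_le_exp _
        have h3 : (k : ℝ) * ρ y ≤ k * Real.exp (-k) := by gcongr
        nlinarith [hρ0 y]
      rcases le_total (ρ y) (Real.exp k) with h2 | h2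
      · have hCk : C k y = ρ y := by
          simp only [hC]; rw [min_eq_left h2, max_eq_right h1]
        rw [hCk]
        linarith [neg_one_le_mul_log (hρ0 y)]
      · have hCk : C k y = Real.exp k := by
          simp only [hC]; rw [min_eq_right h2, max_eq_right]
          exact Real.exp_le_exp.2 (by linarith [k.cast_nonneg (α := ℝ)])
        rw [hCk, Real.log_exp]
        nlinarith [k.cast_nonneg (α := ℝ), hρ0 y]
    · have hCk : C k y = Real.exp (-k) := by
        simp only [hC]; rw [hy hyD, max_eq_left ((min_le_left _ _).trans (Real.exp_pos _).le)]
      rw [hy hyD, hCk]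
      nlinarith [hψ0 y]
  have hlim : ∀ᵐ y ∂n, Tendsto (fun k : ℕ => ρ y * (1 + Real.log (C k y)) - C k y * ψ y + ψ y) atTop
      (𝓝 (ρ y * Real.log (ρ y) + ψ y)) := by
    filter_upwards [hDn] with y hy
    rcases (hρ0 y).eq_or_lt with h0 | h0
    · have hCk : ∀ k, C k y = Real.exp (-k) := fun k => by
        simp only [hC]; rw [← h0, max_eq_left ((min_le_left _ _).trans (Real.exp_pos _).le)]
      simp only [hCk, ← h0, zero_mul, zero_sub, zero_add]
      have : Tendsto (fun k : ℕ => Real.exp (-(k : ℝ))) atTop (𝓝 0) :=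
        Real.tendsto_exp_neg_atTop_nhds_zero.comp tendsto_natCast_atTop_atTop
      simpa using (this.mul_const (ψ y)).neg.add_const (ψ y)
    · have hyD : y ∈ D := by by_contra hyD; exact h0.ne' (hy hyD)
      obtain ⟨k₀, hk₀⟩ := exists_nat_ge |Real.log (ρ y)|
      refine tendsto_const_nhds.congr' ?_
      filter_upwards [eventually_ge_atTop k₀] with k hk
      have hk' : |Real.log (ρ y)| ≤ k := hk₀.trans (by exact_mod_cast hk)
      rw [abs_le, Real.le_log_iff_exp_le h0, Real.log_le_iff_le_exp h0] at hk'
      have hCk : C k y = ρ y := by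
        simp only [hC]; rw [min_eq_left hk'.2, max_eq_right hk'.1]
      rw [hCk, hψD y hyD]; ring
  obtain ⟨hI, hle⟩ := integrable_and_integral_le_of_tendsto
    (fun k => ((hi1 k).sub (hi2 k)).add hψi) hnonneg hlim hint
  have hI' : Integrable (fun y => ρ y * Real.log (ρ y)) n := by
    refine (hI.sub hψi).congr (Eventually.of_forall fun y => ?_)
    simp
  refine ⟨inEntropyDomain_iff.2 ⟨hac, hI'⟩, ?_⟩
  rw [integral_add hI' hψi] at hle
  exact le_of_add_le_add_right hle

theorem tendsto_measure_compl_eq_zero {ι : Type*} {l : Filter ι} [l.NeBot]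
    {μ : ι → ProbabilityMeasure Y} {μ' : ProbabilityMeasure Y} (h : Tendsto μ l (𝓝 μ')) {D : Set Y}
    (hD : IsClosed D) (hμ : ∀ᶠ i in l, (μ i : Measure Y) Dᶜ = 0) : (μ' : Measure Y) Dᶜ = 0 := by
  have h1 := ProbabilityMeasure.le_liminf_measure_open_of_tendsto h hD.isOpen_compl
  have h2 : Tendsto (fun i => (μ i : Measure Y) Dᶜ) l (𝓝 0) :=
    tendsto_const_nhds.congr' (by filter_upwards [hμ] with i hi using hi.symm)
  rw [h2.liminf_eq] at h1
  exact le_antisymm h1 zero_le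

variable [ProperSpace Y]

/-- The easy direction of the duality: Young's inequality pointwise, on D where ψ = 1; off D the
density vanishes. -/
theorem ent_ge_dual {μ n : Measure Y} [IsProbabilityMeasure μ] [SigmaFinite n] {D : Set Y}
    (hD : MeasurableSet D) (hμD : μ Dᶜ = 0) {ψ : Y → ℝ} (hψ0 : ∀ y, 0 ≤ ψ y)
    (hψi : Integrable ψ n) (hψD : ∀ y ∈ D, ψ y = 1) (h : InEntropyDomain μ n)
    {φ : Y → ℝ} (hφ : Continuous φ) {B : ℝ} (hB : ∀ y, |φ y| ≤ B) :
    ∫ y, φ y ∂μ - ∫ y, Real.exp (φ y - 1) * ψ y ∂n ≤ ent μ n := by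
  obtain ⟨h1, h2⟩ := inEntropyDomain_iff.1 h
  have i1 : Integrable (fun y => density μ n y * φ y) n :=
    (integrable_density_mul_iff h1 φ).2
      (Integrable.of_bound hφ.aestronglyMeasurable B (Eventually.of_forall hB))
  have i2 : Integrable (fun y => Real.exp (φ y - 1) * ψ y) n :=
    hψi.bdd_mul (c := Real.exp B) (by fun_prop) (Eventually.of_forall fun y => by
      rw [Real.norm_of_nonneg (Real.exp_pos _).le]
      exact Real.exp_le_exp.2 (by linarith [(abs_le.1 (hB y)).2]))
  rw [← integral_density_mul h1, ← integral_sub i1 i2, ent]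
  refine integral_mono_ae (i1.sub i2) h2 ?_
  filter_upwards [density_ae_eq_zero h1 hD.compl hμD] with y hy
  by_cases hyD : y ∈ D
  · simp only [hψD y hyD, mul_one]
    exact mul_sub_exp_le_mul_log (density_nonneg _ _ _) _
  · simp only [hy hyD, zero_mul, zero_sub]
    exact neg_nonpos.2 (mul_nonneg (Real.exp_pos _).le (hψ0 y))

theorem exists_cutoff {Z : Type*} [MetricSpace Z] [ProperSpace Z] {D : Set Z} (hD : IsCompact D) :
    ∃ ψ : Z → ℝ, Continuous ψ ∧
    HasCompactSupport ψ ∧ (∀ y, 0 ≤ ψ y) ∧ ∀ y ∈ D, ψ y = 1 := by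
  obtain ⟨f, h1, -, h3, h4⟩ := exists_continuous_one_zero_of_isCompact hD isClosed_empty
    (disjoint_empty D)
  exact ⟨f, f.continuous, h3, fun y => (h4 y).1, fun y hy => h1 hy⟩

/-- Joint lower semicontinuity of the entropy. -/
theorem ent_le_of_tendsto {ι : Type*} {l : Filter ι} [l.NeBot] {n : ι → Measure Y} {n' : Measure Y}
    [∀ i, IsFiniteMeasureOnCompacts (n i)] [IsFiniteMeasureOnCompacts n']
    (hn : ∀ φ : Y → ℝ, Continuous φ → HasCompactSupport φ →
      Tendsto (fun i => ∫ y, φ y ∂(n i)) l (𝓝 (∫ y, φ y ∂n')))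
    {μ : ι → ProbabilityMeasure Y} {μ' : ProbabilityMeasure Y} (hμ : Tendsto μ l (𝓝 μ'))
    {D : Set Y} (hD : IsCompact D) (hμD : ∀ᶠ i in l, (μ i : Measure Y) Dᶜ = 0) {c : ℝ}
    (hc : ∀ᶠ i in l, InEntropyDomain (μ i : Measure Y) (n i) ∧ ent (μ i : Measure Y) (n i) ≤ c) :
    InEntropyDomain (μ' : Measure Y) n' ∧ ent (μ' : Measure Y) n' ≤ c := by
  obtain ⟨ψ, hψ, hψc, hψ0, hψD⟩ := exists_cutoff hD
  refine inEntropyDomain_of_dual hD.measurableSet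
    (tendsto_measure_compl_eq_zero hμ hD.isClosed hμD) hψ hψ0
    (hψ.integrable_of_hasCompactSupport hψc) hψD fun φ hφ ⟨B, hB⟩ => ?_
  have h1 : Tendsto (fun i => ∫ y, φ y ∂(μ i : Measure Y)) l (𝓝 (∫ y, φ y ∂(μ' : Measure Y))) := by
    have := ProbabilityMeasure.tendsto_iff_forall_integral_tendsto.1 hμ
      (BoundedContinuousFunction.ofNormedAddCommGroup φ hφ B hB)
    simpa using this
  -- The cut-off makes the exponential term an admissible test function for convergence of the
  -- reference measures.
  have h2 := hn (fun y => Real.exp (φ y - 1) * ψ y) (by fun_prop) hψc.mul_left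
  refine le_of_tendsto (h1.sub h2) ?_
  filter_upwards [hμD, hc] with i hi1 hi2
  exact (ent_ge_dual hD.measurableSet hi1 hψ0 (hψ.integrable_of_hasCompactSupport hψc) hψD hi2.1
    hφ hB).trans hi2.2

end Duality

/-! ### Closedness of the causal relation. -/

section CausalClosedness

variable {Y : Type w} [MetricSpace Y]

/-- The variation of γ up to time s is continuous in s, so the intermediate value theorem selects
times at which it has grown by steps of δ. Where it is flat the times need not be ordered, but then
γ takes the same value, which explains the disjunction. -/
theorem exists_chain_of_eVariationOn_le {a b δ : ℝ} (hab : a ≤ b) (hδ : 0 < δ) {γ : ℝ → Y}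
    {K C : ℝ≥0} (hγ : LipschitzOnWith K γ (Icc a b)) (hC : eVariationOn γ (Icc a b) ≤ C) {n : ℕ}
    (hn : C ≤ n * δ) : ∃ t : ℕ → ℝ, (∀ i, t i ∈ Icc a b) ∧ γ (t 0) = γ a ∧ γ (t n) = γ b ∧
      ∀ i, dist (γ (t i)) (γ (t (i + 1))) ≤ δ ∧ (t i ≤ t (i + 1) ∨ γ (t i) = γ (t (i + 1))) := by
  set v : ℝ → ℝ := fun s => (eVariationOn γ (Icc a s)).toReal with hv
  have hfin : ∀ {s t : ℝ}, a ≤ s → t ≤ b → eVariationOn γ (Icc s t) ≠ ⊤ := fun hs ht =>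
    ((eVariationOn.mono γ (Icc_subset_Icc hs ht)).trans_lt (hC.trans_lt ENNReal.coe_lt_top)).ne
  have hadd : ∀ {s t : ℝ}, a ≤ s → s ≤ t → t ≤ b →
      v t = v s + (eVariationOn γ (Icc s t)).toReal := fun {s t} has hst htb => by
    have := eVariationOn.Icc_add_Icc γ (s := univ) has hst (mem_univ s)
    simp only [univ_inter] at this
    simp only [hv]
    rw [← this, ENNReal.toReal_add (hfin le_rfl (hst.trans htb)) (hfin has htb)]
  have hdist : ∀ {s t : ℝ}, a ≤ s → s ≤ t → t ≤ b → dist (γ s) (γ t) ≤ v t - v s :=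
    fun {s t} has hst htb => by
      rw [hadd has hst htb, add_sub_cancel_left, dist_edist]
      exact ENNReal.toReal_mono (hfin has htb)
        (eVariationOn.edist_le γ (left_mem_Icc.2 hst) (right_mem_Icc.2 hst))
  have hlip : ∀ {s t : ℝ}, a ≤ s → s ≤ t → t ≤ b → v t - v s ≤ K * (t - s) ∧ 0 ≤ v t - v s :=
    fun {s t} has hst htb => by
      rw [hadd has hst htb, add_sub_cancel_left]
      refine ⟨?_, ENNReal.toReal_nonneg⟩
      have h1 := (hγ.mono (Icc_subset_Icc has htb)).comp_eVariationOn_le (g := id) (mapsTo_id _)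
      rw [eVariationOn_id_Icc] at h1
      have h2 := ENNReal.toReal_mono (by finiteness) h1
      rwa [ENNReal.toReal_mul, ENNReal.coe_toReal, ENNReal.toReal_ofReal (sub_nonneg.2 hst)] at h2
  have hcont : ContinuousOn v (Icc a b) := by
    refine (LipschitzOnWith.of_dist_le_mul (K := K) fun s hs t ht => ?_).continuousOn
    rcases le_total s t with h | h
    · have := hlip hs.1 h ht.2
      rw [dist_comm, Real.dist_eq, abs_of_nonneg this.2, dist_comm, Real.dist_eq,
        abs_of_nonneg (sub_nonneg.2 h)]
      exact this.1
    · have := hlip ht.1 h hs.2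
      rw [Real.dist_eq, abs_of_nonneg this.2, Real.dist_eq, abs_of_nonneg (sub_nonneg.2 h)]
      exact this.1
  have hva : v a = 0 := by simp [hv]
  have hvb0 : 0 ≤ v b := ENNReal.toReal_nonneg
  have hvb : v b ≤ n * δ := (ENNReal.toReal_mono ENNReal.coe_ne_top hC).trans hn
  have hex : ∀ i : ℕ, ∃ s ∈ Icc a b, v s = min (i * δ) (v b) := fun i => by
    have := intermediate_value_Icc hab hcont
    exact this ⟨by rw [hva]; positivity, min_le_right _ _⟩
  choose t ht htv using hex
  have hmono : ∀ {s t : ℝ}, s ∈ Icc a b → t ∈ Icc a b → v s < v t → s ≤ t := fun {s t} hs ht h => by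
    by_contra! hlt
    linarith [(hlip ht.1 hlt.le hs.2).2]
  have heq : ∀ {s t : ℝ}, s ∈ Icc a b → t ∈ Icc a b → v s = v t → γ s = γ t := fun {s t} hs ht h => by
    rcases le_total s t with hst | hst
    · have := hdist hs.1 hst ht.2
      rw [h, sub_self] at this
      exact dist_le_zero.1 this
    · have := hdist ht.1 hst hs.2
      rw [h, sub_self] at this
      exact (dist_le_zero.1 this).symm
  refine ⟨t, ht, heq (ht 0) (left_mem_Icc.2 hab) ?_, heq (ht n) (right_mem_Icc.2 hab) ?_,
    fun i => ?_⟩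
  · rw [htv, hva]; simpa using hvb0
  · rw [htv, min_eq_right hvb]
  · have hle : v (t i) ≤ v (t (i + 1)) := by
      rw [htv, htv]; push_cast
      exact min_le_min_right _ (by nlinarith)
    have hdiff : v (t (i + 1)) - v (t i) ≤ δ := by
      rw [htv, htv]; push_cast
      rcases le_total (v b) (i * δ) with h | h
      · rw [min_eq_right h]; linarith [min_le_right ((i + 1 : ℝ) * δ) (v b)]
      · rw [min_eq_left h]; linarith [min_le_left ((i + 1 : ℝ) * δ) (v b)]
    rcases hle.eq_or_lt with h | h
    · have := heq (ht i) (ht (i + 1)) h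
      exact ⟨by rw [this, dist_self]; exact hδ.le, Or.inr this⟩
    · have hti := hmono (ht i) (ht (i + 1)) h
      exact ⟨(hdist (ht i).1 hti (ht (i + 1)).2).trans hdiff, Or.inl hti⟩

namespace LorentzianPreLength

variable [ProperSpace Y] {M : LorentzianPreLength Y}

/-- The uniform length bound in D makes the number of links independent of the pair of points, so
chains of a sequence of pairs can be compared. -/
theorem exists_causal_chain (hM_geod : M.IsGeodesic) {D : Set Y} {C : ℝ≥0}
    (hC : ∀ (I : Set ℝ) (γ : ℝ → Y), I.OrdConnected → M.IsCausalCurve I γ → MapsTo γ I D →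
      eVariationOn γ I ≤ C) {δ : ℝ} (hδ : 0 < δ) {n : ℕ} (hn : C ≤ n * δ) {x y : Y}
    (hxy : M.le x y) (hD : ∀ z, M.le x z → M.le z y → z ∈ D) :
    ∃ z : ℕ → Y, z 0 = x ∧ z n = y ∧
      ∀ i, z i ∈ D ∧ dist (z i) (z (i + 1)) ≤ δ ∧ M.le (z i) (z (i + 1)) := by
  rcases eq_or_ne x y with rfl | hne
  · exact ⟨fun _ => x, rfl, rfl, fun i => ⟨hD x (M.le_refl x) (M.le_refl x), by simpa using hδ.le,
      M.le_refl x⟩⟩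
  obtain ⟨a, b, γ, hab, rfl, rfl, hγ, -⟩ := hM_geod x y hxy hne
  have hle : ∀ s ∈ Icc a b, ∀ t ∈ Icc a b, s ≤ t → M.le (γ s) (γ t) := fun s hs t ht hst => by
    rcases hst.eq_or_lt with rfl | h
    · exact M.le_refl _
    · exact hγ.2.2 s hs t ht h
  have hmaps : MapsTo γ (Icc a b) D := fun s hs =>
    hD _ (hle a (left_mem_Icc.2 hab.le) s hs hs.1) (hle s hs b (right_mem_Icc.2 hab.le) hs.2)
  obtain ⟨K, hK⟩ := hγ.2.1.exists_lipschitzOnWith_of_compact isCompact_Icc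
  obtain ⟨t, ht, h0, h1, h2⟩ := exists_chain_of_eVariationOn_le hab.le hδ hK
    (hC _ γ ordConnected_Icc hγ hmaps) hn
  refine ⟨fun i => γ (t i), h0, h1, fun i => ⟨hmaps (ht i), (h2 i).1, ?_⟩⟩
  rcases (h2 i).2 with h | h
  · exact hle _ (ht i) _ (ht (i + 1)) h
  · show M.le (γ (t i)) (γ (t (i + 1)))
    rw [h]; exact M.le_refl _

/-- Local causal closedness and `𝒦`-global hyperbolicity of a geodesic space imply that the causal
relation is closed. -/
theorem isClosed_le (hM_closed : M.LocallyCausallyClosed) (hM_hyp : M.KGloballyHyperbolic)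
    (hM_geod : M.IsGeodesic) : IsClosed {z : Y × Y | M.le z.1 z.2} := by
  refine IsSeqClosed.isClosed fun u z hu hlim => ?_
  have hl1 : Tendsto (fun n => (u n).1) atTop (𝓝 z.1) := (continuous_fst.tendsto z).comp hlim
  have hl2 : Tendsto (fun n => (u n).2) atTop (𝓝 z.2) := (continuous_snd.tendsto z).comp hlim
  -- Adjoining the limits makes both end point sets compact, so all the curves stay in one compact
  -- diamond.
  have hD := hM_hyp.2 _ _ hl1.isCompact_insert_range hl2.isCompact_insert_range
  set D := M.futureJ (insert z.1 (range fun n => (u n).1)) ∩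
    M.pastJ (insert z.2 (range fun n => (u n).2)) with hDdef
  obtain ⟨C, hC⟩ := hM_hyp.1 D hD
  choose U hU hUc using hM_closed
  obtain ⟨δ, hδ, hball⟩ := lebesgue_number_lemma_of_metric hD (c := fun x => interior (U x))
    (fun x => isOpen_interior) (fun x _ => mem_iUnion.2 ⟨x, mem_interior_iff_mem_nhds.2 (hU x)⟩)
  obtain ⟨N, hN⟩ := exists_nat_ge (C / (δ / 2))
  rw [div_le_iff₀ (by positivity)] at hN
  have hchain : ∀ n, ∃ c : ℕ → Y, c 0 = (u n).1 ∧ c N = (u n).2 ∧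
      ∀ i, c i ∈ D ∧ dist (c i) (c (i + 1)) ≤ δ / 2 ∧ M.le (c i) (c (i + 1)) := fun n =>
    exists_causal_chain hM_geod hC (by positivity) hN (hu n) fun w h1 h2 =>
      ⟨⟨_, Or.inr ⟨n, rfl⟩, h1⟩, ⟨_, Or.inr ⟨n, rfl⟩, h2⟩⟩
  choose c hc0 hcN hc using hchain
  -- All links converge along one subsequence. A limit link has length at most half a Lebesgue
  -- number, so it lies in a single set on which the relation is closed.
  obtain ⟨w, hw, φ, hφ, hwlim⟩ := (isCompact_univ_pi fun _ : ℕ => hD).tendsto_subseq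
    (x := c) fun n i _ => (hc n i).1
  have hwi : ∀ i, Tendsto (fun n => c (φ n) i) atTop (𝓝 (w i)) := fun i =>
    (tendsto_pi_nhds.1 hwlim i)
  have hstep : ∀ i, M.le (w i) (w (i + 1)) := fun i => by
    have hwd : dist (w i) (w (i + 1)) ≤ δ / 2 :=
      le_of_tendsto ((hwi i).dist (hwi (i + 1))) (Eventually.of_forall fun n => (hc (φ n) i).2.1)
    obtain ⟨p, hp⟩ := hball (w i) (hw i (mem_univ i))
    have hp2 : w (i + 1) ∈ interior (U p) := hp (by rw [Metric.mem_ball, dist_comm]; linarith)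
    have hp1 : w i ∈ interior (U p) := hp (Metric.mem_ball_self hδ)
    refine ((hUc p).mem_of_tendsto ((hwi i).prodMk_nhds (hwi (i + 1))) ?_).1
    filter_upwards [(hwi i).eventually (isOpen_interior.mem_nhds hp1),
      (hwi (i + 1)).eventually (isOpen_interior.mem_nhds hp2)] with n h1 h2
    exact ⟨(hc (φ n) i).2.2, subset_closure (interior_subset h1),
      subset_closure (interior_subset h2)⟩
  have hall : ∀ i, M.le (w 0) (w i) := fun i => by
    induction i with
    | zero => exact M.le_refl _
    | succ i ih => exact M.le_trans _ _ _ ih (hstep i)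
  have e0 : w 0 = z.1 := tendsto_nhds_unique (hwi 0) 
    ((hl1.comp hφ.tendsto_atTop).congr fun n => (hc0 (φ n)).symm)
  have eN : w N = z.2 := tendsto_nhds_unique (hwi N) 
    ((hl2.comp hφ.tendsto_atTop).congr fun n => (hcN (φ n)).symm)
  have := hall N
  rwa [e0, eN] at this

end LorentzianPreLength

end CausalClosedness

/-! ### Narrow limits of measures carried by a fixed compact set. -/

section Narrow

variable {Z : Type u} [MetricSpace Z] [ProperSpace Z] [MeasurableSpace Z] [BorelSpace Z]

theorem isCompact_carried {D : Set Z} (hD : IsCompact D) :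
    IsCompact {μ : ProbabilityMeasure Z | (μ : Measure Z) Dᶜ = 0} := by
  have := isCompact_setOfPred_probabilityMeasure_mass_eq_compl_isCompact_le (E := Z)
    (u := fun _ => 0) (K := fun _ => D) tendsto_const_nhds (fun _ => hD) (Or.inr monotone_const)
  convert this using 1
  ext μ
  simp

theorem exists_tendsto_of_carried {ι : Type v} (l : Ultrafilter ι) {D : Set Z} (hD : IsCompact D)
    {μ : ι → ProbabilityMeasure Z} (hμ : ∀ᶠ i in l, (μ i : Measure Z) Dᶜ = 0) :
    ∃ μ' : ProbabilityMeasure Z, (μ' : Measure Z) Dᶜ = 0 ∧ Tendsto μ l (𝓝 μ') := by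
  obtain ⟨μ', h1, h2⟩ := (isCompact_carried hD).ultrafilter_le_nhds' (l.map μ) hμ
  exact ⟨μ', h1, h2⟩

theorem exists_bound_of_isCompact {D : Set Z} (hD : IsCompact D) {F : Z → ℝ} (hF : Continuous F) :
    ∃ C, 0 ≤ C ∧ ∀ z ∈ D, |F z| ≤ C := by
  obtain ⟨C, hC⟩ := hD.exists_bound_of_continuousOn hF.continuousOn
  exact ⟨max C 0, le_max_right _ _, fun z hz => (hC z hz).trans (le_max_left _ _)⟩

theorem integrable_of_carried {D : Set Z} (hD : IsCompact D) {μ : Measure Z} [IsFiniteMeasure μ]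
    (hμ : μ Dᶜ = 0) {F : Z → ℝ} (hF : Continuous F) : Integrable F μ := by
  obtain ⟨C, -, hC⟩ := exists_bound_of_isCompact hD hF
  refine Integrable.of_bound hF.aestronglyMeasurable C ?_
  filter_upwards [measure_eq_zero_iff_ae_notMem.1 hμ] with z hz
  exact hC z (not_not.1 hz)

/-- Truncating F at its bound on D yields a bounded test function with the same integrals. -/
theorem tendsto_integral_of_carried {ι : Type v} {l : Filter ι} {D : Set Z} (hD : IsCompact D)
    {μ : ι → ProbabilityMeasure Z} {μ' : ProbabilityMeasure Z} (h : Tendsto μ l (𝓝 μ'))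
    (hμ : ∀ᶠ i in l, (μ i : Measure Z) Dᶜ = 0) {F : Z → ℝ} (hF : Continuous F) :
    Tendsto (fun i => ∫ z, F z ∂(μ i : Measure Z)) l (𝓝 (∫ z, F z ∂(μ' : Measure Z))) := by
  rcases l.eq_or_neBot with rfl | hl
  · exact tendsto_bot
  obtain ⟨C, hC0, hC⟩ := exists_bound_of_isCompact hD hF
  set G : Z → ℝ := fun z => max (-C) (min C (F z)) with hG
  have hGc : Continuous G := by fun_prop
  have hGb : ∀ z, ‖G z‖ ≤ C := fun z => abs_le.2
    ⟨le_max_left _ _, max_le (by linarith) (min_le_left _ _)⟩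
  have key : ∀ ν : Measure Z, ν Dᶜ = 0 → ∫ z, F z ∂ν = ∫ z, G z ∂ν := fun ν hν => by
    refine integral_congr_ae ?_
    filter_upwards [measure_eq_zero_iff_ae_notMem.1 hν] with z hz
    have := abs_le.1 (hC z (not_not.1 hz))
    simp only [hG]
    rw [min_eq_right this.2, max_eq_right this.1]
  have h1 := ProbabilityMeasure.tendsto_iff_forall_integral_tendsto.1 h
    (BoundedContinuousFunction.ofNormedAddCommGroup G hGc C hGb)
  simp only [BoundedContinuousFunction.coe_ofNormedAddCommGroup] at h1
  rw [key _ (tendsto_measure_compl_eq_zero h hD.isClosed hμ)]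
  refine h1.congr' ?_
  filter_upwards [hμ] with i hi using (key _ hi).symm

end Narrow

/-! ### Causal couplings, their limits, and existence of maximisers. -/

section Couplings

variable {Y : Type u} [MetricSpace Y] [ProperSpace Y] [MeasurableSpace Y] [BorelSpace Y]
  {M : LorentzianPreLength Y}

namespace LorentzianPreLength

theorem causalCouplings_carried {μ ν : ProbabilityMeasure Y} {π : ProbabilityMeasure (Y × Y)}
    (hπ : π ∈ M.causalCouplings μ ν) {D E : Set Y} (hD : MeasurableSet D) (hE : MeasurableSet E)
    (hμ : (μ : Measure Y) Dᶜ = 0) (hν : (ν : Measure Y) Eᶜ = 0) :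
    (π : Measure (Y × Y)) (D ×ˢ E)ᶜ = 0 := by
  rw [← hπ.1, Measure.map_apply measurable_fst hD.compl] at hμ
  rw [← hπ.2.1, Measure.map_apply measurable_snd hE.compl] at hν
  refine measure_mono_null ?_ (measure_union_null hμ hν)
  intro z hz
  by_contra h
  simp only [mem_union, mem_preimage, mem_compl_iff, not_or, not_not] at h
  exact hz ⟨h.1, h.2⟩

/-- Limits of causal couplings are causal couplings. -/
theorem causalCouplings_of_tendsto (hle : IsClosed {z : Y × Y | M.le z.1 z.2}) {ι : Type v}
    {l : Filter ι} [l.NeBot] {μ ν : ι → ProbabilityMeasure Y} {μ' ν' : ProbabilityMeasure Y}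
    {π : ι → ProbabilityMeasure (Y × Y)} {π' : ProbabilityMeasure (Y × Y)}
    (hμ : Tendsto μ l (𝓝 μ')) (hν : Tendsto ν l (𝓝 ν')) (hπ : Tendsto π l (𝓝 π'))
    (h : ∀ᶠ i in l, π i ∈ M.causalCouplings (μ i) (ν i)) : π' ∈ M.causalCouplings μ' ν' := by
  have h1 := ProbabilityMeasure.tendsto_map_of_tendsto_of_continuous π π' hπ continuous_fst
  have h2 := ProbabilityMeasure.tendsto_map_of_tendsto_of_continuous π π' hπ continuous_snd
  refine ⟨?_, ?_, ?_⟩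
  · refine congrArg ProbabilityMeasure.toMeasure (tendsto_nhds_unique h1 (hμ.congr' ?_))
    filter_upwards [h] with i hi
    exact ProbabilityMeasure.toMeasure_injective hi.1.symm
  · refine congrArg ProbabilityMeasure.toMeasure (tendsto_nhds_unique h2 (hν.congr' ?_))
    filter_upwards [h] with i hi
    exact ProbabilityMeasure.toMeasure_injective hi.2.1.symm
  · have := tendsto_measure_compl_eq_zero hπ hle (by
      filter_upwards [h] with i hi using hi.2.2)
    exact this

theorem exists_tendsto_causalCouplings (hle : IsClosed {z : Y × Y | M.le z.1 z.2}) {ι : Type v}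
    (l : Ultrafilter ι) {D E : Set Y} (hD : IsCompact D) (hE : IsCompact E)
    {μ ν : ι → ProbabilityMeasure Y} {μ' ν' : ProbabilityMeasure Y}
    {π : ι → ProbabilityMeasure (Y × Y)} (hμ : Tendsto μ l (𝓝 μ')) (hν : Tendsto ν l (𝓝 ν'))
    (hμD : ∀ᶠ i in l, (μ i : Measure Y) Dᶜ = 0) (hνE : ∀ᶠ i in l, (ν i : Measure Y) Eᶜ = 0)
    (h : ∀ᶠ i in l, π i ∈ M.causalCouplings (μ i) (ν i)) :
    ∃ π' ∈ M.causalCouplings μ' ν', (π' : Measure (Y × Y)) (D ×ˢ E)ᶜ = 0 ∧ Tendsto π l (𝓝 π') := by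
  have hc : ∀ᶠ i in l, (π i : Measure (Y × Y)) (D ×ˢ E)ᶜ = 0 := by
    filter_upwards [h, hμD, hνE] with i h1 h2 h3
    exact causalCouplings_carried h1 hD.measurableSet hE.measurableSet h2 h3
  obtain ⟨π', h1, h2⟩ := exists_tendsto_of_carried l (hD.prod hE) hc
  exact ⟨π', causalCouplings_of_tendsto hle hμ hν h2 h, h1, h2⟩

variable (M) in
/-- The real-valued time separation. -/
noncomputable def sep (z : Y × Y) : ℝ := (M.τ z.1 z.2).toReal

theorem sep_nonneg (z : Y × Y) : 0 ≤ M.sep z := ENNReal.toReal_nonneg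

theorem continuous_sep (hM_fin : ∀ x y, M.τ x y ≠ ⊤)
    (hM_cont : Continuous fun z : Y × Y => M.τ z.1 z.2) : Continuous M.sep :=
  continuous_iff_continuousAt.2 fun z =>
    (ENNReal.tendsto_toReal (hM_fin z.1 z.2)).comp hM_cont.continuousAt

theorem sep_add_le (hM_fin : ∀ x y, M.τ x y ≠ ⊤) {x y z : Y} (h1 : M.le x y) (h2 : M.le y z) :
    M.sep (x, y) + M.sep (y, z) ≤ M.sep (x, z) := by
  unfold sep
  rw [← ENNReal.toReal_add (hM_fin _ _) (hM_fin _ _)]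
  exact ENNReal.toReal_mono (hM_fin _ _) (M.reverse_triangle x y z h1 h2)

theorem sep_pos_iff (hM_fin : ∀ x y, M.τ x y ≠ ⊤) (z : Y × Y) : 0 < M.sep z ↔ M.ll z.1 z.2 := by
  rw [← M.τ_pos_iff, sep, ENNReal.toReal_pos_iff]
  exact and_iff_left (hM_fin _ _).lt_top

variable (M) in
/-- The real-valued transport functional `∫ τ^p dπ`. -/
noncomputable def gain (p : ℝ) (π : ProbabilityMeasure (Y × Y)) : ℝ :=
  ∫ z, M.sep z ^ p ∂(π : Measure (Y × Y))

variable (M) in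
/-- There is a causal coupling of `μ` and `ν` whose transport cost is at least `c`. -/
def HasCoupling (p c : ℝ) (μ ν : ProbabilityMeasure Y) : Prop :=
  ∃ π ∈ M.causalCouplings μ ν, c ^ p ≤ M.gain p π

variable (M) in
/-- `π` maximises `∫ τ^p dπ` among causal couplings. -/
def IsMaximal (p : ℝ) (μ ν : ProbabilityMeasure Y) (π : ProbabilityMeasure (Y × Y)) : Prop :=
  π ∈ M.causalCouplings μ ν ∧ ∀ π' ∈ M.causalCouplings μ ν, M.gain p π' ≤ M.gain p π

theorem gain_nonneg (p : ℝ) (π : ProbabilityMeasure (Y × Y)) : 0 ≤ M.gain p π :=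
  integral_nonneg fun z => Real.rpow_nonneg (sep_nonneg z) p

theorem continuous_sep_rpow (hT : Continuous M.sep) {p : ℝ} (hp : 0 ≤ p) :
    Continuous fun z => M.sep z ^ p := hT.rpow_const fun _ => Or.inr hp

/-- Closedness of the causal relation makes the set of causal couplings compact, and the transport
functional is continuous on it. -/
theorem exists_isMaximal (hle : IsClosed {z : Y × Y | M.le z.1 z.2}) (hT : Continuous M.sep) {p : ℝ}
    (hp : 0 ≤ p) {D E : Set Y} (hD : IsCompact D) (hE : IsCompact E) {μ ν : ProbabilityMeasure Y}
    (hμ : (μ : Measure Y) Dᶜ = 0) (hν : (ν : Measure Y) Eᶜ = 0)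
    (h : (M.causalCouplings μ ν).Nonempty) : ∃ π, M.IsMaximal p μ ν π := by
  have hcomp : IsCompact (M.causalCouplings μ ν) := by
    refine isCompact_iff_ultrafilter_le_nhds'.2 fun l hl => ?_
    obtain ⟨π, h1, -, h2⟩ := exists_tendsto_causalCouplings hle l hD hE
      (μ := fun _ => μ) (ν := fun _ => ν) (π := id) tendsto_const_nhds tendsto_const_nhds
      (Eventually.of_forall fun _ => hμ) (Eventually.of_forall fun _ => hν) hl
    exact ⟨π, h1, h2⟩
  have hcont : ContinuousOn (M.gain p) (M.causalCouplings μ ν) := fun π hπ =>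
    tendsto_integral_of_carried (μ := id) (hD.prod hE) (tendsto_id.mono_left nhdsWithin_le_nhds) (by
      filter_upwards [self_mem_nhdsWithin] with π' hπ'
      exact causalCouplings_carried hπ' hD.measurableSet hE.measurableSet hμ hν)
      (continuous_sep_rpow hT hp)
  obtain ⟨π, h1, h2⟩ := hcomp.exists_isMaxOn h hcont
  exact ⟨π, h1, fun π' hπ' => h2 hπ'⟩

/-- Bounding the gain from below by a number, rather than asking for equality, is what makes the
condition stable under narrow limits. -/
theorem HasCoupling.of_tendsto (hle : IsClosed {z : Y × Y | M.le z.1 z.2}) (hT : Continuous M.sep)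
    {p : ℝ} (hp : 0 ≤ p) {ι : Type v} (l : Ultrafilter ι) {D : Set Y} (hD : IsCompact D)
    {μ ν : ι → ProbabilityMeasure Y} {μ' ν' : ProbabilityMeasure Y} {c : ι → ℝ} {c' : ℝ}
    (hμ : Tendsto μ l (𝓝 μ')) (hν : Tendsto ν l (𝓝 ν')) (hc : Tendsto c l (𝓝 c'))
    (hμD : ∀ᶠ i in l, (μ i : Measure Y) Dᶜ = 0) (hνD : ∀ᶠ i in l, (ν i : Measure Y) Dᶜ = 0)
    (h : ∀ᶠ i in l, M.HasCoupling p (c i) (μ i) (ν i)) : M.HasCoupling p c' μ' ν' := by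
  classical
  have : ∀ i, ∃ π : ProbabilityMeasure (Y × Y), M.HasCoupling p (c i) (μ i) (ν i) →
      π ∈ M.causalCouplings (μ i) (ν i) ∧ c i ^ p ≤ M.gain p π := fun i => by
    by_cases hi : M.HasCoupling p (c i) (μ i) (ν i)
    · obtain ⟨π, hπ⟩ := hi
      exact ⟨π, fun _ => hπ⟩
    · obtain ⟨y⟩ := (μ i).nonempty
      exact ⟨⟨Measure.dirac (y, y), inferInstance⟩, fun h => absurd h hi⟩
  choose π hπ using this
  have h' : ∀ᶠ i in l, π i ∈ M.causalCouplings (μ i) (ν i) := h.mono fun i hi => (hπ i hi).1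
  obtain ⟨π', h1, h2, h3⟩ := exists_tendsto_causalCouplings hle l hD hD hμ hν hμD hνD h'
  refine ⟨π', h1, ?_⟩
  have hlim := tendsto_integral_of_carried (hD.prod hD) h3 (by
      filter_upwards [h', hμD, hνD] with i a1 a2 a3
      exact causalCouplings_carried a1 hD.measurableSet hD.measurableSet a2 a3)
      (continuous_sep_rpow hT hp)
  exact le_of_tendsto_of_tendsto (hc.rpow_const (Or.inr hp)) hlim (h.mono fun i hi => (hπ i hi).2)

end LorentzianPreLength

end Couplings

/-! ### Gluing of couplings and the reverse triangle inequality. -/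

section Gluing

open ProbabilityTheory

/-- The gluing lemma. -/
theorem exists_gluing {α β γ : Type u} [MeasurableSpace α] [MeasurableSpace β] [MeasurableSpace γ]
    [StandardBorelSpace γ] [Nonempty γ] (π₁ : Measure (α × β)) (π₂ : Measure (β × γ))
    [IsProbabilityMeasure π₁] [IsProbabilityMeasure π₂]
    (h : π₁.map Prod.snd = π₂.map Prod.fst) :
    ∃ θ : Measure ((α × β) × γ), IsProbabilityMeasure θ ∧ θ.map Prod.fst = π₁ ∧
      θ.map (fun w => (w.1.2, w.2)) = π₂ := by
  -- Given the middle point, the third point is drawn from the disintegration of π₂, independently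
  -- of the first.
  set κ : Kernel (α × β) γ := π₂.condKernel.comap Prod.snd measurable_snd with hκ
  refine ⟨π₁ ⊗ₘ κ, inferInstance, Measure.fst_compProd π₁ κ, ?_⟩
  have hd := π₂.disintegrate π₂.condKernel
  refine Measure.ext_of_lintegral _ fun f hf => ?_
  rw [lintegral_map hf (by fun_prop), Measure.lintegral_compProd (by fun_prop)]
  conv_rhs => rw [← hd, Measure.lintegral_compProd hf, Measure.fst, ← h,
    lintegral_map (Measurable.lintegral_kernel_prod_right' hf) measurable_snd]
  rfl

/-- Concavity of the power at x/r and y/(1 - r), followed by monotonicity. Strict concavity and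
strict monotonicity decide the case of equality. -/
theorem weighted_rpow_add_le {p r x y z : ℝ} (hp : p ∈ Ioo (0 : ℝ) 1) (hr : r ∈ Ioo (0 : ℝ) 1)
    (hx : 0 ≤ x) (hy : 0 ≤ y) (h : x + y ≤ z) :
    r * (x / r) ^ p + (1 - r) * (y / (1 - r)) ^ p ≤ z ^ p ∧
      (z ^ p ≤ r * (x / r) ^ p + (1 - r) * (y / (1 - r)) ^ p → x = r * z ∧ y = (1 - r) * z) := by
  have hr0 : 0 < r := hr.1
  have hr1 : 0 < 1 - r := by linarith [hr.2]
  have hxr : 0 ≤ x / r := by positivity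
  have hyr : 0 ≤ y / (1 - r) := by positivity
  have e : r • (x / r) + (1 - r) • (y / (1 - r)) = x + y := by
    simp only [smul_eq_mul]; field_simp
  have hsc := Real.strictConcaveOn_rpow hp.1 hp.2
  have h1 : r * (x / r) ^ p + (1 - r) * (y / (1 - r)) ^ p ≤ (x + y) ^ p := by
    have := hsc.concaveOn.2 (mem_Ici.2 hxr) (mem_Ici.2 hyr) hr0.le hr1.le (by ring)
    rwa [e] at this
  have h2 : (x + y) ^ p ≤ z ^ p := Real.rpow_le_rpow (by positivity) h hp.1.le
  refine ⟨h1.trans h2, fun h3 => ?_⟩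
  have hz : x + y = z := by
    refine h.antisymm (le_of_not_gt fun hlt => ?_)
    have := Real.rpow_lt_rpow (by positivity) hlt hp.1
    linarith
  have hxy : x / r = y / (1 - r) := by
    by_contra hne
    have := hsc.2 (mem_Ici.2 hxr) (mem_Ici.2 hyr) hne hr0 hr1 (by ring)
    rw [e] at this
    simp only [smul_eq_mul] at this
    linarith
  rw [div_eq_div_iff hr0.ne' hr1.ne'] at hxy
  constructor <;> rw [← hz] <;> linarith

namespace LorentzianPreLength

variable {Y : Type u} [MetricSpace Y] [ProperSpace Y] [MeasurableSpace Y] [BorelSpace Y]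
  {M : LorentzianPreLength Y}

/-- Reverse triangle inequality for the transport cost, with its equality case. -/
theorem exists_glued_coupling (hM_fin : ∀ x y, M.τ x y ≠ ⊤) (hT : Continuous M.sep) {p : ℝ}
    (hp : p ∈ Ioo (0 : ℝ) 1) (hle : IsClosed {z : Y × Y | M.le z.1 z.2})
    {D : Set Y} (hD : IsCompact D) {μ ν ρ : ProbabilityMeasure Y}
    (hμ : (μ : Measure Y) Dᶜ = 0) (hν : (ν : Measure Y) Dᶜ = 0) (hρ : (ρ : Measure Y) Dᶜ = 0)
    {π₁ π₂ : ProbabilityMeasure (Y × Y)} (h1 : π₁ ∈ M.causalCouplings μ ν)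
    (h2 : π₂ ∈ M.causalCouplings ν ρ) {a b : ℝ} (ha : 0 < a) (hb : 0 < b)
    (hga : a ^ p ≤ M.gain p π₁) (hgb : b ^ p ≤ M.gain p π₂) :
    ∃ π ∈ M.causalCouplings μ ρ, (a + b) ^ p ≤ M.gain p π ∧
      (M.gain p π ≤ (a + b) ^ p →
        (π₁ : Measure (Y × Y)).map M.sep =
          (π : Measure (Y × Y)).map (fun z => a / (a + b) * M.sep z) ∧
        (π₂ : Measure (Y × Y)).map M.sep =
          (π : Measure (Y × Y)).map (fun z => b / (a + b) * M.sep z)) := by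
  obtain ⟨y0⟩ := μ.nonempty
  have : Nonempty Y := ⟨y0⟩
  obtain ⟨θ, hθ, hθ1, hθ2⟩ := exists_gluing (π₁ : Measure (Y × Y)) (π₂ : Measure (Y × Y))
    (h1.2.1.trans h2.1.symm)
  have m13 : Measurable fun w : (Y × Y) × Y => (w.1.1, w.2) := by fun_prop
  have m23 : Measurable fun w : (Y × Y) × Y => (w.1.2, w.2) := by fun_prop
  set π : ProbabilityMeasure (Y × Y) :=
    ⟨θ.map fun w => (w.1.1, w.2), Measure.isProbabilityMeasure_map m13.aemeasurable⟩ with hπdef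
  have hπ : (π : Measure (Y × Y)) = θ.map fun w => (w.1.1, w.2) := rfl
  have hle12 : ∀ᵐ w ∂θ, M.le w.1.1 w.1.2 := by
    have := h1.2.2
    rw [← hθ1] at this
    exact ae_of_ae_map measurable_fst.aemeasurable this
  have hle23 : ∀ᵐ w ∂θ, M.le w.1.2 w.2 := by
    have := h2.2.2
    rw [← hθ2] at this
    exact ae_of_ae_map m23.aemeasurable this
  have hmarg1 : (π : Measure (Y × Y)).map Prod.fst = μ := by
    rw [hπ, Measure.map_map measurable_fst m13, ← h1.1, ← hθ1,
      Measure.map_map measurable_fst measurable_fst]; rfl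
  have hmarg2 : (π : Measure (Y × Y)).map Prod.snd = ρ := by
    rw [hπ, Measure.map_map measurable_snd m13, ← h2.2.1, ← hθ2,
      Measure.map_map measurable_snd m23]; rfl
  have hcc : π ∈ M.causalCouplings μ ρ := by
    refine ⟨hmarg1, hmarg2, ?_⟩
    rw [hπ, ae_map_iff m13.aemeasurable hle.measurableSet]
    filter_upwards [hle12, hle23] with w a1 a2 using M.le_trans _ _ _ a1 a2
  have hcar : θ ((D ×ˢ D) ×ˢ D)ᶜ = 0 := by
    have c1 := causalCouplings_carried h1 hD.measurableSet hD.measurableSet hμ hν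
    have c2 := causalCouplings_carried h2 hD.measurableSet hD.measurableSet hν hρ
    rw [← hθ1, Measure.map_apply measurable_fst (hD.prod hD).measurableSet.compl] at c1
    rw [← hθ2, Measure.map_apply m23 (hD.prod hD).measurableSet.compl] at c2
    refine measure_mono_null ?_ (measure_union_null c1 c2)
    intro w hw
    by_contra h
    simp only [mem_union, mem_preimage, mem_compl_iff, not_or, not_not] at h
    exact hw ⟨h.1, h.2.2⟩
  -- With these weights r(a/r)^p + (1 - r)(b/(1 - r))^p = (a + b)^p, so the two lower bounds combine
  -- without loss.
  set r := a / (a + b) with hr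
  have hr1 : 1 - r = b / (a + b) := by rw [hr]; field_simp; ring
  have hrI : r ∈ Ioo (0 : ℝ) 1 := ⟨by positivity, by rw [hr, div_lt_one (by positivity)]; linarith⟩
  have hr0' : 0 < r := hrI.1
  have hr1' : 0 < 1 - r := by linarith [hrI.2]
  set f1 : (Y × Y) × Y → ℝ := fun w => M.sep w.1 with hf1
  set f2 : (Y × Y) × Y → ℝ := fun w => M.sep (w.1.2, w.2) with hf2
  set f3 : (Y × Y) × Y → ℝ := fun w => M.sep (w.1.1, w.2) with hf3
  have hc1 : Continuous f1 := by fun_prop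
  have hc2 : Continuous f2 := by fun_prop
  have hc3 : Continuous f3 := by fun_prop
  have hcp : ∀ {f : (Y × Y) × Y → ℝ}, Continuous f → Continuous fun w => f w ^ p := fun hf =>
    hf.rpow_const fun _ => Or.inr hp.1.le
  have hint : ∀ {f : (Y × Y) × Y → ℝ}, Continuous f → Integrable f θ := fun hf =>
    integrable_of_carried ((hD.prod hD).prod hD) hcar hf
  have hptw : ∀ᵐ w ∂θ, r * (f1 w / r) ^ p + (1 - r) * (f2 w / (1 - r)) ^ p ≤ f3 w ^ p ∧
      (f3 w ^ p ≤ r * (f1 w / r) ^ p + (1 - r) * (f2 w / (1 - r)) ^ p →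
        f1 w = r * f3 w ∧ f2 w = (1 - r) * f3 w) := by
    filter_upwards [hle12, hle23] with w a1 a2
    exact weighted_rpow_add_le hp hrI (sep_nonneg _) (sep_nonneg _) (sep_add_le hM_fin a1 a2)
  set B : (Y × Y) × Y → ℝ := fun w => r * (f1 w / r) ^ p + (1 - r) * (f2 w / (1 - r)) ^ p with hB
  have hBi : Integrable B θ := hint (by
    refine Continuous.add ?_ ?_
    · exact continuous_const.mul (hcp (hc1.div_const r))
    · exact continuous_const.mul (hcp (hc2.div_const (1 - r))))
  have hCi : Integrable (fun w => f3 w ^ p) θ := hint (hcp hc3)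
  have g1 : M.gain p π₁ = ∫ w, f1 w ^ p ∂θ := by
    rw [gain, ← hθ1, integral_map measurable_fst.aemeasurable
      (continuous_sep_rpow hT hp.1.le).aestronglyMeasurable]
  have g2 : M.gain p π₂ = ∫ w, f2 w ^ p ∂θ := by
    rw [gain, ← hθ2, integral_map m23.aemeasurable
      (continuous_sep_rpow hT hp.1.le).aestronglyMeasurable]
  have g3 : M.gain p π = ∫ w, f3 w ^ p ∂θ := by
    rw [gain, hπ, integral_map m13.aemeasurable
      (continuous_sep_rpow hT hp.1.le).aestronglyMeasurable]
  have hBint : (a + b) ^ p ≤ ∫ w, B w ∂θ := by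
    have e1 : ∫ w, r * (f1 w / r) ^ p ∂θ = r / r ^ p * M.gain p π₁ := by
      rw [g1, ← integral_const_mul]
      refine integral_congr_ae (Eventually.of_forall fun w => ?_)
      simp only
      rw [Real.div_rpow (sep_nonneg _) hr0'.le]; ring
    have e2 : ∫ w, (1 - r) * (f2 w / (1 - r)) ^ p ∂θ = (1 - r) / (1 - r) ^ p * M.gain p π₂ := by
      rw [g2, ← integral_const_mul]
      refine integral_congr_ae (Eventually.of_forall fun w => ?_)
      simp only
      rw [Real.div_rpow (sep_nonneg _) hr1'.le]; ring
    have e3 : ∫ w, B w ∂θ = r / r ^ p * M.gain p π₁ + (1 - r) / (1 - r) ^ p * M.gain p π₂ := by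
      rw [← e1, ← e2]
      exact integral_add (hint (continuous_const.mul (hcp (hc1.div_const r))))
        (hint (continuous_const.mul (hcp (hc2.div_const (1 - r)))))
    have k1 : r / r ^ p * a ^ p = r * (a + b) ^ p := by
      have : a = r * (a + b) := by rw [hr]; field_simp
      nth_rewrite 1 [this]
      rw [Real.mul_rpow hr0'.le (by positivity)]
      field_simp
    have k2 : (1 - r) / (1 - r) ^ p * b ^ p = (1 - r) * (a + b) ^ p := by
      have : b = (1 - r) * (a + b) := by rw [hr1]; field_simp
      nth_rewrite 1 [this]
      rw [Real.mul_rpow hr1'.le (by positivity)]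
      field_simp
    have l1 : r / r ^ p * a ^ p ≤ r / r ^ p * M.gain p π₁ := by gcongr
    have l2 : (1 - r) / (1 - r) ^ p * b ^ p ≤ (1 - r) / (1 - r) ^ p * M.gain p π₂ := by gcongr
    rw [e3]
    linarith
  have hmono : ∫ w, B w ∂θ ≤ M.gain p π := by
    rw [g3]
    exact integral_mono_ae hBi hCi (hptw.mono fun w hw => hw.1)
  refine ⟨π, hcc, hBint.trans hmono, fun hopt => ?_⟩
  -- No excess gain means that a nonnegative integrand has integral zero, so equality holds almost
  -- everywhere.
  have heq : ∫ w, (f3 w ^ p - B w) ∂θ = 0 := by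
    rw [integral_sub hCi hBi, ← g3]; linarith
  have hae := (integral_eq_zero_iff_of_nonneg_ae (hptw.mono fun w hw => sub_nonneg.2 hw.1)
    (hCi.sub hBi)).1 heq
  have hfin : ∀ᵐ w ∂θ, f1 w = r * f3 w ∧ f2 w = (1 - r) * f3 w := by
    filter_upwards [hptw, hae] with w a1 a2
    exact a1.2 (sub_nonpos.1 (le_of_eq a2))
  rw [← hr1]
  constructor
  · rw [← hθ1, Measure.map_map hT.measurable measurable_fst, hπ,
      Measure.map_map (hT.measurable.const_mul r) m13]
    exact Measure.map_congr (hfin.mono fun w hw => hw.1)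
  · rw [← hθ2, Measure.map_map hT.measurable m23, hπ,
      Measure.map_map (hT.measurable.const_mul (1 - r)) m13]
    exact Measure.map_congr (hfin.mono fun w hw => hw.2)

end LorentzianPreLength

end Gluing

/-! ### Curves realising the transport cost. -/

section EllGeodesics

namespace LorentzianPreLength

variable {Y : Type u} [MetricSpace Y] [ProperSpace Y] [MeasurableSpace Y] [BorelSpace Y]
  {M : LorentzianPreLength Y}

theorem integral_comp_sep_of_map_eq (hT : Continuous M.sep) {π₁ π : ProbabilityMeasure (Y × Y)}
    {c : ℝ} (h : (π₁ : Measure (Y × Y)).map M.sep =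
      (π : Measure (Y × Y)).map (fun z => c * M.sep z)) {F : ℝ → ℝ} (hF : Continuous F) :
    ∫ z, F (M.sep z) ∂(π₁ : Measure (Y × Y)) = ∫ z, F (c * M.sep z) ∂(π : Measure (Y × Y)) := by
  rw [← integral_map hT.measurable.aemeasurable hF.aestronglyMeasurable, h,
    integral_map (hT.measurable.const_mul c).aemeasurable hF.aestronglyMeasurable]

theorem gain_of_map_eq (hT : Continuous M.sep) {p : ℝ} (hp : 0 ≤ p)
    {π₁ π : ProbabilityMeasure (Y × Y)} {c : ℝ} (hc : 0 ≤ c)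
    (h : (π₁ : Measure (Y × Y)).map M.sep =
      (π : Measure (Y × Y)).map (fun z => c * M.sep z)) : M.gain p π₁ = c ^ p * M.gain p π := by
  rw [gain, integral_comp_sep_of_map_eq hT h (F := fun x => x ^ p)
    (continuous_id.rpow_const fun _ => Or.inr hp), gain, ← integral_const_mul]
  refine integral_congr_ae (Eventually.of_forall fun z => ?_)
  exact Real.mul_rpow hc (sep_nonneg z)

/-- A curve of probability measures on `D` along which the transport cost between times `s < t` is
at least `(t - s) ℓ`. -/
structure IsCurve (M : LorentzianPreLength Y) (p ℓ : ℝ) (D : Set Y)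
    (g : ℝ → ProbabilityMeasure Y) : Prop where
  carried : ∀ t ∈ Icc (0 : ℝ) 1, (g t : Measure Y) Dᶜ = 0
  hasCoupling : ∀ s ∈ Icc (0 : ℝ) 1, ∀ t ∈ Icc (0 : ℝ) 1, s < t →
    M.HasCoupling p ((t - s) * ℓ) (g s) (g t)

/-- The coupling is glued to couplings before s and after t. The cases s = 0 and t = 1 are separate
because gluing needs positive lengths on both sides. -/
theorem IsCurve.exists_extension (hM_fin : ∀ x y, M.τ x y ≠ ⊤) (hT : Continuous M.sep) {p : ℝ}
    (hp : p ∈ Ioo (0 : ℝ) 1) (hle : IsClosed {z : Y × Y | M.le z.1 z.2})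
    {D : Set Y} (hD : IsCompact D) {ℓ : ℝ} (hℓ : 0 < ℓ) {g : ℝ → ProbabilityMeasure Y}
    (hg : M.IsCurve p ℓ D g) {s t : ℝ} (hs : s ∈ Icc (0 : ℝ) 1) (ht : t ∈ Icc (0 : ℝ) 1)
    {π₁ : ProbabilityMeasure (Y × Y)} (h1 : π₁ ∈ M.causalCouplings (g s) (g t)) {c : ℝ}
    (hc : 0 < c) (hgc : c ^ p ≤ M.gain p π₁) :
    ∃ π ∈ M.causalCouplings (g 0) (g 1), (s * ℓ + c + (1 - t) * ℓ) ^ p ≤ M.gain p π ∧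
      (M.gain p π ≤ (s * ℓ + c + (1 - t) * ℓ) ^ p →
        (π₁ : Measure (Y × Y)).map M.sep = (π : Measure (Y × Y)).map
          (fun z => c / (s * ℓ + c + (1 - t) * ℓ) * M.sep z)) := by
  have m0 : (0 : ℝ) ∈ Icc (0 : ℝ) 1 := by simp
  have m1 : (1 : ℝ) ∈ Icc (0 : ℝ) 1 := by simp
  have left : ∃ π ∈ M.causalCouplings (g 0) (g t), (s * ℓ + c) ^ p ≤ M.gain p π ∧
      (M.gain p π ≤ (s * ℓ + c) ^ p → (π₁ : Measure (Y × Y)).map M.sep =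
        (π : Measure (Y × Y)).map (fun z => c / (s * ℓ + c) * M.sep z)) := by
    rcases hs.1.eq_or_lt with rfl | hs0
    · refine ⟨π₁, h1, by simpa using hgc, fun _ => ?_⟩
      simp [hc.ne']
    · obtain ⟨π₀, k1, k2⟩ := hg.hasCoupling 0 m0 s hs hs0
      rw [sub_zero] at k2
      obtain ⟨π, q1, q2, q3⟩ := exists_glued_coupling hM_fin hT hp hle hD (hg.carried 0 m0)
        (hg.carried s hs) (hg.carried t ht) k1 h1 (by positivity) hc k2 hgc
      exact ⟨π, q1, q2, fun h => (q3 h).2⟩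
  obtain ⟨π₂, l1, l2, l3⟩ := left
  have hsc : 0 < s * ℓ + c := by have := hs.1; positivity
  rcases ht.2.eq_or_lt with rfl | ht1
  · refine ⟨π₂, l1, by simpa using l2, fun h => ?_⟩
    simpa using l3 (by simpa using h)
  · obtain ⟨π₀, k1, k2⟩ := hg.hasCoupling t ht 1 m1 ht1
    obtain ⟨π, q1, q2, q3⟩ := exists_glued_coupling hM_fin hT hp hle hD (hg.carried 0 m0)
      (hg.carried t ht) (hg.carried 1 m1) l1 k1 hsc (mul_pos (by linarith) hℓ) l2 k2
    refine ⟨π, q1, q2, fun h => ?_⟩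
    obtain ⟨e, -⟩ := q3 h
    set S := s * ℓ + c + (1 - t) * ℓ with hS
    have hSpos : 0 < S := add_pos hsc (mul_pos (by linarith) hℓ)
    have hgain := gain_of_map_eq hT hp.1.le (by positivity) e
    -- Equality in the outer gluing determines the gain of the inner one, which is therefore an
    -- equality case too; the two scalings multiply.
    have := l3 (by
      rw [hgain, Real.div_rpow hsc.le hSpos.le]
      calc _ ≤ (s * ℓ + c) ^ p / S ^ p * S ^ p := by gcongr
        _ = _ := by field_simp)
    rw [this]
    have m : Measurable fun x : ℝ => c / (s * ℓ + c) * x := by fun_prop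
    have e1 : (π₂ : Measure (Y × Y)).map (fun z => c / (s * ℓ + c) * M.sep z) =
        ((π₂ : Measure (Y × Y)).map M.sep).map (fun x : ℝ => c / (s * ℓ + c) * x) := by
      rw [Measure.map_map m hT.measurable]; rfl
    rw [e1, e, Measure.map_map m (hT.measurable.const_mul _)]
    congr 1
    ext z
    simp only [Function.comp]
    field_simp

/-- Optimal couplings between intermediate points of a curve realising the maximal cost have the
same time separation, up to scaling, as some maximal coupling of the end points. -/
theorem IsCurve.exists_isMaximal_map_eq (hM_fin : ∀ x y, M.τ x y ≠ ⊤) (hT : Continuous M.sep) {p : ℝ}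
    (hp : p ∈ Ioo (0 : ℝ) 1) (hle : IsClosed {z : Y × Y | M.le z.1 z.2})
    {D : Set Y} (hD : IsCompact D) {ℓ : ℝ} (hℓ : 0 < ℓ) {g : ℝ → ProbabilityMeasure Y}
    (hg : M.IsCurve p ℓ D g) (hmax : ∀ π ∈ M.causalCouplings (g 0) (g 1), M.gain p π ≤ ℓ ^ p)
    {s t : ℝ} (hs : s ∈ Icc (0 : ℝ) 1) (ht : t ∈ Icc (0 : ℝ) 1) (hst : s < t)
    {π₁ : ProbabilityMeasure (Y × Y)} (h1 : M.IsMaximal p (g s) (g t) π₁) :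
    ∃ π, M.IsMaximal p (g 0) (g 1) π ∧ (π₁ : Measure (Y × Y)).map M.sep =
      (π : Measure (Y × Y)).map (fun z => (t - s) * M.sep z) := by
  obtain ⟨π₂, k1, k2⟩ := hg.hasCoupling s hs t ht hst
  obtain ⟨π, q1, q2, q3⟩ := hg.exists_extension hM_fin hT hp hle hD hℓ hs ht h1.1
    (mul_pos (sub_pos.2 hst) hℓ) (k2.trans (h1.2 _ k1))
  -- The three lengths add up to the maximal one, so the extension is maximal and the equality case
  -- applies.
  rw [show s * ℓ + (t - s) * ℓ + (1 - t) * ℓ = ℓ by ring] at q2 q3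
  rw [mul_div_assoc, div_self hℓ.ne', mul_one] at q3
  exact ⟨π, ⟨q1, fun π' h => (hmax π' h).trans q2⟩, q3 (hmax π q1)⟩

/-- A larger gain on [s, t] would extend to a coupling of the end points beating ℓ. So lower bounds
on the cost along the curve are already equalities. -/
theorem IsCurve.gain_le (hM_fin : ∀ x y, M.τ x y ≠ ⊤) (hT : Continuous M.sep) {p : ℝ}
    (hp : p ∈ Ioo (0 : ℝ) 1) (hle : IsClosed {z : Y × Y | M.le z.1 z.2})
    {D : Set Y} (hD : IsCompact D) {ℓ : ℝ} (hℓ : 0 < ℓ) {g : ℝ → ProbabilityMeasure Y}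
    (hg : M.IsCurve p ℓ D g) (hmax : ∀ π ∈ M.causalCouplings (g 0) (g 1), M.gain p π ≤ ℓ ^ p)
    {s t : ℝ} (hs : s ∈ Icc (0 : ℝ) 1) (ht : t ∈ Icc (0 : ℝ) 1) (hst : s < t)
    {π₁ : ProbabilityMeasure (Y × Y)} (h1 : π₁ ∈ M.causalCouplings (g s) (g t)) :
    M.gain p π₁ ≤ ((t - s) * ℓ) ^ p := by
  by_contra! hlt
  have hpos : 0 < (t - s) * ℓ := mul_pos (sub_pos.2 hst) hℓ
  have e : (M.gain p π₁ ^ (1 / p)) ^ p = M.gain p π₁ := by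
    rw [← Real.rpow_mul (gain_nonneg p π₁), one_div_mul_cancel hp.1.ne', Real.rpow_one]
  have hc : (t - s) * ℓ < M.gain p π₁ ^ (1 / p) := by
    refine lt_of_not_ge fun h => ?_
    have := Real.rpow_le_rpow (Real.rpow_nonneg (gain_nonneg p π₁) _) h hp.1.le
    rw [e] at this
    linarith
  obtain ⟨π, q1, q2, -⟩ := hg.exists_extension hM_fin hT hp hle hD hℓ hs ht h1 (hpos.trans hc) e.le
  have := Real.rpow_lt_rpow hℓ.le (show ℓ < s * ℓ + M.gain p π₁ ^ (1 / p) + (1 - t) * ℓ by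
    nlinarith) hp.1
  linarith [hmax π q1]

/-- Parts of maximal couplings are maximal couplings of their marginals. -/
theorem IsMaximal.of_add (hT : Continuous M.sep) {p : ℝ} (hp : 0 ≤ p) {D E : Set Y} (hD : IsCompact D) (hE : IsCompact E)
    {μ ν μ' ν' : ProbabilityMeasure Y} (hμ : (μ : Measure Y) Dᶜ = 0) (hν : (ν : Measure Y) Eᶜ = 0)
    {π π' : ProbabilityMeasure (Y × Y)} (h : M.IsMaximal p μ ν π) {c : ℝ≥0∞} (hc0 : c ≠ 0)
    (hc : c ≠ ⊤) {ρ : Measure (Y × Y)} (hR : (π : Measure (Y × Y)) = c • (π' : Measure (Y × Y)) + ρ)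
    (h' : π' ∈ M.causalCouplings μ' ν') : M.IsMaximal p μ' ν' π' := by
  refine ⟨h', fun ϖ hϖ => ?_⟩
  have hcar := causalCouplings_carried h.1 hD.measurableSet hE.measurableSet hμ hν
  have hRle : ρ ≤ π := by rw [hR]; exact Measure.le_add_left le_rfl
  have hRfin : IsFiniteMeasure ρ := isFiniteMeasure_of_le _ hRle
  -- A competitor for the part π' is substituted inside π; the marginals of the whole are unchanged,
  -- so maximality of π applies.
  have hfst : ((c • (ϖ : Measure (Y × Y)) + ρ).map Prod.fst) = μ := by
    rw [Measure.map_add _ _ measurable_fst, Measure.map_smul, hϖ.1, ← h'.1, ← Measure.map_smul,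
      ← Measure.map_add _ _ measurable_fst, ← hR, h.1.1]
  have hsnd : ((c • (ϖ : Measure (Y × Y)) + ρ).map Prod.snd) = ν := by
    rw [Measure.map_add _ _ measurable_snd, Measure.map_smul, hϖ.2.1, ← h'.2.1, ← Measure.map_smul,
      ← Measure.map_add _ _ measurable_snd, ← hR, h.1.2.1]
  have hprob : IsProbabilityMeasure (c • (ϖ : Measure (Y × Y)) + ρ) := by
    constructor
    have : ((c • (ϖ : Measure (Y × Y)) + ρ).map Prod.fst) univ = 1 := by rw [hfst]; simp
    rwa [Measure.map_apply measurable_fst MeasurableSet.univ] at this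
  have hle' : ∀ᵐ z ∂(c • (ϖ : Measure (Y × Y)) + ρ), M.le z.1 z.2 := by
    rw [ae_add_measure_iff]
    exact ⟨Measure.ae_smul_measure hϖ.2.2 c, (Measure.absolutelyContinuous_of_le hRle).ae_le h.1.2.2⟩
  have hmem : (⟨_, hprob⟩ : ProbabilityMeasure (Y × Y)) ∈ M.causalCouplings μ ν := ⟨hfst, hsnd, hle'⟩
  have hgain := h.2 _ hmem
  have hcar' : (c • (ϖ : Measure (Y × Y)) + ρ) (D ×ˢ E)ᶜ = 0 :=
    causalCouplings_carried hmem hD.measurableSet hE.measurableSet hμ hν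
  have hcont := continuous_sep_rpow hT hp
  have i1 := integrable_of_carried (hD.prod hE) hcar hcont
  have i2 : Integrable (fun z => M.sep z ^ p) (c • (ϖ : Measure (Y × Y)) + ρ) :=
    integrable_of_carried (hD.prod hE) hcar' hcont
  rw [hR] at i1
  have key : c.toReal * M.gain p ϖ + ∫ z, M.sep z ^ p ∂ρ ≤
      c.toReal * M.gain p π' + ∫ z, M.sep z ^ p ∂ρ := by
    have e1 : M.gain p ⟨_, hprob⟩ = c.toReal * M.gain p ϖ + ∫ z, M.sep z ^ p ∂ρ := by
      change ∫ z, M.sep z ^ p ∂(c • (ϖ : Measure (Y × Y)) + ρ) = _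
      rw [integral_add_measure i2.left_of_add_measure i2.right_of_add_measure,
        integral_smul_measure]; rfl
    have e2 : M.gain p π = c.toReal * M.gain p π' + ∫ z, M.sep z ^ p ∂ρ := by
      rw [gain, hR, integral_add_measure i1.left_of_add_measure i1.right_of_add_measure,
        integral_smul_measure]; rfl
    rw [← e1, ← e2]; exact hgain
  have hcpos : 0 < c.toReal := ENNReal.toReal_pos hc0 hc
  nlinarith

theorem lintegral_τ_rpow (hM_fin : ∀ x y, M.τ x y ≠ ⊤) (hT : Continuous M.sep) {p : ℝ} (hp : 0 ≤ p)
    {E : Set (Y × Y)} (hE : IsCompact E) {π : ProbabilityMeasure (Y × Y)}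
    (hπ : (π : Measure (Y × Y)) Eᶜ = 0) :
    ∫⁻ z, M.τ z.1 z.2 ^ p ∂(π : Measure (Y × Y)) = ENNReal.ofReal (M.gain p π) := by
  rw [gain, ofReal_integral_eq_lintegral_ofReal
    (integrable_of_carried hE hπ (continuous_sep_rpow hT hp))
    (Eventually.of_forall fun z => Real.rpow_nonneg (sep_nonneg z) p)]
  refine lintegral_congr fun z => ?_
  rw [← ENNReal.ofReal_rpow_of_nonneg (sep_nonneg z) hp, sep, ENNReal.ofReal_toReal (hM_fin _ _)]

theorem cost_eq_gain (hM_fin : ∀ x y, M.τ x y ≠ ⊤) (hT : Continuous M.sep) {p : ℝ} (hp : 0 < p)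
    {E : Set (Y × Y)} (hE : IsCompact E) {π : ProbabilityMeasure (Y × Y)}
    (hπ : (π : Measure (Y × Y)) Eᶜ = 0) :
    M.cost p π = ENNReal.ofReal (M.gain p π ^ (1 / p)) := by
  rw [cost, lintegral_τ_rpow hM_fin hT hp.le hE hπ,
    ENNReal.ofReal_rpow_of_nonneg (gain_nonneg p π) (by positivity)]

theorem lorentzWasserstein_eq (hM_fin : ∀ x y, M.τ x y ≠ ⊤) (hT : Continuous M.sep) {p : ℝ}
    (hp : 0 < p) {D E : Set Y} (hD : IsCompact D) (hE : IsCompact E) {μ ν : ProbabilityMeasure Y}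
    (hμ : (μ : Measure Y) Dᶜ = 0) (hν : (ν : Measure Y) Eᶜ = 0) {π : ProbabilityMeasure (Y × Y)}
    (h : M.IsMaximal p μ ν π) :
    M.lorentzWasserstein p μ ν = ((M.gain p π ^ (1 / p) : ℝ) : EReal) := by
  have hcost : ∀ π' ∈ M.causalCouplings μ ν,
      (M.cost p π' : EReal) = ((M.gain p π' ^ (1 / p) : ℝ) : EReal) := fun π' h' => by
    rw [cost_eq_gain hM_fin hT hp (hD.prod hE)
      (causalCouplings_carried h' hD.measurableSet hE.measurableSet hμ hν)]
    rw [EReal.coe_ennreal_ofReal, max_eq_left (Real.rpow_nonneg (gain_nonneg p π') _)]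
  refine le_antisymm (iSup₂_le fun π' h' => ?_) ?_
  · rw [hcost π' h']
    exact EReal.coe_le_coe_iff.2
      (Real.rpow_le_rpow (gain_nonneg p π') (h.2 π' h') (by positivity))
  · rw [← hcost π h.1]
    exact le_iSup₂ (f := fun π' (_ : π' ∈ M.causalCouplings μ ν) => (M.cost p π' : EReal)) π h.1

theorem isOptimal_iff_isMaximal (hM_fin : ∀ x y, M.τ x y ≠ ⊤) (hT : Continuous M.sep) {p : ℝ}
    (hle : IsClosed {z : Y × Y | M.le z.1 z.2})
    (hp : 0 < p) {D E : Set Y} (hD : IsCompact D) (hE : IsCompact E) {μ ν : ProbabilityMeasure Y}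
    (hμ : (μ : Measure Y) Dᶜ = 0) (hν : (ν : Measure Y) Eᶜ = 0) {π : ProbabilityMeasure (Y × Y)} :
    M.IsOptimal p μ ν π ↔ M.IsMaximal p μ ν π := by
  have hcost : ∀ π' ∈ M.causalCouplings μ ν,
      (M.cost p π' : EReal) = ((M.gain p π' ^ (1 / p) : ℝ) : EReal) := fun π' h' => by
    rw [cost_eq_gain hM_fin hT hp (hD.prod hE)
      (causalCouplings_carried h' hD.measurableSet hE.measurableSet hμ hν)]
    rw [EReal.coe_ennreal_ofReal, max_eq_left (Real.rpow_nonneg (gain_nonneg p π') _)]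
  constructor
  · rintro ⟨h1, h2⟩
    obtain ⟨π', h'⟩ := exists_isMaximal hle hT hp.le hD hE hμ hν ⟨π, h1⟩
    rw [hcost π h1, lorentzWasserstein_eq hM_fin hT hp hD hE hμ hν h', EReal.coe_eq_coe_iff] at h2
    have h3 : M.gain p π = M.gain p π' :=
      (Real.rpow_left_inj (gain_nonneg p π) (gain_nonneg p π') (by positivity)).1 h2
    exact ⟨h1, fun ϖ hϖ => h3 ▸ h'.2 ϖ hϖ⟩
  · intro h
    exact ⟨h.1, by rw [hcost π h.1, lorentzWasserstein_eq hM_fin hT hp hD hE hμ hν h]⟩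

end LorentzianPreLength

end EllGeodesics

/-! ### Transport of couplings and costs along an isomorphic embedding. -/

section Transfer

namespace LorentzianPreLength

variable {X : Type u} [MetricSpace X] [ProperSpace X] [MeasurableSpace X] [BorelSpace X]
  {L : LorentzianPreLength X}
  {Y : Type w} [MetricSpace Y] [ProperSpace Y] [MeasurableSpace Y] [BorelSpace Y]
  {M : LorentzianPreLength Y} {ι : X → Y}

/-- A proper space is σ-compact, so its image is a countable union of compact sets and hence Borel,
even if it is not closed. -/
theorem IsIsomorphicEmbedding.measurableEmbedding (hι : L.IsIsomorphicEmbedding M ι) :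
    MeasurableEmbedding ι := by
  refine hι.1.measurableEmbedding ?_
  rw [← image_univ, ← iUnion_compactCovering X, image_iUnion]
  exact MeasurableSet.iUnion fun n =>
    ((isCompact_compactCovering X n).image hι.1.continuous).measurableSet

theorem _root_.MeasurableEmbedding.exists_probabilityMeasure_map_eq {A : Type u} {B : Type v}
    [MeasurableSpace A] [MeasurableSpace B] {f : A → B} (hf : MeasurableEmbedding f)
    {ν : ProbabilityMeasure B} (hν : (ν : Measure B) (range f)ᶜ = 0) :
    ∃ μ : ProbabilityMeasure A, μ.map hf.measurable.aemeasurable = ν := by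
  have h : ((ν : Measure B).comap f).map f = ν := by
    rw [hf.map_comap, Measure.restrict_eq_self_of_ae_mem]
    filter_upwards [measure_eq_zero_iff_ae_notMem.1 hν] with b hb using not_not.1 hb
  have hp : IsProbabilityMeasure ((ν : Measure B).comap f) := by
    constructor
    have : ((ν : Measure B).comap f).map f univ = 1 := by rw [h]; simp
    rwa [Measure.map_apply hf.measurable MeasurableSet.univ] at this
  exact ⟨⟨_, hp⟩, ProbabilityMeasure.toMeasure_injective h⟩

theorem _root_.MeasurableEmbedding.map_measure_injective {A : Type u} {B : Type v}
    [MeasurableSpace A] [MeasurableSpace B] {f : A → B} (hf : MeasurableEmbedding f)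
    {μ ν : Measure A} (h : μ.map f = ν.map f) : μ = ν := by
  rw [← hf.comap_map μ, h, hf.comap_map ν]

theorem IsIsomorphicEmbedding.map_mem_causalCouplings (hι : L.IsIsomorphicEmbedding M ι)
    {μ ν : ProbabilityMeasure X} {π : ProbabilityMeasure (X × X)} :
    π.map (hι.measurableEmbedding.prodMap hι.measurableEmbedding).measurable.aemeasurable ∈
      M.causalCouplings (μ.map hι.measurableEmbedding.measurable.aemeasurable)
        (ν.map hι.measurableEmbedding.measurable.aemeasurable) ↔ π ∈ L.causalCouplings μ ν := by
  have he := hι.measurableEmbedding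
  have he2 := he.prodMap he
  simp only [causalCouplings, mem_ofPred_eq, ProbabilityMeasure.toMeasure_map]
  rw [Measure.map_map measurable_fst he2.measurable, Measure.map_map measurable_snd he2.measurable,
    he2.ae_map_iff]
  have e1 : Prod.fst ∘ Prod.map ι ι = ι ∘ (Prod.fst : X × X → X) := rfl
  have e2 : Prod.snd ∘ Prod.map ι ι = ι ∘ (Prod.snd : X × X → X) := rfl
  rw [e1, e2, ← Measure.map_map he.measurable measurable_fst,
    ← Measure.map_map he.measurable measurable_snd]
  refine and_congr ⟨he.map_measure_injective, fun h => by rw [h]⟩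
    (and_congr ⟨he.map_measure_injective, fun h => by rw [h]⟩ ?_)
  simp only [Prod.map_fst, Prod.map_snd, ← hι.2.1]

/-- The marginals charge only the range of ι, so the coupling charges only the product of ranges and
can be pulled back. -/
theorem IsIsomorphicEmbedding.exists_map_eq (hι : L.IsIsomorphicEmbedding M ι)
    {μ ν : ProbabilityMeasure X} {π : ProbabilityMeasure (Y × Y)}
    (hπ : π ∈ M.causalCouplings (μ.map hι.measurableEmbedding.measurable.aemeasurable)
        (ν.map hι.measurableEmbedding.measurable.aemeasurable)) :
    ∃ π' ∈ L.causalCouplings μ ν,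
      π'.map (hι.measurableEmbedding.prodMap hι.measurableEmbedding).measurable.aemeasurable = π := by
  have he := hι.measurableEmbedding
  have hr : ∀ μ : ProbabilityMeasure X,
      (μ.map he.measurable.aemeasurable : Measure Y) (range ι)ᶜ = 0 := fun μ => by
    rw [ProbabilityMeasure.toMeasure_map, Measure.map_apply he.measurable
      he.measurableSet_range.compl]
    simp
  have h1 := causalCouplings_carried hπ he.measurableSet_range he.measurableSet_range (hr μ) (hr ν)
  rw [← range_prodMap] at h1
  obtain ⟨π', h2⟩ := (he.prodMap he).exists_probabilityMeasure_map_eq h1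
  refine ⟨π', ?_, h2⟩
  rw [← hι.map_mem_causalCouplings, h2]
  exact hπ

theorem IsIsomorphicEmbedding.lintegral_τ (hι : L.IsIsomorphicEmbedding M ι)
    (π : ProbabilityMeasure (X × X)) (f : ℝ≥0∞ → ℝ≥0∞) :
    ∫⁻ z, f (M.τ z.1 z.2) ∂(π.map (hι.measurableEmbedding.prodMap
      hι.measurableEmbedding).measurable.aemeasurable : Measure (Y × Y)) =
      ∫⁻ z, f (L.τ z.1 z.2) ∂(π : Measure (X × X)) := by
  rw [ProbabilityMeasure.toMeasure_map,
    (hι.measurableEmbedding.prodMap hι.measurableEmbedding).lintegral_map]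
  simp only [Prod.map_fst, Prod.map_snd, hι.2.2]

theorem IsIsomorphicEmbedding.cost_map (hι : L.IsIsomorphicEmbedding M ι) (p : ℝ)
    (π : ProbabilityMeasure (X × X)) :
    M.cost p (π.map (hι.measurableEmbedding.prodMap
      hι.measurableEmbedding).measurable.aemeasurable) = L.cost p π := by
  rw [cost, hι.lintegral_τ π (fun x => x ^ p), cost]

theorem IsIsomorphicEmbedding.lorentzWasserstein_map (hι : L.IsIsomorphicEmbedding M ι) (p : ℝ)
    (μ ν : ProbabilityMeasure X) :
    M.lorentzWasserstein p (μ.map hι.measurableEmbedding.measurable.aemeasurable)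
      (ν.map hι.measurableEmbedding.measurable.aemeasurable) = L.lorentzWasserstein p μ ν := by
  refine le_antisymm (iSup₂_le fun π hπ => ?_) (iSup₂_le fun π hπ => ?_)
  · obtain ⟨π', h1, rfl⟩ := hι.exists_map_eq hπ
    rw [hι.cost_map]
    exact le_iSup₂ (f := fun π' (_ : π' ∈ L.causalCouplings μ ν) => (L.cost p π' : EReal)) π' h1
  · rw [← hι.cost_map]
    exact le_iSup₂ (f := fun π' (_ : π' ∈ M.causalCouplings _ _) => (M.cost p π' : EReal)) _
      (hι.map_mem_causalCouplings.2 hπ)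

theorem IsIsomorphicEmbedding.isOptimal_map_iff (hι : L.IsIsomorphicEmbedding M ι) (p : ℝ)
    {μ ν : ProbabilityMeasure X} {π : ProbabilityMeasure (X × X)} :
    M.IsOptimal p (μ.map hι.measurableEmbedding.measurable.aemeasurable)
      (ν.map hι.measurableEmbedding.measurable.aemeasurable) (π.map (hι.measurableEmbedding.prodMap
      hι.measurableEmbedding).measurable.aemeasurable) ↔ L.IsOptimal p μ ν π := by
  rw [IsOptimal, IsOptimal, hι.map_mem_causalCouplings, hι.cost_map, hι.lorentzWasserstein_map]

theorem IsIsomorphicEmbedding.ll_iff (hι : L.IsIsomorphicEmbedding M ι) (x y : X) :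
    M.ll (ι x) (ι y) ↔ L.ll x y := by
  rw [← M.τ_pos_iff, ← L.τ_pos_iff, hι.2.2]

end LorentzianPreLength

end Transfer

/-! ### The curvature-dimension condition read in the ambient space. -/

section Curves

namespace LorentzianPreLength

/-- The standing assumptions on the ambient space: `τ` is finite and continuous, the causal relation
is closed, and causal diamonds of compact sets are compact. -/
structure IsTame {Y : Type w} [MetricSpace Y] [ProperSpace Y] (M : LorentzianPreLength Y) : Prop where
  fin : ∀ x y, M.τ x y ≠ ⊤
  cont : Continuous M.sep
  closed : IsClosed {z : Y × Y | M.le z.1 z.2}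
  diamond : ∀ K₁ K₂ : Set Y, IsCompact K₁ → IsCompact K₂ → IsCompact (M.futureJ K₁ ∩ M.pastJ K₂)

section

variable {Y : Type w} [MetricSpace Y] [ProperSpace Y] {M : LorentzianPreLength Y}

theorem isClosed_futureJ (hle : IsClosed {z : Y × Y | M.le z.1 z.2}) {D : Set Y}
    (hD : IsCompact D) : IsClosed (M.futureJ D) := by
  refine IsSeqClosed.isClosed fun y y' hy hlim => ?_
  choose x hx hxy using hy
  obtain ⟨x', hx', φ, hφ, hlim'⟩ := hD.tendsto_subseq hx
  exact ⟨x', hx', hle.mem_of_tendsto (hlim'.prodMk_nhds (hlim.comp hφ.tendsto_atTop))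
    (Eventually.of_forall fun n => hxy (φ n))⟩

theorem isClosed_pastJ (hle : IsClosed {z : Y × Y | M.le z.1 z.2}) {D : Set Y}
    (hD : IsCompact D) : IsClosed (M.pastJ D) := by
  refine IsSeqClosed.isClosed fun y y' hy hlim => ?_
  choose x hx hxy using hy
  obtain ⟨x', hx', φ, hφ, hlim'⟩ := hD.tendsto_subseq hx
  exact ⟨x', hx', hle.mem_of_tendsto ((hlim.comp hφ.tendsto_atTop).prodMk_nhds hlim')
    (Eventually.of_forall fun n => hxy (φ n))⟩

end

variable {X : Type u} [MetricSpace X] [ProperSpace X] [MeasurableSpace X] [BorelSpace X]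
  {L : LorentzianPreLength X}
  {Y : Type w} [MetricSpace Y] [ProperSpace Y] [MeasurableSpace Y] [BorelSpace Y]
  {M : LorentzianPreLength Y} {ι : X → Y}

theorem futureJ_carried {μ ν : ProbabilityMeasure Y} {π : ProbabilityMeasure (Y × Y)}
    (hle : IsClosed {z : Y × Y | M.le z.1 z.2}) (hπ : π ∈ M.causalCouplings μ ν) {D : Set Y}
    (hD : IsCompact D) (hμ : (μ : Measure Y) Dᶜ = 0) : (ν : Measure Y) (M.futureJ D)ᶜ = 0 := by
  have hm := (isClosed_futureJ hle hD).measurableSet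
  rw [← hπ.1, Measure.map_apply measurable_fst hD.measurableSet.compl] at hμ
  rw [← hπ.2.1, Measure.map_apply measurable_snd hm.compl, measure_eq_zero_iff_ae_notMem]
  filter_upwards [hπ.2.2, measure_eq_zero_iff_ae_notMem.1 hμ] with z h1 h2 h3
  exact h3 ⟨z.1, not_not.1 h2, h1⟩

theorem pastJ_carried {μ ν : ProbabilityMeasure Y} {π : ProbabilityMeasure (Y × Y)}
    (hle : IsClosed {z : Y × Y | M.le z.1 z.2}) (hπ : π ∈ M.causalCouplings μ ν) {D : Set Y}
    (hD : IsCompact D) (hν : (ν : Measure Y) Dᶜ = 0) : (μ : Measure Y) (M.pastJ D)ᶜ = 0 := by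
  have hm := (isClosed_pastJ hle hD).measurableSet
  rw [← hπ.2.1, Measure.map_apply measurable_snd hD.measurableSet.compl] at hν
  rw [← hπ.1, Measure.map_apply measurable_fst hm.compl, measure_eq_zero_iff_ae_notMem]
  filter_upwards [hπ.2.2, measure_eq_zero_iff_ae_notMem.1 hν] with z h1 h2 h3
  exact h3 ⟨z.2, not_not.1 h2, h1⟩

theorem diamond_carried {μ ν ρ : ProbabilityMeasure Y} {π₁ π₂ : ProbabilityMeasure (Y × Y)}
    (hle : IsClosed {z : Y × Y | M.le z.1 z.2}) (h₁ : π₁ ∈ M.causalCouplings μ ν)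
    (h₂ : π₂ ∈ M.causalCouplings ν ρ) {D E : Set Y} (hD : IsCompact D) (hE : IsCompact E)
    (hμ : (μ : Measure Y) Dᶜ = 0) (hρ : (ρ : Measure Y) Eᶜ = 0) :
    (ν : Measure Y) (M.futureJ D ∩ M.pastJ E)ᶜ = 0 := by
  rw [compl_inter]
  exact measure_union_null (futureJ_carried hle h₁ hD hμ) (pastJ_carried hle h₂ hE hρ)

/-- Covers the degenerate times at which a curve is compared with its own end point. -/
theorem diagonal_mem_causalCouplings (hle : IsClosed {z : Y × Y | M.le z.1 z.2})
    (μ : ProbabilityMeasure Y) :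
    μ.map (f := fun y => (y, y)) (by fun_prop) ∈ M.causalCouplings μ μ := by
  have hm : Measurable fun y : Y => (y, y) := by fun_prop
  refine ⟨?_, ?_, ?_⟩
  · rw [ProbabilityMeasure.toMeasure_map, Measure.map_map measurable_fst hm]
    exact Measure.map_id
  · rw [ProbabilityMeasure.toMeasure_map, Measure.map_map measurable_snd hm]
    exact Measure.map_id
  · rw [ProbabilityMeasure.toMeasure_map, ae_map_iff hm.aemeasurable hle.measurableSet]
    exact Eventually.of_forall fun y => M.le_refl y

theorem nonempty_causalCouplings_of_pos {p : ℝ} {μ ν : ProbabilityMeasure Y}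
    (h : 0 < M.lorentzWasserstein p μ ν) : (M.causalCouplings μ ν).Nonempty := by
  by_contra hne
  rw [not_nonempty_iff_eq_empty] at hne
  rw [lorentzWasserstein, hne] at h
  simp at h

theorem gain_pos (hT : Continuous M.sep) {p : ℝ} (hp : 0 ≤ p) {E : Set (Y × Y)} (hE : IsCompact E)
    {π : ProbabilityMeasure (Y × Y)} (hπ : (π : Measure (Y × Y)) Eᶜ = 0)
    (h : ∀ᵐ z ∂(π : Measure (Y × Y)), 0 < M.sep z) : 0 < M.gain p π := by
  refine (gain_nonneg p π).lt_of_ne fun h0 => ?_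
  have := (integral_eq_zero_iff_of_nonneg (fun z => Real.rpow_nonneg (sep_nonneg z) p)
    (integrable_of_carried hE hπ (continuous_sep_rpow hT hp))).1 h0.symm
  have hf : ∀ᵐ z ∂(π : Measure (Y × Y)), False := by
    filter_upwards [this, h] with z h1 h2
    exact (Real.rpow_pos_of_pos h2 p).ne' h1
  exact hf.exists.elim fun _ h => h

/-- The curvature-dimension condition of `X`, read in the ambient space: midpoint concavity of the
entropy power along some curve. -/
theorem TCD.exists_isCurve (hM : M.IsTame) (hι : L.IsIsomorphicEmbedding M ι) {m : Measure X}
    [IsFiniteMeasureOnCompacts m] {p K N : ℝ} (hp : p ∈ Ioo (0 : ℝ) 1) (hN : 0 < N)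
    (hTCD : L.TCD m p K N) {D E : Set Y} (hD : IsCompact D) (hE : IsCompact E)
    {ν₀ ν₁ : ProbabilityMeasure Y} (h0 : (ν₀ : Measure Y) Dᶜ = 0) (h1 : (ν₁ : Measure Y) Eᶜ = 0)
    (he0 : InEntropyDomain (ν₀ : Measure Y) (m.map ι))
    (he1 : InEntropyDomain (ν₁ : Measure Y) (m.map ι)) {ϖ : ProbabilityMeasure (Y × Y)}
    (hϖ : M.IsMaximal p ν₀ ν₁ ϖ) (hpos : ∀ᵐ z ∂(ϖ : Measure (Y × Y)), 0 < M.sep z) :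
    ∃ (π : ProbabilityMeasure (Y × Y)) (g : ℝ → ProbabilityMeasure Y), M.IsMaximal p ν₀ ν₁ π ∧
      g 0 = ν₀ ∧ g 1 = ν₁ ∧
      M.IsCurve p (M.gain p ϖ ^ (1 / p)) (M.futureJ D ∩ M.pastJ E) g ∧
      InEntropyDomain (g (1 / 2) : Measure Y) (m.map ι) ∧
      Real.exp (K * (∫ z, M.sep z ^ 2 ∂(π : Measure (Y × Y))) / N / 8) *
        ((Real.exp (-(ent (ν₀ : Measure Y) (m.map ι) / N)) +
          Real.exp (-(ent (ν₁ : Measure Y) (m.map ι) / N))) / 2) ≤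
        Real.exp (-(ent (g (1 / 2) : Measure Y) (m.map ι) / N)) := by
  have hme := hι.measurableEmbedding
  have hme2 := hme.prodMap hme
  -- Finite entropy implies absolute continuity, hence no mass outside the range of ι.
  have hrange : ∀ ν : ProbabilityMeasure Y, InEntropyDomain (ν : Measure Y) (m.map ι) →
      ∃ μ : ProbabilityMeasure X, μ.map hme.measurable.aemeasurable = ν := fun ν hν => by
    refine hme.exists_probabilityMeasure_map_eq ((inEntropyDomain_iff.1 hν).1 ?_)
    rw [Measure.map_apply hme.measurable hme.measurableSet_range.compl]
    simp
  have hdom : ∀ μ : ProbabilityMeasure X, InEntropyDomain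
      (μ.map hme.measurable.aemeasurable : Measure Y) (m.map ι) ↔
      InEntropyDomain (μ : Measure X) m := fun μ => by
    rw [InEntropyDomain, ProbabilityMeasure.toMeasure_map, relEntropy_map hme, InEntropyDomain]
  have hent : ∀ μ : ProbabilityMeasure X, InEntropyDomain (μ : Measure X) m →
      (relEntropy (μ : Measure X) m).toReal =
        ent (μ.map hme.measurable.aemeasurable : Measure Y) (m.map ι) := fun μ hμ => by
    rw [← ((hdom μ).2 hμ).toReal_relEntropy, ProbabilityMeasure.toMeasure_map, relEntropy_map hme]
  obtain ⟨μ₀, rfl⟩ := hrange ν₀ he0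
  obtain ⟨μ₁, rfl⟩ := hrange ν₁ he1
  obtain ⟨ϖ', hϖ', rfl⟩ := hι.exists_map_eq hϖ.1
  have hcar := causalCouplings_carried hϖ.1 hD.measurableSet hE.measurableSet h0 h1
  have hgain := gain_pos hM.cont hp.1.le (hD.prod hE) hcar hpos
  have hlW := lorentzWasserstein_eq hM.fin hM.cont hp.1 hD hE h0 h1 hϖ
  set ℓ := M.gain p (ϖ'.map hme2.measurable.aemeasurable) ^ (1 / p) with hℓ
  have hℓpos : 0 < ℓ := Real.rpow_pos_of_pos hgain _
  have hopt : ∀ {π : ProbabilityMeasure (X × X)}, L.IsOptimal p μ₀ μ₁ π →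
      M.IsMaximal p (μ₀.map hme.measurable.aemeasurable) (μ₁.map hme.measurable.aemeasurable)
        (π.map hme2.measurable.aemeasurable) := fun h =>
    (isOptimal_iff_isMaximal hM.fin hM.cont hM.closed hp.1 hD hE h0 h1).1
      ((hι.isOptimal_map_iff p).2 h)
  have hsupp : ∀ (μ : ProbabilityMeasure X) (A : Set Y), IsCompact A →
      (μ.map hme.measurable.aemeasurable : Measure Y) Aᶜ = 0 →
      ∀ x ∈ (μ : Measure X).support, ι x ∈ A := fun μ A hA hμA x hx => by
    rw [ProbabilityMeasure.toMeasure_map, Measure.map_apply hme.measurable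
      hA.measurableSet.compl] at hμA
    exact Measure.support_subset_of_isClosed (hA.isClosed.preimage hι.1.continuous) hμA hx
  have hdual : L.TimelikeDualisableBy p μ₀ μ₁ ϖ' := by
    refine ⟨?_, ⟨?_, ?_⟩, ?_⟩
    · rw [← hι.lorentzWasserstein_map, hlW]
      exact ⟨EReal.coe_pos.2 hℓpos, EReal.coe_lt_top _⟩
    · exact (hι.isOptimal_map_iff p).1
        ((isOptimal_iff_isMaximal hM.fin hM.cont hM.closed hp.1 hD hE h0 h1).2 hϖ)
    · have := ae_of_ae_map hme2.measurable.aemeasurable hpos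
      filter_upwards [this] with z hz
      rw [← hι.ll_iff]
      exact (sep_pos_iff hM.fin (Prod.map ι ι z)).1 hz
    · obtain ⟨C, hC0, hC⟩ := exists_bound_of_isCompact (hD.prod hE)
        (continuous_sep_rpow hM.cont hp.1.le)
      -- Supports are compact here and τ^p is bounded on them, so constants serve as dual
      -- potentials.
      refine ⟨fun _ => C, fun _ => 0, measurable_const, measurable_const, integrable_const _,
        fun x hx y hy => ?_⟩
      rw [ellPow]
      split_ifs
      · have h3 := (le_abs_self _).trans
          (hC (ι x, ι y) ⟨hsupp μ₀ D hD h0 x hx, hsupp μ₁ E hE h1 y hy⟩)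
        have h4 : L.τ x y ^ p = ENNReal.ofReal (M.sep (ι x, ι y) ^ p) := by
          rw [← ENNReal.ofReal_rpow_of_nonneg (sep_nonneg _) hp.1.le, sep,
            ENNReal.ofReal_toReal (hM.fin _ _), hι.2.2]
        rw [h4, EReal.coe_ennreal_ofReal, max_eq_left (Real.rpow_nonneg (sep_nonneg _) p), add_zero]
        exact EReal.coe_le_coe_iff.2 h3
      · exact bot_le
  obtain ⟨π', hπ', μ, rfl, rfl, ⟨-, -, hgeo⟩, hedom, hesc, hed⟩ :=
    hTCD μ₀ μ₁ ((hdom _).1 he0) ((hdom _).1 he1) ⟨ϖ', hdual⟩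
  have hπmax := hopt hπ'.2.1.1
  have hlW' : ∀ s t : ℝ, 0 ≤ s → s < t → t ≤ 1 → M.lorentzWasserstein p
      ((μ s).map hme.measurable.aemeasurable) ((μ t).map hme.measurable.aemeasurable) =
      (((t - s) * ℓ : ℝ) : EReal) := fun s t hs hst ht => by
    rw [hι.lorentzWasserstein_map, hgeo s t hs hst ht, ← hι.lorentzWasserstein_map, hlW,
      EReal.coe_mul]
  have hne : ∀ s t : ℝ, 0 ≤ s → s < t → t ≤ 1 → (M.causalCouplings
      ((μ s).map hme.measurable.aemeasurable)
      ((μ t).map hme.measurable.aemeasurable)).Nonempty := fun s t hs hst ht => by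
    refine nonempty_causalCouplings_of_pos (p := p) ?_
    rw [hlW' s t hs hst ht]
    exact EReal.coe_pos.2 (mul_pos (sub_pos.2 hst) hℓpos)
  have hdiam := hM.diamond D E hD hE
  -- Intermediate measures are causally between the end measures, hence live in the compact diamond.
  have hgcar : ∀ t ∈ Icc (0 : ℝ) 1, ((μ t).map hme.measurable.aemeasurable : Measure Y)
      (M.futureJ D ∩ M.pastJ E)ᶜ = 0 := fun t ht => by
    have a : (M.causalCouplings ((μ 0).map hme.measurable.aemeasurable)
        ((μ t).map hme.measurable.aemeasurable)).Nonempty := by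
      rcases ht.1.eq_or_lt with rfl | h
      · exact ⟨_, diagonal_mem_causalCouplings hM.closed _⟩
      · exact hne 0 t le_rfl h ht.2
    have b : (M.causalCouplings ((μ t).map hme.measurable.aemeasurable)
        ((μ 1).map hme.measurable.aemeasurable)).Nonempty := by
      rcases ht.2.eq_or_lt with rfl | h
      · exact ⟨_, diagonal_mem_causalCouplings hM.closed _⟩
      · exact hne t 1 ht.1 h le_rfl
    exact diamond_carried hM.closed a.some_mem b.some_mem hD hE h0 h1
  refine ⟨_, fun t => (μ t).map hme.measurable.aemeasurable, hπmax, rfl, rfl, ⟨hgcar, ?_⟩, ?_, ?_⟩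
  · intro s hs t ht hst
    obtain ⟨π, hπ⟩ := exists_isMaximal hM.closed hM.cont hp.1.le hdiam hdiam (hgcar s hs)
      (hgcar t ht) (hne s t hs.1 hst ht.2)
    refine ⟨π, hπ.1, ?_⟩
    have := lorentzWasserstein_eq hM.fin hM.cont hp.1 hdiam hdiam (hgcar s hs) (hgcar t ht) hπ
    rw [hlW' s t hs.1 hst ht.2, EReal.coe_eq_coe_iff] at this
    rw [this, ← Real.rpow_mul (gain_nonneg p π), one_div_mul_cancel hp.1.ne', Real.rpow_one]
  · exact (hdom _).2 (hedom (1 / 2) (by norm_num [mem_Icc]))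
  · have hK : (K : EReal) * ((∫⁻ z, L.τ z.1 z.2 ^ 2 ∂(π' : Measure (X × X)) : ℝ≥0∞) : EReal) =
        ((K * ∫ z, M.sep z ^ 2 ∂(π'.map hme2.measurable.aemeasurable : Measure (Y × Y)) : ℝ) :
          EReal) := by
      have hc := causalCouplings_carried hπmax.1 hD.measurableSet hE.measurableSet h0 h1
      have e := lintegral_τ_rpow hM.fin hM.cont (p := 2) (by norm_num) (hD.prod hE) hc
      rw [hι.lintegral_τ π' (fun x => x ^ (2 : ℝ))] at e
      simp only [ENNReal.rpow_two, gain, Real.rpow_two] at e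
      rw [e, EReal.coe_ennreal_ofReal, max_eq_left (integral_nonneg fun z => sq_nonneg _),
        EReal.coe_mul]
    rw [hK] at hed
    have := hesc.midpoint_of_distribIneq hed hN
    rw [hent _ (hedom 0 (by simp)), hent _ (hedom 1 (by simp)),
      hent _ (hedom (1 / 2) (by norm_num [mem_Icc]))] at this
    exact this

end LorentzianPreLength

end Curves

/-! ### Partitions of unity and Jensen's inequality for the entropy. -/

section Smoothing

variable {Z : Type u} [MetricSpace Z] [ProperSpace Z] [MeasurableSpace Z] [BorelSpace Z]

/-- The condition bounds the Lévy–Prokhorov distance by r, and that distance metrises narrow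
convergence. -/
theorem exists_forall_mem_of_measure_le_thickening {π : ProbabilityMeasure Z}
    {W : Set (ProbabilityMeasure Z)} (hW : W ∈ 𝓝 π) : ∃ r₀ > 0, ∀ r ∈ Ioo 0 r₀,
      ∀ σ : ProbabilityMeasure Z, (∀ F : Set Z, MeasurableSet F →
        (σ : Measure Z) F ≤ (π : Measure Z) (Metric.thickening r F)) → σ ∈ W := by
  have hc := (LevyProkhorov.continuous_toMeasure_probabilityMeasure (Ω := Z)).tendsto
    (LevyProkhorov.ofMeasure π)
  obtain ⟨r₀, hr₀, hball⟩ := Metric.mem_nhds_iff.1 (hc hW)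
  refine ⟨r₀, hr₀, fun r hr σ hσ => ?_⟩
  refine hball (a := LevyProkhorov.ofMeasure σ) ?_
  rw [Metric.mem_ball, LevyProkhorov.dist_probabilityMeasure_def]
  refine (levyProkhorovDist_le_of_forall_le _ _ hr.1.le fun ε B hε hB => ?_).trans_lt hr.2
  exact (hσ B hB).trans ((measure_mono (Metric.thickening_mono hε.le B)).trans le_self_add)

/-- A finite continuous partition of unity near a compact set, of mesh `r`. -/
theorem exists_partition {K : Set Z} (hK : IsCompact K) {r : ℝ} (hr : 0 < r) :
    ∃ (s : Finset Z) (χ : Z → Z → ℝ), (∀ k, Continuous (χ k)) ∧ (∀ k, HasCompactSupport (χ k)) ∧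
      (∀ k y, 0 ≤ χ k y) ∧ (∀ t ⊆ s, ∀ y, ∑ k ∈ t, χ k y ≤ 1) ∧ (∀ y ∈ K, ∑ k ∈ s, χ k y = 1) ∧
      ∀ k y y', χ k y ≠ 0 → χ k y' ≠ 0 → dist y y' < r := by
  obtain ⟨t, -, htf, hcov⟩ := hK.finite_cover_balls (show 0 < r / 4 by positivity)
  set s := htf.toFinset with hs
  set f : Z → Z → ℝ := fun k y => max 0 (r / 2 - dist y k) with hf
  -- The floor r/4 avoids division by zero away from K. On K it is inactive, because the balls of
  -- radius r/4 cover K and each tent has height r/2 with slope one.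
  set S : Z → ℝ := fun y => max (∑ k ∈ s, f k y) (r / 4) with hS
  have hf0 : ∀ k y, 0 ≤ f k y := fun k y => le_max_left _ _
  have hfc : ∀ k, Continuous (f k) := fun k => by fun_prop
  have hSpos : ∀ y, 0 < S y := fun y => lt_of_lt_of_le (by positivity) (le_max_right _ _)
  have hSc : Continuous S := by fun_prop
  have hdist : ∀ k y, f k y / S y ≠ 0 → dist y k < r / 2 := fun k y h => by
    by_contra! h'
    refine h ?_
    rw [hf]
    simp only
    rw [max_eq_left (by linarith), zero_div]
  refine ⟨s, fun k y => f k y / S y, fun k => (hfc k).div hSc fun y => (hSpos y).ne', fun k => ?_,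
    fun k y => div_nonneg (hf0 k y) (hSpos y).le, fun t ht y => ?_, fun y hy => ?_, fun k y y' h h' => ?_⟩
  · refine HasCompactSupport.intro (isCompact_closedBall k (r / 2)) fun y hy => ?_
    by_contra h
    exact hy (Metric.mem_closedBall.2 (hdist k y h).le)
  · rw [← Finset.sum_div, div_le_one (hSpos y)]
    exact (Finset.sum_le_sum_of_subset_of_nonneg ht fun k _ _ => hf0 k y).trans (le_max_left _ _)
  · obtain ⟨k, hk, hyk⟩ := mem_iUnion₂.1 (hcov hy)
    have h1 : r / 4 ≤ ∑ k ∈ s, f k y := by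
      refine le_trans ?_ (Finset.single_le_sum (fun k _ => hf0 k y) (htf.mem_toFinset.2 hk))
      have := Metric.mem_ball.1 hyk
      exact le_max_of_le_right (by linarith)
    rw [← Finset.sum_div]
    have : S y = ∑ k ∈ s, f k y := max_eq_left h1
    rw [← this, div_self (hSpos y).ne']
  · calc dist y y' ≤ dist y k + dist y' k := dist_triangle_right _ _ _
      _ < r := by linarith [hdist k y h, hdist k y' h']

/-- Jensen's inequality for weights of total mass at most 1, from the tangent line at ρ; the missing
mass contributes ρ(1 - ∑ x) ≥ 0. -/
theorem sum_mul_log_le {ι : Type v} {s : Finset ι} {x c : ι → ℝ} (hx : ∀ k ∈ s, 0 ≤ x k)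
    (hx1 : ∑ k ∈ s, x k ≤ 1) (hc : ∀ k ∈ s, 0 ≤ c k) :
    (∑ k ∈ s, c k * x k) * Real.log (∑ k ∈ s, c k * x k) ≤
      ∑ k ∈ s, x k * (c k * Real.log (c k)) := by
  set ρ := ∑ k ∈ s, c k * x k with hρ
  have hρ0 : 0 ≤ ρ := Finset.sum_nonneg fun k hk => mul_nonneg (hc k hk) (hx k hk)
  rcases hρ0.eq_or_lt with h0 | hpos
  · rw [← h0, zero_mul]
    have := (Finset.sum_eq_zero_iff_of_nonneg fun k hk => mul_nonneg (hc k hk) (hx k hk)).1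
      (hρ.symm.trans h0.symm)
    refine (Finset.sum_eq_zero fun k hk => ?_).ge
    linear_combination Real.log (c k) * this k hk
  · have h1 : ∑ k ∈ s, x k * (c k * Real.log ρ + c k - ρ) ≤ ∑ k ∈ s, x k * (c k * Real.log (c k)) :=
      Finset.sum_le_sum fun k hk =>
        mul_le_mul_of_nonneg_left (mul_log_add_sub_le (hc k hk) hpos) (hx k hk)
    have h2 : ∑ k ∈ s, x k * (c k * Real.log ρ + c k - ρ) =
        ρ * Real.log ρ + ρ - ρ * ∑ k ∈ s, x k := by
      rw [hρ, Finset.sum_mul, ← hρ, Finset.mul_sum]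
      nth_rewrite 3 [hρ]
      rw [← Finset.sum_add_distrib, ← Finset.sum_sub_distrib]
      exact Finset.sum_congr rfl fun k _ => by ring
    nlinarith

/-- Entropy of a measure whose density is a combination of bump functions. -/
theorem ent_withDensity_sum_le {n : Measure Z} [IsFiniteMeasureOnCompacts n] {s : Finset Z}
    {χ : Z → Z → ℝ} (hχ : ∀ k, Continuous (χ k)) (hχc : ∀ k, HasCompactSupport (χ k))
    (hχ0 : ∀ k y, 0 ≤ χ k y) (hχ1 : ∀ y, ∑ k ∈ s, χ k y ≤ 1) {c : Z → ℝ} (hc : ∀ k, 0 ≤ c k) :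
    InEntropyDomain (n.withDensity fun y => ENNReal.ofReal (∑ k ∈ s, c k * χ k y)) n ∧
      ent (n.withDensity fun y => ENNReal.ofReal (∑ k ∈ s, c k * χ k y)) n ≤
        ∑ k ∈ s, (c k * ∫ y, χ k y ∂n) * Real.log (c k) := by
  set ρ : Z → ℝ := fun y => ∑ k ∈ s, c k * χ k y with hρ
  have hρc : Continuous ρ := continuous_finsetSum _ fun k _ => (hχ k).const_mul (c k)
  have hρ0 : ∀ y, 0 ≤ ρ y := fun y => Finset.sum_nonneg fun k _ => mul_nonneg (hc k) (hχ0 k y)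
  have hρs : HasCompactSupport ρ := by
    have : IsCompact (⋃ k ∈ s, tsupport (χ k)) := s.isCompact_biUnion fun k _ => hχc k
    refine HasCompactSupport.intro this fun y hy => Finset.sum_eq_zero fun k hk => ?_
    have h : y ∉ tsupport (χ k) := fun h => hy (mem_iUnion₂.2 ⟨k, hk, h⟩)
    rw [image_eq_zero_of_notMem_tsupport h, mul_zero]
  have hd := density_withDensity (m := n) hρc.measurable hρ0
  have hd' : (fun y => density (n.withDensity fun x => ENNReal.ofReal (ρ x)) n y *
      Real.log (density (n.withDensity fun x => ENNReal.ofReal (ρ x)) n y)) =ᵐ[n]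
      fun y => ρ y * Real.log (ρ y) := by
    filter_upwards [hd] with y hy
    rw [hy]
  have hi : Integrable (fun y => ρ y * Real.log (ρ y)) n := by
    refine (Real.continuous_mul_log.comp hρc).integrable_of_hasCompactSupport ?_
    exact hρs.comp_left (g := fun x => x * Real.log x) (by simp)
  refine ⟨inEntropyDomain_iff.2 ⟨withDensity_absolutelyContinuous _ _,
    hi.congr hd'.symm⟩, ?_⟩
  rw [ent, integral_congr_ae hd']
  have hχi : ∀ k, Integrable (χ k) n := fun k => (hχ k).integrable_of_hasCompactSupport (hχc k)
  calc ∫ y, ρ y * Real.log (ρ y) ∂n ≤ ∫ y, ∑ k ∈ s, χ k y * (c k * Real.log (c k)) ∂n :=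
        integral_mono hi (integrable_finsetSum _ fun k _ => (hχi k).mul_const _) fun y =>
          sum_mul_log_le (fun k _ => hχ0 k y) (hχ1 y) fun k _ => hc k
    _ = _ := by
        rw [integral_finsetSum _ fun k _ => (hχi k).mul_const _]
        refine Finset.sum_congr rfl fun k _ => ?_
        rw [integral_mul_const]; ring

/-- Averaging with respect to a partition of unity decreases the entropy. -/
theorem sum_mul_log_le_ent {μ n : Measure Z} [IsProbabilityMeasure μ] [IsFiniteMeasureOnCompacts n]
    (h : InEntropyDomain μ n) {s : Finset Z}
    {χ : Z → Z → ℝ} (hχ : ∀ k, Continuous (χ k)) (hχc : ∀ k, HasCompactSupport (χ k))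
    (hχ0 : ∀ k y, 0 ≤ χ k y) (hχ1 : ∀ y, ∑ k ∈ s, χ k y ≤ 1)
    (hχμ : ∀ᵐ y ∂μ, ∑ k ∈ s, χ k y = 1) (ha : ∀ k ∈ s, 0 < ∫ y, χ k y ∂n) :
    ∑ k ∈ s, (∫ y, χ k y ∂μ) * Real.log ((∫ y, χ k y ∂μ) / ∫ y, χ k y ∂n) ≤ ent μ n := by
  obtain ⟨hac, hint⟩ := inEntropyDomain_iff.1 h
  set ρ := density μ n with hρ
  have hρ0 : ∀ y, 0 ≤ ρ y := density_nonneg μ n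
  have hχi : ∀ k, Integrable (χ k) n := fun k => (hχ k).integrable_of_hasCompactSupport (hχc k)
  have hb : ∀ k ∈ s, ∀ y, χ k y ≤ 1 := fun k hk y =>
    (Finset.single_le_sum (f := fun k => χ k y) (fun k _ => hχ0 k y) hk).trans (hχ1 y)
  have hχμi : ∀ k ∈ s, Integrable (χ k) μ := fun k hk =>
    Integrable.of_bound (hχ k).aestronglyMeasurable 1 (Eventually.of_forall fun y => by
      rw [Real.norm_eq_abs, abs_of_nonneg (hχ0 k y)]; exact hb k hk y)
  have hterm : ∀ k ∈ s, Integrable (fun y => (ρ y * Real.log (ρ y)) * χ k y) n := fun k hk => by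
    refine hint.mul_bdd (c := 1) (hχ k).aestronglyMeasurable (Eventually.of_forall fun y => ?_)
    rw [Real.norm_eq_abs, abs_of_nonneg (hχ0 k y)]; exact hb k hk y
  have hk : ∀ k ∈ s, (∫ y, χ k y ∂μ) * Real.log ((∫ y, χ k y ∂μ) / ∫ y, χ k y ∂n) ≤
      ∫ y, (ρ y * Real.log (ρ y)) * χ k y ∂n := fun k hk => by
    have hw0 : 0 ≤ ∫ y, χ k y ∂μ := integral_nonneg (hχ0 k)
    have hρχ : Integrable (fun y => ρ y * χ k y) n := (integrable_density_mul_iff hac _).2 (hχμi k hk)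
    have hw : ∫ y, ρ y * χ k y ∂n = ∫ y, χ k y ∂μ := integral_density_mul hac _
    rcases hw0.eq_or_lt with h0 | hpos
    · rw [← h0, zero_mul]
      have := (integral_eq_zero_iff_of_nonneg (fun y => mul_nonneg (hρ0 y) (hχ0 k y)) hρχ).1
        (hw.trans h0.symm)
      refine (integral_eq_zero_of_ae ?_).ge
      filter_upwards [this] with y hy
      simp only [Pi.zero_apply] at hy ⊢
      linear_combination Real.log (ρ y) * hy
    -- The tangent line of r log r is taken at the average density c of the cell, so that
    -- integrating it gives exactly the k-th term.
    · set c := (∫ y, χ k y ∂μ) / ∫ y, χ k y ∂n with hc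
      have hcpos : 0 < c := div_pos hpos (ha k hk)
      have i1 : Integrable (fun y => (Real.log c + 1) * (ρ y * χ k y) - c * χ k y) n :=
        (hρχ.const_mul _).sub ((hχi k).const_mul c)
      have e : ∫ y, ((Real.log c + 1) * (ρ y * χ k y) - c * χ k y) ∂n =
          (∫ y, χ k y ∂μ) * Real.log c := by
        rw [integral_sub (hρχ.const_mul _) ((hχi k).const_mul c), integral_const_mul, hw,
          integral_const_mul, hc, div_mul_cancel₀ _ (ha k hk).ne']
        ring
      rw [← e]
      refine integral_mono i1 (hterm k hk) fun y => ?_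
      have := mul_le_mul_of_nonneg_right (mul_log_add_sub_le (hρ0 y) hcpos) (hχ0 k y)
      simp only
      linarith
  refine (Finset.sum_le_sum hk).trans ?_
  rw [← integral_finsetSum _ hterm, ent]
  refine le_of_eq (integral_congr_ae ?_)
  have hms : MeasurableSet {y | ∑ k ∈ s, χ k y = 1}ᶜ :=
    ((continuous_finsetSum s fun k _ => hχ k).measurable (measurableSet_singleton (1 : ℝ))).compl
  filter_upwards [density_ae_eq_zero hac hms hχμ] with y hy
  rw [← Finset.mul_sum]
  by_cases h1 : ∑ k ∈ s, χ k y = 1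
  · rw [h1, mul_one]
  · rw [hρ, hy h1]; simp

end Smoothing

/-! ### Smoothing a coupling relative to the approximating reference measures. -/

section SmoothedCoupling

variable {Z : Type u} [MetricSpace Z] [ProperSpace Z] [MeasurableSpace Z] [BorelSpace Z]

/-- The normalised measure with density proportional to `f`. -/
noncomputable def bumpMeasure (n : Measure Z) (f : Z → ℝ) : Measure Z :=
  (ENNReal.ofReal (∫ y, f y ∂n))⁻¹ • n.withDensity fun y => ENNReal.ofReal (f y)

theorem bumpMeasure_univ {n : Measure Z} {f : Z → ℝ} (hf : Integrable f n) (hf0 : ∀ y, 0 ≤ f y)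
    (hpos : 0 < ∫ y, f y ∂n) : bumpMeasure n f univ = 1 := by
  rw [bumpMeasure, Measure.smul_apply, withDensity_apply _ MeasurableSet.univ, Measure.restrict_univ,
    ← ofReal_integral_eq_lintegral_ofReal hf (Eventually.of_forall hf0), smul_eq_mul]
  exact ENNReal.inv_mul_cancel (ENNReal.ofReal_pos.2 hpos).ne' ENNReal.ofReal_ne_top

theorem bumpMeasure_zeros {n : Measure Z} {f : Z → ℝ} (hf : Continuous f) :
    bumpMeasure n f {y | f y = 0} = 0 := by
  have hm : MeasurableSet {y | f y = 0} := hf.measurable (measurableSet_singleton 0)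
  rw [bumpMeasure, Measure.smul_apply, withDensity_apply _ hm,
    setLIntegral_congr_fun (g := fun _ => 0) hm (fun y hy => by simp [show f y = 0 from hy])]
  simp

theorem sum_smul_bumpMeasure {n : Measure Z} {s : Finset Z} {χ : Z → Z → ℝ}
    (hχ : ∀ k, Continuous (χ k)) (hχ0 : ∀ k y, 0 ≤ χ k y) (ha : ∀ k ∈ s, 0 < ∫ y, χ k y ∂n)
    {w : Z → ℝ} (hw : ∀ k, 0 ≤ w k) {A : Set Z} (hA : MeasurableSet A) :
    ∑ k ∈ s, ENNReal.ofReal (w k) * bumpMeasure n (χ k) A =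
      (n.withDensity fun y => ENNReal.ofReal (∑ k ∈ s, w k / (∫ y, χ k y ∂n) * χ k y)) A := by
  have h0 : ∀ k ∈ s, 0 ≤ w k / (∫ y, χ k y ∂n) := fun k hk => div_nonneg (hw k) (ha k hk).le
  rw [withDensity_apply _ hA]
  have e : ∀ y, ENNReal.ofReal (∑ k ∈ s, w k / (∫ y, χ k y ∂n) * χ k y) =
      ∑ k ∈ s, ENNReal.ofReal (w k / (∫ y, χ k y ∂n)) * ENNReal.ofReal (χ k y) := fun y => by
    rw [ENNReal.ofReal_sum_of_nonneg fun k hk => mul_nonneg (h0 k hk) (hχ0 k y)]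
    exact Finset.sum_congr rfl fun k hk => ENNReal.ofReal_mul (h0 k hk)
  simp_rw [e]
  rw [lintegral_finsetSum' _ fun k _ => ((hχ k).measurable.ennreal_ofReal.const_mul _).aemeasurable]
  refine Finset.sum_congr rfl fun k hk => ?_
  rw [lintegral_const_mul _ (hχ k).measurable.ennreal_ofReal, bumpMeasure, Measure.smul_apply,
    withDensity_apply _ hA, smul_eq_mul, ← mul_assoc, ENNReal.ofReal_div_of_pos (ha k hk),
    div_eq_mul_inv]

/-- Smoothing a coupling with a partition of unity of mesh `r` moves mass by less than `r`. -/
theorem exists_smoothing {n : Measure Z} [IsFiniteMeasureOnCompacts n] {s : Finset Z}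
    {χ : Z → Z → ℝ} (hχ : ∀ k, Continuous (χ k)) (hχc : ∀ k, HasCompactSupport (χ k))
    (hχ0 : ∀ k y, 0 ≤ χ k y) (hχ1 : ∀ y, ∑ k ∈ s, χ k y ≤ 1) {r : ℝ}
    (hr : ∀ k y y', χ k y ≠ 0 → χ k y' ≠ 0 → dist y y' < r)
    (ha : ∀ k ∈ s, 0 < ∫ y, χ k y ∂n) {π : ProbabilityMeasure (Z × Z)} {μ₀ μ₁ : ProbabilityMeasure Z}
    (h0 : (π : Measure (Z × Z)).map Prod.fst = μ₀) (h1 : (π : Measure (Z × Z)).map Prod.snd = μ₁)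
    (hμ₀ : ∀ᵐ y ∂(μ₀ : Measure Z), ∑ k ∈ s, χ k y = 1)
    (hμ₁ : ∀ᵐ y ∂(μ₁ : Measure Z), ∑ k ∈ s, χ k y = 1) :
    ∃ σ : ProbabilityMeasure (Z × Z), (∀ F : Set (Z × Z), MeasurableSet F →
        (σ : Measure (Z × Z)) F ≤ (π : Measure (Z × Z)) (Metric.thickening r F)) ∧
      (σ : Measure (Z × Z)).map Prod.fst = n.withDensity (fun y => ENNReal.ofReal
        (∑ k ∈ s, (∫ y, χ k y ∂(μ₀ : Measure Z)) / (∫ y, χ k y ∂n) * χ k y)) ∧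
      (σ : Measure (Z × Z)).map Prod.snd = n.withDensity (fun y => ENNReal.ofReal
        (∑ k ∈ s, (∫ y, χ k y ∂(μ₁ : Measure Z)) / (∫ y, χ k y ∂n) * χ k y)) := by
  have hχi : ∀ k, Integrable (χ k) n := fun k => (hχ k).integrable_of_hasCompactSupport (hχc k)
  have hP1 : ∀ k ∈ s, bumpMeasure n (χ k) univ = 1 := fun k hk =>
    bumpMeasure_univ (hχi k) (hχ0 k) (ha k hk)
  have hPp : ∀ k ∈ s, IsProbabilityMeasure (bumpMeasure n (χ k)) := fun k hk => ⟨hP1 k hk⟩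
  have hb : ∀ k ∈ s, ∀ y, χ k y ≤ 1 := fun k hk y =>
    (Finset.single_le_sum (f := fun k => χ k y) (fun k _ => hχ0 k y) hk).trans (hχ1 y)
  -- The π-mass of the cell (k, l). It is redistributed as the product of the two normalised bumps,
  -- so the marginals have densities that are combinations of bumps.
  set w : Z → Z → ℝ≥0∞ := fun k l =>
    ∫⁻ z, ENNReal.ofReal (χ k z.1) * ENNReal.ofReal (χ l z.2) ∂(π : Measure (Z × Z)) with hw
  have m1 : ∀ k, Measurable fun z : Z × Z => ENNReal.ofReal (χ k z.1) := fun k =>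
    ((hχ k).measurable.comp measurable_fst).ennreal_ofReal
  have m2 : ∀ k, Measurable fun z : Z × Z => ENNReal.ofReal (χ k z.2) := fun k =>
    ((hχ k).measurable.comp measurable_snd).ennreal_ofReal
  have m12 : ∀ k l, Measurable fun z : Z × Z =>
      ENNReal.ofReal (χ k z.1) * ENNReal.ofReal (χ l z.2) := fun k l => (m1 k).mul (m2 l)
  have hsum : ∀ y, ∑ k ∈ s, ENNReal.ofReal (χ k y) = ENNReal.ofReal (∑ k ∈ s, χ k y) := fun y =>
    (ENNReal.ofReal_sum_of_nonneg fun k _ => hχ0 k y).symm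
  have hint : ∀ μ : ProbabilityMeasure Z, ∀ k ∈ s, ENNReal.ofReal (∫ y, χ k y ∂(μ : Measure Z)) =
      ∫⁻ y, ENNReal.ofReal (χ k y) ∂(μ : Measure Z) := fun μ k hk =>
    ofReal_integral_eq_lintegral_ofReal (Integrable.of_bound (hχ k).aestronglyMeasurable 1
      (Eventually.of_forall fun y => by
        rw [Real.norm_eq_abs, abs_of_nonneg (hχ0 k y)]; exact hb k hk y))
      (Eventually.of_forall (hχ0 k))
  have hw0 : ∀ k ∈ s, ∑ l ∈ s, w k l = ENNReal.ofReal (∫ y, χ k y ∂(μ₀ : Measure Z)) := by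
    intro k hk
    rw [hint μ₀ k hk, ← h0, lintegral_map (hχ k).measurable.ennreal_ofReal measurable_fst,
      ← lintegral_finsetSum' _ fun l _ => (m12 k l).aemeasurable]
    rw [← h1] at hμ₁
    refine lintegral_congr_ae ?_
    filter_upwards [ae_of_ae_map measurable_snd.aemeasurable hμ₁] with z hz
    rw [← Finset.mul_sum, hsum, hz]; simp
  have hw1 : ∀ l ∈ s, ∑ k ∈ s, w k l = ENNReal.ofReal (∫ y, χ l y ∂(μ₁ : Measure Z)) := by
    intro l hl
    rw [hint μ₁ l hl, ← h1, lintegral_map (hχ l).measurable.ennreal_ofReal measurable_snd,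
      ← lintegral_finsetSum' _ fun k _ => (m12 k l).aemeasurable]
    rw [← h0] at hμ₀
    refine lintegral_congr_ae ?_
    filter_upwards [ae_of_ae_map measurable_fst.aemeasurable hμ₀] with z hz
    rw [← Finset.sum_mul, hsum, hz]; simp
  set σ : Measure (Z × Z) := ∑ k ∈ s, ∑ l ∈ s,
    w k l • (bumpMeasure n (χ k)).prod (bumpMeasure n (χ l)) with hσ
  have hσapp : ∀ F : Set (Z × Z), σ F = ∑ k ∈ s, ∑ l ∈ s,
      w k l * (bumpMeasure n (χ k)).prod (bumpMeasure n (χ l)) F := fun F => by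
    simp [hσ, Measure.finsetSum_apply]
  have hfst : σ.map Prod.fst = n.withDensity (fun y => ENNReal.ofReal
        (∑ k ∈ s, (∫ y, χ k y ∂(μ₀ : Measure Z)) / (∫ y, χ k y ∂n) * χ k y)) := by
    ext A hA
    rw [← sum_smul_bumpMeasure hχ hχ0 ha (fun k => integral_nonneg (hχ0 k)) hA,
      Measure.map_apply measurable_fst hA, hσapp]
    refine Finset.sum_congr rfl fun k hk => ?_
    rw [← hw0 k hk, Finset.sum_mul]
    refine Finset.sum_congr rfl fun l hl => ?_
    have := hPp k hk
    have := hPp l hl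
    rw [← prod_univ, Measure.prod_prod, hP1 l hl, mul_one]
  have hsnd : σ.map Prod.snd = n.withDensity (fun y => ENNReal.ofReal
        (∑ k ∈ s, (∫ y, χ k y ∂(μ₁ : Measure Z)) / (∫ y, χ k y ∂n) * χ k y)) := by
    ext A hA
    rw [← sum_smul_bumpMeasure hχ hχ0 ha (fun k => integral_nonneg (hχ0 k)) hA,
      Measure.map_apply measurable_snd hA, hσapp, Finset.sum_comm]
    refine Finset.sum_congr rfl fun l hl => ?_
    rw [← hw1 l hl, Finset.sum_mul]
    refine Finset.sum_congr rfl fun k hk => ?_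
    have := hPp k hk
    have := hPp l hl
    rw [← univ_prod, Measure.prod_prod, hP1 k hk, one_mul]
  have hprob : IsProbabilityMeasure σ := by
    constructor
    rw [hσapp]
    calc _ = ∑ k ∈ s, ∑ l ∈ s, w k l := by
          refine Finset.sum_congr rfl fun k hk => Finset.sum_congr rfl fun l hl => ?_
          have := hPp k hk
          have := hPp l hl
          rw [measure_univ, mul_one]
      _ = ∑ k ∈ s, ∫⁻ y, ENNReal.ofReal (χ k y) ∂(μ₀ : Measure Z) :=
          Finset.sum_congr rfl fun k hk => by rw [hw0 k hk, hint μ₀ k hk]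
      _ = ∫⁻ y, 1 ∂(μ₀ : Measure Z) := by
          rw [← lintegral_finsetSum' _ fun k _ => (hχ k).measurable.ennreal_ofReal.aemeasurable]
          refine lintegral_congr_ae ?_
          filter_upwards [hμ₀] with y hy
          rw [hsum, hy, ENNReal.ofReal_one]
      _ = 1 := by simp
  refine ⟨⟨σ, hprob⟩, fun F hF => ?_, hfst, hsnd⟩
  have hT : MeasurableSet (Metric.thickening r F) := Metric.isOpen_thickening.measurableSet
  -- If the cell meets F, it lies within r of F, since bumps have diameter below r. Otherwise the
  -- product measure does not charge F.
  have hterm : ∀ k ∈ s, ∀ l ∈ s, w k l * (bumpMeasure n (χ k)).prod (bumpMeasure n (χ l)) F ≤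
      ∫⁻ z in Metric.thickening r F,
        ENNReal.ofReal (χ k z.1) * ENNReal.ofReal (χ l z.2) ∂(π : Measure (Z × Z)) := by
    intro k hk l hl
    have := hPp k hk
    have := hPp l hl
    by_cases hne : ∃ z ∈ F, χ k z.1 ≠ 0 ∧ χ l z.2 ≠ 0
    · obtain ⟨z, hz, hz1, hz2⟩ := hne
      refine (mul_le_of_le_one_right zero_le prob_le_one).trans ?_
      rw [← lintegral_indicator hT]
      refine lintegral_mono fun z' => ?_
      by_cases hz' : z' ∈ Metric.thickening r F
      · rw [indicator_of_mem hz']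
      · rw [indicator_of_notMem hz']
        by_contra hcon
        simp only [nonpos_iff_eq_zero, mul_eq_zero, not_or, ENNReal.ofReal_eq_zero, not_le] at hcon
        refine hz' (Metric.mem_thickening_iff.2 ⟨z, hz, ?_⟩)
        rw [Prod.dist_eq]
        exact max_lt (hr k _ _ hcon.1.ne' hz1) (hr l _ _ hcon.2.ne' hz2)
    · push Not at hne
      have : (bumpMeasure n (χ k)).prod (bumpMeasure n (χ l)) F = 0 := by
        refine measure_mono_null (t := {y | χ k y = 0} ×ˢ univ ∪ univ ×ˢ {y | χ l y = 0}) ?_ ?_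
        · intro z hz
          by_cases h : χ k z.1 = 0
          · exact Or.inl ⟨h, trivial⟩
          · exact Or.inr ⟨trivial, hne z hz h⟩
        · refine measure_union_null ?_ ?_
          · rw [Measure.prod_prod, bumpMeasure_zeros (hχ k), zero_mul]
          · rw [Measure.prod_prod, bumpMeasure_zeros (hχ l), mul_zero]
      rw [this, mul_zero]
      exact zero_le
  calc σ F = _ := hσapp F
    _ ≤ ∑ k ∈ s, ∑ l ∈ s, ∫⁻ z in Metric.thickening r F,
        ENNReal.ofReal (χ k z.1) * ENNReal.ofReal (χ l z.2) ∂(π : Measure (Z × Z)) :=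
        Finset.sum_le_sum fun k hk => Finset.sum_le_sum fun l hl => hterm k hk l hl
    _ = ∫⁻ z in Metric.thickening r F, ∑ k ∈ s, ∑ l ∈ s,
        ENNReal.ofReal (χ k z.1) * ENNReal.ofReal (χ l z.2) ∂(π : Measure (Z × Z)) := by
        rw [lintegral_finsetSum' _ fun k _ => Finset.aemeasurable_fun_sum _ fun l _ =>
          (m12 k l).aemeasurable]
        refine Finset.sum_congr rfl fun k _ => ?_
        rw [lintegral_finsetSum' _ fun l _ => (m12 k l).aemeasurable]
    _ ≤ ∫⁻ z in Metric.thickening r F, 1 ∂(π : Measure (Z × Z)) := by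
        refine lintegral_mono fun z => ?_
        simp only
        rw [← Finset.sum_mul_sum, hsum, hsum]
        exact mul_le_one' (ENNReal.ofReal_le_one.2 (hχ1 _)) (ENNReal.ofReal_le_one.2 (hχ1 _))
    _ = _ := by simp

/-- Approximation of a coupling of measures with finite entropy relative to the limit measure. -/
theorem eventually_exists_smoothing {n : ℕ → Measure Z} {n' : Measure Z} (hn : WeaklyConverges n n')
    {K : Set Z} (hK : IsCompact K) {π : ProbabilityMeasure (Z × Z)} {μ₀ μ₁ : ProbabilityMeasure Z}
    (h0 : (π : Measure (Z × Z)).map Prod.fst = μ₀) (h1 : (π : Measure (Z × Z)).map Prod.snd = μ₁)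
    (hK0 : (μ₀ : Measure Z) Kᶜ = 0) (hK1 : (μ₁ : Measure Z) Kᶜ = 0)
    (he0 : InEntropyDomain (μ₀ : Measure Z) n') (he1 : InEntropyDomain (μ₁ : Measure Z) n')
    {r δ : ℝ} (hr : 0 < r) (hδ : 0 < δ) :
    ∀ᶠ j in atTop, ∃ (σ : ProbabilityMeasure (Z × Z)) (ν₀ ν₁ : ProbabilityMeasure Z),
      (∀ F : Set (Z × Z), MeasurableSet F →
        (σ : Measure (Z × Z)) F ≤ (π : Measure (Z × Z)) (Metric.thickening r F)) ∧
      (σ : Measure (Z × Z)).map Prod.fst = ν₀ ∧ (σ : Measure (Z × Z)).map Prod.snd = ν₁ ∧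
      (InEntropyDomain (ν₀ : Measure Z) (n j) ∧
        ent (ν₀ : Measure Z) (n j) ≤ ent (μ₀ : Measure Z) n' + δ) ∧
      (InEntropyDomain (ν₁ : Measure Z) (n j) ∧
        ent (ν₁ : Measure Z) (n j) ≤ ent (μ₁ : Measure Z) n' + δ) := by
  classical
  obtain ⟨hnj, hn', hlim⟩ := hn
  obtain ⟨s₀, χ, hχ, hχc, hχ0, hχ1', hχK, hχr⟩ := exists_partition hK hr
  have hχi : ∀ k, Integrable (χ k) n' := fun k => (hχ k).integrable_of_hasCompactSupport (hχc k)
  -- Bumps of zero mass for n' are invisible to μ₀ and μ₁, which are absolutely continuous. The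
  -- remaining ones keep positive mass for n j eventually, as normalisation requires.
  set s := s₀.filter fun k => 0 < ∫ y, χ k y ∂n' with hs
  have hss : s ⊆ s₀ := Finset.filter_subset _ _
  have hχ1 : ∀ y, ∑ k ∈ s, χ k y ≤ 1 := hχ1' s hss
  have ha : ∀ k ∈ s, 0 < ∫ y, χ k y ∂n' := fun k hk => (Finset.mem_filter.1 hk).2
  have hae : ∀ μ : ProbabilityMeasure Z, (μ : Measure Z) Kᶜ = 0 →
      InEntropyDomain (μ : Measure Z) n' → ∀ᵐ y ∂(μ : Measure Z), ∑ k ∈ s, χ k y = 1 := by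
    intro μ hμK hμ
    have hac := (inEntropyDomain_iff.1 hμ).1
    have hz : ∀ᵐ y ∂(μ : Measure Z), ∀ k ∈ s₀ \ s, χ k y = 0 := by
      rw [Filter.eventually_all_finset]
      intro k hk
      rw [Finset.mem_sdiff, hs, Finset.mem_filter] at hk
      have hk0 : ∫ y, χ k y ∂n' = 0 := le_antisymm
        (not_lt.1 fun h => hk.2 ⟨hk.1, h⟩) (integral_nonneg (hχ0 k))
      exact hac.ae_le ((integral_eq_zero_iff_of_nonneg (hχ0 k) (hχi k)).1 hk0)
    filter_upwards [hz, measure_eq_zero_iff_ae_notMem.1 hμK] with y hy hyK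
    rw [← hχK y (not_not.1 hyK), ← Finset.sum_sdiff hss,
      Finset.sum_eq_zero hy, zero_add]
  have haj : ∀ k, Tendsto (fun j => ∫ y, χ k y ∂(n j)) atTop (𝓝 (∫ y, χ k y ∂n')) := fun k =>
    hlim (χ k) (hχ k) (hχc k)
  have hapos : ∀ᶠ j in atTop, ∀ k ∈ s, 0 < ∫ y, χ k y ∂(n j) := by
    rw [Filter.eventually_all_finset]
    exact fun k hk => (haj k).eventually (lt_mem_nhds (ha k hk))
  have hent : ∀ μ : ProbabilityMeasure Z, (μ : Measure Z) Kᶜ = 0 →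
      InEntropyDomain (μ : Measure Z) n' → ∀ᶠ j in atTop,
      ∑ k ∈ s, (∫ y, χ k y ∂(μ : Measure Z)) *
        Real.log ((∫ y, χ k y ∂(μ : Measure Z)) / ∫ y, χ k y ∂(n j)) ≤
        ent (μ : Measure Z) n' + δ := by
    intro μ hμK hμ
    have h := sum_mul_log_le_ent hμ hχ hχc hχ0 hχ1 (hae μ hμK hμ) ha
    have ht : Tendsto (fun j => ∑ k ∈ s, (∫ y, χ k y ∂(μ : Measure Z)) *
        Real.log ((∫ y, χ k y ∂(μ : Measure Z)) / ∫ y, χ k y ∂(n j))) atTop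
        (𝓝 (∑ k ∈ s, (∫ y, χ k y ∂(μ : Measure Z)) *
        Real.log ((∫ y, χ k y ∂(μ : Measure Z)) / ∫ y, χ k y ∂n'))) := by
      refine tendsto_finsetSum _ fun k hk => ?_
      have hnn : 0 ≤ ∫ y, χ k y ∂(μ : Measure Z) := integral_nonneg (hχ0 k)
      rcases hnn.eq_or_lt with h0 | hpos
      · simp [← h0]
      · exact ((tendsto_const_nhds.div (haj k) (ha k hk).ne').log
          (div_pos hpos (ha k hk)).ne').const_mul _
    exact (ht.eventually (gt_mem_nhds (show _ < ent (μ : Measure Z) n' + δ by linarith))).mono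
      fun j hj => hj.le
  filter_upwards [hapos, hent μ₀ hK0 he0, hent μ₁ hK1 he1] with j hj hj0 hj1
  have := hnj j
  obtain ⟨σ, hσ, hf, hg⟩ := exists_smoothing hχ hχc hχ0 hχ1 hχr hj h0 h1 (hae μ₀ hK0 he0)
    (hae μ₁ hK1 he1)
  have key : ∀ μ : ProbabilityMeasure Z, ∑ k ∈ s, (∫ y, χ k y ∂(μ : Measure Z)) *
        Real.log ((∫ y, χ k y ∂(μ : Measure Z)) / ∫ y, χ k y ∂(n j)) ≤
        ent (μ : Measure Z) n' + δ →
      InEntropyDomain ((n j).withDensity (fun y => ENNReal.ofReal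
        (∑ k ∈ s, (∫ y, χ k y ∂(μ : Measure Z)) / (∫ y, χ k y ∂(n j)) * χ k y))) (n j) ∧
      ent ((n j).withDensity (fun y => ENNReal.ofReal
        (∑ k ∈ s, (∫ y, χ k y ∂(μ : Measure Z)) / (∫ y, χ k y ∂(n j)) * χ k y))) (n j) ≤
        ent (μ : Measure Z) n' + δ := fun μ hμ => by
    obtain ⟨a, b⟩ := ent_withDensity_sum_le (n := n j) hχ hχc hχ0 hχ1
      (c := fun k => (∫ y, χ k y ∂(μ : Measure Z)) / (∫ y, χ k y ∂(n j)))
      fun k => div_nonneg (integral_nonneg (hχ0 k)) (integral_nonneg (hχ0 k))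
    refine ⟨a, b.trans (le_trans (le_of_eq ?_) hμ)⟩
    refine Finset.sum_congr rfl fun k hk => ?_
    rw [div_mul_cancel₀ _ (hj k hk).ne']
  refine ⟨σ, σ.map measurable_fst.aemeasurable, σ.map measurable_snd.aemeasurable, hσ, rfl, rfl, ?_, ?_⟩
  · rw [ProbabilityMeasure.toMeasure_map, hf]; exact key μ₀ hj0
  · rw [ProbabilityMeasure.toMeasure_map, hg]; exact key μ₁ hj1

end SmoothedCoupling

/-! ### Conditioning on sets of almost full measure. -/

section Restriction

variable {Z : Type u} [MeasurableSpace Z]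

/-- Slight restrictions of measures increase their entropy only slightly. -/
theorem eventually_ent_le_of_smul_le {E B δ : ℝ} (hB : 0 ≤ B) (hδ : 0 < δ) {K : Set Z}
    (hK : MeasurableSet K) :
    ∀ᶠ c in 𝓝 (1 : ℝ), ∀ (m : Measure Z) [SigmaFinite m] (μ ν : ProbabilityMeasure Z),
      ENNReal.ofReal c • (ν : Measure Z) ≤ μ → (μ : Measure Z) Kᶜ = 0 → m K ≤ ENNReal.ofReal B →
      InEntropyDomain (μ : Measure Z) m → ent (μ : Measure Z) m ≤ E →
      InEntropyDomain (ν : Measure Z) m ∧ ent (ν : Measure Z) m ≤ E + δ := by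
  -- This makes bB less than δ; all other terms of the bound in `ent_le_of_smul_le` tend to E as c
  -- tends to 1.
  set b := δ / (2 * (B + 1)) with hb
  have hbpos : 0 < b := by positivity
  have hbB : b * B < δ := by
    have : b * (2 * (B + 1)) = δ := by rw [hb]; field_simp
    nlinarith
  have hcont : ContinuousAt (fun c : ℝ => (E - (1 - c) * Real.log b + b * B) / c - Real.log c) 1 := by
    refine ContinuousAt.sub (ContinuousAt.div (by fun_prop) continuousAt_id one_ne_zero) ?_
    exact Real.continuousAt_log one_ne_zero
  have hlt : (E - (1 - 1) * Real.log b + b * B) / 1 - Real.log 1 < E + δ := by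
    simp; linarith
  filter_upwards [hcont.eventually (gt_mem_nhds hlt), lt_mem_nhds (zero_lt_one' ℝ)] with c hc hc0 m _
    μ ν hle hμK hmK hd he
  obtain ⟨h1, h2⟩ := ent_le_of_smul_le hc0 hle hK hμK hB hmK hd
  refine ⟨h1, (h2 b hbpos).trans (le_trans ?_ hc.le)⟩
  gcongr

theorem tendsto_cond [TopologicalSpace Z] [OpensMeasurableSpace Z] {π : ProbabilityMeasure Z}
    {A : ℕ → Set Z} (hA : ∀ k, MeasurableSet (A k)) (hmono : Monotone A)
    (hfull : (π : Measure Z) (⋃ k, A k)ᶜ = 0) {ϖ : ℕ → ProbabilityMeasure Z}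
    (hϖ : ∀ᶠ k in atTop, (ϖ k : Measure Z) = ProbabilityTheory.cond (π : Measure Z) (A k)) :
    Tendsto ϖ atTop (𝓝 π) ∧ Tendsto (fun k => (π : Measure Z) (A k)) atTop (𝓝 1) := by
  have h1 : Tendsto (fun k => (π : Measure Z) (A k)) atTop (𝓝 1) := by
    have := tendsto_measure_iUnion_atTop (μ := (π : Measure Z)) hmono
    rwa [(prob_compl_eq_zero_iff (MeasurableSet.iUnion hA)).1 hfull] at this
  refine ⟨?_, h1⟩
  rw [ProbabilityMeasure.tendsto_iff_forall_integral_tendsto]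
  intro f
  have h2 := tendsto_setIntegral_of_monotone (μ := (π : Measure Z)) hA hmono
    (f.integrable (π : Measure Z)).integrableOn
  have h3 : ∫ z in ⋃ k, A k, f z ∂(π : Measure Z) = ∫ z, f z ∂(π : Measure Z) := by
    rw [Measure.restrict_eq_self_of_ae_mem]
    filter_upwards [measure_eq_zero_iff_ae_notMem.1 hfull] with z hz using not_not.1 hz
  rw [h3] at h2
  have h4 : Tendsto (fun k => ((π : Measure Z) (A k)).toReal⁻¹) atTop (𝓝 1) := by
    have := ((ENNReal.tendsto_toReal ENNReal.one_ne_top).comp h1).inv₀ (by simp)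
    simpa using this
  have h5 := h4.mul h2
  rw [one_mul] at h5
  refine h5.congr' ?_
  filter_upwards [hϖ] with k hk
  rw [hk, ProbabilityTheory.cond, integral_smul_measure, ENNReal.toReal_inv, smul_eq_mul]

end Restriction

/-! ### Approximation of timelike couplings. -/

section Approximation

namespace LorentzianPreLength

variable {Y : Type u} [MetricSpace Y] [ProperSpace Y] [MeasurableSpace Y] [BorelSpace Y]
  {M : LorentzianPreLength Y}

theorem exists_restriction {μ ν : ProbabilityMeasure Y} {π : ProbabilityMeasure (Y × Y)}
    (hπ : π ∈ M.causalCouplings μ ν) {A : Set (Y × Y)} (hA : MeasurableSet A)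
    (h0 : (π : Measure (Y × Y)) A ≠ 0) :
    ∃ (π' : ProbabilityMeasure (Y × Y)) (μ' ν' : ProbabilityMeasure Y),
      (π' : Measure (Y × Y)) = ProbabilityTheory.cond (π : Measure (Y × Y)) A ∧
      π' ∈ M.causalCouplings μ' ν' ∧
      (π : Measure (Y × Y)) = (π : Measure (Y × Y)) A • (π' : Measure (Y × Y)) +
        (π : Measure (Y × Y)).restrict Aᶜ ∧
      (π : Measure (Y × Y)) A • (μ' : Measure Y) ≤ μ ∧
      (π : Measure (Y × Y)) A • (ν' : Measure Y) ≤ ν := by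
  have hp : IsProbabilityMeasure (ProbabilityTheory.cond (π : Measure (Y × Y)) A) :=
    ProbabilityTheory.cond_isProbabilityMeasure h0
  set π' : ProbabilityMeasure (Y × Y) := ⟨_, hp⟩ with hπ'
  have e : (π : Measure (Y × Y)) A • (π' : Measure (Y × Y)) = (π : Measure (Y × Y)).restrict A := by
    change (π : Measure (Y × Y)) A • ((π : Measure (Y × Y)) A)⁻¹ • (π : Measure (Y × Y)).restrict A = _
    rw [smul_smul, ENNReal.mul_inv_cancel h0 (measure_ne_top _ _), one_smul]
  refine ⟨π', π'.map measurable_fst.aemeasurable, π'.map measurable_snd.aemeasurable, rfl,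
    ⟨rfl, rfl, ?_⟩, ?_, ?_, ?_⟩
  · exact ProbabilityTheory.cond_absolutelyContinuous.ae_le hπ.2.2
  · rw [e, Measure.restrict_add_restrict_compl hA]
  · rw [ProbabilityMeasure.toMeasure_map, ← Measure.map_smul, e, ← hπ.1]
    exact Measure.map_mono Measure.restrict_le_self measurable_fst
  · rw [ProbabilityMeasure.toMeasure_map, ← Measure.map_smul, e, ← hπ.2.1]
    exact Measure.map_mono Measure.restrict_le_self measurable_snd

/-- Couplings which are uniformly timelike can be approximated by causal couplings of measures with
almost the same entropy relative to the approximating reference measures. -/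
theorem eventually_exists_coupling_of_le_sep (hM : M.IsTame) {n : ℕ → Measure Y} {n' : Measure Y}
    (hn : WeaklyConverges n n') {D E : Set Y} (hD : IsCompact D) (hE : IsCompact E)
    {μ₀ μ₁ : ProbabilityMeasure Y} (hμ₀ : (μ₀ : Measure Y) Dᶜ = 0) (hμ₁ : (μ₁ : Measure Y) Eᶜ = 0)
    (he0 : InEntropyDomain (μ₀ : Measure Y) n') (he1 : InEntropyDomain (μ₁ : Measure Y) n')
    {π : ProbabilityMeasure (Y × Y)} (hπ : π ∈ M.causalCouplings μ₀ μ₁) {ε : ℝ} (hε : 0 < ε)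
    (hsep : ∀ᵐ z ∂(π : Measure (Y × Y)), ε ≤ M.sep z)
    {W : Set (ProbabilityMeasure (Y × Y))} (hW : W ∈ 𝓝 π) {δ : ℝ} (hδ : 0 < δ) :
    ∀ᶠ j in atTop, ∃ σ ∈ W, ∃ ν₀ ν₁ : ProbabilityMeasure Y, σ ∈ M.causalCouplings ν₀ ν₁ ∧
      (ν₀ : Measure Y) (Metric.cthickening 1 D)ᶜ = 0 ∧
      (ν₁ : Measure Y) (Metric.cthickening 1 E)ᶜ = 0 ∧
      (InEntropyDomain (ν₀ : Measure Y) (n j) ∧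
        ent (ν₀ : Measure Y) (n j) ≤ ent (μ₀ : Measure Y) n' + δ) ∧
      (InEntropyDomain (ν₁ : Measure Y) (n j) ∧
        ent (ν₁ : Measure Y) (n j) ≤ ent (μ₁ : Measure Y) n' + δ) := by
  have hcar := causalCouplings_carried hπ hD.measurableSet hE.measurableSet hμ₀ hμ₁
  -- On this compact set τ is at least ε, so a thickening of it is still timelike. Smoothing below
  -- that radius therefore preserves causality.
  set S : Set (Y × Y) := D ×ˢ E ∩ {z | ε ≤ M.sep z} with hS
  have hSc : IsCompact S := (hD.prod hE).inter_right (_root_.isClosed_le continuous_const hM.cont)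
  have hπS : (π : Measure (Y × Y)) Sᶜ = 0 := by
    rw [hS, compl_inter]
    exact measure_union_null hcar hsep
  obtain ⟨r₀, hr₀, hW'⟩ := exists_forall_mem_of_measure_le_thickening hW
  obtain ⟨r₁, hr₁, hsub⟩ := hSc.exists_thickening_subset_open
    (isOpen_lt continuous_const hM.cont : IsOpen {z | 0 < M.sep z}) fun z hz => hε.trans_le hz.2
  obtain ⟨r, hr, hrlt⟩ : ∃ r, 0 < r ∧ r < min r₀ (min r₁ 1) :=
    exists_between (lt_min hr₀ (lt_min hr₁ one_pos))
  have hrr₀ : r < r₀ := hrlt.trans_le (min_le_left _ _)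
  have hrr₁ : r < r₁ := hrlt.trans_le ((min_le_right _ _).trans (min_le_left _ _))
  have hr1 : r < 1 := hrlt.trans_le ((min_le_right _ _).trans (min_le_right _ _))
  have hK0 : (μ₀ : Measure Y) (D ∪ E)ᶜ = 0 :=
    measure_mono_null (compl_subset_compl.2 subset_union_left) hμ₀
  have hK1 : (μ₁ : Measure Y) (D ∪ E)ᶜ = 0 :=
    measure_mono_null (compl_subset_compl.2 subset_union_right) hμ₁
  filter_upwards [eventually_exists_smoothing hn (hD.union hE) hπ.1 hπ.2.1 hK0 hK1 he0 he1 hr hδ]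
    with j hj
  obtain ⟨σ, ν₀, ν₁, hσ, hf, hg, h0, h1⟩ := hj
  have hzero : ∀ F : Set (Y × Y), MeasurableSet F → (∀ z ∈ S, ∀ z' ∈ F, ¬ dist z z' < r) →
      (σ : Measure (Y × Y)) F = 0 := fun F hF h => by
    refine le_antisymm ((hσ F hF).trans (le_of_eq (measure_mono_null ?_ hπS))) zero_le
    intro z hz hzS
    obtain ⟨z', hz', hd⟩ := Metric.mem_thickening_iff.1 hz
    exact h z hzS z' hz' hd
  refine ⟨σ, hW' r ⟨hr, hrr₀⟩ σ hσ, ν₀, ν₁, ⟨hf, hg, ?_⟩, ?_, ?_, h0, h1⟩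
  · refine hzero _ hM.closed.measurableSet.compl fun z hz z' hz' hd => hz' ?_
    have : z' ∈ {z | 0 < M.sep z} := hsub (Metric.mem_thickening_iff.2
      ⟨z, hz, by rw [dist_comm]; exact hd.trans hrr₁⟩)
    exact M.le_of_ll _ _ ((sep_pos_iff hM.fin z').1 this)
  · rw [← hf, Measure.map_apply measurable_fst Metric.isClosed_cthickening.measurableSet.compl]
    refine hzero _ (measurable_fst Metric.isClosed_cthickening.measurableSet.compl)
      fun z hz z' hz' hd => hz' ?_
    refine Metric.mem_cthickening_of_dist_le z'.1 z.1 1 D hz.1.1 ?_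
    have h2 : dist z.1 z'.1 ≤ dist z z' := le_max_left _ _
    rw [dist_comm]
    linarith
  · rw [← hg, Measure.map_apply measurable_snd Metric.isClosed_cthickening.measurableSet.compl]
    refine hzero _ (measurable_snd Metric.isClosed_cthickening.measurableSet.compl)
      fun z hz z' hz' hd => hz' ?_
    refine Metric.mem_cthickening_of_dist_le z'.2 z.2 1 E hz.1.2 ?_
    have h2 : dist z.2 z'.2 ≤ dist z z' := le_max_right _ _
    rw [dist_comm]
    linarith

/-- The same approximation for arbitrary timelike couplings. -/
theorem eventually_exists_coupling (hM : M.IsTame) {n : ℕ → Measure Y} {n' : Measure Y}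
    (hn : WeaklyConverges n n') {D E : Set Y} (hD : IsCompact D) (hE : IsCompact E)
    {μ₀ μ₁ : ProbabilityMeasure Y} (hμ₀ : (μ₀ : Measure Y) Dᶜ = 0) (hμ₁ : (μ₁ : Measure Y) Eᶜ = 0)
    (he0 : InEntropyDomain (μ₀ : Measure Y) n') (he1 : InEntropyDomain (μ₁ : Measure Y) n')
    {π : ProbabilityMeasure (Y × Y)} (hπ : π ∈ M.causalCouplings μ₀ μ₁)
    (hsep : ∀ᵐ z ∂(π : Measure (Y × Y)), 0 < M.sep z)
    {W : Set (ProbabilityMeasure (Y × Y))} (hW : W ∈ 𝓝 π) {δ : ℝ} (hδ : 0 < δ) :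
    ∀ᶠ j in atTop, ∃ σ ∈ W, ∃ ν₀ ν₁ : ProbabilityMeasure Y, σ ∈ M.causalCouplings ν₀ ν₁ ∧
      (ν₀ : Measure Y) (Metric.cthickening 1 D)ᶜ = 0 ∧
      (ν₁ : Measure Y) (Metric.cthickening 1 E)ᶜ = 0 ∧
      (InEntropyDomain (ν₀ : Measure Y) (n j) ∧
        ent (ν₀ : Measure Y) (n j) ≤ ent (μ₀ : Measure Y) n' + δ) ∧
      (InEntropyDomain (ν₁ : Measure Y) (n j) ∧
        ent (ν₁ : Measure Y) (n j) ≤ ent (μ₁ : Measure Y) n' + δ) := by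
  have hn' : IsFiniteMeasureOnCompacts n' := hn.2.1
  -- Conditioning on A k makes the coupling uniformly timelike. One large k is fixed at the price of
  -- δ/2 of entropy, and the smoothing uses the other half.
  set A : ℕ → Set (Y × Y) := fun k => {z | 1 / ((k : ℝ) + 1) ≤ M.sep z} with hA
  have hAm : ∀ k, MeasurableSet (A k) := fun k =>
    (_root_.isClosed_le continuous_const hM.cont).measurableSet
  have hmono : Monotone A := fun k l hkl z hz => by
    have h : 1 / ((l : ℝ) + 1) ≤ 1 / ((k : ℝ) + 1) :=
      one_div_le_one_div_of_le (by positivity) (by gcongr)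
    exact h.trans hz
  have hfull : (π : Measure (Y × Y)) (⋃ k, A k)ᶜ = 0 := by
    refine measure_mono_null (t := {z | ¬ 0 < M.sep z}) ?_ hsep
    intro z hz hpos
    obtain ⟨k, hk⟩ := exists_nat_one_div_lt hpos
    exact hz (mem_iUnion.2 ⟨k, hk.le⟩)
  have hex : ∀ k, ∃ (π' : ProbabilityMeasure (Y × Y)) (μ' ν' : ProbabilityMeasure Y),
      (π : Measure (Y × Y)) (A k) ≠ 0 →
      (π' : Measure (Y × Y)) = ProbabilityTheory.cond (π : Measure (Y × Y)) (A k) ∧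
      π' ∈ M.causalCouplings μ' ν' ∧
      (π : Measure (Y × Y)) (A k) • (μ' : Measure Y) ≤ μ₀ ∧
      (π : Measure (Y × Y)) (A k) • (ν' : Measure Y) ≤ μ₁ := fun k => by
    by_cases h : (π : Measure (Y × Y)) (A k) = 0
    · exact ⟨π, μ₀, μ₁, fun h' => absurd h h'⟩
    · obtain ⟨π', μ', ν', a, b, -, c, d⟩ := exists_restriction hπ (hAm k) h
      exact ⟨π', μ', ν', fun _ => ⟨a, b, c, d⟩⟩
  choose ϖ μ' ν' hϖ using hex
  have hne : ∀ᶠ k in atTop, (π : Measure (Y × Y)) (A k) ≠ 0 := by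
    have h1 : Tendsto (fun k => (π : Measure (Y × Y)) (A k)) atTop (𝓝 1) := by
      have := tendsto_measure_iUnion_atTop (μ := (π : Measure (Y × Y))) hmono
      rwa [(prob_compl_eq_zero_iff (MeasurableSet.iUnion hAm)).1 hfull] at this
    exact h1.eventually_ne one_ne_zero
  obtain ⟨hlim, hone⟩ := tendsto_cond hAm hmono hfull (hne.mono fun k hk => (hϖ k hk).1)
  have hreal : Tendsto (fun k => ((π : Measure (Y × Y)) (A k)).toReal) atTop (𝓝 1) :=
    (ENNReal.tendsto_toReal ENNReal.one_ne_top).comp hone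
  have hent : ∀ (μ : ProbabilityMeasure Y) (K : Set Y), IsCompact K → (μ : Measure Y) Kᶜ = 0 →
      InEntropyDomain (μ : Measure Y) n' → ∀ᶠ k in atTop, ∀ ν : ProbabilityMeasure Y,
        (π : Measure (Y × Y)) (A k) • (ν : Measure Y) ≤ μ →
        InEntropyDomain (ν : Measure Y) n' ∧
          ent (ν : Measure Y) n' ≤ ent (μ : Measure Y) n' + δ / 2 := fun μ K hK hμK hμ => by
    have h := eventually_ent_le_of_smul_le (Z := Y) (E := ent (μ : Measure Y) n')
      (B := (n' K).toReal) (δ := δ / 2) ENNReal.toReal_nonneg (by positivity) hK.measurableSet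
    filter_upwards [hreal.eventually h] with k hk ν hν
    refine hk n' μ ν ?_ hμK ?_ hμ le_rfl
    · rwa [ENNReal.ofReal_toReal (measure_ne_top _ _)]
    · rw [ENNReal.ofReal_toReal hK.measure_lt_top.ne]
  obtain ⟨k, hk1, hk2, hk3, hk4⟩ := (hne.and ((hlim.eventually (eventually_mem_nhds_iff.2 hW)).and
    ((hent μ₀ D hD hμ₀ he0).and (hent μ₁ E hE hμ₁ he1)))).exists
  obtain ⟨a1, a2, a3, a4⟩ := hϖ k hk1
  obtain ⟨b1, b2⟩ := hk3 _ a3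
  obtain ⟨c1, c2⟩ := hk4 _ a4
  have hnull : ∀ {μ ν : ProbabilityMeasure Y} {K : Set Y},
      (π : Measure (Y × Y)) (A k) • (ν : Measure Y) ≤ μ → (μ : Measure Y) Kᶜ = 0 →
      (ν : Measure Y) Kᶜ = 0 := fun {μ ν K} h h0 => by
    have := le_antisymm ((h Kᶜ).trans h0.le) zero_le
    rw [Measure.smul_apply, smul_eq_mul, mul_eq_zero] at this
    exact this.resolve_left hk1
  have hs : ∀ᵐ z ∂(ϖ k : Measure (Y × Y)), 1 / ((k : ℝ) + 1) ≤ M.sep z := by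
    rw [a1]
    exact ProbabilityTheory.ae_cond_mem (hAm k)
  filter_upwards [eventually_exists_coupling_of_le_sep hM hn hD hE (hnull a3 hμ₀) (hnull a4 hμ₁)
    b1 c1 a2 (by positivity) hs hk2 (half_pos hδ)] with j hj
  obtain ⟨σ, hσ, ν₀, ν₁, d1, d2, d3, ⟨d4, d5⟩, d6, d7⟩ := hj
  exact ⟨σ, hσ, ν₀, ν₁, d1, d2, d3, ⟨d4, by linarith⟩, d6, by linarith⟩

end LorentzianPreLength

end Approximation

/-! ### Approximating pairs with timelike maximal couplings. -/

section Stability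

/-- The remainder has mass 1 - c, which tends to 0, so it does not affect integrals of bounded
functions in the limit. -/
theorem tendsto_of_eq_smul_add {Z : Type u} [MeasurableSpace Z] [TopologicalSpace Z]
    [OpensMeasurableSpace Z] {ι : Type v} {l : Filter ι} {ξ ξ' : ι → ProbabilityMeasure Z}
    {ϖ : ProbabilityMeasure Z} {c : ι → ℝ≥0∞} (hξ : Tendsto ξ l (𝓝 ϖ)) (hc : Tendsto c l (𝓝 1))
    (h : ∀ᶠ i in l, ∃ ρ : Measure Z, (ξ i : Measure Z) = c i • (ξ' i : Measure Z) + ρ) :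
    Tendsto ξ' l (𝓝 ϖ) := by
  rw [ProbabilityMeasure.tendsto_iff_forall_integral_tendsto] at hξ ⊢
  intro f
  have hcr : Tendsto (fun i => (c i).toReal) l (𝓝 1) :=
    (ENNReal.tendsto_toReal ENNReal.one_ne_top).comp hc
  have hdiff : Tendsto (fun i => ∫ z, f z ∂(ξ i : Measure Z) -
      (c i).toReal * ∫ z, f z ∂(ξ' i : Measure Z)) l (𝓝 0) := by
    have hb : Tendsto (fun i => ‖f‖ * (1 - (c i).toReal)) l (𝓝 0) := by
      simpa using (hcr.const_sub 1).const_mul ‖f‖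
    refine squeeze_zero_norm' ?_ hb
    filter_upwards [h, hc.eventually (gt_mem_nhds ENNReal.one_lt_top)] with i hi hci
    obtain ⟨ρ, hρ⟩ := hi
    have hρle : ρ ≤ ξ i := by rw [hρ]; exact Measure.le_add_left le_rfl
    have : IsFiniteMeasure ρ := isFiniteMeasure_of_le _ hρle
    have hfi : Integrable (fun z => f z) (c i • (ξ' i : Measure Z) + ρ) := by
      rw [← hρ]; exact f.integrable _
    have hmass : ρ.real univ = 1 - (c i).toReal := by
      have h1 : (ξ i : Measure Z) univ = 1 := measure_univ
      rw [hρ, Measure.add_apply, Measure.smul_apply, measure_univ, smul_eq_mul, mul_one] at h1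
      have h2 := congrArg ENNReal.toReal h1
      rw [ENNReal.toReal_add hci.ne (measure_ne_top _ _), ENNReal.toReal_one] at h2
      rw [Measure.real]; linarith
    have e : ∫ z, f z ∂(ξ i : Measure Z) - (c i).toReal * ∫ z, f z ∂(ξ' i : Measure Z) =
        ∫ z, f z ∂ρ := by
      rw [hρ, integral_add_measure hfi.left_of_add_measure hfi.right_of_add_measure,
        integral_smul_measure, smul_eq_mul]
      ring
    rw [e, ← hmass]
    exact (norm_integral_le_of_norm_le_const (Eventually.of_forall f.norm_coe_le_norm))
  have h3 : Tendsto (fun i => (∫ z, f z ∂(ξ i : Measure Z) - (∫ z, f z ∂(ξ i : Measure Z) -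
      (c i).toReal * ∫ z, f z ∂(ξ' i : Measure Z))) / (c i).toReal) l
      (𝓝 ((∫ z, f z ∂(ϖ : Measure Z) - 0) / 1)) := ((hξ f).sub hdiff).div hcr one_ne_zero
  rw [sub_zero, div_one] at h3
  refine h3.congr' ?_
  filter_upwards [hcr.eventually_ne one_ne_zero] with i hi
  field_simp
  ring

namespace LorentzianPreLength

variable {Y : Type u} [MetricSpace Y] [ProperSpace Y] [MeasurableSpace Y] [BorelSpace Y]
  {M : LorentzianPreLength Y}

/-- The consequence of the entropic curvature-dimension condition which passes to limits. -/
def MidpointCondition (M : LorentzianPreLength Y) (n : Measure Y) (p K N : ℝ) : Prop :=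
  ∀ (D E : Set Y), IsCompact D → IsCompact E → ∀ ν₀ ν₁ : ProbabilityMeasure Y,
    (ν₀ : Measure Y) Dᶜ = 0 → (ν₁ : Measure Y) Eᶜ = 0 →
    InEntropyDomain (ν₀ : Measure Y) n → InEntropyDomain (ν₁ : Measure Y) n →
    ∀ ϖ : ProbabilityMeasure (Y × Y), M.IsMaximal p ν₀ ν₁ ϖ →
    (∀ᵐ z ∂(ϖ : Measure (Y × Y)), 0 < M.sep z) →
    ∃ (π : ProbabilityMeasure (Y × Y)) (g : ℝ → ProbabilityMeasure Y), M.IsMaximal p ν₀ ν₁ π ∧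
      g 0 = ν₀ ∧ g 1 = ν₁ ∧
      M.IsCurve p (M.gain p ϖ ^ (1 / p)) (M.futureJ D ∩ M.pastJ E) g ∧
      InEntropyDomain (g (1 / 2) : Measure Y) n ∧
      Real.exp (K * (∫ z, M.sep z ^ 2 ∂(π : Measure (Y × Y))) / N / 8) *
        ((Real.exp (-(ent (ν₀ : Measure Y) n / N)) + Real.exp (-(ent (ν₁ : Measure Y) n / N))) / 2) ≤
        Real.exp (-(ent (g (1 / 2) : Measure Y) n / N))

theorem eventually_measure_le {n : ℕ → Measure Y} {n' : Measure Y} (hn : WeaklyConverges n n')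
    {D : Set Y} (hD : IsCompact D) :
    ∃ B : ℝ, 0 ≤ B ∧ ∀ᶠ j in atTop, n j D ≤ ENNReal.ofReal B := by
  obtain ⟨hnj, hn', hlim⟩ := hn
  obtain ⟨ψ, h1, h2, h3, h4⟩ := exists_cutoff hD
  have h0 : 0 ≤ ∫ y, ψ y ∂n' := integral_nonneg h3
  refine ⟨∫ y, ψ y ∂n' + 1, by linarith, ?_⟩
  filter_upwards [(hlim ψ h1 h2).eventually
    (gt_mem_nhds (show _ < ∫ y, ψ y ∂n' + 1 by linarith))] with j hj
  have := hnj j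
  calc n j D = ∫⁻ y in D, 1 ∂(n j) := by simp
    _ ≤ ∫⁻ y in D, ENNReal.ofReal (ψ y) ∂(n j) :=
        setLIntegral_mono h1.measurable.ennreal_ofReal fun y hy => by rw [h4 y hy]; simp
    _ ≤ ∫⁻ y, ENNReal.ofReal (ψ y) ∂(n j) := setLIntegral_le_lintegral _ _
    _ = ENNReal.ofReal (∫ y, ψ y ∂(n j)) := (ofReal_integral_eq_lintegral_ofReal
        (h1.integrable_of_hasCompactSupport h2) (Eventually.of_forall h3)).symm
    _ ≤ _ := ENNReal.ofReal_le_ofReal hj.le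

/-- A diagonal choice along a countable neighbourhood basis of π; the indices j k tend to infinity
but need not be increasing. -/
theorem exists_seq_coupling (hM : M.IsTame) {n : ℕ → Measure Y} {n' : Measure Y}
    (hn : WeaklyConverges n n') {D E : Set Y} (hD : IsCompact D) (hE : IsCompact E)
    {μ₀ μ₁ : ProbabilityMeasure Y} (hμ₀ : (μ₀ : Measure Y) Dᶜ = 0) (hμ₁ : (μ₁ : Measure Y) Eᶜ = 0)
    (he0 : InEntropyDomain (μ₀ : Measure Y) n') (he1 : InEntropyDomain (μ₁ : Measure Y) n')
    {π : ProbabilityMeasure (Y × Y)} (hπ : π ∈ M.causalCouplings μ₀ μ₁)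
    (hsep : ∀ᵐ z ∂(π : Measure (Y × Y)), 0 < M.sep z) :
    ∃ (j : ℕ → ℕ) (σ : ℕ → ProbabilityMeasure (Y × Y)) (ν₀ ν₁ : ℕ → ProbabilityMeasure Y),
      Tendsto j atTop atTop ∧ Tendsto σ atTop (𝓝 π) ∧
      (∀ k, σ k ∈ M.causalCouplings (ν₀ k) (ν₁ k)) ∧
      (∀ k, (ν₀ k : Measure Y) (Metric.cthickening 1 D)ᶜ = 0) ∧
      (∀ k, (ν₁ k : Measure Y) (Metric.cthickening 1 E)ᶜ = 0) ∧
      (∀ k, InEntropyDomain (ν₀ k : Measure Y) (n (j k)) ∧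
        ent (ν₀ k : Measure Y) (n (j k)) ≤ ent (μ₀ : Measure Y) n' + 1 / ((k : ℝ) + 1)) ∧
      (∀ k, InEntropyDomain (ν₁ k : Measure Y) (n (j k)) ∧
        ent (ν₁ k : Measure Y) (n (j k)) ≤ ent (μ₁ : Measure Y) n' + 1 / ((k : ℝ) + 1)) := by
  obtain ⟨W, hW⟩ := (𝓝 π).exists_antitone_basis
  have hex : ∀ k : ℕ, ∃ (j : ℕ) (σ : ProbabilityMeasure (Y × Y)) (ν₀ ν₁ : ProbabilityMeasure Y),
      k ≤ j ∧ σ ∈ W k ∧ σ ∈ M.causalCouplings ν₀ ν₁ ∧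
      (ν₀ : Measure Y) (Metric.cthickening 1 D)ᶜ = 0 ∧
      (ν₁ : Measure Y) (Metric.cthickening 1 E)ᶜ = 0 ∧
      (InEntropyDomain (ν₀ : Measure Y) (n j) ∧
        ent (ν₀ : Measure Y) (n j) ≤ ent (μ₀ : Measure Y) n' + 1 / ((k : ℝ) + 1)) ∧
      (InEntropyDomain (ν₁ : Measure Y) (n j) ∧
        ent (ν₁ : Measure Y) (n j) ≤ ent (μ₁ : Measure Y) n' + 1 / ((k : ℝ) + 1)) := fun k => by
    obtain ⟨j, h1, σ, h2, ν₀, ν₁, h3⟩ := ((eventually_ge_atTop k).and (eventually_exists_coupling hM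
      hn hD hE hμ₀ hμ₁ he0 he1 hπ hsep (hW.1.mem_of_mem (i := k) trivial)
      (show 0 < 1 / ((k : ℝ) + 1) by positivity))).exists
    exact ⟨j, σ, ν₀, ν₁, h1, h2, h3⟩
  choose j σ ν₀ ν₁ h1 h2 h3 h4 h5 h6 h7 using hex
  exact ⟨j, σ, ν₀, ν₁, tendsto_atTop_mono h1 tendsto_id, hW.tendsto h2, h3, h4, h5, h6, h7⟩

/-- A pair all of whose maximal couplings are timelike is a limit of pairs of almost the same
entropy with timelike maximal couplings. -/
theorem exists_timelike_approximation (hM : M.IsTame) {n : ℕ → Measure Y} {n' : Measure Y}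
    (hn : WeaklyConverges n n') {p : ℝ} (hp : 0 ≤ p) {D E : Set Y} (hD : IsCompact D)
    (hE : IsCompact E) {μ₀ μ₁ : ProbabilityMeasure Y} (hμ₀ : (μ₀ : Measure Y) Dᶜ = 0)
    (hμ₁ : (μ₁ : Measure Y) Eᶜ = 0) (he0 : InEntropyDomain (μ₀ : Measure Y) n')
    (he1 : InEntropyDomain (μ₁ : Measure Y) n') {π : ProbabilityMeasure (Y × Y)}
    (hπ : M.IsMaximal p μ₀ μ₁ π)
    (hsep : ∀ ϖ, M.IsMaximal p μ₀ μ₁ ϖ → ∀ᵐ z ∂(ϖ : Measure (Y × Y)), 0 < M.sep z) :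
    ∃ (l : Ultrafilter ℕ) (j : ℕ → ℕ) (ν₀ ν₁ : ℕ → ProbabilityMeasure Y)
      (ξ : ℕ → ProbabilityMeasure (Y × Y)), Tendsto j l atTop ∧
      Tendsto ν₀ l (𝓝 μ₀) ∧ Tendsto ν₁ l (𝓝 μ₁) ∧
      Tendsto (fun k => M.gain p (ξ k)) l (𝓝 (M.gain p π)) ∧
      (∀ᶠ k in l, (ν₀ k : Measure Y) (Metric.cthickening 1 D)ᶜ = 0 ∧
        (ν₁ k : Measure Y) (Metric.cthickening 1 E)ᶜ = 0 ∧
        M.IsMaximal p (ν₀ k) (ν₁ k) (ξ k) ∧ ∀ᵐ z ∂(ξ k : Measure (Y × Y)), 0 < M.sep z) ∧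
      ∀ δ > 0, ∀ᶠ k in l, (InEntropyDomain (ν₀ k : Measure Y) (n (j k)) ∧
        ent (ν₀ k : Measure Y) (n (j k)) ≤ ent (μ₀ : Measure Y) n' + δ) ∧
        (InEntropyDomain (ν₁ k : Measure Y) (n (j k)) ∧
        ent (ν₁ k : Measure Y) (n (j k)) ≤ ent (μ₁ : Measure Y) n' + δ) := by
  obtain ⟨j, σ, ν₀, ν₁, hj, hσ, hcc, hν₀, hν₁, hd0, hd1⟩ := exists_seq_coupling hM hn hD hE hμ₀ hμ₁
    he0 he1 hπ.1 (hsep π hπ)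
  set l : Ultrafilter ℕ := hyperfilter ℕ with hl
  have hlt : (l : Filter ℕ) ≤ atTop := Nat.hyperfilter_le_atTop
  have hD1 : IsCompact (Metric.cthickening 1 D) := hD.cthickening
  have hE1 : IsCompact (Metric.cthickening 1 E) := hE.cthickening
  have hν₀lim : Tendsto ν₀ l (𝓝 μ₀) := by
    have := ProbabilityMeasure.tendsto_map_of_tendsto_of_continuous σ π (hσ.mono_left hlt)
      continuous_fst
    have e : ∀ k, (σ k).map measurable_fst.aemeasurable = ν₀ k := fun k =>
      ProbabilityMeasure.toMeasure_injective (hcc k).1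
    have e' : π.map measurable_fst.aemeasurable = μ₀ :=
      ProbabilityMeasure.toMeasure_injective hπ.1.1
    simpa only [e, e'] using this
  have hν₁lim : Tendsto ν₁ l (𝓝 μ₁) := by
    have := ProbabilityMeasure.tendsto_map_of_tendsto_of_continuous σ π (hσ.mono_left hlt)
      continuous_snd
    have e : ∀ k, (σ k).map measurable_snd.aemeasurable = ν₁ k := fun k =>
      ProbabilityMeasure.toMeasure_injective (hcc k).2.1
    have e' : π.map measurable_snd.aemeasurable = μ₁ :=
      ProbabilityMeasure.toMeasure_injective hπ.1.2.1
    simpa only [e, e'] using this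
  choose ξ hξ using fun k => exists_isMaximal hM.closed hM.cont hp hD1 hE1 (hν₀ k) (hν₁ k)
    ⟨σ k, hcc k⟩
  obtain ⟨ϖ, hϖ, hϖcar, hξlim⟩ := exists_tendsto_causalCouplings hM.closed l hD1 hE1 hν₀lim hν₁lim
    (Eventually.of_forall hν₀) (Eventually.of_forall hν₁) (Eventually.of_forall fun k => (hξ k).1)
  have hcont := continuous_sep_rpow hM.cont hp
  have hcar : ∀ {k : ℕ} {π' : ProbabilityMeasure (Y × Y)}, π' ∈ M.causalCouplings (ν₀ k) (ν₁ k) →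
      (π' : Measure (Y × Y)) (Metric.cthickening 1 D ×ˢ Metric.cthickening 1 E)ᶜ = 0 := fun h =>
    causalCouplings_carried h hD1.measurableSet hE1.measurableSet (hν₀ _) (hν₁ _)
  have hgξ : Tendsto (fun k => M.gain p (ξ k)) l (𝓝 (M.gain p ϖ)) :=
    tendsto_integral_of_carried (hD1.prod hE1) hξlim (Eventually.of_forall fun k => hcar (hξ k).1)
      hcont
  have hgσ : Tendsto (fun k => M.gain p (σ k)) l (𝓝 (M.gain p π)) :=
    tendsto_integral_of_carried (hD1.prod hE1) (hσ.mono_left hlt)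
      (Eventually.of_forall fun k => hcar (hcc k)) hcont
  -- The smoothed couplings σ k compete with ξ k and converge to π, so the limit ϖ is maximal and
  -- therefore timelike.
  have hge : M.gain p π ≤ M.gain p ϖ :=
    le_of_tendsto_of_tendsto' hgσ hgξ fun k => (hξ k).2 _ (hcc k)
  have hgeq : M.gain p ϖ = M.gain p π := le_antisymm (hπ.2 ϖ hϖ) hge
  have hϖmax : M.IsMaximal p μ₀ μ₁ ϖ := ⟨hϖ, fun π' h => (hπ.2 π' h).trans hge⟩
  set A : Set (Y × Y) := {z | 0 < M.sep z} with hA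
  have hAo : IsOpen A := isOpen_lt continuous_const hM.cont
  -- The timelike set is open and has full measure for ϖ. Hence ξ k almost fills it, and its
  -- restriction there remains maximal by `IsMaximal.of_add`.
  have hξA : Tendsto (fun k => (ξ k : Measure (Y × Y)) A) l (𝓝 1) := by
    have h1 := ProbabilityMeasure.le_liminf_measure_open_of_tendsto hξlim hAo
    rw [(prob_compl_eq_zero_iff hAo.measurableSet).1 (hsep ϖ hϖmax)] at h1
    exact tendsto_of_le_liminf_of_limsup_le h1
      (limsup_le_of_le (h := Eventually.of_forall fun k => prob_le_one))
  have hne : ∀ᶠ k in (l : Filter ℕ), (ξ k : Measure (Y × Y)) A ≠ 0 := hξA.eventually_ne one_ne_zero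
  have hex : ∀ k, ∃ (π' : ProbabilityMeasure (Y × Y)) (μ' ν' : ProbabilityMeasure Y),
      (ξ k : Measure (Y × Y)) A ≠ 0 →
      (π' : Measure (Y × Y)) = ProbabilityTheory.cond (ξ k : Measure (Y × Y)) A ∧
      π' ∈ M.causalCouplings μ' ν' ∧
      (ξ k : Measure (Y × Y)) = (ξ k : Measure (Y × Y)) A • (π' : Measure (Y × Y)) +
        (ξ k : Measure (Y × Y)).restrict Aᶜ ∧
      (ξ k : Measure (Y × Y)) A • (μ' : Measure Y) ≤ ν₀ k ∧
      (ξ k : Measure (Y × Y)) A • (ν' : Measure Y) ≤ ν₁ k := fun k => by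
    by_cases h : (ξ k : Measure (Y × Y)) A = 0
    · exact ⟨ξ k, ν₀ k, ν₁ k, fun h' => absurd h h'⟩
    · obtain ⟨π', μ', ν', h⟩ := exists_restriction (hξ k).1 hAo.measurableSet h
      exact ⟨π', μ', ν', fun _ => h⟩
  choose ξ' ν₀' ν₁' hξ' using hex
  have hξ'lim : Tendsto ξ' l (𝓝 ϖ) := tendsto_of_eq_smul_add hξlim hξA
    (hne.mono fun k hk => ⟨_, (hξ' k hk).2.2.1⟩)
  have hnull : ∀ {k : ℕ} {μ ν : ProbabilityMeasure Y} {K : Set Y},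
      (ξ k : Measure (Y × Y)) A ≠ 0 →
      (ξ k : Measure (Y × Y)) A • (ν : Measure Y) ≤ μ → (μ : Measure Y) Kᶜ = 0 →
      (ν : Measure Y) Kᶜ = 0 := fun {k μ ν K} hk h h0 => by
    have := le_antisymm ((h Kᶜ).trans h0.le) zero_le
    rw [Measure.smul_apply, smul_eq_mul, mul_eq_zero] at this
    exact this.resolve_left hk
  have hreal : Tendsto (fun k => ((ξ k : Measure (Y × Y)) A).toReal) l (𝓝 1) :=
    (ENNReal.tendsto_toReal ENNReal.one_ne_top).comp hξA
  have hent : ∀ (e : ℝ) (C : Set Y), IsCompact C → ∀ (ν ν' : ℕ → ProbabilityMeasure Y),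
      (∀ k, (ν k : Measure Y) Cᶜ = 0) →
      (∀ k, InEntropyDomain (ν k : Measure Y) (n (j k)) ∧
        ent (ν k : Measure Y) (n (j k)) ≤ e + 1 / ((k : ℝ) + 1)) →
      (∀ᶠ k in (l : Filter ℕ), (ξ k : Measure (Y × Y)) A • (ν' k : Measure Y) ≤ ν k) →
      ∀ δ > 0, ∀ᶠ k in (l : Filter ℕ), InEntropyDomain (ν' k : Measure Y) (n (j k)) ∧
        ent (ν' k : Measure Y) (n (j k)) ≤ e + δ := by
    intro e C hC ν ν' hν hd hle δ hδ
    obtain ⟨B, hB, hnB⟩ := eventually_measure_le hn hC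
    have h := eventually_ent_le_of_smul_le (Z := Y) (E := e + δ / 2) hB (half_pos hδ)
      hC.measurableSet
    have hk0 := hlt ((tendsto_one_div_add_atTop_nhds_zero_nat (𝕜 := ℝ)).eventually
      (gt_mem_nhds (half_pos hδ)))
    filter_upwards [hreal.eventually h, (hj.mono_left hlt).eventually hnB, hle, hk0] with k a1 a2 a3 a4
    have := hn.1 (j k)
    obtain ⟨b1, b2⟩ := a1 (n (j k)) (ν k) (ν' k)
      (by rwa [ENNReal.ofReal_toReal (measure_ne_top _ _)]) (hν k) a2 (hd k).1
      ((hd k).2.trans (by gcongr))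
    exact ⟨b1, by linarith⟩
  refine ⟨l, j, ν₀', ν₁', ξ', hj.mono_left hlt, ?_, ?_, ?_, ?_, fun δ hδ => ?_⟩
  · have := ProbabilityMeasure.tendsto_map_of_tendsto_of_continuous ξ' ϖ hξ'lim continuous_fst
    have e' : ϖ.map measurable_fst.aemeasurable = μ₀ :=
      ProbabilityMeasure.toMeasure_injective hϖ.1
    rw [e'] at this
    refine this.congr' (hne.mono fun k hk => ?_)
    exact ProbabilityMeasure.toMeasure_injective (hξ' k hk).2.1.1
  · have := ProbabilityMeasure.tendsto_map_of_tendsto_of_continuous ξ' ϖ hξ'lim continuous_snd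
    have e' : ϖ.map measurable_snd.aemeasurable = μ₁ :=
      ProbabilityMeasure.toMeasure_injective hϖ.2.1
    rw [e'] at this
    refine this.congr' (hne.mono fun k hk => ?_)
    exact ProbabilityMeasure.toMeasure_injective (hξ' k hk).2.1.2.1
  · rw [← hgeq]
    refine tendsto_integral_of_carried (hD1.prod hE1) hξ'lim (hne.mono fun k hk => ?_) hcont
    exact causalCouplings_carried (hξ' k hk).2.1 hD1.measurableSet hE1.measurableSet
      (hnull hk (hξ' k hk).2.2.2.1 (hν₀ k)) (hnull hk (hξ' k hk).2.2.2.2 (hν₁ k))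
  · filter_upwards [hne] with k hk
    obtain ⟨a1, a2, a3, a4, a5⟩ := hξ' k hk
    refine ⟨hnull hk a4 (hν₀ k), hnull hk a5 (hν₁ k), ?_, ?_⟩
    · exact (hξ k).of_add hM.cont hp hD1 hE1 (hν₀ k) (hν₁ k) hk (measure_ne_top _ _) a3 a2
    · rw [a1]
      exact ProbabilityTheory.ae_cond_mem hAo.measurableSet
  · exact (hent _ _ hD1 ν₀ ν₀' hν₀ hd0 (hne.mono fun k hk => (hξ' k hk).2.2.2.1) δ hδ).and
      (hent _ _ hE1 ν₁ ν₁' hν₁ hd1 (hne.mono fun k hk => (hξ' k hk).2.2.2.2) δ hδ)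

end LorentzianPreLength

end Stability

/-! ### Passage to the limit in the midpoint condition. -/

section LimitCurves

namespace LorentzianPreLength

variable {Y : Type u} [MetricSpace Y] [ProperSpace Y] [MeasurableSpace Y] [BorelSpace Y]
  {M : LorentzianPreLength Y}

/-- Stability of the midpoint condition, for pairs all of whose maximal couplings are timelike. -/
theorem exists_limit_curve (hM : M.IsTame) {n : ℕ → Measure Y} {n' : Measure Y}
    (hn : WeaklyConverges n n') {p K N : ℝ} (hp : p ∈ Ioo (0 : ℝ) 1) (hN : 0 < N)
    (hmid : ∀ j, M.MidpointCondition (n j) p K N) {D E : Set Y} (hD : IsCompact D)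
    (hE : IsCompact E) {μ₀ μ₁ : ProbabilityMeasure Y} (hμ₀ : (μ₀ : Measure Y) Dᶜ = 0)
    (hμ₁ : (μ₁ : Measure Y) Eᶜ = 0) (he0 : InEntropyDomain (μ₀ : Measure Y) n')
    (he1 : InEntropyDomain (μ₁ : Measure Y) n') {π₀ : ProbabilityMeasure (Y × Y)}
    (hπ₀ : M.IsMaximal p μ₀ μ₁ π₀)
    (hsep : ∀ ϖ, M.IsMaximal p μ₀ μ₁ ϖ → ∀ᵐ z ∂(ϖ : Measure (Y × Y)), 0 < M.sep z) :
    ∃ (π : ProbabilityMeasure (Y × Y)) (g : ℝ → ProbabilityMeasure Y), M.IsMaximal p μ₀ μ₁ π ∧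
      g 0 = μ₀ ∧ g 1 = μ₁ ∧
      (∀ s ∈ Icc (0 : ℝ) 1, ∀ t ∈ Icc (0 : ℝ) 1, s < t →
        M.HasCoupling p ((t - s) * M.gain p π₀ ^ (1 / p)) (g s) (g t)) ∧
      InEntropyDomain (g (1 / 2) : Measure Y) n' ∧
      Real.exp (K * (∫ z, M.sep z ^ 2 ∂(π : Measure (Y × Y))) / N / 8) *
        ((Real.exp (-(ent (μ₀ : Measure Y) n' / N)) +
          Real.exp (-(ent (μ₁ : Measure Y) n' / N))) / 2) ≤
        Real.exp (-(ent (g (1 / 2) : Measure Y) n' / N)) := by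
  obtain ⟨l, j, ν₀, ν₁, ϖ, hj, hν₀, hν₁, hgain, hgood, hent⟩ := exists_timelike_approximation hM hn
    hp.1.le hD hE hμ₀ hμ₁ he0 he1 hπ₀ hsep
  set D1 := Metric.cthickening 1 D
  set E1 := Metric.cthickening 1 E
  have hD1 : IsCompact D1 := hD.cthickening
  have hE1 : IsCompact E1 := hE.cthickening
  set C := M.futureJ D1 ∩ M.pastJ E1 with hCdef
  have hC : IsCompact C := hM.diamond _ _ hD1 hE1
  have hex : ∀ k, ∃ (π : ProbabilityMeasure (Y × Y)) (g : ℝ → ProbabilityMeasure Y),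
      ((ν₀ k : Measure Y) D1ᶜ = 0 ∧ (ν₁ k : Measure Y) E1ᶜ = 0 ∧
        M.IsMaximal p (ν₀ k) (ν₁ k) (ϖ k) ∧ ∀ᵐ z ∂(ϖ k : Measure (Y × Y)), 0 < M.sep z) →
      InEntropyDomain (ν₀ k : Measure Y) (n (j k)) → InEntropyDomain (ν₁ k : Measure Y) (n (j k)) →
      M.IsMaximal p (ν₀ k) (ν₁ k) π ∧ g 0 = ν₀ k ∧ g 1 = ν₁ k ∧
      M.IsCurve p (M.gain p (ϖ k) ^ (1 / p)) C g ∧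
      InEntropyDomain (g (1 / 2) : Measure Y) (n (j k)) ∧
      Real.exp (K * (∫ z, M.sep z ^ 2 ∂(π : Measure (Y × Y))) / N / 8) *
        ((Real.exp (-(ent (ν₀ k : Measure Y) (n (j k)) / N)) +
          Real.exp (-(ent (ν₁ k : Measure Y) (n (j k)) / N))) / 2) ≤
        Real.exp (-(ent (g (1 / 2) : Measure Y) (n (j k)) / N)) := fun k => by
    by_cases h : ((ν₀ k : Measure Y) D1ᶜ = 0 ∧ (ν₁ k : Measure Y) E1ᶜ = 0 ∧
        M.IsMaximal p (ν₀ k) (ν₁ k) (ϖ k) ∧ ∀ᵐ z ∂(ϖ k : Measure (Y × Y)), 0 < M.sep z) ∧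
      InEntropyDomain (ν₀ k : Measure Y) (n (j k)) ∧ InEntropyDomain (ν₁ k : Measure Y) (n (j k))
    · obtain ⟨π, g, h'⟩ := hmid (j k) D1 E1 hD1 hE1 (ν₀ k) (ν₁ k) h.1.1 h.1.2.1 h.2.1 h.2.2 (ϖ k)
        h.1.2.2.1 h.1.2.2.2
      exact ⟨π, g, fun _ _ _ => h'⟩
    · exact ⟨ϖ k, fun _ => ν₀ k, fun a b c => absurd ⟨a, b, c⟩ h⟩
  choose π g hπg using hex
  have hgood' : ∀ᶠ k in (l : Filter ℕ), ((ν₀ k : Measure Y) D1ᶜ = 0 ∧ (ν₁ k : Measure Y) E1ᶜ = 0 ∧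
      M.IsMaximal p (ν₀ k) (ν₁ k) (ϖ k)) ∧ M.IsMaximal p (ν₀ k) (ν₁ k) (π k) ∧ g k 0 = ν₀ k ∧
      g k 1 = ν₁ k ∧
      M.IsCurve p (M.gain p (ϖ k) ^ (1 / p)) C (g k) ∧
      InEntropyDomain (g k (1 / 2) : Measure Y) (n (j k)) ∧
      Real.exp (K * (∫ z, M.sep z ^ 2 ∂(π k : Measure (Y × Y))) / N / 8) *
        ((Real.exp (-(ent (ν₀ k : Measure Y) (n (j k)) / N)) +
          Real.exp (-(ent (ν₁ k : Measure Y) (n (j k)) / N))) / 2) ≤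
        Real.exp (-(ent (g k (1 / 2) : Measure Y) (n (j k)) / N)) := by
    filter_upwards [hgood, hent 1 one_pos] with k h1 h2
    exact ⟨⟨h1.1, h1.2.1, h1.2.2.1⟩, hπg k h1 h2.1.1 h2.2.1⟩
  obtain ⟨π', hπ', -, hπlim⟩ := exists_tendsto_causalCouplings hM.closed l hD1 hE1 hν₀ hν₁
    (hgood'.mono fun k h => h.1.1) (hgood'.mono fun k h => h.1.2.1)
    (hgood'.mono fun k h => h.2.1.1)
  have hcar : ∀ᶠ k in (l : Filter ℕ), (π k : Measure (Y × Y)) (D1 ×ˢ E1)ᶜ = 0 := hgood'.mono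
    fun k h => causalCouplings_carried h.2.1.1 hD1.measurableSet hE1.measurableSet h.1.1 h.1.2.1
  have hgπ : M.gain p π' = M.gain p π₀ := by
    refine tendsto_nhds_unique (tendsto_integral_of_carried (hD1.prod hE1) hπlim hcar
      (continuous_sep_rpow hM.cont hp.1.le)) (hgain.congr' (hgood'.mono fun k h => ?_))
    exact le_antisymm (h.2.1.2 _ h.1.2.2.1) (h.1.2.2.2 _ h.2.1.1)
  have hI : Tendsto (fun k => ∫ z, M.sep z ^ 2 ∂(π k : Measure (Y × Y))) l
      (𝓝 (∫ z, M.sep z ^ 2 ∂(π' : Measure (Y × Y)))) :=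
    tendsto_integral_of_carried (hD1.prod hE1) hπlim hcar (hM.cont.pow 2)
  -- One ultrafilter provides limits at all times simultaneously; no equicontinuity in time is
  -- needed.
  have hlim : ∀ t, ∃ γ : ProbabilityMeasure Y, t ∈ Icc (0 : ℝ) 1 →
      Tendsto (fun k => g k t) l (𝓝 γ) := fun t => by
    by_cases ht : t ∈ Icc (0 : ℝ) 1
    · obtain ⟨γ, -, h⟩ := exists_tendsto_of_carried l hC (μ := fun k => g k t)
        (hgood'.mono fun k h => h.2.2.2.2.1.carried t ht)
      exact ⟨γ, fun _ => h⟩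
    · exact ⟨μ₀, fun h => absurd h ht⟩
  choose γ hγ using hlim
  have hℓ : Tendsto (fun k => M.gain p (ϖ k) ^ (1 / p)) l (𝓝 (M.gain p π₀ ^ (1 / p))) :=
    hgain.rpow_const (Or.inr (by have := hp.1; positivity))
  refine ⟨π', γ, ⟨hπ', fun ξ hξ => hgπ ▸ hπ₀.2 ξ hξ⟩, ?_, ?_, fun s hs t ht hst => ?_, ?_⟩
  · exact tendsto_nhds_unique (hγ 0 (by simp)) (hν₀.congr' (hgood'.mono fun k h => h.2.2.1.symm))
  · exact tendsto_nhds_unique (hγ 1 (by simp)) (hν₁.congr' (hgood'.mono fun k h => h.2.2.2.1.symm))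
  · exact HasCoupling.of_tendsto hM.closed hM.cont hp.1.le l hC (hγ s hs) (hγ t ht)
      (hℓ.const_mul (t - s)) (hgood'.mono fun k h => h.2.2.2.2.1.carried s hs)
      (hgood'.mono fun k h => h.2.2.2.2.1.carried t ht)
      (hgood'.mono fun k h => h.2.2.2.2.1.hasCoupling s hs t ht hst)
  · set I := ∫ z, M.sep z ^ 2 ∂(π' : Measure (Y × Y)) with hIdef
    set e0 := ent (μ₀ : Measure Y) n'
    set e1 := ent (μ₁ : Measure Y) n'
    set F : ℝ → ℝ → ℝ := fun x δ => Real.exp (K * x / N / 8) *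
      ((Real.exp (-((e0 + δ) / N)) + Real.exp (-((e1 + δ) / N))) / 2) with hF
    have hFpos : ∀ x δ, 0 < F x δ := fun x δ => by positivity
    have hhalf : (1 / 2 : ℝ) ∈ Icc (0 : ℝ) 1 := by norm_num [mem_Icc]
    have hn' : IsFiniteMeasureOnCompacts n' := hn.2.1
    have hnj : ∀ k, IsFiniteMeasureOnCompacts (n (j k)) := fun k => hn.1 (j k)
    -- The midpoint inequality is rewritten as an upper bound for the entropy at time 1/2, with
    -- slack δ in the end entropies, and passes to the limit by lower semicontinuity. The slack then
    -- tends to 0.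
    have key : ∀ δ > 0, InEntropyDomain (γ (1 / 2) : Measure Y) n' ∧
        ent (γ (1 / 2) : Measure Y) n' ≤ -N * Real.log (F I δ) + δ := fun δ hδ => by
      refine ent_le_of_tendsto (l := (l : Filter ℕ)) (n := fun k => n (j k))
        (fun φ h1 h2 => (hn.2.2 φ h1 h2).comp hj) (hγ _ hhalf) hC
        (hgood'.mono fun k h => h.2.2.2.2.1.carried _ hhalf) ?_
      have hcont : ContinuousAt (fun x => -N * Real.log (F x δ)) I := by
        refine continuousAt_const.mul (ContinuousAt.log ?_ (hFpos I δ).ne')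
        fun_prop
      filter_upwards [hgood', hent δ hδ, (hcont.tendsto.comp hI).eventually
        (gt_mem_nhds (show _ < -N * Real.log (F I δ) + δ by linarith))] with k h1 h2 h3
      obtain ⟨-, -, -, -, -, h5, h6⟩ := h1
      refine ⟨h5, _root_.le_trans ?_ h3.le⟩
      have h7 : F (∫ z, M.sep z ^ 2 ∂(π k : Measure (Y × Y))) δ ≤
          Real.exp (-(ent (g k (1 / 2) : Measure Y) (n (j k)) / N)) := by
        refine _root_.le_trans ?_ h6
        simp only [hF]
        gcongr
        · exact h2.1.2
        · exact h2.2.2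
      have h8 := Real.log_le_log (hFpos _ _) h7
      rw [Real.log_exp] at h8
      have h9 : N * Real.log (F (∫ z, M.sep z ^ 2 ∂(π k : Measure (Y × Y))) δ) ≤
          N * -(ent (g k (1 / 2) : Measure Y) (n (j k)) / N) := by gcongr
      have h10 : N * -(ent (g k (1 / 2) : Measure Y) (n (j k)) / N) =
          -ent (g k (1 / 2) : Measure Y) (n (j k)) := by field_simp
      simp only [Function.comp]
      linarith
    refine ⟨(key 1 one_pos).1, ?_⟩
    have hcont : ContinuousAt (fun δ => -N * Real.log (F I δ) + δ) 0 := by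
      refine ContinuousAt.add (continuousAt_const.mul (ContinuousAt.log ?_ (hFpos I 0).ne'))
        continuousAt_id
      fun_prop
    have hle : ent (γ (1 / 2) : Measure Y) n' ≤ -N * Real.log (F I 0) + 0 := by
      refine ge_of_tendsto (hcont.tendsto.mono_left (nhdsWithin_le_nhds (s := Ioi 0))) ?_
      filter_upwards [self_mem_nhdsWithin] with δ hδ using (key δ hδ).2
    have hF0 : F I 0 = Real.exp (K * I / N / 8) *
        ((Real.exp (-(e0 / N)) + Real.exp (-(e1 / N))) / 2) := by simp [hF]
    rw [← hF0, ← Real.exp_log (hFpos I 0), Real.exp_le_exp]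
    rw [le_neg, div_le_iff₀ hN]
    linarith

end LorentzianPreLength

end LimitCurves

/-! ### Lexicographic maximisation on a compact set. -/

section LexicographicMaximum

/-- Maximising S 0, then S 1 among its maximisers, and so on, gives a decreasing sequence of
nonempty compact sets by upper semicontinuity; any common point works. -/
theorem IsCompact.exists_lexicographic_max {α : Type u} [TopologicalSpace α] [T2Space α] {G : Set α}
    (hG : IsCompact G) (hne : G.Nonempty) {S : ℕ → α → ℝ}
    (hS : ∀ n, UpperSemicontinuousOn (S n) G) :
    ∃ g ∈ G, ∀ n, ∀ g' ∈ G, (∀ m < n, S m g ≤ S m g') → S n g' ≤ S n g := by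
  set A : ℕ → Set α := fun n =>
    Nat.rec G (fun n B => {g ∈ B | ∀ g' ∈ B, S n g' ≤ S n g}) n with hA
  have hA0 : A 0 = G := rfl
  have hA1 : ∀ n, A (n + 1) = {g ∈ A n | ∀ g' ∈ A n, S n g' ≤ S n g} := fun n => rfl
  have hstep : ∀ n, IsCompact (A n) ∧ (A n).Nonempty ∧ A n ⊆ G := by
    intro n
    induction n with
    | zero => exact ⟨hG, hne, subset_rfl⟩
    | succ n ih =>
      obtain ⟨h1, h2, h3⟩ := ih
      have husc := (hS n).mono h3
      obtain ⟨a, ha, hmax⟩ := husc.exists_isMaxOn h2 h1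
      obtain ⟨v, hv, hv'⟩ := upperSemicontinuousOn_iff_preimage_Ici.1 husc (S n a)
      have e : A (n + 1) = A n ∩ v := by
        rw [hA1, ← hv']
        ext g
        exact ⟨fun h => ⟨h.1, h.2 a ha⟩, fun h => ⟨h.1, fun g' hg' => (hmax hg').trans h.2⟩⟩
      refine ⟨e ▸ h1.inter_right hv, ⟨a, ?_⟩, fun g hg => h3 ?_⟩
      · rw [hA1]; exact ⟨ha, fun g' hg' => hmax hg'⟩
      · rw [hA1] at hg; exact hg.1
  obtain ⟨g, hg⟩ := IsCompact.nonempty_iInter_of_sequence_nonempty_isCompact_isClosed A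
    (fun n => by rw [hA1]; exact sep_subset _ _) (fun n => (hstep n).2.1) hG
    (fun n => (hstep n).1.isClosed)
  rw [mem_iInter] at hg
  refine ⟨g, hg 0, fun n g' hg' h => ?_⟩
  have hmem : ∀ m ≤ n, g' ∈ A m := by
    intro m
    induction m with
    | zero => exact fun _ => hg'
    | succ m ih =>
      intro hm
      rw [hA1]
      have h1 := hg (m + 1)
      rw [hA1] at h1
      exact ⟨ih (by omega), fun g'' h'' => (h1.2 g'' h'').trans (h m (by omega))⟩
  have h1 := hg (n + 1)
  rw [hA1] at h1
  exact h1.2 g' (hmem n le_rfl)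

end LexicographicMaximum

/-! ### Upper semicontinuity of the entropy power. -/

section EntropyPower

variable {Y : Type u} [MetricSpace Y] [ProperSpace Y] [MeasurableSpace Y] [BorelSpace Y]

open Classical in
/-- The entropy power `exp(-Ent(μ|n)/N)`, equal to `0` outside the domain of the entropy. -/
noncomputable def entropyPower (N : ℝ) (n : Measure Y) (μ : ProbabilityMeasure Y) : ℝ :=
  if InEntropyDomain (μ : Measure Y) n then Real.exp (-(ent (μ : Measure Y) n / N)) else 0

theorem entropyPower_of_inEntropyDomain {N : ℝ} {n : Measure Y} {μ : ProbabilityMeasure Y}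
    (h : InEntropyDomain (μ : Measure Y) n) :
    entropyPower N n μ = Real.exp (-(ent (μ : Measure Y) n / N)) := if_pos h

theorem entropyPower_nonneg (N : ℝ) (n : Measure Y) (μ : ProbabilityMeasure Y) :
    0 ≤ entropyPower N n μ := by
  unfold entropyPower
  split_ifs
  exacts [(Real.exp_pos _).le, le_rfl]

theorem entropyPower_pos_iff {N : ℝ} {n : Measure Y} {μ : ProbabilityMeasure Y} :
    0 < entropyPower N n μ ↔ InEntropyDomain (μ : Measure Y) n := by
  unfold entropyPower
  split_ifs with h
  · exact iff_of_true (Real.exp_pos _) h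
  · exact iff_of_false (lt_irrefl _) h

/-- A positive lower bound is an upper bound for the entropy, which is lower semicontinuous. The
value 0 at infinite entropy makes other bounds trivial. -/
theorem le_entropyPower_of_tendsto {ι : Type*} {l : Filter ι} [l.NeBot] {N : ℝ} (hN : 0 < N)
    {n : Measure Y} [IsFiniteMeasureOnCompacts n] {μ : ι → ProbabilityMeasure Y}
    {μ' : ProbabilityMeasure Y} (hμ : Tendsto μ l (𝓝 μ')) {D : Set Y} (hD : IsCompact D)
    (hμD : ∀ᶠ i in l, (μ i : Measure Y) Dᶜ = 0) {c : ℝ}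
    (hc : ∀ᶠ i in l, c ≤ entropyPower N n (μ i)) : c ≤ entropyPower N n μ' := by
  rcases le_or_gt c 0 with h0 | h0
  · exact h0.trans (entropyPower_nonneg _ _ _)
  obtain ⟨h1, h2⟩ := ent_le_of_tendsto (n := fun _ => n) (n' := n) (fun φ _ _ => tendsto_const_nhds)
    hμ hD hμD (c := -N * Real.log c) (by
      filter_upwards [hc] with i hi
      have hd := entropyPower_pos_iff.1 (h0.trans_le hi)
      refine ⟨hd, ?_⟩
      rw [entropyPower_of_inEntropyDomain hd, ← Real.log_le_iff_le_exp h0, le_neg,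
        div_le_iff₀ hN] at hi
      linarith)
  rw [entropyPower_of_inEntropyDomain h1, ← Real.log_le_iff_le_exp h0, le_neg, div_le_iff₀ hN]
  linarith

theorem upperSemicontinuousOn_entropyPower {N : ℝ} (hN : 0 < N) (n : Measure Y)
    [IsFiniteMeasureOnCompacts n] {D : Set Y} (hD : IsCompact D) :
    UpperSemicontinuousOn (entropyPower N n)
      {μ : ProbabilityMeasure Y | (μ : Measure Y) Dᶜ = 0} := by
  intro μ' hμ' y hy
  by_contra hcon
  rw [not_eventually] at hcon
  set A := {μ : ProbabilityMeasure Y | (μ : Measure Y) Dᶜ = 0}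
  set l := 𝓝[A] μ' ⊓ 𝓟 {μ | ¬ entropyPower N n μ < y}
  have hl : l.NeBot := Filter.frequently_mem_iff_neBot.1 hcon
  refine absurd (le_entropyPower_of_tendsto (l := l) (μ := id) hN
    ((tendsto_id.mono_left nhdsWithin_le_nhds).mono_left inf_le_left) hD
    (mem_inf_of_left (eventually_mem_nhdsWithin)) (c := y) ?_) (not_le.2 hy)
  exact mem_inf_of_right (mem_principal.2 fun μ hμ => not_lt.1 hμ)

end EntropyPower

/-! ### The compact space of curves, regularisation and splicing. -/

section CurveSpace

variable {Y : Type u} [MetricSpace Y] [ProperSpace Y] [MeasurableSpace Y] [BorelSpace Y]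
  {M : LorentzianPreLength Y}

namespace LorentzianPreLength

theorem HasCoupling.trans (hM : M.IsTame) {p : ℝ} (hp : p ∈ Ioo (0 : ℝ) 1) {D : Set Y}
    (hD : IsCompact D) {μ ν ρ : ProbabilityMeasure Y} (hμ : (μ : Measure Y) Dᶜ = 0)
    (hν : (ν : Measure Y) Dᶜ = 0) (hρ : (ρ : Measure Y) Dᶜ = 0) {a b : ℝ} (ha : 0 < a) (hb : 0 < b)
    (h1 : M.HasCoupling p a μ ν) (h2 : M.HasCoupling p b ν ρ) : M.HasCoupling p (a + b) μ ρ := by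
  obtain ⟨π₁, h1, h1'⟩ := h1
  obtain ⟨π₂, h2, h2'⟩ := h2
  obtain ⟨π, h3, h4, -⟩ := exists_glued_coupling hM.fin hM.cont hp hM.closed hD hμ hν hρ h1 h2 ha hb
    h1' h2'
  exact ⟨π, h3, h4⟩

/-- Diamonds are causally convex, so spliced curves do not leave the compact set that carries the
original ones. -/
theorem diamond_diamond_subset (D E : Set Y) :
    M.futureJ (M.futureJ D ∩ M.pastJ E) ∩ M.pastJ (M.futureJ D ∩ M.pastJ E) ⊆
      M.futureJ D ∩ M.pastJ E := by
  rintro y ⟨⟨x, ⟨⟨x', hx', h1⟩, -⟩, h2⟩, ⟨z, ⟨-, ⟨z', hz', h3⟩⟩, h4⟩⟩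
  exact ⟨⟨x', hx', M.le_trans _ _ _ h1 h2⟩, ⟨z', hz', M.le_trans _ _ _ h4 h3⟩⟩

/-- The curves from `ν₀` to `ν₁` in the space of probability measures on `C` along which the
transport cost between times `s < t` is at least `(t - s) ℓ`. -/
def curveSpace (M : LorentzianPreLength Y) (p ℓ : ℝ) (C : Set Y) (ν₀ ν₁ : ProbabilityMeasure Y) :
    Set (ℝ → ProbabilityMeasure Y) :=
  {g | (∀ t, (g t : Measure Y) Cᶜ = 0) ∧ g 0 = ν₀ ∧ g 1 = ν₁ ∧
    ∀ s ∈ Icc (0 : ℝ) 1, ∀ t ∈ Icc (0 : ℝ) 1, s < t → M.HasCoupling p ((t - s) * ℓ) (g s) (g t)}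

theorem isCurve_of_mem_curveSpace {p ℓ : ℝ} {C : Set Y} {ν₀ ν₁ : ProbabilityMeasure Y}
    {g : ℝ → ProbabilityMeasure Y} (hg : g ∈ M.curveSpace p ℓ C ν₀ ν₁) : M.IsCurve p ℓ C g :=
  ⟨fun t _ => hg.1 t, hg.2.2.2⟩

/-- Tychonoff's theorem over all real times, together with stability of the coupling bound under
limits. For this, curves are required to be carried by C outside [0, 1] as well. -/
theorem isCompact_curveSpace (hM : M.IsTame) {p : ℝ} (hp : 0 ≤ p) (ℓ : ℝ) {C : Set Y}
    (hC : IsCompact C) (ν₀ ν₁ : ProbabilityMeasure Y) :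
    IsCompact (M.curveSpace p ℓ C ν₀ ν₁) := by
  refine isCompact_iff_ultrafilter_le_nhds'.2 fun l hl => ?_
  obtain ⟨g, hg, hlim⟩ := (isCompact_univ_pi (s := fun _ : ℝ =>
    {μ : ProbabilityMeasure Y | (μ : Measure Y) Cᶜ = 0})
    fun _ => isCompact_carried hC).ultrafilter_le_nhds' l
      (mem_of_superset hl fun g hg t _ => hg.1 t)
  have hg' : ∀ t, Tendsto (fun g : ℝ → ProbabilityMeasure Y => g t) l (𝓝 (g t)) := fun t =>
    (continuous_apply t).continuousAt.tendsto.comp (tendsto_id.mono_left hlim)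
  refine ⟨g, ⟨fun t => hg t (mem_univ t), ?_, ?_, fun s hs t ht hst => ?_⟩, hlim⟩
  · exact tendsto_nhds_unique (hg' 0)
      (tendsto_const_nhds.congr' (mem_of_superset hl fun g hg => hg.2.1.symm))
  · exact tendsto_nhds_unique (hg' 1)
      (tendsto_const_nhds.congr' (mem_of_superset hl fun g hg => hg.2.2.1.symm))
  · exact HasCoupling.of_tendsto hM.closed hM.cont hp l hC (hg' s) (hg' t) tendsto_const_nhds
      (mem_of_superset hl fun g hg => hg.1 s) (mem_of_superset hl fun g hg => hg.1 t)
      (mem_of_superset hl fun g hg => hg.2.2.2 s hs t ht hst)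

theorem dyadic_floor_mem_Icc {t : ℝ} (ht : t ∈ Icc (0 : ℝ) 1) (k : ℕ) :
    (⌊t * 2 ^ k⌋ : ℝ) * (1 / 2) ^ k ∈ Icc (0 : ℝ) 1 := by
  have h0 : (0 : ℝ) ≤ ⌊t * 2 ^ k⌋ := by
    exact_mod_cast Int.floor_nonneg.2 (mul_nonneg ht.1 (by positivity))
  refine ⟨by positivity, ?_⟩
  calc (⌊t * 2 ^ k⌋ : ℝ) * (1 / 2) ^ k ≤ t * 2 ^ k * (1 / 2) ^ k := by gcongr; exact Int.floor_le _
    _ = t := by rw [mul_assoc, ← mul_pow]; norm_num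
    _ ≤ 1 := ht.2

theorem dyadic_floor_eq (n : ℕ) (i : ℤ) {k : ℕ} (hk : n ≤ k) :
    (⌊(i * (1 / 2) ^ n : ℝ) * 2 ^ k⌋ : ℝ) * (1 / 2) ^ k = i * (1 / 2) ^ n := by
  obtain ⟨m, rfl⟩ := Nat.exists_eq_add_of_le hk
  have e : (i * (1 / 2) ^ n : ℝ) * 2 ^ (n + m) = ((i * 2 ^ m : ℤ) : ℝ) := by
    push_cast
    rw [pow_add, one_div, inv_pow]
    field_simp
  rw [e, Int.floor_intCast, ← e, mul_assoc, ← mul_pow]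
  norm_num

/-- Any curve can be modified off the dyadic times so as to be a limit of its values at dyadic
times. -/
theorem exists_regularisation (hM : M.IsTame) {p : ℝ} (hp : 0 ≤ p) {ℓ : ℝ} {C : Set Y}
    (hC : IsCompact C) {ν₀ ν₁ : ProbabilityMeasure Y} {g : ℝ → ProbabilityMeasure Y}
    (hg : g ∈ M.curveSpace p ℓ C ν₀ ν₁) :
    ∃ (l : Ultrafilter ℕ) (g' : ℝ → ProbabilityMeasure Y), (l : Filter ℕ) ≤ atTop ∧
      g' ∈ M.curveSpace p ℓ C ν₀ ν₁ ∧
      (∀ (n : ℕ) (i : ℤ), g' (i * (1 / 2) ^ n) = g (i * (1 / 2) ^ n)) ∧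
      ∀ t, Tendsto (fun k : ℕ => g (⌊t * 2 ^ k⌋ * (1 / 2) ^ k)) l (𝓝 (g' t)) := by
  set l : Ultrafilter ℕ := Ultrafilter.of atTop
  have hl : (l : Filter ℕ) ≤ atTop := Ultrafilter.of_le _
  choose g' hg'C hg' using fun t : ℝ => exists_tendsto_of_carried l hC
    (μ := fun k : ℕ => g (⌊t * 2 ^ k⌋ * (1 / 2) ^ k)) (Eventually.of_forall fun k => hg.1 _)
  have heq : ∀ (n : ℕ) (i : ℤ), g' (i * (1 / 2) ^ n) = g (i * (1 / 2) ^ n) := fun n i => by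
    refine tendsto_nhds_unique (hg' _) (tendsto_const_nhds.congr' ?_)
    filter_upwards [hl (eventually_ge_atTop n)] with k hk
    rw [dyadic_floor_eq n i hk]
  refine ⟨l, g', hl, ⟨hg'C, ?_, ?_, fun s hs t ht hst => ?_⟩, heq, hg'⟩
  · have := heq 0 0; simp only [Int.cast_zero, zero_mul] at this; rw [this, hg.2.1]
  · have := heq 0 1; simp only [Int.cast_one, pow_zero, mul_one] at this; rw [this, hg.2.2.1]
  · have h1 := (tendsto_dyadic_floor s).mono_left hl
    have h2 := (tendsto_dyadic_floor t).mono_left hl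
    refine HasCoupling.of_tendsto hM.closed hM.cont hp l hC (hg' s) (hg' t)
      ((h2.sub h1).mul_const ℓ) (Eventually.of_forall fun k => hg.1 _)
      (Eventually.of_forall fun k => hg.1 _) ?_
    -- The dyadic approximations of s < t are eventually strictly ordered, and their gap tends to t
    -- - s.
    filter_upwards [h1.eventually_lt h2 hst] with k hk
    exact hg.2.2.2 _ (dyadic_floor_mem_Icc hs k) _ (dyadic_floor_mem_Icc ht k) hk

open Classical in
/-- A piece of a curve may be replaced by another curve with the same end points. -/
theorem splice_mem_curveSpace (hM : M.IsTame) {p : ℝ} (hp : p ∈ Ioo (0 : ℝ) 1) {ℓ : ℝ} (hℓ : 0 < ℓ)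
    {D E : Set Y} (hC : IsCompact (M.futureJ D ∩ M.pastJ E)) {ν₀ ν₁ : ProbabilityMeasure Y}
    {g f : ℝ → ProbabilityMeasure Y}
    (hg : g ∈ M.curveSpace p ℓ (M.futureJ D ∩ M.pastJ E) ν₀ ν₁) {a b : ℝ} (ha : 0 ≤ a) (hab : a < b)
    (hb : b ≤ 1) (h0 : f 0 = g a) (h1 : f 1 = g b)
    (hf : ∀ s ∈ Icc (0 : ℝ) 1, ∀ t ∈ Icc (0 : ℝ) 1, s < t →
      M.HasCoupling p ((t - s) * ((b - a) * ℓ)) (f s) (f t)) :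
    (fun t => if t ∈ Ioo a b then f ((t - a) / (b - a)) else g t) ∈
      M.curveSpace p ℓ (M.futureJ D ∩ M.pastJ E) ν₀ ν₁ := by
  set C := M.futureJ D ∩ M.pastJ E with hCdef
  set g' : ℝ → ProbabilityMeasure Y := fun t => if t ∈ Ioo a b then f ((t - a) / (b - a)) else g t
  have hba : 0 < b - a := sub_pos.2 hab
  have hin : ∀ t ∈ Icc a b, g' t = f ((t - a) / (b - a)) := fun t ht => by
    by_cases h : t ∈ Ioo a b
    · exact if_pos h
    · rw [show g' t = g t from if_neg h]
      rcases ht.1.eq_or_lt with rfl | h2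
      · simp [h0]
      · have : t = b := le_antisymm ht.2 (not_lt.1 fun h3 => h ⟨h2, h3⟩)
        rw [this, div_self hba.ne', h1]
  have hout : ∀ t, t ∉ Ioo a b → g' t = g t := fun t ht => if_neg ht
  have hr : ∀ t ∈ Icc a b, (t - a) / (b - a) ∈ Icc (0 : ℝ) 1 := fun t ht =>
    ⟨div_nonneg (sub_nonneg.2 ht.1) hba.le, (div_le_one hba).2 (by linarith [ht.2])⟩
  have hinner : ∀ s ∈ Icc a b, ∀ t ∈ Icc a b, s < t →
      M.HasCoupling p ((t - s) * ℓ) (g' s) (g' t) := fun s hs t ht hst => by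
    rw [hin s hs, hin t ht]
    have := hf _ (hr s hs) _ (hr t ht) (by gcongr)
    rwa [← mul_assoc, ← sub_div, div_mul_cancel₀ _ hba.ne', sub_sub_sub_cancel_right] at this
  have mab : a ∈ Icc a b := ⟨le_rfl, hab.le⟩
  have mba : b ∈ Icc a b := ⟨hab.le, le_rfl⟩
  have ma : a ∉ Ioo a b := fun h => lt_irrefl _ h.1
  have mb : b ∉ Ioo a b := fun h => lt_irrefl _ h.2
  -- Inside (a, b) the measure lies causally between g a and g b, and diamonds of C stay in C.
  have hcar : ∀ t, (g' t : Measure Y) Cᶜ = 0 := fun t => by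
    by_cases ht : t ∈ Ioo a b
    · obtain ⟨π₁, k1, -⟩ := hinner a mab t (Ioo_subset_Icc_self ht) ht.1
      obtain ⟨π₂, k2, -⟩ := hinner t (Ioo_subset_Icc_self ht) b mba ht.2
      rw [hout a ma] at k1
      rw [hout b mb] at k2
      refine measure_mono_null (compl_subset_compl.2 (diamond_diamond_subset D E)) ?_
      exact diamond_carried hM.closed k1 k2 hC hC (hg.1 a) (hg.1 b)
    · rw [hout t ht]; exact hg.1 t
  have houter : ∀ s ∈ Icc (0 : ℝ) 1, ∀ t ∈ Icc (0 : ℝ) 1, s < t → s ∉ Ioo a b → t ∉ Ioo a b →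
      M.HasCoupling p ((t - s) * ℓ) (g' s) (g' t) := fun s hs t ht hst hs' ht' => by
    rw [hout s hs', hout t ht']
    exact hg.2.2.2 s hs t ht hst
  -- A pair separated by a or b is handled by gluing there; the lower bounds on the cost add up.
  have htrans : ∀ s t u, s < t → t < u → M.HasCoupling p ((t - s) * ℓ) (g' s) (g' t) →
      M.HasCoupling p ((u - t) * ℓ) (g' t) (g' u) → M.HasCoupling p ((u - s) * ℓ) (g' s) (g' u) :=
    fun s t u hst htu k1 k2 => by
      have := HasCoupling.trans hM hp hC (hcar s) (hcar t) (hcar u)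
        (mul_pos (sub_pos.2 hst) hℓ) (mul_pos (sub_pos.2 htu) hℓ) k1 k2
      rwa [show (t - s) * ℓ + (u - t) * ℓ = (u - s) * ℓ by ring] at this
  have a01 : a ∈ Icc (0 : ℝ) 1 := ⟨ha, by linarith⟩
  have b01 : b ∈ Icc (0 : ℝ) 1 := ⟨by linarith, hb⟩
  refine ⟨hcar, ?_, ?_, fun s hs t ht hst => ?_⟩
  · rw [hout 0 fun h => absurd h.1 (not_lt.2 ha), hg.2.1]
  · rw [hout 1 fun h => absurd h.2 (not_lt.2 hb), hg.2.2.1]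
  by_cases hs' : s ∈ Ioo a b <;> by_cases ht' : t ∈ Ioo a b
  · exact hinner s (Ioo_subset_Icc_self hs') t (Ioo_subset_Icc_self ht') hst
  · have hbt : b ≤ t := not_lt.1 fun h => ht' ⟨hs'.1.trans hst, h⟩
    rcases hbt.eq_or_lt with rfl | hbt
    · exact hinner s (Ioo_subset_Icc_self hs') b mba hst
    · exact htrans s b t hs'.2 hbt (hinner s (Ioo_subset_Icc_self hs') b mba hs'.2)
        (houter b b01 t ht hbt mb ht')
  · have hsa : s ≤ a := not_lt.1 fun h => hs' ⟨h, hst.trans ht'.2⟩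
    rcases hsa.eq_or_lt with rfl | hsa
    · exact hinner s mab t (Ioo_subset_Icc_self ht') hst
    · exact htrans s a t hsa ht'.1 (houter s hs a a01 hsa hs' ma)
        (hinner a mab t (Ioo_subset_Icc_self ht') ht'.1)
  · exact houter s hs t ht hst hs' ht'

end LorentzianPreLength

end CurveSpace

/-! ### The optimal curve in the limit. -/

section OptimalCurve

variable {Y : Type u} [MetricSpace Y] [ProperSpace Y] [MeasurableSpace Y] [BorelSpace Y]
  {M : LorentzianPreLength Y}

namespace LorentzianPreLength

theorem IsMaximal.gain_eq {p : ℝ} {μ ν : ProbabilityMeasure Y} {π π' : ProbabilityMeasure (Y × Y)}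
    (h : M.IsMaximal p μ ν π) (h' : M.IsMaximal p μ ν π') : M.gain p π = M.gain p π' :=
  le_antisymm (h'.2 _ h.1) (h.2 _ h'.1)

theorem gain_rpow_rpow {p : ℝ} (hp : p ≠ 0) (π : ProbabilityMeasure (Y × Y)) :
    (M.gain p π ^ (1 / p)) ^ p = M.gain p π := by
  rw [← Real.rpow_mul (gain_nonneg p π), one_div_mul_cancel hp, Real.rpow_one]

/-- A continuous functional attains its minimum over the maximal couplings. -/
theorem exists_isMaximal_forall_le (hM : M.IsTame) {p : ℝ} (hp : 0 ≤ p) {D E : Set Y}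
    (hD : IsCompact D) (hE : IsCompact E) {μ ν : ProbabilityMeasure Y} (hμ : (μ : Measure Y) Dᶜ = 0)
    (hν : (ν : Measure Y) Eᶜ = 0) {π₀ : ProbabilityMeasure (Y × Y)} (h₀ : M.IsMaximal p μ ν π₀)
    {F : Y × Y → ℝ} (hF : Continuous F) :
    ∃ π, M.IsMaximal p μ ν π ∧ ∀ π', M.IsMaximal p μ ν π' →
      ∫ z, F z ∂(π : Measure (Y × Y)) ≤ ∫ z, F z ∂(π' : Measure (Y × Y)) := by
  have hcar : ∀ π, M.IsMaximal p μ ν π → (π : Measure (Y × Y)) (D ×ˢ E)ᶜ = 0 := fun π h =>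
    causalCouplings_carried h.1 hD.measurableSet hE.measurableSet hμ hν
  have hcomp : IsCompact {π | M.IsMaximal p μ ν π} := by
    refine isCompact_iff_ultrafilter_le_nhds'.2 fun l hl => ?_
    obtain ⟨π, h1, -, h2⟩ := exists_tendsto_causalCouplings hM.closed l hD hE
      (μ := fun _ => μ) (ν := fun _ => ν) (π := id) tendsto_const_nhds tendsto_const_nhds
      (Eventually.of_forall fun _ => hμ) (Eventually.of_forall fun _ => hν)
      (mem_of_superset hl fun π h => h.1)
    refine ⟨π, ⟨h1, fun π' h' => ?_⟩, h2⟩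
    have h3 := tendsto_integral_of_carried (hD.prod hE) h2 (mem_of_superset hl fun π h => hcar π h)
      (continuous_sep_rpow hM.cont hp)
    refine (h₀.2 π' h').trans (tendsto_nhds_unique h3 (tendsto_const_nhds.congr' ?_)).ge
    exact mem_of_superset hl fun π h => h₀.gain_eq h
  have hcont : ContinuousOn (fun π : ProbabilityMeasure (Y × Y) => ∫ z, F z ∂(π : Measure (Y × Y)))
      {π | M.IsMaximal p μ ν π} := fun π hπ =>
    tendsto_integral_of_carried (μ := id) (hD.prod hE) (tendsto_id.mono_left nhdsWithin_le_nhds) (by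
      filter_upwards [self_mem_nhdsWithin] with π' hπ' using hcar π' hπ') hF
  obtain ⟨π, h1, h2⟩ := hcomp.exists_isMinOn ⟨π₀, h₀⟩ hcont
  exact ⟨π, h1, fun π' hπ' => h2 hπ'⟩

/-- Times outside [0, 1] receive the value f 0, so that the curve is carried by the diamond at every
real time. -/
theorem exists_mem_curveSpace (hM : M.IsTame) {p ℓ : ℝ} {D E : Set Y}
    (hD : IsCompact D) (hE : IsCompact E) {ν₀ ν₁ : ProbabilityMeasure Y}
    (h0 : (ν₀ : Measure Y) Dᶜ = 0) (h1 : (ν₁ : Measure Y) Eᶜ = 0) {f : ℝ → ProbabilityMeasure Y}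
    (hf0 : f 0 = ν₀) (hf1 : f 1 = ν₁) (hf : ∀ s ∈ Icc (0 : ℝ) 1, ∀ t ∈ Icc (0 : ℝ) 1, s < t →
      M.HasCoupling p ((t - s) * ℓ) (f s) (f t)) :
    (M.curveSpace p ℓ (M.futureJ D ∩ M.pastJ E) ν₀ ν₁).Nonempty := by
  classical
  have m0 : (0 : ℝ) ∈ Icc (0 : ℝ) 1 := by simp
  have m1 : (1 : ℝ) ∈ Icc (0 : ℝ) 1 := by simp
  have hcar : ∀ t ∈ Icc (0 : ℝ) 1, (f t : Measure Y) (M.futureJ D ∩ M.pastJ E)ᶜ = 0 := fun t ht => by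
    have a : (M.causalCouplings (f 0) (f t)).Nonempty := by
      rcases ht.1.eq_or_lt with rfl | h
      · exact ⟨_, diagonal_mem_causalCouplings hM.closed _⟩
      · obtain ⟨π, h2, -⟩ := hf 0 m0 t ht h; exact ⟨π, h2⟩
    have b : (M.causalCouplings (f t) (f 1)).Nonempty := by
      rcases ht.2.eq_or_lt with rfl | h
      · exact ⟨_, diagonal_mem_causalCouplings hM.closed _⟩
      · obtain ⟨π, h2, -⟩ := hf t ht 1 m1 h; exact ⟨π, h2⟩
    exact diamond_carried hM.closed a.some_mem b.some_mem hD hE (hf0 ▸ h0) (hf1 ▸ h1)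
  refine ⟨fun t => if t ∈ Icc (0 : ℝ) 1 then f t else f 0, fun t => ?_, ?_, ?_,
    fun s hs t ht hst => ?_⟩
  · simp only
    split_ifs with h
    exacts [hcar t h, hcar 0 m0]
  · simp [hf0]
  · simp [hf1]
  · simp only [if_pos hs, if_pos ht]
    exact hf s hs t ht hst

/-- The curve is a lexicographic maximiser of the dyadic entropy sums. Were the midpoint inequality
to fail at a dyadic time, splicing in a limit curve would raise one sum without lowering a coarser
one. -/
theorem exists_optimal_curve (hM : M.IsTame) {n : ℕ → Measure Y} {n' : Measure Y}
    (hn : WeaklyConverges n n') {p K N : ℝ} (hp : p ∈ Ioo (0 : ℝ) 1) (hN : 0 < N)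
    (hmid : ∀ j, M.MidpointCondition (n j) p K N) {D E : Set Y} (hD : IsCompact D)
    (hE : IsCompact E) {μ₀ μ₁ : ProbabilityMeasure Y} (hμ₀ : (μ₀ : Measure Y) Dᶜ = 0)
    (hμ₁ : (μ₁ : Measure Y) Eᶜ = 0) (he0 : InEntropyDomain (μ₀ : Measure Y) n')
    (he1 : InEntropyDomain (μ₁ : Measure Y) n') {π₀ : ProbabilityMeasure (Y × Y)}
    (hπ₀ : M.IsMaximal p μ₀ μ₁ π₀)
    (hsep : ∀ ϖ, M.IsMaximal p μ₀ μ₁ ϖ → ∀ᵐ z ∂(ϖ : Measure (Y × Y)), 0 < M.sep z) :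
    ∃ (π : ProbabilityMeasure (Y × Y)) (g : ℝ → ProbabilityMeasure Y), M.IsMaximal p μ₀ μ₁ π ∧
      g 0 = μ₀ ∧ g 1 = μ₁ ∧
      M.IsCurve p (M.gain p π₀ ^ (1 / p)) (M.futureJ D ∩ M.pastJ E) g ∧
      (∀ t ∈ Icc (0 : ℝ) 1, InEntropyDomain (g t : Measure Y) n') ∧
      ∀ e : ℝ → ℝ, (∀ t ∈ Icc (0 : ℝ) 1, e t = ent (g t : Measure Y) n') → SemiConvex e ∧
        DistribIneq N ((K * ∫ z, M.sep z ^ 2 ∂(π : Measure (Y × Y)) : ℝ) : EReal) e := by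
  classical
  have hn' : IsFiniteMeasureOnCompacts n' := hn.2.1
  set C := M.futureJ D ∩ M.pastJ E with hCdef
  have hC : IsCompact C := hM.diamond D E hD hE
  set ℓ := M.gain p π₀ ^ (1 / p) with hℓdef
  have hℓp : ℓ ^ p = M.gain p π₀ := gain_rpow_rpow hp.1.ne' π₀
  have hℓ : 0 < ℓ := Real.rpow_pos_of_pos (gain_pos hM.cont hp.1.le (hD.prod hE)
    (causalCouplings_carried hπ₀.1 hD.measurableSet hE.measurableSet hμ₀ hμ₁) (hsep _ hπ₀)) _
  -- Intermediate couplings are compared with possibly different maximal couplings of the end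
  -- points; minimising K∫τ² makes one π serve for all, whatever the sign of K.
  obtain ⟨π, hπ, hπmin⟩ := exists_isMaximal_forall_le hM hp.1.le hD hE hμ₀ hμ₁ hπ₀
    ((hM.cont.pow 2).const_mul K)
  simp only [integral_const_mul, Pi.pow_apply] at hπmin
  set I := ∫ z, M.sep z ^ 2 ∂(π : Measure (Y × Y)) with hI
  have hne : (M.curveSpace p ℓ C μ₀ μ₁).Nonempty := by
    obtain ⟨-, f, -, hf0, hf1, hf, -, -⟩ := exists_limit_curve hM hn hp hN hmid hD hE hμ₀ hμ₁ he0 he1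
      hπ₀ hsep
    exact exists_mem_curveSpace hM hD hE hμ₀ hμ₁ hf0 hf1 hf
  set S : ℕ → (ℝ → ProbabilityMeasure Y) → ℝ := fun k g =>
    ∑ i ∈ Finset.range (2 ^ k + 1), entropyPower N n' (g (((i : ℤ) : ℝ) * (1 / 2) ^ k)) with hS
  obtain ⟨g₀, hg₀, hg₀max⟩ := (isCompact_curveSpace hM hp.1.le ℓ hC μ₀ μ₁).exists_lexicographic_max
    hne (S := S) fun k => upperSemicontinuousOn_sum fun i _ =>
      (upperSemicontinuousOn_entropyPower hN n' hC).comp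
        (continuous_apply (((i : ℤ) : ℝ) * (1 / 2) ^ k)).continuousOn fun g hg => hg.1 _
  -- The sums see only dyadic times. Redefining the curve elsewhere by dyadic limits keeps it
  -- optimal and provides the semicontinuity of U.
  obtain ⟨l, g, hl, hg, hgeq, hglim⟩ := exists_regularisation hM hp.1.le hC hg₀
  have hSeq : ∀ k, S k g = S k g₀ := fun k => by
    simp only [hS]; exact Finset.sum_congr rfl fun i _ => by rw [hgeq]
  have hgmax : ∀ k, ∀ g' ∈ M.curveSpace p ℓ C μ₀ μ₁, (∀ m < k, S m g ≤ S m g') →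
      S k g' ≤ S k g := fun k g' hg' h => by
    rw [hSeq]; exact hg₀max k g' hg' fun m hm => hSeq m ▸ h m hm
  have hcurve := isCurve_of_mem_curveSpace hg
  have hmax : ∀ π ∈ M.causalCouplings (g 0) (g 1), M.gain p π ≤ ℓ ^ p := fun π h => by
    rw [hg.2.1, hg.2.2.1] at h
    rw [hℓp]; exact hπ₀.2 π h
  set U : ℝ → ℝ := fun t => entropyPower N n' (g t) with hU
  have hmidU : DyadicMidpoint (K * I / N) U := by
    intro n₀ i h hh hle ha hb hUa hUb
    set t : ℝ := i * (1 / 2) ^ n₀ with ht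
    have hat : t - h < t + h := by linarith
    have hs01 : t - h ∈ Icc (0 : ℝ) 1 := ⟨ha, by linarith⟩
    have ht01 : t + h ∈ Icc (0 : ℝ) 1 := ⟨by linarith, hb⟩
    have hda := entropyPower_pos_iff.1 hUa
    have hdb := entropyPower_pos_iff.1 hUb
    obtain ⟨π₂, hπ₂, hπ₂'⟩ := hg.2.2.2 _ hs01 _ ht01 hat
    obtain ⟨π₁, hπ₁⟩ := exists_isMaximal hM.closed hM.cont hp.1.le hC hC (hg.1 _) (hg.1 _) ⟨π₂, hπ₂⟩
    -- The rigidity of maximal intermediate couplings: it shows them to be timelike and also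
    -- evaluates their ∫τ².
    have hpull : ∀ ϖ, M.IsMaximal p (g (t - h)) (g (t + h)) ϖ → ∃ π', M.IsMaximal p μ₀ μ₁ π' ∧
        (ϖ : Measure (Y × Y)).map M.sep =
          (π' : Measure (Y × Y)).map (fun z => (t + h - (t - h)) * M.sep z) := fun ϖ hϖ => by
      have := hcurve.exists_isMaximal_map_eq hM.fin hM.cont hp hM.closed hC hℓ hmax hs01 ht01 hat hϖ
      rwa [hg.2.1, hg.2.2.1] at this
    have hlen : t + h - (t - h) = 2 * h := by ring
    rw [hlen] at hpull hπ₂'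
    have hsep₁ : ∀ ϖ, M.IsMaximal p (g (t - h)) (g (t + h)) ϖ →
        ∀ᵐ z ∂(ϖ : Measure (Y × Y)), 0 < M.sep z := fun ϖ hϖ => by
      obtain ⟨π', h1, h2⟩ := hpull ϖ hϖ
      refine ae_of_ae_map (p := fun x => 0 < x) hM.cont.measurable.aemeasurable ?_
      rw [h2, ae_map_iff (hM.cont.measurable.const_mul _).aemeasurable measurableSet_Ioi]
      filter_upwards [hsep π' h1] with z hz
      positivity
    have hgain : M.gain p π₁ ^ (1 / p) = 2 * h * ℓ := by
      have h1 := hcurve.gain_le hM.fin hM.cont hp hM.closed hC hℓ hmax hs01 ht01 hat hπ₁.1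
      rw [hlen] at h1
      rw [le_antisymm h1 (hπ₂'.trans (hπ₁.2 _ hπ₂)), ← Real.rpow_mul (by positivity),
        mul_one_div_cancel hp.1.ne', Real.rpow_one]
    obtain ⟨ϖ, f, hϖ, hf0, hf1, hf, hfd, hfU⟩ := exists_limit_curve hM hn hp hN hmid hC hC (hg.1 _)
      (hg.1 _) hda hdb hπ₁ hsep₁
    rw [hgain] at hf
    have hsplice := splice_mem_curveSpace hM hp hℓ (D := D) (E := E) hC hg ha hat hb hf0 hf1
      (by rw [hlen]; exact hf)
    set g' : ℝ → ProbabilityMeasure Y :=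
      fun s => if s ∈ Ioo (t - h) (t + h) then f ((s - (t - h)) / (t + h - (t - h))) else g s
    have hg't : g' t = f (1 / 2) := by
      simp only [g']
      rw [if_pos ⟨by linarith, by linarith⟩, hlen]
      congr 1
      field_simp
      ring
    -- Since h is at most the mesh of level n₀, the open interval (t - h, t + h) contains no other
    -- point of that grid or of a coarser one.
    have hg'd : ∀ m ≤ n₀, ∀ j : ℤ, (j : ℝ) * (1 / 2) ^ m ≠ t →
        g' (j * (1 / 2) ^ m) = g (j * (1 / 2) ^ m) := fun m hm j hj => by
      refine if_neg fun hmem => hj ?_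
      obtain ⟨r, rfl⟩ := Nat.exists_eq_add_of_le hm
      have e : (j : ℝ) * (1 / 2) ^ m = ((j * 2 ^ r : ℤ) : ℝ) * (1 / 2) ^ (m + r) := by
        push_cast
        rw [pow_add, mul_mul_mul_comm, ← mul_assoc, mul_assoc (j * _ : ℝ), ← mul_pow]
        norm_num
      have hpos : (0 : ℝ) < (1 / 2) ^ (m + r) := by positivity
      rw [e, ht]
      rw [e, ht] at hmem
      have h1 : ((j * 2 ^ r : ℤ) : ℝ) < i + 1 := by
        refine lt_of_mul_lt_mul_right ?_ hpos.le
        linarith [hmem.2]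
      have h2 : (i : ℝ) < (j * 2 ^ r : ℤ) + 1 := by
        refine lt_of_mul_lt_mul_right ?_ hpos.le
        linarith [hmem.1]
      have h3 : j * 2 ^ r < i + 1 := by exact_mod_cast h1
      have h4 : i < j * 2 ^ r + 1 := by exact_mod_cast h2
      rw [show i = j * 2 ^ r by omega]
    have hUt : entropyPower N n' (f (1 / 2)) ≤ U t := by
      by_contra! hlt
      have hterm : ∀ m ≤ n₀, ∀ j : ℤ, U (j * (1 / 2) ^ m) ≤
          entropyPower N n' (g' (j * (1 / 2) ^ m)) := fun m hm j => by
        by_cases hj : (j : ℝ) * (1 / 2) ^ m = t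
        · rw [hj, hg't]; exact hlt.le
        · rw [hg'd m hm j hj]
      have hi0 : 0 ≤ i := by
        have : 0 ≤ t := by linarith
        have := nonneg_of_mul_nonneg_left this (by positivity : (0 : ℝ) < (1 / 2) ^ n₀)
        exact_mod_cast this
      have hi1 : i ≤ 2 ^ n₀ := by
        have h1 : t * 2 ^ n₀ ≤ 1 * 2 ^ n₀ := by gcongr; linarith
        rw [ht, mul_assoc, ← mul_pow] at h1
        norm_num at h1
        exact_mod_cast h1
      have hlt' : S n₀ g < S n₀ g' := by
        refine Finset.sum_lt_sum (fun j _ => hterm n₀ le_rfl j) ⟨i.toNat, ?_, ?_⟩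
        · rw [Finset.mem_range]
          zify
          rw [Int.toNat_of_nonneg hi0]
          omega
        · rw [Int.toNat_of_nonneg hi0, ← ht, hg't]; exact hlt
      exact absurd (hgmax n₀ g' hsplice fun m hm => Finset.sum_le_sum fun j _ => hterm m hm.le j)
        (not_le.2 hlt')
    refine _root_.le_trans ?_ hUt
    rw [entropyPower_of_inEntropyDomain hfd]
    refine _root_.le_trans ?_ hfU
    simp only [hU]
    rw [entropyPower_of_inEntropyDomain hda, entropyPower_of_inEntropyDomain hdb]
    gcongr Real.exp ?_ * _
    -- The separation under ϖ is 2h times that under π', so K∫τ² dϖ ≥ 4h²KI, and 4h²/8 is the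
    -- exponent h²/2 of `DyadicMidpoint`.
    obtain ⟨π', h1, h2⟩ := hpull ϖ hϖ
    rw [integral_comp_sep_of_map_eq hM.cont h2 (F := fun x => x ^ 2) (by fun_prop)]
    simp only [mul_pow]
    rw [integral_const_mul]
    have h3 := hπmin π' h1
    have h4 : K * I * h ^ 2 ≤ K * (∫ z, M.sep z ^ 2 ∂(π' : Measure (Y × Y))) * h ^ 2 :=
      mul_le_mul_of_nonneg_right h3 (sq_nonneg h)
    rw [div_mul_eq_mul_div, div_div, div_div, div_le_div_iff₀ (by positivity) (by positivity)]
    nlinarith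
  have hUsc : ∀ t ∈ Ioo (0 : ℝ) 1, ∀ v, U t < v →
      ∃ᶠ k : ℕ in atTop, U (⌊t * 2 ^ k⌋ * (1 / 2) ^ k) < v := fun t ht v hv => by
    by_contra hcon
    rw [not_frequently] at hcon
    refine absurd (le_entropyPower_of_tendsto hN (hglim t) hC (Eventually.of_forall fun k => hg₀.1 _)
      (Eventually.mono (hl hcon) fun k hk => ?_)) (not_le.2 hv)
    simp only [hU, hgeq] at hk
    exact not_lt.1 hk
  have hU0 : 0 < U 0 := entropyPower_pos_iff.2 (by rw [hg.2.1]; exact he0)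
  have hU1 : 0 < U 1 := entropyPower_pos_iff.2 (by rw [hg.2.2.1]; exact he1)
  have key : ∀ e : ℝ → ℝ, (∀ t ∈ Icc (0 : ℝ) 1, e t = ent (g t : Measure Y) n') →
      (∀ t ∈ Icc (0 : ℝ) 1, 0 < U t) ∧ SemiConvex e ∧ DistribIneq N ((K * I : ℝ) : EReal) e :=
    fun e he => hmidU.semiConvex_and_distribIneq hN hUsc hU0 hU1 fun t ht htpos => by
      simp only [hU]
      rw [entropyPower_of_inEntropyDomain (entropyPower_pos_iff.1 htpos), Real.log_exp, he t ht]
      field_simp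
  exact ⟨π, g, hπ, hg.2.1, hg.2.2.1, hcurve,
    fun t ht => entropyPower_pos_iff.1 ((key _ fun _ _ => rfl).1 t ht), fun e he => (key e he).2⟩

end LorentzianPreLength

end OptimalCurve

/-! ### Return to the limit space and conclusion. -/

section Stability

namespace LorentzianPreLength

variable {X : Type u} [MetricSpace X] [ProperSpace X] [MeasurableSpace X] [BorelSpace X]
  {L : LorentzianPreLength X}
  {Y : Type w} [MetricSpace Y] [ProperSpace Y] [MeasurableSpace Y] [BorelSpace Y]
  {M : LorentzianPreLength Y} {ι : X → Y}

/-- The weak curvature-dimension condition holds on a subspace whose reference measure is a limit of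
measures satisfying the midpoint condition. -/
theorem IsIsomorphicEmbedding.wTCD_of_weaklyConverges (hι : L.IsIsomorphicEmbedding M ι)
    (hM : M.IsTame) {n : ℕ → Measure Y} {m : Measure X} [IsFiniteMeasureOnCompacts m]
    (hn : WeaklyConverges n (m.map ι)) {p K N : ℝ} (hp : p ∈ Ioo (0 : ℝ) 1) (hN : 0 < N)
    (hmid : ∀ j, M.MidpointCondition (n j) p K N) : L.WTCD m p K N := by
  classical
  intro μ₀ μ₁ he0 he1 hc0 hc1 ⟨π₀, hπ₀⟩
  have hme := hι.measurableEmbedding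
  have hme2 := hme.prodMap hme
  obtain ⟨⟨hW, ⟨hopt₀, -⟩, hab⟩, Γ, hΓm, hΓc, hΓ, hΓopt⟩ := hπ₀
  have hdom : ∀ μ : ProbabilityMeasure X, InEntropyDomain
      (μ.map hme.measurable.aemeasurable : Measure Y) (m.map ι) ↔
      InEntropyDomain (μ : Measure X) m := fun μ => by
    rw [InEntropyDomain, ProbabilityMeasure.toMeasure_map, relEntropy_map hme, InEntropyDomain]
  have hD := hc0.image hι.1.continuous
  have hE := hc1.image hι.1.continuous
  set D := ι '' (μ₀ : Measure X).support
  set E := ι '' (μ₁ : Measure X).support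
  set C := M.futureJ D ∩ M.pastJ E with hCdef
  have hC : IsCompact C := hM.diamond D E hD hE
  have hcar : ∀ (μ : ProbabilityMeasure X), IsCompact (ι '' (μ : Measure X).support) →
      (μ.map hme.measurable.aemeasurable : Measure Y) (ι '' (μ : Measure X).support)ᶜ = 0 :=
    fun μ h => by
      rw [ProbabilityMeasure.toMeasure_map, Measure.map_apply hme.measurable h.measurableSet.compl,
        preimage_compl, preimage_image_eq _ hme.injective]
      exact Measure.measure_compl_support
  have h0 := hcar μ₀ hD
  have h1 := hcar μ₁ hE
  have hiff : ∀ {π : ProbabilityMeasure (X × X)}, L.IsOptimal p μ₀ μ₁ π ↔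
      M.IsMaximal p (μ₀.map hme.measurable.aemeasurable) (μ₁.map hme.measurable.aemeasurable)
        (π.map hme2.measurable.aemeasurable) := by
    intro π
    rw [← hι.isOptimal_map_iff p]
    exact isOptimal_iff_isMaximal hM.fin hM.cont hM.closed hp.1 hD hE h0 h1
  -- This is where strong dualisability enters: the single set Γ makes every optimal coupling
  -- timelike, not only the given one.
  have hll : ∀ π, L.IsOptimal p μ₀ μ₁ π → ∀ᵐ z ∂(π : Measure (X × X)), L.ll z.1 z.2 := fun π h => by
    have h2 := (prob_compl_eq_zero_iff hΓm).2 ((hΓopt π h.1).1 h)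
    filter_upwards [measure_eq_zero_iff_ae_notMem.1 h2] with z hz
    exact (hΓ z (not_not.1 hz)).1
  have hsep : ∀ ϖ, M.IsMaximal p (μ₀.map hme.measurable.aemeasurable)
      (μ₁.map hme.measurable.aemeasurable) ϖ →
      ∀ᵐ z ∂(ϖ : Measure (Y × Y)), 0 < M.sep z := fun ϖ hϖ => by
    obtain ⟨π, -, rfl⟩ := hι.exists_map_eq hϖ.1
    rw [ProbabilityMeasure.toMeasure_map, ae_map_iff hme2.measurable.aemeasurable
      (measurableSet_lt measurable_const hM.cont.measurable)]
    filter_upwards [hll π (hiff.2 hϖ)] with z hz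
    rw [sep_pos_iff hM.fin]
    exact (hι.ll_iff _ _).2 hz
  have hπ₀M := hiff.1 hopt₀
  obtain ⟨ϖ, g, hϖ, hg0, hg1, hg, hgd, hgconv⟩ := exists_optimal_curve hM hn hp hN hmid hD hE h0 h1
    ((hdom _).2 he0) ((hdom _).2 he1) hπ₀M hsep
  set ℓ := M.gain p (π₀.map hme2.measurable.aemeasurable) ^ (1 / p) with hℓdef
  have hℓp : ℓ ^ p = M.gain p (π₀.map hme2.measurable.aemeasurable) := gain_rpow_rpow hp.1.ne' _
  have hℓ : 0 < ℓ := Real.rpow_pos_of_pos (gain_pos hM.cont hp.1.le (hD.prod hE)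
    (causalCouplings_carried hπ₀M.1 hD.measurableSet hE.measurableSet h0 h1) (hsep _ hπ₀M)) _
  have hmax : ∀ π ∈ M.causalCouplings (g 0) (g 1), M.gain p π ≤ ℓ ^ p := fun π h => by
    rw [hg0, hg1] at h
    rw [hℓp]; exact hπ₀M.2 π h
  obtain ⟨π, hπ, rfl⟩ := hι.exists_map_eq hϖ.1
  have hpull : ∀ t, ∃ μ : ProbabilityMeasure X, t ∈ Icc (0 : ℝ) 1 →
      μ.map hme.measurable.aemeasurable = g t := fun t => by
    by_cases ht : t ∈ Icc (0 : ℝ) 1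
    · obtain ⟨μ, hμ⟩ := hme.exists_probabilityMeasure_map_eq (ν := g t) (by
        refine (inEntropyDomain_iff.1 (hgd t ht)).1 ?_
        rw [Measure.map_apply hme.measurable hme.measurableSet_range.compl]
        simp)
      exact ⟨μ, fun _ => hμ⟩
    · exact ⟨μ₀, fun h => absurd h ht⟩
  choose μ hμ using hpull
  have m0 : (0 : ℝ) ∈ Icc (0 : ℝ) 1 := by simp
  have m1 : (1 : ℝ) ∈ Icc (0 : ℝ) 1 := by simp
  have hinj : ∀ {μ ν : ProbabilityMeasure X}, μ.map hme.measurable.aemeasurable =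
      ν.map hme.measurable.aemeasurable → μ = ν := fun {μ ν} h =>
    ProbabilityMeasure.toMeasure_injective
      (hme.map_measure_injective (congrArg ProbabilityMeasure.toMeasure h))
  have hμ0 : μ 0 = μ₀ := hinj ((hμ 0 m0).trans hg0)
  have hμ1 : μ 1 = μ₁ := hinj ((hμ 1 m1).trans hg1)
  have hlW : ∀ s ∈ Icc (0 : ℝ) 1, ∀ t ∈ Icc (0 : ℝ) 1, s < t →
      L.lorentzWasserstein p (μ s) (μ t) = (((t - s) * ℓ : ℝ) : EReal) := fun s hs t ht hst => by
    obtain ⟨π₂, hπ₂, hπ₂'⟩ := hg.hasCoupling s hs t ht hst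
    obtain ⟨π₁, hπ₁⟩ := exists_isMaximal hM.closed hM.cont hp.1.le hC hC (hg.carried s hs)
      (hg.carried t ht) ⟨π₂, hπ₂⟩
    have e : M.gain p π₁ = ((t - s) * ℓ) ^ p := le_antisymm
      (hg.gain_le hM.fin hM.cont hp hM.closed hC hℓ hmax hs ht hst hπ₁.1)
      (hπ₂'.trans (hπ₁.2 _ hπ₂))
    rw [← hι.lorentzWasserstein_map, hμ s hs, hμ t ht, lorentzWasserstein_eq hM.fin hM.cont hp.1 hC hC
      (hg.carried s hs) (hg.carried t ht) hπ₁, e,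
      ← Real.rpow_mul (mul_nonneg (sub_nonneg.2 hst.le) hℓ.le), mul_one_div_cancel hp.1.ne',
      Real.rpow_one]
  have hlW01 : L.lorentzWasserstein p (μ 0) (μ 1) = (ℓ : EReal) := by
    rw [hlW 0 m0 1 m1 one_pos, sub_zero, one_mul]
  have hμd : ∀ t ∈ Icc (0 : ℝ) 1, InEntropyDomain (μ t : Measure X) m := fun t ht => by
    rw [← hdom, hμ t ht]; exact hgd t ht
  have hent : ∀ t ∈ Icc (0 : ℝ) 1, (relEntropy (μ t : Measure X) m).toReal =
      ent (g t : Measure Y) (m.map ι) := fun t ht => by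
    rw [← hμ t ht, ← ((hdom _).2 (hμd t ht)).toReal_relEntropy, ProbabilityMeasure.toMeasure_map,
      relEntropy_map hme]
  obtain ⟨hsc, hdi⟩ := hgconv _ hent
  have hK : (K : EReal) * ((∫⁻ z, L.τ z.1 z.2 ^ 2 ∂(π : Measure (X × X)) : ℝ≥0∞) : EReal) =
      ((K * ∫ z, M.sep z ^ 2 ∂(π.map hme2.measurable.aemeasurable : Measure (Y × Y)) : ℝ) :
        EReal) := by
    have hc := causalCouplings_carried hϖ.1 hD.measurableSet hE.measurableSet h0 h1
    have e := lintegral_τ_rpow hM.fin hM.cont (p := 2) (by norm_num) (hD.prod hE) hc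
    rw [hι.lintegral_τ π (fun x => x ^ (2 : ℝ))] at e
    simp only [ENNReal.rpow_two, gain, Real.rpow_two] at e
    rw [e, EReal.coe_ennreal_ofReal, max_eq_left (integral_nonneg fun z => sq_nonneg _),
      EReal.coe_mul]
  -- The potentials and Γ do not depend on the coupling, so they certify dualisability by the new π
  -- as well.
  refine ⟨π, ⟨⟨hW, ⟨hiff.2 hϖ, hll π (hiff.2 hϖ)⟩, hab⟩, Γ, hΓm, hΓc, hΓ, hΓopt⟩, μ, hμ0, hμ1,
    ⟨?_, ?_, fun s t hs hst ht => ?_⟩, hμd, hsc, ?_⟩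
  · rw [hlW01]; exact EReal.coe_pos.2 hℓ
  · rw [hlW01]; exact EReal.coe_lt_top _
  · rw [hlW01, hlW s ⟨hs, by linarith⟩ t ⟨by linarith, ht⟩ hst, EReal.coe_mul]
  · rw [hK]; exact hdi

end LorentzianPreLength

end Stability

theorem mainTheorem3
    {X : ℕ → Type u} [∀ j, MetricSpace (X j)] [∀ j, ProperSpace (X j)]
    [∀ j, MeasurableSpace (X j)] [∀ j, BorelSpace (X j)]
    {X' : Type v} [MetricSpace X'] [ProperSpace X'] [MeasurableSpace X'] [BorelSpace X']
    {Y : Type w} [MetricSpace Y] [ProperSpace Y] [MeasurableSpace Y] [BorelSpace Y]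
    (L : ∀ j, LorentzianPreLength (X j)) (m : ∀ j, Measure (X j))
    [∀ j, IsFiniteMeasureOnCompacts (m j)] [∀ j, (m j).IsOpenPosMeasure]
    (hL : ∀ j, (L j).IsGeodesic)
    (L' : LorentzianPreLength X') (m' : Measure X')
    [IsFiniteMeasureOnCompacts m'] [m'.IsOpenPosMeasure]
    (hL' : L'.IsGeodesic)
    (M : LorentzianPreLength Y)
    (hM_closed : M.LocallyCausallyClosed) (hM_hyp : M.KGloballyHyperbolic)
    (hM_geod : M.IsGeodesic)
    (hM_fin : ∀ x y, M.τ x y ≠ ⊤) (hM_cont : Continuous fun z : Y × Y => M.τ z.1 z.2)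
    (ι : ∀ j, X j → Y) (ι' : X' → Y)
    (hι : ∀ j, (L j).IsIsomorphicEmbedding M (ι j)) (hι' : L'.IsIsomorphicEmbedding M ι')
    (hconv : WeaklyConverges (fun j => (m j).map (ι j)) (m'.map ι'))
    (p K N : ℝ) (hp : p ∈ Ioo (0 : ℝ) 1) (hN : 0 < N)
    (hTCD : ∀ j, (L j).TCD (m j) p K N) :
    L'.WTCD m' p K N := by
  have hM : M.IsTame := ⟨hM_fin, LorentzianPreLength.continuous_sep hM_fin hM_cont,
    LorentzianPreLength.isClosed_le hM_closed hM_hyp hM_geod, hM_hyp.2⟩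
  exact hι'.wTCD_of_weaklyConverges hM hconv hp hN
    fun j D E hD hE ν₀ ν₁ h0 h1 he0 he1 ϖ hϖ hpos =>
      (hTCD j).exists_isCurve hM (hι j) hp hN hD hE h0 h1 he0 he1 hϖ hpos
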